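/- Units with $c=1$, metric $g=\mathrm{diag}(-1,1,1,1)$. Let $N$ point particles with masses $m_n$ and charges $q_n$ move on smooth world-lines $t\mapsto \mathbf z_n(t)\in\mathbb R^3$ ($t\in\mathbb R$), with velocities $|\mathbf v_n(t)|<1$ and $\mathbf z_n(t)\neq \mathbf z_k(t)$ for $n\ne k$; put $\gamma_n=(1-\mathbf v_n^2)^{-1/2}$, $u_n=\gamma_n(1,\mathbf v_n)$, and let a dot denote the proper-time derivative $\gamma_n\,d/dt$. Let $F^{\mu\nu}=-F^{\nu\mu}$ be a locally integrable field on $\mathbb R^4$ that solves, in the sense of distributions, the Maxwell equations with these point sources, $$\partial_\nu F^{\mu\nu}=\sum_n q_n(1,\mathbf v_n(t))^\mu\,\delta^3(\mathbf x-\mathbf z_n(t)),\qquad \partial^\lambda F^{\mu\nu}+\partial^\mu F^{\nu\lambda}+\partial^\nu F^{\lambda\mu}=0 .$$ Assume that $F$ is smooth off the world-lines and that, for each $n$, near the world-line of particle $n$ one has $F=F_{\mathrm{ext},n}+F_{\mathrm{ret},n}$ off the world-line, where $F_{\mathrm{ret},n}$ is the retarded (Liénard–Wiechert) field of particle $n$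 and $F_{\mathrm{ext},n}$ is smooth also on the world-line. Let $T^{\mu\nu}=F^{\mu\lambda}F^{\nu}{}_{\lambda}-\tfrac14 g^{\mu\nu}F^{\eta\lambda}F_{\eta\lambda}$. If $f(r)=a/r+b+O(r)$ as $r\to0^+$, put $\mathcal R\lim_{r\to 0} f(r)=b$; the $\mathcal R$-integral $\mathcal R\!\int_V G\,d^3\mathbf x$ is the $\mathcal R$-limit of the integral of $G$ over the points of $V$ at distance more than $r$ from all the particles. Define $$\widetilde F^{\mu\nu}(z_n)=\mathcal R\lim_{r\to0}\int_{|\mathbf x|=r}\frac{d\Omega_{\mathbf x}}{4\pi}F^{\mu\nu}(\mathbf z_n+\mathbf x,t),\qquad P_V^\mu(t)=\mathcal R\!\int_V d^3\mathbf x\,T^{0\mu}(\mathbf x,t)+\sum_{\mathbf z_n(t)\in V}m_nu_n^\mu(t).$$ **Theorem 1.** The $\mathcal R$-limits defining $\widetilde F^{\mu\nu}(z_n)$ exist at all times, and the $\mathcal R$-integrals in $P_V^\mu(t)$ exist for every bounded open $V$ at every time $t$ at which no particle lies on $\partial V$. The local conservation law $$\frac{d}{dt}P_V^\mu(t)=-\int_{\partial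 V}d\sigma\,n_iT^{i\mu}(\mathbf x,t)$$ holds for every bounded Lipschitz domain (open set) $V\subset\mathbb R^3$, every $\mu$, and every $t$ at which no particle lies on $\partial V$, if and only if every particle obeys at all times $$m_n\gamma_n\frac{du_n^\mu}{dt}=q_nu_{n,\nu}\widetilde F^{\mu\nu}(z_n).$$ Moreover, for each particle and each time, this equation is equivalent to the Lorentz–Dirac equation $$m_n\dot u_n^\mu=q_nu_{n,\nu}F_{\mathrm{ext},n}^{\mu\nu}(z_n)+\frac23\,\frac{q_n^2}{4\pi}\left(\ddot u_n^\mu-\dot u_{n,\nu}\dot u_n^\nu u_n^\mu\right).$$ -/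

import Mathlib

open MeasureTheory Set Filter Topology
open scoped ContDiff

noncomputable section

namespace PointChargeED

/-! Units with `c = 1`; metric of signature `(-, +, +, +)`; all tensor components are
contravariant unless lowered explicitly with `metric`. -/

/-- Physical space. -/
abbrev Space := EuclideanSpace ℝ (Fin 3)

/-- Space-time; component `0` is the time. Also used for four-vectors. -/
abbrev Event := Fin 4 → ℝ

/-- Fields of contravariant tensors of rank two. -/
abbrev TensorField := Event → Fin 4 → Fin 4 → ℝ

/-- The event (or four-vector) with time component `t` and space components `x`. -/
def event (t : ℝ) (x : Space) : Event := Fin.cons t (fun i => x i)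

/-- The space components of an event. -/
def spacePart (p : Event) : Space := WithLp.toLp 2 (fun i : Fin 3 => p i.succ)

/-- The diagonal entries of the Minkowski metric: `g⁰⁰ = -1`, `g¹¹ = g²² = g³³ = 1`. -/
def metric (μ : Fin 4) : ℝ := if μ = 0 then -1 else 1

/-- The partial derivative `∂_ν`. -/
def partialD (ν : Fin 4) (φ : Event → ℝ) (p : Event) : ℝ := fderiv ℝ φ p (Pi.single ν 1)

/-- The electromagnetic energy-momentum tensor
`T^{μν} = F^{μλ} F^ν_λ - (1/4) g^{μν} F^{ηλ} F_{ηλ}` at an event where the field is `f`. -/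
def stress (f : Fin 4 → Fin 4 → ℝ) (μ ν : Fin 4) : ℝ :=
  (∑ l, metric l * f μ l * f ν l)
    - 1 / 4 * (if μ = ν then metric μ else 0) * ∑ k, ∑ l, metric k * metric l * f k l * f k l

/-! ### Finite parts -/

/-- `f r = a / r + b + O(r)` as `r → 0+`, for some `a`: the finite part of `f` is `b`. -/
def HasRLim (f : ℝ → ℝ) (b : ℝ) : Prop :=
  ∃ a : ℝ, (fun r => f r - (a / r + b)) =O[𝓝[>] 0] (fun r => r)

theorem HasRLim.unique {f : ℝ → ℝ} {b c : ℝ} (hb : HasRLim f b) (hc : HasRLim f c) : b = c := by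
  obtain ⟨a₁, h₁⟩ := hb
  obtain ⟨a₂, h₂⟩ := hc
  have h : (fun r : ℝ => (a₂ - a₁) / r + (c - b)) =O[𝓝[>] 0] (fun r : ℝ => r) := by
    refine (h₁.sub h₂).congr_left fun r => ?_
    ring
  have hid : Tendsto (fun r : ℝ => r) (𝓝[>] 0) (𝓝 0) := tendsto_id.mono_left nhdsWithin_le_nhds
  have h0 := h.trans_tendsto hid
  have h1 : Tendsto (fun r : ℝ => (a₂ - a₁) + (c - b) * r) (𝓝[>] 0) (𝓝 0) := by
    have := h0.mul hid
    rw [mul_zero] at this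
    refine this.congr' ?_
    filter_upwards [self_mem_nhdsWithin] with r hr
    have : r ≠ 0 := ne_of_gt hr
    field_simp
  have h2 : Tendsto (fun r : ℝ => (a₂ - a₁) + (c - b) * r) (𝓝[>] 0) (𝓝 ((a₂ - a₁) + (c - b) * 0)) :=
    tendsto_const_nhds.add (hid.const_mul _)
  have ha : a₂ - a₁ = 0 := by simpa using tendsto_nhds_unique h2 h1
  rw [ha] at h0
  have : c - b = 0 := by
    refine tendsto_nhds_unique (f := fun _ : ℝ => c - b) (l := 𝓝[>] (0 : ℝ)) tendsto_const_nhds ?_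
    simpa using h0
  linarith

/-- The `R`-limit of `f` at `0+` (a default value if it does not exist). -/
def rLim (f : ℝ → ℝ) : ℝ := Classical.epsilon (HasRLim f)

theorem HasRLim.rLim_eq {f : ℝ → ℝ} {b : ℝ} (h : HasRLim f b) : rLim f = b :=
  (Classical.epsilon_spec (p := HasRLim f) ⟨b, h⟩).unique h

/-- The integral of `G` over the part of `V` at distance more than `r` from the points `z n`. -/
def cutIntegral {N : ℕ} (z : Fin N → Space) (V : Set Space) (G : Space → ℝ) (r : ℝ) : ℝ :=
  ∫ x in {x ∈ V | ∀ n, r < dist x (z n)}, G x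

/-- The `R`-integral of `G` over `V`, with singular points `z n`, exists and equals `b`. -/
def HasRIntegral {N : ℕ} (z : Fin N → Space) (V : Set Space) (G : Space → ℝ) (b : ℝ) : Prop :=
  (∀ᶠ r in 𝓝[>] (0 : ℝ), IntegrableOn G {x ∈ V | ∀ n, r < dist x (z n)}) ∧
    HasRLim (cutIntegral z V G) b

/-- The `R`-integral. -/
def rIntegral {N : ℕ} (z : Fin N → Space) (V : Set Space) (G : Space → ℝ) : ℝ :=
  rLim (cutIntegral z V G)

/-- The average of `G` over the sphere of radius `r` centred at `c`. -/
def sphereAverage (G : Space → ℝ) (c : Space) (r : ℝ) : ℝ :=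
  (4 * Real.pi)⁻¹ *
    ∫ w : Metric.sphere (0 : Space) 1, G (c + r • (w : Space)) ∂(volume : Measure Space).toSphere

/-! ### Surface integrals over boundaries of Lipschitz domains -/

/-- A patch of the boundary of `V`: inside the open set `dom`, in the orthonormal coordinates
given by `frame`, `V` is the region below the graph of a Lipschitz function of the first two
coordinates. The patch carries a smooth weight supported in `dom`. -/
structure BoundaryPatch (V : Set Space) where
  frame : Space ≃ₗᵢ[ℝ] Space
  height : EuclideanSpace ℝ (Fin 2) → ℝ
  lipschitz : ∃ K, LipschitzWith K height
  dom : Set Space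
  isOpen_dom : IsOpen dom
  mem_iff : ∀ x ∈ dom, x ∈ V ↔ frame x 2 < height !₂[frame x 0, frame x 1]
  weight : Space → ℝ
  contDiff_weight : ContDiff ℝ ∞ weight
  hasCompactSupport_weight : HasCompactSupport weight
  tsupport_weight : tsupport weight ⊆ dom

namespace BoundaryPatch

variable {V : Set Space} (P : BoundaryPatch V)

/-- The point of the graph with parameter `s`. -/
def point (s : EuclideanSpace ℝ (Fin 2)) : Space := P.frame.symm !₂[s 0, s 1, P.height s]

/-- The outward normal `(-∂₁h, -∂₂h, 1)` of the graph; its length is the density of the surface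
area with respect to the parameters, so that it represents `n dσ`. -/
def normal (s : EuclideanSpace ℝ (Fin 2)) : Space :=
  P.frame.symm !₂[-fderiv ℝ P.height s (EuclideanSpace.single 0 1),
    -fderiv ℝ P.height s (EuclideanSpace.single 1 1), 1]

/-- The surface integral of `weight * (n · X)` over the patch. -/
def flux (X : Space → Space) : ℝ :=
  ∫ s, P.weight (P.point s) * inner ℝ (P.normal s) (X (P.point s))

end BoundaryPatch

/-- A finite atlas of the boundary of `V` with a partition of unity: for a bounded `V` it exists
exactly if `V` is a Lipschitz domain. -/
structure BoundaryAtlas (V : Set Space) where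
  card : ℕ
  patch : Fin card → BoundaryPatch V
  sum_weight : ∀ x ∈ frontier V, ∑ k, (patch k).weight x = 1

/-- The outward flux `∫_{∂V} n · X dσ`. -/
def BoundaryAtlas.flux {V : Set Space} (A : BoundaryAtlas V) (X : Space → Space) : ℝ :=
  ∑ k, (A.patch k).flux X

/-! ### Particles -/

/-- `N` point particles with smooth time-like world-lines that never meet. -/
structure ParticleSystem (N : ℕ) where
  mass : Fin N → ℝ
  charge : Fin N → ℝ
  pos : Fin N → ℝ → Space
  smooth : ∀ n, ContDiff ℝ ∞ (pos n)
  speed_lt_one : ∀ n t, ‖deriv (pos n) t‖ < 1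
  distinct : ∀ t, Function.Injective (fun n => pos n t)

namespace ParticleSystem

variable {N : ℕ} (S : ParticleSystem N)

/-- The velocity `v_n = dz_n/dt`. -/
def vel (n : Fin N) (t : ℝ) : Space := deriv (S.pos n) t

/-- The Lorentz factor. -/
def gamma (n : Fin N) (t : ℝ) : ℝ := (Real.sqrt (1 - ‖S.vel n t‖ ^ 2))⁻¹

/-- The four-velocity `u = γ (1, v)`. -/
def u (n : Fin N) (t : ℝ) : Event := S.gamma n t • event 1 (S.vel n t)

/-- The first derivative of the four-velocity with respect to the proper time,
`d/dτ = γ d/dt`. -/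
def uDot (n : Fin N) (t : ℝ) (μ : Fin 4) : ℝ := S.gamma n t * deriv (fun s => S.u n s μ) t

/-- The second derivative of the four-velocity with respect to the proper time. -/
def uDDot (n : Fin N) (t : ℝ) (μ : Fin 4) : ℝ := S.gamma n t * deriv (fun s => S.uDot n s μ) t

/-- The world-line of a particle. -/
def worldLine (n : Fin N) : Set Event := Set.range fun t => event t (S.pos n t)

/-- The retarded time of the event `p`: the solution `s` of `|x - z_n(s)| = t - s`,
where `p = (t, x)`. There is at most one, since the world-line is time-like, and there is one
if `p` is close to the world-line. -/
def retTime (n : Fin N) (p : Event) : ℝ := sSup {s | ‖spacePart p - S.pos n s‖ = p 0 - s}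

/-- The retarded Liénard-Wiechert potential
`A^μ = (q / 4π) (1, v)^μ / (R - v · 𝐑)`, with `𝐑 = x - z_n(s)`, `R = t - s = |𝐑|` and the
velocity taken at the retarded time `s`. -/
def retPotential (n : Fin N) (p : Event) (μ : Fin 4) : ℝ :=
  S.charge n / (4 * Real.pi) * event 1 (S.vel n (S.retTime n p)) μ /
    ((p 0 - S.retTime n p)
      - inner ℝ (S.vel n (S.retTime n p)) (spacePart p - S.pos n (S.retTime n p)))

/-- The retarded field `∂^μ A^ν - ∂^ν A^μ` generated by particle `n`. -/
def retField (n : Fin N) : TensorField := fun p μ ν =>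
  metric μ * partialD μ (fun x => S.retPotential n x ν) p
    - metric ν * partialD ν (fun x => S.retPotential n x μ) p

/-- `F` solves, in the sense of distributions, the Maxwell equations whose sources are the point
charges: `∂_ν F^{μν} = j^μ` with `j^μ = ∑ q_n (1, v_n)^μ δ³(x - z_n(t))`, and
`∂^λ F^{μν} + ∂^μ F^{νλ} + ∂^ν F^{λμ} = 0`. Here `F^{0i} = Eⁱ` and `F^{ij} = ε^{ijk} B_k`. -/
structure IsMaxwellField (F : TensorField) : Prop where
  antisymm : ∀ p μ ν, F p μ ν = -F p ν μ
  locallyIntegrable : LocallyIntegrable F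
  inhomogeneous : ∀ φ : Event → ℝ, ContDiff ℝ ∞ φ → HasCompactSupport φ → ∀ μ,
    -∫ p, ∑ ν, F p μ ν * partialD ν φ p =
      ∑ n, S.charge n * ∫ t, event 1 (S.vel n t) μ * φ (event t (S.pos n t))
  homogeneous : ∀ φ : Event → ℝ, ContDiff ℝ ∞ φ → HasCompactSupport φ → ∀ l μ ν,
    ∫ p, (F p μ ν * (metric l * partialD l φ p) + F p ν l * (metric μ * partialD μ φ p)
      + F p l μ * (metric ν * partialD ν φ p)) = 0

/-- `F` is smooth off the world-lines, and near the world-line of each particle `n` it is the sum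
of the retarded field of that particle and of a non-singular external field `Fext n`, which is
smooth also on the world-line. -/
structure IsRegularField (F : TensorField) (Fext : Fin N → TensorField) : Prop where
  smooth_off : ContDiffOn ℝ ∞ F (⋃ n, S.worldLine n)ᶜ
  decomposition : ∀ n, ∃ U : Set Event, IsOpen U ∧ S.worldLine n ⊆ U ∧
    ContDiffOn ℝ ∞ (Fext n) U ∧
    ∀ p ∈ U, p ∉ S.worldLine n → ∀ μ ν, F p μ ν = Fext n p μ ν + S.retField n p μ ν

variable (F : TensorField)

/-- The average of `F^{μν}` over the sphere of radius `r` around particle `n` at time `t`. -/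
def fieldAverage (n : Fin N) (t : ℝ) (μ ν : Fin 4) (r : ℝ) : ℝ :=
  sphereAverage (fun x => F (event t x) μ ν) (S.pos n t) r

/-- The regularized field at particle `n`: the `R`-limit of the spherical averages. -/
def regField (n : Fin N) (t : ℝ) (μ ν : Fin 4) : ℝ := rLim (S.fieldAverage F n t μ ν)

/-- The electromagnetic energy-momentum in `V`, the `R`-integral of `T^{0μ}`. -/
def emMomentum (V : Set Space) (μ : Fin 4) (t : ℝ) : ℝ :=
  rIntegral (fun n => S.pos n t) V (fun x => stress (F (event t x)) 0 μ)

open Classical in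
/-- The total energy-momentum in `V`. -/
def momentum (V : Set Space) (μ : Fin 4) (t : ℝ) : ℝ :=
  S.emMomentum F V μ t + ∑ n, if S.pos n t ∈ V then S.mass n * S.u n t μ else 0

/-- The current `(T^{1μ}, T^{2μ}, T^{3μ})` of the `μ` component of the energy-momentum. -/
def momentumCurrent (F : TensorField) (μ : Fin 4) (t : ℝ) (x : Space) : Space :=
  WithLp.toLp 2 (fun i : Fin 3 => stress (F (event t x)) i.succ μ)

/-- The local conservation law `dP_V^μ/dt = - ∫_{∂V} n_i T^{iμ} dσ` for all bounded Lipschitz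
domains `V`, at all times at which no particle crosses the boundary. -/
def LocalConservation : Prop :=
  ∀ V : Set Space, IsOpen V → Bornology.IsBounded V → ∀ A : BoundaryAtlas V,
    ∀ t : ℝ, (∀ n, S.pos n t ∉ frontier V) → ∀ μ : Fin 4,
      HasDerivAt (S.momentum F V μ) (-A.flux (momentumCurrent F μ t)) t

/-- The equation of motion `m_n γ_n du_n^μ/dt = q_n u_{n,ν} F̃^{μν}(z_n)` at time `t`. -/
def EquationOfMotion (n : Fin N) (t : ℝ) : Prop :=
  ∀ μ : Fin 4, S.mass n * S.gamma n t * deriv (fun s => S.u n s μ) t =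
    S.charge n * ∑ ν, metric ν * S.u n t ν * S.regField F n t μ ν

/-- The Lorentz-Dirac equation at time `t` in the external field `G`,
`m u̇^μ = q u_ν G^{μν} + (2/3) (q²/4π) (ü^μ - u̇_ν u̇^ν u^μ)`. -/
def LorentzDirac (G : TensorField) (n : Fin N) (t : ℝ) : Prop :=
  ∀ μ : Fin 4, S.mass n * S.uDot n t μ =
    S.charge n * ∑ ν, metric ν * S.u n t ν * G (event t (S.pos n t)) μ ν
      + 2 / 3 * (S.charge n ^ 2 / (4 * Real.pi)) *
        (S.uDDot n t μ - (∑ ν, metric ν * S.uDot n t ν * S.uDot n t ν) * S.u n t μ)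

end ParticleSystem

end PointChargeED

end

/-!
The field is singular at the particles, but in a controlled way. In the coordinates `(t, w, r)` of the
point at the distance `r` from a particle in the direction `w`, the function `r ^ 2 * F` extends to a
smooth function `φ ((t, w), r)` across `r = 0` (`exists_isNearField`): by the implicit function theorem
the retardation, measured in units of `r`, is smooth there (`contDiffAt_scaledDelay`), and the retarded
field is given by the Liénard-Wiechert formula (`retField_eq`). At `r = 0` one finds the Coulomb field of
a uniformly moving charge. Negative `r` describes the advanced field, with the opposite sign. Therefore
the even part of `φ` under the reflection of `(w, r)` to `(-w, -r)` is `r ^ 2` times the external field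
plus half the difference of the retarded and the advanced field. The latter is finite at the particle,
and its value, the `selfField`, is the third derivative in a Hermite divided difference between the
advanced and the retarded time (`tendsto_scaledRetField_add`).

All the finite parts follow from this symmetry. The spherical averages of `F` have the finite part
`Fext + selfField` (`hasRLim_fieldAverage`). The momentum `K / r ^ 2` on the sphere of radius `r`, per
unit of `r`, has no term of order `1 / r`, so that its integral has a finite part without logarithms
(`nearMomentum`). The flow of momentum `J / r ^ 2` into the sphere has the finite part
`q (1, v)_ν (Fext + selfField)^{μν}`, the Lorentz force (`sphereFlow_zero`): the Coulomb field does not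
act on its own charge because of the parity of its energy-momentum tensor, and its interference with
the regularized field is evaluated with the law of Gauss (`integral_fluxDensity`).

Off the world-lines, Maxwell's equations hold classically and make the energy-momentum tensor free of
divergence (`sum_partialD_stress`). Integrated over the directions `w`, this gives a balance between `K`
and `J` (`radial_balance`), and with it the derivative of `nearMomentum` (`hasDerivAt_nearMomentum`). Away
from the particles the tensor is multiplied with a cutoff, and the divergence theorem for Lipschitz
domains (`setIntegral_diverg`) applies. Altogether the momentum in `V` changes by the flux through the
boundary and by the sum of `m du/dt - force` over the particles in `V` (`hasDerivAt_momentum`). Hence the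
equations of motion imply the conservation law; conversely, the law for a small octahedron around one
particle contains the equation of motion of this particle. Finally, the contraction of `selfField` with
the four-velocity is the radiation reaction of the Lorentz-Dirac equation (`sum_selfField`).
-/

noncomputable section

namespace PointChargeED

/-! ### Parametric integrals, Hadamard quotients and Hermite interpolation -/

theorem exists_local_bound_of_continuous {E Z G : Type} [NormedAddCommGroup E] [NormedSpace ℝ E]
    [FiniteDimensional ℝ E] [TopologicalSpace Z] [NormedAddCommGroup G] {S : Set Z}
    (hS : IsCompact S) {f : E × Z → G} (hf : Continuous f) (x₀ : E) :
    ∃ C : ℝ, ∀ x ∈ Metric.closedBall x₀ 1, ∀ z ∈ S, ‖f (x, z)‖ ≤ C := by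
  have := FiniteDimensional.proper_real E
  obtain ⟨C, hC⟩ := ((isCompact_closedBall x₀ (1 : ℝ)).prod hS).exists_bound_of_continuousOn
    hf.continuousOn
  exact ⟨C, fun x hx z hz => hC (x, z) ⟨hx, hz⟩⟩

section Parametric

variable {E Z G Y : Type} [NormedAddCommGroup E] [NormedSpace ℝ E] [FiniteDimensional ℝ E]
  [NormedAddCommGroup Z] [NormedAddCommGroup G] [NormedSpace ℝ G]
  [TopologicalSpace Y] [SecondCountableTopology Y] [MeasurableSpace Y] [OpensMeasurableSpace Y]
  {μ : Measure Y} [IsFiniteMeasure μ] {ι : Y → Z} {S : Set Z}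

theorem continuous_integral_comp (hι : Continuous ι) (hS : IsCompact S)
    (hιS : ∀ᵐ y ∂μ, ι y ∈ S) {f : E × Z → G} (hf : Continuous f) :
    Continuous fun x => ∫ y, f (x, ι y) ∂μ := by
  rw [continuous_iff_continuousAt]
  intro x₀
  obtain ⟨C, hC⟩ := exists_local_bound_of_continuous hS hf x₀
  refine continuousAt_of_dominated (bound := fun _ => C) ?_ ?_ (integrable_const C) ?_
  · exact Eventually.of_forall fun x =>
      (hf.comp (continuous_const.prodMk hι)).aestronglyMeasurable
  · filter_upwards [Metric.closedBall_mem_nhds x₀ one_pos] with x hx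
    filter_upwards [hιS] with y hy using hC x hx _ hy
  · exact Eventually.of_forall fun y =>
      (hf.comp (continuous_id.prodMk continuous_const)).continuousAt

variable [NormedSpace ℝ Z]

theorem hasFDerivAt_integral_comp (hι : Continuous ι) (hS : IsCompact S)
    (hιS : ∀ᵐ y ∂μ, ι y ∈ S) {f : E × Z → G} (hf : ContDiff ℝ 1 f) (x₀ : E) :
    HasFDerivAt (fun x => ∫ y, f (x, ι y) ∂μ)
      (∫ y, (fderiv ℝ f (x₀, ι y)).comp (ContinuousLinearMap.inl ℝ E Z) ∂μ) x₀ := by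
  have hc : Continuous fun p : E × Z => (fderiv ℝ f p).comp (ContinuousLinearMap.inl ℝ E Z) :=
    (hf.continuous_fderiv one_ne_zero).clm_comp continuous_const
  obtain ⟨C, hC⟩ := exists_local_bound_of_continuous hS hc x₀
  obtain ⟨C', hC'⟩ := exists_local_bound_of_continuous hS hf.continuous x₀
  refine hasFDerivAt_integral_of_dominated_of_fderiv_le (bound := fun _ => C)
    (F' := fun x y => (fderiv ℝ f (x, ι y)).comp (ContinuousLinearMap.inl ℝ E Z))
    (Metric.ball_mem_nhds x₀ one_pos) ?_ ?_ ?_ ?_ (integrable_const C) ?_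
  · exact Eventually.of_forall fun x =>
      (hf.continuous.comp (continuous_const.prodMk hι)).aestronglyMeasurable
  · refine Integrable.of_bound
      (hf.continuous.comp (continuous_const.prodMk hι)).aestronglyMeasurable C' ?_
    filter_upwards [hιS] with y hy using hC' x₀ (Metric.mem_closedBall_self zero_le_one) _ hy
  · exact (hc.comp (continuous_const.prodMk hι)).aestronglyMeasurable
  · filter_upwards [hιS] with y hy x hx using hC x (Metric.ball_subset_closedBall hx) _ hy
  · refine Eventually.of_forall fun y x _ => ?_
    have h1 : HasFDerivAt f (fderiv ℝ f (x, ι y)) (x, ι y) :=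
      (hf.differentiable one_ne_zero).differentiableAt.hasFDerivAt
    exact h1.comp x (hasFDerivAt_prodMk_left x (ι y))

theorem contDiff_nat_integral_comp (hι : Continuous ι) (hS : IsCompact S)
    (hιS : ∀ᵐ y ∂μ, ι y ∈ S) (n : ℕ) :
    ∀ {G : Type} [NormedAddCommGroup G] [NormedSpace ℝ G] {f : E × Z → G}, ContDiff ℝ n f →
      ContDiff ℝ n fun x => ∫ y, f (x, ι y) ∂μ := by
  induction n with
  | zero =>
    intro G _ _ f hf
    exact contDiff_zero.2 (continuous_integral_comp hι hS hιS hf.continuous)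
  | succ n ih =>
    intro G _ _ f hf
    have h1 : ContDiff ℝ 1 f := hf.of_le (by exact_mod_cast Nat.le_add_left 1 n)
    have hd := hasFDerivAt_integral_comp hι hS hιS h1
    have : ((n + 1 : ℕ) : WithTop ℕ∞) = (n : WithTop ℕ∞) + 1 := by norm_cast
    rw [this] at hf ⊢
    rw [contDiff_succ_iff_fderiv]
    refine ⟨fun x => (hd x).differentiableAt, by simp, ?_⟩
    have : (fderiv ℝ fun x => ∫ y, f (x, ι y) ∂μ) = fun x =>
        ∫ y, (fderiv ℝ f (x, ι y)).comp (ContinuousLinearMap.inl ℝ E Z) ∂μ :=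
      funext fun x => (hd x).fderiv
    rw [this]
    exact ih (f := fun p => (fderiv ℝ f p).comp (ContinuousLinearMap.inl ℝ E Z))
      ((hf.fderiv_right le_rfl).clm_comp contDiff_const)

/-- Integrating a smooth function over a compact family of values of some of its variables leaves
a smooth function of the other variables. -/
theorem contDiff_integral_comp (hι : Continuous ι) (hS : IsCompact S)
    (hιS : ∀ᵐ y ∂μ, ι y ∈ S) {f : E × Z → G} (hf : ContDiff ℝ ∞ f) :
    ContDiff ℝ ∞ fun x => ∫ y, f (x, ι y) ∂μ :=
  contDiff_infty.2 fun n =>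
    contDiff_nat_integral_comp hι hS hιS n (hf.of_le (by exact_mod_cast le_top))

end Parametric

section Hadamard

variable {E G : Type} [NormedAddCommGroup E] [NormedSpace ℝ E]
  [NormedAddCommGroup G] [NormedSpace ℝ G]

/-- The partial derivative with respect to the last, real, variable. -/
def lastD (f : E × ℝ → G) (p : E × ℝ) : G := fderiv ℝ f p (0, 1)

theorem hasDerivAt_lastD {f : E × ℝ → G} {p : E} {x : ℝ} (hf : DifferentiableAt ℝ f (p, x)) :
    HasDerivAt (fun x => f (p, x)) (lastD f (p, x)) x := by
  have h := hf.hasFDerivAt.comp_hasDerivAt x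
    ((hasDerivAt_const x p).prodMk (hasDerivAt_id x))
  exact h

theorem contDiffAt_lastD {f : E × ℝ → G} {p : E × ℝ} (hf : ContDiffAt ℝ ∞ f p) :
    ContDiffAt ℝ ∞ (lastD f) p :=
  (hf.fderiv_right (m := ∞) (by simp)).clm_apply contDiffAt_const

theorem contDiff_lastD {f : E × ℝ → G} (hf : ContDiff ℝ ∞ f) : ContDiff ℝ ∞ (lastD f) :=
  contDiff_iff_contDiffAt.2 fun _ => contDiffAt_lastD hf.contDiffAt

/-- The Hadamard quotient `(f (p, r) - f (p, 0)) / r`, continued to `r = 0`, written as the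
average of the derivative. -/
def hadamard (f : E × ℝ → G) (p : E × ℝ) : G :=
  ∫ θ, lastD f (p.1, θ * p.2) ∂((volume : Measure ℝ).restrict (Icc 0 1))

theorem contDiff_hadamard [FiniteDimensional ℝ E] {f : E × ℝ → G} (hf : ContDiff ℝ ∞ f) :
    ContDiff ℝ ∞ (hadamard f) := by
  refine contDiff_integral_comp (E := E × ℝ) (Z := ℝ) (ι := id)
    (f := fun q => lastD f (q.1.1, q.2 * q.1.2)) continuous_id isCompact_Icc
    (ae_restrict_mem measurableSet_Icc) ?_
  exact (contDiff_lastD hf).comp (by fun_prop)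

theorem hadamard_spec [CompleteSpace G] {f : E × ℝ → G} (hf : ContDiff ℝ ∞ f) (p : E) (r : ℝ) :
    f (p, r) = f (p, 0) + r • hadamard f (p, r) := by
  have hd : ∀ θ : ℝ, HasDerivAt (fun θ : ℝ => f (p, θ * r)) (r • lastD f (p, θ * r)) θ := by
    intro θ
    have h1 := hasDerivAt_lastD (p := p) (x := θ * r)
      ((hf.differentiable (by simp)).differentiableAt)
    have h2 : HasDerivAt (fun θ : ℝ => θ * r) r θ := by
      simpa using (hasDerivAt_id θ).mul_const r
    exact h1.scomp θ h2
  have hc : Continuous fun θ : ℝ => r • lastD f (p, θ * r) :=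
    ((contDiff_lastD hf).continuous.comp (by fun_prop)).const_smul r
  have := intervalIntegral.integral_eq_sub_of_hasDerivAt (a := 0) (b := 1)
    (fun θ _ => hd θ) (hc.intervalIntegrable _ _)
  rw [intervalIntegral.integral_of_le zero_le_one, ← integral_Icc_eq_integral_Ioc,
    integral_smul] at this
  simp only [one_mul, zero_mul] at this
  simp only [hadamard, this]
  abel

theorem hadamard_zero [CompleteSpace G] (f : E × ℝ → G) (p : E) :
    hadamard f (p, 0) = lastD f (p, 0) := by
  simp [hadamard]

end Hadamard

/-- The Hermite divided difference at two double nodes `a`, `b`, here multiplied by `(b - a) ^ 3`, is a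
sixth of the third derivative at a point between them. -/
theorem exists_hermite_divided_difference {g g₁ g₂ g₃ : ℝ → ℝ} {a b : ℝ} (hab : a < b)
    (h₁ : ∀ x ∈ Icc a b, HasDerivAt g (g₁ x) x) (h₂ : ∀ x ∈ Icc a b, HasDerivAt g₁ (g₂ x) x)
    (h₃ : ∀ x ∈ Icc a b, HasDerivAt g₂ (g₃ x) x) :
    ∃ ξ ∈ Ioo a b, (g₁ a + g₁ b) * (b - a) - 2 * (g b - g a) = g₃ ξ / 6 * (b - a) ^ 3 := by
  have hba : 0 < b - a := sub_pos.2 hab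
  -- with this `c`, twice the error of the trapezoidal rule on `[a, x]`, minus `c * (x - a) ^ 3`,
  -- vanishes at `x = b`, and so Rolle's theorem applies to it, and then to its derivative
  set c : ℝ := ((g₁ a + g₁ b) * (b - a) - 2 * (g b - g a)) / (b - a) ^ 3 with hc
  have hc' : c * (b - a) ^ 3 = (g₁ a + g₁ b) * (b - a) - 2 * (g b - g a) := by
    rw [hc]; field_simp
  have hP : ∀ x ∈ Icc a b, HasDerivAt
      (fun x => (g₁ a + g₁ x) * (x - a) - 2 * (g x - g a) - c * (x - a) ^ 3)
      (g₂ x * (x - a) + g₁ a - g₁ x - 3 * c * (x - a) ^ 2) x := by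
    intro x hx
    have e1 := ((h₂ x hx).const_add (g₁ a)).mul ((hasDerivAt_id x).sub_const a)
    have e2 := ((h₁ x hx).sub_const (g a)).const_mul 2
    have e3 := (((hasDerivAt_id x).sub_const a).pow 3).const_mul c
    refine ((e1.sub e2).sub e3).congr_deriv ?_
    simp
    ring
  have hP' : ∀ x ∈ Icc a b, HasDerivAt
      (fun x => g₂ x * (x - a) + g₁ a - g₁ x - 3 * c * (x - a) ^ 2)
      ((g₃ x - 6 * c) * (x - a)) x := by
    intro x hx
    have e1 := (h₃ x hx).mul ((hasDerivAt_id x).sub_const a)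
    have e3 := (((hasDerivAt_id x).sub_const a).pow 2).const_mul (3 * c)
    refine (((e1.add_const (g₁ a)).sub (h₂ x hx)).sub e3).congr_deriv ?_
    simp
    ring
  obtain ⟨η, hη, hη0⟩ := exists_hasDerivAt_eq_zero hab
    (fun x hx => (hP x hx).continuousAt.continuousWithinAt)
    (by simp only [sub_self]; rw [hc']; ring) fun x hx => hP x (Ioo_subset_Icc_self hx)
  have hsub : ∀ x ∈ Icc a η, x ∈ Icc a b := fun x hx => ⟨hx.1, hx.2.trans hη.2.le⟩
  obtain ⟨ξ, hξ, hξ0⟩ := exists_hasDerivAt_eq_zero hη.1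
    (fun x hx => (hP' x (hsub x hx)).continuousAt.continuousWithinAt)
    (by simp only [hη0]; ring) fun x hx => hP' x (hsub x (Ioo_subset_Icc_self hx))
  refine ⟨ξ, ⟨hξ.1, hξ.2.trans hη.2⟩, ?_⟩
  have : g₃ ξ - 6 * c = 0 := by
    rcases mul_eq_zero.1 hξ0 with h | h
    · exact h
    · linarith [hξ.1]
  rw [← hc', show g₃ ξ = 6 * c by linarith]
  ring

/-! ### The divergence theorem for Lipschitz domains -/

/-- The divergence of a vector field. -/
def diverg (X : Space → Space) (x : Space) : ℝ :=
  LinearMap.trace ℝ Space (fderiv ℝ X x : Space →ₗ[ℝ] Space)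

theorem diverg_eq_sum (X : Space → Space) (x : Space) :
    diverg X x = ∑ i, fderiv ℝ X x (EuclideanSpace.single i 1) i := by
  rw [diverg, LinearMap.trace_eq_sum_inner _ (EuclideanSpace.basisFun (Fin 3) ℝ)]
  simp [EuclideanSpace.inner_single_left]

theorem fderiv_component {E : Type} [NormedAddCommGroup E] [NormedSpace ℝ E] {X : E → Space}
    {x : E} (hX : DifferentiableAt ℝ X x) (v : E) (i : Fin 3) :
    fderiv ℝ (fun y => X y i) x v = fderiv ℝ X x v i := by
  have h2 : HasFDerivAt (fun y => X y i)
      ((EuclideanSpace.proj i : Space →L[ℝ] ℝ).comp (fderiv ℝ X x)) x :=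
    (EuclideanSpace.proj i : Space →L[ℝ] ℝ).hasFDerivAt.comp x hX.hasFDerivAt
  rw [h2.fderiv]
  rfl

theorem diverg_eq_sum_component {X : Space → Space} {x : Space} (hX : DifferentiableAt ℝ X x) :
    diverg X x = ∑ i, fderiv ℝ (fun y => X y i) x (EuclideanSpace.single i 1) := by
  simp only [diverg_eq_sum, fderiv_component hX]

theorem diverg_add {X Y : Space → Space} {x : Space} (hX : DifferentiableAt ℝ X x)
    (hY : DifferentiableAt ℝ Y x) : diverg (fun y => X y + Y y) x = diverg X x + diverg Y x := by
  have : fderiv ℝ (fun y => X y + Y y) x = fderiv ℝ X x + fderiv ℝ Y x := fderiv_add hX hY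
  simp [diverg, this]

theorem diverg_sum {n : ℕ} {X : Fin n → Space → Space} {x : Space}
    (hX : ∀ k, DifferentiableAt ℝ (X k) x) :
    diverg (fun y => ∑ k, X k y) x = ∑ k, diverg (X k) x := by
  have : fderiv ℝ (fun y => ∑ k, X k y) x = ∑ k, fderiv ℝ (X k) x :=
    fderiv_fun_sum fun k _ => hX k
  simp [diverg, this]

theorem continuous_diverg {X : Space → Space} (hX : ContDiff ℝ 1 X) : Continuous (diverg X) := by
  simp only [funext (diverg_eq_sum X)]
  have h := hX.continuous_fderiv one_ne_zero
  fun_prop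

theorem diverg_of_eventuallyEq {X Y : Space → Space} {x : Space} (h : X =ᶠ[𝓝 x] Y) :
    diverg X x = diverg Y x := by rw [diverg, diverg, h.fderiv_eq]

theorem diverg_comp_isometry (e : Space ≃ₗᵢ[ℝ] Space) {X : Space → Space} {y : Space}
    (hX : DifferentiableAt ℝ X (e.symm y)) :
    diverg (fun y => e (X (e.symm y))) y = diverg X (e.symm y) := by
  have h1 : HasFDerivAt (fun y => e (X (e.symm y)))
      ((e.toContinuousLinearEquiv : Space →L[ℝ] Space).comp ((fderiv ℝ X (e.symm y)).comp
        (e.symm.toContinuousLinearEquiv : Space →L[ℝ] Space))) y := by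
    have a := hX.hasFDerivAt.comp y e.symm.toContinuousLinearEquiv.hasFDerivAt
    exact e.toContinuousLinearEquiv.hasFDerivAt.comp y a
  rw [diverg, h1.fderiv, diverg]
  exact LinearMap.trace_conj' (fderiv ℝ X (e.symm y) : Space →ₗ[ℝ] Space) e.toLinearEquiv

/-- The derivatives of a compactly supported Lipschitz function, which exist almost everywhere, have
mean zero. -/
theorem integral_lineDeriv_eq_zero {E : Type} [NormedAddCommGroup E] [NormedSpace ℝ E]
    [MeasurableSpace E] [BorelSpace E] [FiniteDimensional ℝ E] (μ : Measure E)
    [μ.IsAddHaarMeasure] {g : E → ℝ} {C : NNReal}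
    (hg : LipschitzWith C g) (hc : HasCompactSupport g) (v : E) :
    ∫ x, lineDeriv ℝ g x v ∂μ = 0 := by
  have h := LipschitzWith.integral_lineDeriv_mul_eq (μ := μ)
    (LipschitzWith.const (1 : ℝ) : LipschitzWith 0 fun _ : E => (1 : ℝ)) hg hc (-v)
  have h0 : ∀ x, lineDeriv ℝ (fun _ : E => (1 : ℝ)) x (-v) = 0 := fun x => by
    simp [lineDeriv]
  simpa [h0] using h.symm

/-- A function that vanishes on the boundary of a bounded domain has zero mean derivatives: its
extension by zero is Lipschitz. -/
theorem setIntegral_fderiv_eq_zero {V : Set Space} (hV : IsOpen V) (hb : Bornology.IsBounded V)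
    (hnull : volume (frontier V) = 0) {Y : Space → ℝ} (hY : ContDiff ℝ 1 Y)
    (h0 : ∀ x ∈ frontier V, Y x = 0) (v : Space) : ∫ x in V, fderiv ℝ Y x v = 0 := by
  obtain ⟨R, hR⟩ := hb.subset_closedBall (0 : Space)
  have hcl : closure V ⊆ Metric.closedBall 0 R :=
    closure_minimal hR Metric.isClosed_closedBall
  obtain ⟨C, hC⟩ := (hY.contDiffOn (s := Metric.closedBall 0 R)).exists_lipschitzOnWith one_ne_zero
    (convex_closedBall 0 R) (isCompact_closedBall 0 R)
  set g : Space → ℝ := V.indicator Y with hg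
  have key : ∀ x ∈ V, ∀ y ∉ V, |Y x| ≤ C * dist x y := by
    intro x hx y hy
    -- on the way out of `V`, the segment from `x` to `y` meets the boundary, where `Y` vanishes
    obtain ⟨p, hp, hpf⟩ : ∃ p ∈ segment ℝ x y, p ∈ frontier V := by
      by_contra! hcon
      have hs : segment ℝ x y ⊆ V :=
        (convex_segment x y).isPreconnected.subset_of_closure_inter_subset hV
          ⟨x, left_mem_segment ℝ x y, hx⟩ fun p hp => by
            by_contra hpV
            exact hcon p hp.2 ⟨hp.1, by rwa [hV.interior_eq]⟩
      exact hy (hs (right_mem_segment ℝ x y))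
    have h1 := hC.dist_le_mul x (hR hx) p (hcl (frontier_subset_closure hpf))
    rw [h0 p hpf, Real.dist_eq, sub_zero] at h1
    refine h1.trans (mul_le_mul_of_nonneg_left ?_ C.2)
    have := dist_add_dist_of_mem_segment hp
    linarith [dist_nonneg (x := p) (y := y)]
  have hlip : LipschitzWith C g := by
    refine LipschitzWith.of_dist_le_mul fun x y => ?_
    rw [Real.dist_eq]
    by_cases hx : x ∈ V <;> by_cases hy : y ∈ V
    · simpa [hg, hx, hy, Real.dist_eq] using hC.dist_le_mul x (hR hx) y (hR hy)
    · simpa [hg, hx, hy] using key x hx y hy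
    · simpa [hg, hx, hy, dist_comm] using key y hy x hx
    · simp only [hg, indicator_of_notMem hx, indicator_of_notMem hy, sub_self, abs_zero]
      positivity
  have hcs : HasCompactSupport g := by
    refine HasCompactSupport.of_support_subset_isCompact (isCompact_closedBall (0 : Space) R) ?_
    exact support_indicator_subset.trans hR
  have hz := integral_lineDeriv_eq_zero volume hlip hcs v
  rw [← integral_indicator hV.measurableSet, ← hz]
  refine integral_congr_ae ?_
  filter_upwards [measure_eq_zero_iff_ae_notMem.1 hnull] with x hx
  by_cases hxV : x ∈ V
  · have he : g =ᶠ[𝓝 x] Y := by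
      filter_upwards [hV.mem_nhds hxV] with y hy using indicator_of_mem hy Y
    rw [indicator_of_mem hxV, he.lineDeriv_eq,
      ((hY.differentiable one_ne_zero) x).lineDeriv_eq_fderiv]
  · have hxc : x ∉ closure V := fun hc => hx ⟨hc, by rwa [hV.interior_eq]⟩
    have he : g =ᶠ[𝓝 x] fun _ => 0 := by
      filter_upwards [isClosed_closure.isOpen_compl.mem_nhds hxc] with y hy
      exact indicator_of_notMem (fun h => hy (subset_closure h)) Y
    rw [indicator_of_notMem hxV, he.lineDeriv_eq]
    simp [lineDeriv]

/-- The parameter plane of boundary patches. -/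
abbrev Plane := EuclideanSpace ℝ (Fin 2)

/-- Splitting off the last coordinate. -/
def ofPlane (p : Plane × ℝ) : Space := !₂[p.1 0, p.1 1, p.2]

theorem contDiff_ofPlane {n : WithTop ℕ∞} : ContDiff ℝ n ofPlane := by
  rw [contDiff_euclidean]
  intro i
  fin_cases i <;> simp [ofPlane] <;> fun_prop

theorem ofPlane_add_smul (p q : Plane × ℝ) (c : ℝ) :
    ofPlane (p + c • q) = ofPlane p + c • ofPlane q := by
  ext i; fin_cases i <;> simp [ofPlane]

theorem ofPlane_coords (y : Space) : ofPlane (!₂[y 0, y 1], y 2) = y := by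
  ext i; fin_cases i <;> simp [ofPlane]

theorem norm_sq_ofPlane (p : Plane × ℝ) : ‖ofPlane p‖ ^ 2 = ‖p.1‖ ^ 2 + p.2 ^ 2 := by
  simp [ofPlane, EuclideanSpace.norm_sq_eq, Fin.sum_univ_three, Fin.sum_univ_two]

theorem continuous_planeCoords : Continuous fun y : Space => (!₂[y 0, y 1] : Plane) := by
  have : ContDiff ℝ 0 fun y : Space => (!₂[y 0, y 1] : Plane) := by
    rw [contDiff_euclidean]
    intro i
    fin_cases i <;> simp <;> fun_prop
  exact this.continuous

/-- `ofPlane` as a measurable equivalence. -/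
def planeEquiv : Plane × ℝ ≃ᵐ Space where
  toFun := ofPlane
  invFun y := (!₂[y 0, y 1], y 2)
  left_inv p := by
    refine Prod.ext ?_ (by simp [ofPlane])
    ext i; fin_cases i <;> simp [ofPlane]
  right_inv := ofPlane_coords
  measurable_toFun := (contDiff_ofPlane (n := 0)).continuous.measurable
  measurable_invFun := by
    exact (continuous_planeCoords.prodMk (by fun_prop)).measurable

theorem measurePreserving_planeEquiv : MeasurePreserving planeEquiv := by
  have h1 := (volume_preserving_piFinSuccAbove (fun _ : Fin 3 => ℝ) 2).symm
  have h2 : MeasurePreserving (Prod.map (id : ℝ → ℝ) (WithLp.ofLp (p := 2) (V := Fin 2 → ℝ)))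
      (volume.prod volume) (volume.prod volume) :=
    (MeasurePreserving.id volume).prod (PiLp.volume_preserving_ofLp (Fin 2))
  have h3 := (((PiLp.volume_preserving_toLp (Fin 3)).comp h1).comp h2).comp
    (Measure.measurePreserving_swap (μ := (volume : Measure Plane)) (ν := (volume : Measure ℝ)))
  convert! h3 using 1
  ext p i
  fin_cases i <;>
    simp [planeEquiv, ofPlane, Fin.insertNth_apply_same, Fin.insertNthEquiv]
  · exact (Fin.insertNth_apply_succAbove (α := fun _ => ℝ) (2 : Fin 3) p.2 p.1.ofLp 0).symm
  · exact (Fin.insertNth_apply_succAbove (α := fun _ => ℝ) (2 : Fin 3) p.2 p.1.ofLp 1).symm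

/-- Graphs are null sets; this makes the boundary of a Lipschitz domain a null set. -/
theorem volume_graph_eq_zero {h : Plane → ℝ} (hh : Continuous h) :
    volume {y : Space | y 2 = h !₂[y 0, y 1]} = 0 := by
  have hm : MeasurableSet {p : Plane × ℝ | p.2 = h p.1} :=
    measurableSet_eq_fun measurable_snd (hh.measurable.comp measurable_fst)
  have hpre : planeEquiv ⁻¹' {y : Space | y 2 = h !₂[y 0, y 1]} = {p : Plane × ℝ | p.2 = h p.1} := by
    ext p
    have : (!₂[p.1 0, p.1 1] : Plane) = p.1 := by ext i; fin_cases i <;> simp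
    simp [planeEquiv, ofPlane, this]
  rw [← measurePreserving_planeEquiv.measure_preimage_equiv, hpre,
    Measure.volume_eq_prod, Measure.prod_apply hm]
  simp

theorem hasFDerivAt_comp_prodMk_left {E G : Type} [NormedAddCommGroup E] [NormedSpace ℝ E]
    [NormedAddCommGroup G] [NormedSpace ℝ G] {g : E × ℝ → G} {s : E} {c : ℝ}
    (hg : DifferentiableAt ℝ g (s, c)) :
    HasFDerivAt (fun s => g (s, c)) ((fderiv ℝ g (s, c)).comp (ContinuousLinearMap.inl ℝ E ℝ)) s :=
  HasFDerivAt.comp (f := fun s : E => (s, c)) s hg.hasFDerivAt (hasFDerivAt_prodMk_left s c)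

section Graph

variable {f : Plane × ℝ → ℝ} {R : ℝ} {h : Plane → ℝ} {C : NNReal}

/-- The integral of `f` along the vertical line through `s`, from height `-R` up to `c`. -/
def vertical (f : Plane × ℝ → ℝ) (R : ℝ) (p : Plane × ℝ) : ℝ := ∫ τ in (-R)..p.2, f (p.1, τ)

theorem vertical_eq (f : Plane × ℝ → ℝ) (R : ℝ) (p : Plane × ℝ) :
    vertical f R p = (p.2 + R) * ∫ θ, f (p.1, -R + (p.2 + R) * θ)
      ∂((volume : Measure ℝ).restrict (Icc 0 1)) := by
  have h := intervalIntegral.smul_integral_comp_add_mul (a := 0) (b := 1)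
    (fun τ => f (p.1, τ)) (p.2 + R) (-R)
  rw [smul_eq_mul] at h
  rw [intervalIntegral.integral_of_le zero_le_one, ← integral_Icc_eq_integral_Ioc] at h
  rw [vertical, h]
  congr 1 <;> ring

theorem contDiff_vertical (hf : ContDiff ℝ 1 f) (R : ℝ) : ContDiff ℝ 1 (vertical f R) := by
  rw [funext (vertical_eq f R)]
  refine ContDiff.mul (by fun_prop) ?_
  exact contDiff_nat_integral_comp (E := Plane × ℝ) (Z := ℝ) (ι := id)
    (f := fun q => f (q.1.1, -R + (q.1.2 + R) * q.2)) continuous_id isCompact_Icc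
    (ae_restrict_mem measurableSet_Icc) 1 (hf.comp (by fun_prop))

theorem fderiv_vertical_fst (hf : ContDiff ℝ 1 f) (R : ℝ) (p : Plane × ℝ) (e : Plane) :
    fderiv ℝ (vertical f R) p (e, 0) = vertical (fun q => fderiv ℝ f q (e, 0)) R p := by
  obtain ⟨s, c⟩ := p
  have hd := hasFDerivAt_integral_comp (E := Plane) (Z := ℝ) (ι := id) (S := Icc (0 : ℝ) 1)
    (μ := (volume : Measure ℝ).restrict (Icc 0 1)) (f := fun q => f (q.1, -R + (c + R) * q.2))
    continuous_id isCompact_Icc (ae_restrict_mem measurableSet_Icc)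
    (hf.comp (by fun_prop)) s
  have h2 := hasFDerivAt_comp_prodMk_left ((contDiff_vertical hf R).differentiable one_ne_zero (s, c))
  simp only [vertical_eq] at h2
  have h3 := h2.unique (hd.const_mul (c + R))
  have h4 := congrArg (fun L : Plane →L[ℝ] ℝ => L e) h3
  have hvf : fderiv ℝ (vertical f R) (s, c) (e, 0) = (c + R) *
      (∫ y, (fderiv ℝ (fun q : Plane × ℝ => f (q.1, -R + (c + R) * q.2)) (s, y)).comp
        (ContinuousLinearMap.inl ℝ Plane ℝ) ∂((volume : Measure ℝ).restrict (Icc 0 1))) e := by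
    simpa [vertical_eq] using h4
  rw [hvf, vertical_eq]
  congr 1
  have hcd : ContDiff ℝ 1 fun q : Plane × ℝ => f (q.1, -R + (c + R) * q.2) :=
    hf.comp (by fun_prop)
  have hcont : Continuous fun y : ℝ =>
      (fderiv ℝ (fun q : Plane × ℝ => f (q.1, -R + (c + R) * q.2)) (s, y)).comp
        (ContinuousLinearMap.inl ℝ Plane ℝ) :=
    ((hcd.continuous_fderiv one_ne_zero).comp (by fun_prop)).clm_comp continuous_const
  rw [ContinuousLinearMap.integral_apply (hcont.integrableOn_Icc)]
  refine integral_congr_ae (Eventually.of_forall fun y => ?_)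
  have ha := hasFDerivAt_comp_prodMk_left
    ((hf.differentiable one_ne_zero) (s, -R + (c + R) * y))
  have hb := hasFDerivAt_comp_prodMk_left ((hcd.differentiable one_ne_zero) (s, y))
  have := congrArg (fun L : Plane →L[ℝ] ℝ => L e) (hb.unique ha)
  simpa using this

theorem fderiv_vertical_snd (hf : ContDiff ℝ 1 f) (R : ℝ) (p : Plane × ℝ) :
    fderiv ℝ (vertical f R) p (0, 1) = f p := by
  have hl := hasDerivAt_lastD (p := p.1) (x := p.2)
    ((contDiff_vertical hf R).differentiable one_ne_zero (p.1, p.2))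
  have hc : Continuous fun τ => f (p.1, τ) := hf.continuous.comp (by fun_prop)
  have := intervalIntegral.integral_hasDerivAt_right (hc.intervalIntegrable (-R) p.2)
    (hc.stronglyMeasurableAtFilter _ _) hc.continuousAt
  exact hl.unique this

theorem vertical_eq_setIntegral (hf : Continuous f)
    (h0 : ∀ s τ, R ≤ |τ| → f (s, τ) = 0) (p : Plane × ℝ) :
    vertical f R p = ∫ τ in Iio p.2, f (p.1, τ) := by
  have hc : Continuous fun τ => f (p.1, τ) := hf.comp (by fun_prop)
  have hcs : HasCompactSupport fun τ => f (p.1, τ) :=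
    HasCompactSupport.intro (isCompact_Icc (a := -R) (b := R)) fun τ hτ => by
      refine h0 _ _ ?_
      by_contra! hcon
      exact hτ (abs_le.1 hcon.le)
  have hi := hc.integrable_of_hasCompactSupport hcs (μ := volume)
  rw [vertical, ← intervalIntegral.integral_Iic_sub_Iic hi.integrableOn hi.integrableOn,
    ← integral_Iic_eq_integral_Iio, sub_eq_self]
  refine setIntegral_eq_zero_of_forall_eq_zero fun τ hτ => h0 _ _ ?_
  have : τ ≤ -R := hτ
  exact (by linarith : R ≤ -τ).trans (neg_le_abs τ)

/-- The divergence theorem below a Lipschitz graph, for a field in a horizontal direction: the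
derivative of the integrals over vertical lines contains the boundary term. -/
theorem integral_vertical_fderiv (hf : ContDiff ℝ 1 f) (h0' : ∀ s τ, R ≤ ‖s‖ → f (s, τ) = 0)
    (hh : LipschitzWith C h) (e : Plane) :
    Integrable (fun s => fderiv ℝ h s e * f (s, h s)) ∧
    ∫ s, vertical (fun q => fderiv ℝ f q (e, 0)) R (s, h s) =
      -∫ s, fderiv ℝ h s e * f (s, h s) := by
  obtain ⟨M, hM⟩ := (isCompact_closedBall (0 : Plane) R).exists_bound_of_continuousOn
    hh.continuous.continuousOn
  set A : Plane × ℝ → ℝ := vertical f R with hA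
  have hA1 : ContDiff ℝ 1 A := contDiff_vertical hf R
  have hA0 : ∀ s c, R ≤ ‖s‖ → A (s, c) = 0 := fun s c hs => by
    simp [hA, vertical, h0' s _ hs]
  -- a smooth cut-off in the height, which does not change the values on the graph
  obtain ⟨χ, hχ1⟩ : ∃ χ : ContDiffBump (0 : ℝ), ∀ c, |c| ≤ |M| + 1 → χ c = 1 :=
    ⟨⟨|M| + 1, |M| + 2, by positivity, by linarith⟩, fun c hc =>
      ContDiffBump.one_of_mem_closedBall _ (by simpa using hc)⟩
  set B : Plane × ℝ → ℝ := fun p => χ p.2 * A p with hB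
  have hB1 : ContDiff ℝ 1 B := ContDiff.mul (χ.contDiff.comp contDiff_snd) hA1
  have hBc : HasCompactSupport B := by
    refine HasCompactSupport.intro ((isCompact_closedBall (0 : Plane) R).prod
      (isCompact_closedBall (0 : ℝ) χ.rOut)) fun p hp => ?_
    rw [mem_prod, not_and_or] at hp
    rcases hp with hp | hp
    · have : R ≤ ‖p.1‖ := by
        by_contra! hcon
        exact hp (by simpa using hcon.le)
      simp [hB, hA0 p.1 p.2 this]
    · have : χ p.2 = 0 := χ.zero_of_le_dist (by
        by_contra! hcon
        exact hp (by simpa using hcon.le))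
      simp [hB, this]
  obtain ⟨D, hD⟩ := hB1.lipschitzWith_of_hasCompactSupport hBc one_ne_zero
  set Γ : Plane → ℝ := fun s => A (s, h s) with hΓ
  have hΓB : Γ = fun s => B (s, h s) := by
    funext s
    by_cases hs : R ≤ ‖s‖
    · simp [hΓ, hB, hA0 s _ hs]
    · have : |h s| ≤ |M| + 1 := by
        have := hM s (by simpa using (not_le.1 hs).le)
        rw [Real.norm_eq_abs] at this
        linarith [le_abs_self M]
      simp [hΓ, hB, hχ1 _ this]
  have hΓl : LipschitzWith (D * max 1 C) Γ := by
    rw [hΓB]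
    exact hD.comp (LipschitzWith.id.prodMk hh)
  have hΓc : HasCompactSupport Γ :=
    HasCompactSupport.intro (isCompact_closedBall (0 : Plane) R) fun s hs => by
      refine hA0 s _ ?_
      by_contra! hcon
      exact hs (by simpa using hcon.le)
  have hz := integral_lineDeriv_eq_zero volume hΓl hΓc e
  -- the chain rule at the points where the height is differentiable (Rademacher)
  have hae : ∀ᵐ s, lineDeriv ℝ Γ s e =
      vertical (fun q => fderiv ℝ f q (e, 0)) R (s, h s) + fderiv ℝ h s e * f (s, h s) := by
    filter_upwards [hh.ae_differentiableAt] with s hs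
    have hd : HasFDerivAt Γ ((fderiv ℝ A (s, h s)).comp
        ((ContinuousLinearMap.id ℝ Plane).prod (fderiv ℝ h s))) s := by
      have hin : HasFDerivAt (fun s : Plane => ((s, h s) : Plane × ℝ))
          ((ContinuousLinearMap.id ℝ Plane).prod (fderiv ℝ h s)) s :=
        (hasFDerivAt_id s).prodMk hs.hasFDerivAt
      exact HasFDerivAt.comp s (hA1.differentiable one_ne_zero (s, h s)).hasFDerivAt hin
    rw [hd.differentiableAt.lineDeriv_eq_fderiv, hd.fderiv]
    have hsplit : ((e, fderiv ℝ h s e) : Plane × ℝ) =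
        (e, 0) + fderiv ℝ h s e • ((0, 1) : Plane × ℝ) := by simp
    have : ((fderiv ℝ A (s, h s)).comp
        ((ContinuousLinearMap.id ℝ Plane).prod (fderiv ℝ h s))) e =
        fderiv ℝ A (s, h s) (e, fderiv ℝ h s e) := rfl
    rw [this, hsplit, map_add, map_smul, fderiv_vertical_fst hf, fderiv_vertical_snd hf,
      smul_eq_mul]
  have hi2 : Integrable fun s => fderiv ℝ h s e * f (s, h s) := by
    have hfc : Continuous fun s => f (s, h s) := hf.continuous.comp (continuous_id.prodMk hh.continuous)
    have hfi : Integrable fun s => f (s, h s) :=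
      hfc.integrable_of_hasCompactSupport
        (HasCompactSupport.intro (isCompact_closedBall (0 : Plane) R) fun s hs => by
          refine h0' s _ ?_
          by_contra! hcon
          exact hs (by simpa using hcon.le))
    refine hfi.bdd_mul (c := C * ‖e‖) (measurable_fderiv_apply_const ℝ h e).aestronglyMeasurable ?_
    exact Eventually.of_forall fun s =>
      ((fderiv ℝ h s).le_opNorm e).trans
        (mul_le_mul_of_nonneg_right (norm_fderiv_le_of_lipschitz ℝ hh) (norm_nonneg e))
  have hd1 : Continuous fun q => fderiv ℝ f q (e, 0) :=
    (hf.continuous_fderiv one_ne_zero).clm_apply continuous_const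
  have hi1 : Integrable fun s => vertical (fun q => fderiv ℝ f q (e, 0)) R (s, h s) := by
    have hcont : Continuous fun s => vertical (fun q => fderiv ℝ f q (e, 0)) R (s, h s) := by
      have : Continuous fun p : Plane × ℝ => fderiv ℝ A p (e, 0) :=
        (hA1.continuous_fderiv one_ne_zero).clm_apply continuous_const
      simp only [hA, fderiv_vertical_fst hf] at this
      exact this.comp (continuous_id.prodMk hh.continuous)
    refine hcont.integrable_of_hasCompactSupport
      (HasCompactSupport.intro (isCompact_closedBall (0 : Plane) R) fun s hs => ?_)
    have hs' : R < ‖s‖ := by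
      by_contra! hcon
      exact hs (by simpa using hcon)
    have : ∀ τ, fderiv ℝ f (s, τ) = 0 := fun τ => by
      have he : f =ᶠ[𝓝 (s, τ)] fun _ => 0 := by
        have : IsOpen {p : Plane × ℝ | R < ‖p.1‖} := isOpen_lt continuous_const (by fun_prop)
        filter_upwards [this.mem_nhds (by simpa using hs')] with p hp using h0' p.1 p.2 (le_of_lt hp)
      rw [he.fderiv_eq]; simp
    simp [vertical, this]
  refine ⟨hi2, ?_⟩
  rw [integral_congr_ae hae, integral_add hi1 hi2] at hz
  linarith

end Graph

theorem integral_add_add {α : Type*} [MeasurableSpace α] {μ : Measure α} {f g h : α → ℝ}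
    (hf : Integrable f μ) (hg : Integrable g μ) (hh : Integrable h μ) :
    ∫ x, f x + g x + h x ∂μ = ∫ x, f x ∂μ + ∫ x, g x ∂μ + ∫ x, h x ∂μ := by
  rw [← integral_add hf hg]
  exact integral_add (hf.add hg) hh

/-- The divergence theorem for a compactly supported field on the region below a Lipschitz
graph. -/
theorem integral_diverg_below_graph {h : Plane → ℝ} {C : NNReal} (hh : LipschitzWith C h)
    {Z : Space → Space} (hZ : ContDiff ℝ 1 Z) (hc : HasCompactSupport Z) :
    ∫ y in {y : Space | y 2 < h !₂[y 0, y 1]}, diverg Z y =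
      ∫ s, inner ℝ (!₂[-fderiv ℝ h s (EuclideanSpace.single 0 1),
        -fderiv ℝ h s (EuclideanSpace.single 1 1), 1] : Space) (Z !₂[s 0, s 1, h s]) := by
  obtain ⟨R, hR, hsupp⟩ : ∃ R : ℝ, 0 < R ∧ ∀ y, R ≤ ‖y‖ → Z y = 0 := by
    obtain ⟨R, hR⟩ := hc.isBounded.subset_ball (0 : Space)
    refine ⟨max R 1, by positivity, fun y hy => ?_⟩
    by_contra hne
    have := hR (subset_tsupport _ (Function.mem_support.2 hne))
    rw [Metric.mem_ball, dist_zero_right] at this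
    linarith [le_max_left R 1]
  set f : Fin 3 → Plane × ℝ → ℝ := fun i p => Z (ofPlane p) i with hf
  have hZi : ∀ i, ContDiff ℝ 1 fun y => Z y i := fun i => by
    have := contDiff_euclidean.1 hZ i
    exact this
  have hf1 : ∀ i, ContDiff ℝ 1 (f i) := fun i => (hZi i).comp contDiff_ofPlane
  have h0 : ∀ i s τ, R ≤ |τ| → f i (s, τ) = 0 := fun i s τ hτ => by
    have : R ≤ ‖ofPlane (s, τ)‖ := by
      refine hτ.trans (abs_le.2 (abs_le_of_sq_le_sq' ?_ (norm_nonneg _)))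
      rw [norm_sq_ofPlane]; simp
    simp [hf, hsupp _ this]
  have h0' : ∀ i s τ, R ≤ ‖s‖ → f i (s, τ) = 0 := fun i s τ hs => by
    have : R ≤ ‖ofPlane (s, τ)‖ := by
      refine hs.trans (abs_le_of_sq_le_sq' ?_ (norm_nonneg _)).2
      rw [norm_sq_ofPlane]; nlinarith [sq_nonneg τ]
    simp [hf, hsupp _ this]
  have hfd : ∀ i p q, fderiv ℝ (f i) p q = fderiv ℝ (fun y => Z y i) (ofPlane p) (ofPlane q) := by
    intro i p q
    have hd : DifferentiableAt ℝ (f i) p := (hf1 i).differentiable one_ne_zero p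
    rw [← hd.lineDeriv_eq_fderiv,
      ← ((hZi i).differentiable one_ne_zero (ofPlane p)).lineDeriv_eq_fderiv]
    simp only [lineDeriv, hf, ofPlane_add_smul]
  have hdiv : ∀ p, diverg Z (ofPlane p) = fderiv ℝ (f 0) p (EuclideanSpace.single 0 1, 0)
      + fderiv ℝ (f 1) p (EuclideanSpace.single 1 1, 0) + fderiv ℝ (f 2) p (0, 1) := by
    intro p
    have e0 : ofPlane (EuclideanSpace.single 0 1, 0) = EuclideanSpace.single 0 1 := by
      ext i; fin_cases i <;> simp [ofPlane]
    have e1 : ofPlane (EuclideanSpace.single 1 1, 0) = EuclideanSpace.single 1 1 := by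
      ext i; fin_cases i <;> simp [ofPlane]
    have e2 : ofPlane (0, 1) = EuclideanSpace.single 2 1 := by
      ext i; fin_cases i <;> simp [ofPlane]
    rw [diverg_eq_sum_component (hZ.differentiable one_ne_zero _), Fin.sum_univ_three, hfd, hfd,
      hfd, e0, e1, e2]
  have hcf : ∀ i q, Continuous fun p => fderiv ℝ (f i) p q := fun i q =>
    ((hf1 i).continuous_fderiv one_ne_zero).clm_apply continuous_const
  have hdz : ∀ i q s τ, R < |τ| → fderiv ℝ (f i) (s, τ) q = 0 := fun i q s τ hτ => by
    have he : f i =ᶠ[𝓝 (s, τ)] fun _ => 0 := by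
      have : IsOpen {p : Plane × ℝ | R < |p.2|} := isOpen_lt continuous_const (by fun_prop)
      filter_upwards [this.mem_nhds (by simpa using hτ)] with p hp using h0 i p.1 p.2 (le_of_lt hp)
    rw [he.fderiv_eq]; simp
  have hdz' : ∀ i q s τ, R < ‖s‖ → fderiv ℝ (f i) (s, τ) q = 0 := fun i q s τ hs => by
    have he : f i =ᶠ[𝓝 (s, τ)] fun _ => 0 := by
      have : IsOpen {p : Plane × ℝ | R < ‖p.1‖} := isOpen_lt continuous_const (by fun_prop)
      filter_upwards [this.mem_nhds (by simpa using hs)] with p hp using h0' i p.1 p.2 (le_of_lt hp)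
    rw [he.fderiv_eq]; simp
  -- enlarge `R`, so that the derivatives vanish from there on
  set R' : ℝ := R + 1 with hR'
  have k0 : ∀ i s τ, R' ≤ |τ| → f i (s, τ) = 0 := fun i s τ hτ => h0 i s τ (by linarith)
  have k0' : ∀ i s τ, R' ≤ ‖s‖ → f i (s, τ) = 0 := fun i s τ hτ => h0' i s τ (by linarith)
  have kd : ∀ i q s τ, R' ≤ |τ| → fderiv ℝ (f i) (s, τ) q = 0 :=
    fun i q s τ hτ => hdz i q s τ (by linarith)
  have hmeas : MeasurableSet {y : Space | y 2 < h !₂[y 0, y 1]} := by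
    exact measurableSet_lt (by fun_prop) (hh.continuous.comp continuous_planeCoords).measurable
  have hint : Integrable fun p : Plane × ℝ =>
      ({y : Space | y 2 < h !₂[y 0, y 1]}.indicator (diverg Z)) (ofPlane p) := by
    have h1 : Integrable (diverg Z) := by
      refine (continuous_diverg hZ).integrable_of_hasCompactSupport ?_
      refine HasCompactSupport.intro hc fun y hy => ?_
      have : Z =ᶠ[𝓝 y] fun _ => 0 := by
        filter_upwards [(isClosed_tsupport Z).isOpen_compl.mem_nhds hy] with x hx
        exact image_eq_zero_of_notMem_tsupport hx
      rw [diverg_of_eventuallyEq this]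
      simp [diverg]
    exact measurePreserving_planeEquiv.integrable_comp_emb planeEquiv.measurableEmbedding |>.2
      (h1.indicator hmeas)
  have hcoord : ∀ p : Plane × ℝ, (!₂[(ofPlane p) 0, (ofPlane p) 1] : Plane) = p.1 := fun p => by
    ext i; fin_cases i <;> simp [ofPlane]
  have hcoord2 : ∀ p : Plane × ℝ, (ofPlane p) 2 = p.2 := fun p => by simp [ofPlane]
  -- Fubini: the integral over a vertical line up to the graph, by the direction of the derivative
  have hinner : ∀ s, ∫ τ, ({y : Space | y 2 < h !₂[y 0, y 1]}.indicator (diverg Z)) (ofPlane (s, τ))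
      = vertical (fun q => fderiv ℝ (f 0) q (EuclideanSpace.single 0 1, 0)) R' (s, h s)
        + vertical (fun q => fderiv ℝ (f 1) q (EuclideanSpace.single 1 1, 0)) R' (s, h s)
        + f 2 (s, h s) := by
    intro s
    have hv2 : f 2 (s, h s) = vertical (fun q => fderiv ℝ (f 2) q (0, 1)) R' (s, h s) := by
      have hd : ∀ τ, HasDerivAt (fun τ => f 2 (s, τ)) (fderiv ℝ (f 2) (s, τ) (0, 1)) τ := fun τ =>
        hasDerivAt_lastD ((hf1 2).differentiable one_ne_zero _)
      have hcc : Continuous fun τ => fderiv ℝ (f 2) (s, τ) (0, 1) :=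
        (hcf 2 (0, 1)).comp (by fun_prop)
      rw [vertical, intervalIntegral.integral_eq_sub_of_hasDerivAt (fun τ _ => hd τ)
        (hcc.intervalIntegrable _ _), k0 2 s (-R') (by rw [abs_neg]; exact le_abs_self _), sub_zero]
    have hcs : ∀ i q, IntegrableOn (fun τ => fderiv ℝ (f i) (s, τ) q) (Iio (h s)) := fun i q => by
      refine Integrable.integrableOn (Continuous.integrable_of_hasCompactSupport
        ((hcf i q).comp (by fun_prop)) ?_)
      exact HasCompactSupport.intro (isCompact_Icc (a := -R') (b := R')) fun τ hτ => by
        refine kd i q s τ ?_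
        by_contra! hcon
        exact hτ (abs_le.1 hcon.le)
    rw [hv2, vertical_eq_setIntegral (hcf _ _) (kd 0 _), vertical_eq_setIntegral (hcf _ _) (kd 1 _),
      vertical_eq_setIntegral (hcf _ _) (kd 2 _), ← integral_add_add (hcs _ _) (hcs _ _) (hcs _ _),
      ← integral_indicator measurableSet_Iio]
    refine integral_congr_ae (Eventually.of_forall fun τ => ?_)
    simp only [indicator, mem_ofPred_eq, hcoord, hcoord2, mem_Iio, hdiv]
  obtain ⟨i0, e0⟩ := integral_vertical_fderiv (R := R') (hf1 0) (k0' 0) hh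
    (EuclideanSpace.single 0 1)
  obtain ⟨i1, e1⟩ := integral_vertical_fderiv (R := R') (hf1 1) (k0' 1) hh
    (EuclideanSpace.single 1 1)
  have i2 : Integrable fun s => f 2 (s, h s) :=
    ((hf1 2).continuous.comp (continuous_id.prodMk hh.continuous)).integrable_of_hasCompactSupport
      (HasCompactSupport.intro (isCompact_closedBall (0 : Plane) R') fun s hs => by
        refine k0' 2 s _ ?_
        by_contra! hcon
        exact hs (by simpa using hcon.le))
  have hvi : ∀ i q, Integrable fun s => vertical (fun p => fderiv ℝ (f i) p (q, 0)) R' (s, h s) := by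
    intro i q
    have hcont : Continuous fun s => vertical (fun p => fderiv ℝ (f i) p (q, 0)) R' (s, h s) := by
      have : Continuous fun p : Plane × ℝ => fderiv ℝ (vertical (f i) R') p (q, 0) :=
        ((contDiff_vertical (hf1 i) R').continuous_fderiv one_ne_zero).clm_apply continuous_const
      simp only [fderiv_vertical_fst (hf1 i)] at this
      exact this.comp (continuous_id.prodMk hh.continuous)
    refine hcont.integrable_of_hasCompactSupport
      (HasCompactSupport.intro (isCompact_closedBall (0 : Plane) R) fun s hs => ?_)
    have hs' : R < ‖s‖ := by
      by_contra! hcon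
      exact hs (by simpa using hcon)
    simp [vertical, hdz' i _ s _ hs']
  rw [← integral_indicator hmeas,
    ← measurePreserving_planeEquiv.integral_comp planeEquiv.measurableEmbedding]
  change ∫ p, ({y : Space | y 2 < h !₂[y 0, y 1]}.indicator (diverg Z)) (ofPlane p) = _
  rw [Measure.volume_eq_prod, integral_prod _ (by rwa [← Measure.volume_eq_prod])]
  simp only [hinner]
  rw [integral_add_add (hvi 0 _) (hvi 1 _) i2, e0, e1]
  have hsum := integral_add_add i0.neg i1.neg i2
  simp only [Pi.neg_apply, integral_neg] at hsum
  rw [← hsum]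
  refine integral_congr_ae (Eventually.of_forall fun s => ?_)
  simp only [PiLp.inner_apply, Fin.sum_univ_three]
  simp [hf, ofPlane]
  ring

namespace BoundaryPatch

variable {V : Set Space} (P : BoundaryPatch V)

theorem frame_point (s : Plane) : P.frame (P.point s) = !₂[s 0, s 1, P.height s] := by
  simp [point]

theorem continuous_height : Continuous P.height := by
  obtain ⟨K, hK⟩ := P.lipschitz
  exact hK.continuous

/-- The height above the graph, positive outside of `V`. -/
def excess (x : Space) : ℝ := P.frame x 2 - P.height !₂[P.frame x 0, P.frame x 1]

theorem continuous_excess : Continuous P.excess := by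
  have h := P.continuous_height.comp (continuous_planeCoords.comp P.frame.continuous)
  have h2 : Continuous fun x => P.frame x 2 := by
    have := P.frame.continuous
    fun_prop
  exact h2.sub h

theorem mem_iff_excess {x : Space} (hx : x ∈ P.dom) : x ∈ V ↔ P.excess x < 0 := by
  rw [P.mem_iff x hx, excess, sub_neg]

theorem excess_point (s : Plane) : P.excess (P.point s) = 0 := by
  have : (!₂[s 0, s 1] : Plane) = s := by ext i; fin_cases i <;> simp
  simp [excess, frame_point, this]

theorem excess_eq_zero_of_mem_frontier (hV : IsOpen V) {x : Space} (hx : x ∈ P.dom)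
    (hf : x ∈ frontier V) : P.excess x = 0 := by
  refine le_antisymm ?_ ?_
  · by_contra! hpos
    have hopen : IsOpen (P.dom ∩ {y | 0 < P.excess y}) :=
      P.isOpen_dom.inter (isOpen_lt continuous_const P.continuous_excess)
    obtain ⟨y, ⟨hyd, hye⟩, hyV⟩ := mem_closure_iff.1 (frontier_subset_closure hf) _ hopen ⟨hx, hpos⟩
    have := (P.mem_iff_excess hyd).1 hyV
    simp only [mem_ofPred_eq] at hye
    linarith
  · by_contra! hneg
    have := hf.2
    rw [hV.interior_eq] at this
    exact this ((P.mem_iff_excess hx).2 hneg)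

theorem point_mem_frontier (hV : IsOpen V) {s : Plane} (hs : P.point s ∈ P.dom) :
    P.point s ∈ frontier V := by
  refine ⟨?_, ?_⟩
  · set γ : ℝ → Space := fun ε => P.frame.symm !₂[s 0, s 1, P.height s - ε] with hγ
    have hγc : Continuous γ := by
      refine P.frame.symm.continuous.comp ?_
      have : ContDiff ℝ 0 fun ε : ℝ => (!₂[s 0, s 1, P.height s - ε] : Space) := by
        rw [contDiff_euclidean]
        intro i
        fin_cases i <;> simp <;> fun_prop
      exact this.continuous
    have h0 : γ 0 = P.point s := by simp [hγ, point]
    have ht : Tendsto γ (𝓝[>] 0) (𝓝 (P.point s)) := by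
      rw [← h0]; exact (hγc.tendsto 0).mono_left nhdsWithin_le_nhds
    refine mem_closure_of_tendsto ht ?_
    filter_upwards [ht (P.isOpen_dom.mem_nhds hs), self_mem_nhdsWithin] with ε hε hpos
    have : (!₂[s 0, s 1] : Plane) = s := by ext i; fin_cases i <;> simp
    rw [P.mem_iff _ hε]
    simpa [hγ, this] using hpos
  · rw [hV.interior_eq, P.mem_iff_excess hs, excess_point]
    exact lt_irrefl 0

theorem volume_excess_eq_zero : volume {x | P.excess x = 0} = 0 := by
  have h := volume_graph_eq_zero P.continuous_height
  have hpre : {x | P.excess x = 0} =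
      P.frame ⁻¹' {y : Space | y 2 = P.height !₂[y 0, y 1]} := by
    ext x; simp [excess, sub_eq_zero]
  rw [hpre, P.frame.measurePreserving.measure_preimage_emb P.frame.toHomeomorph.measurableEmbedding]
  exact h

theorem flux_congr (hV : IsOpen V) {X Y : Space → Space} (h : ∀ x ∈ frontier V, X x = Y x) :
    P.flux X = P.flux Y := by
  refine integral_congr_ae (Eventually.of_forall fun s => ?_)
  by_cases hw : P.weight (P.point s) = 0
  · simp [hw]
  · have hs : P.point s ∈ P.dom := P.tsupport_weight (subset_tsupport _ hw)
    simp only [h _ (P.point_mem_frontier hV hs)]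

/-- The divergence theorem for the part of a field that is carried by one patch: on the support of the
weight, `V` is the region below the graph. -/
theorem setIntegral_diverg_eq_flux (hV : IsOpen V) {X : Space → Space} (hX : ContDiff ℝ 1 X) :
    ∫ x in V, diverg (fun x => P.weight x • X x) x = P.flux X := by
  obtain ⟨C, hC⟩ := P.lipschitz
  set Y : Space → Space := fun x => P.weight x • X x with hY
  have hw1 : ContDiff ℝ 1 P.weight := P.contDiff_weight.of_le (by exact_mod_cast le_top)
  have hY1 : ContDiff ℝ 1 Y := hw1.smul hX
  have hYs : ∀ x ∉ tsupport P.weight, diverg Y x = 0 := fun x hx => by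
    have : Y =ᶠ[𝓝 x] fun _ => 0 := by
      filter_upwards [(isClosed_tsupport _).isOpen_compl.mem_nhds hx] with y hy
      simp [hY, image_eq_zero_of_notMem_tsupport hy]
    rw [diverg_of_eventuallyEq this]
    simp [diverg]
  set Z : Space → Space := fun y => P.frame (Y (P.frame.symm y)) with hZ
  have hZ1 : ContDiff ℝ 1 Z :=
    P.frame.contDiff.comp (hY1.comp P.frame.symm.contDiff)
  have hZc : HasCompactSupport Z := by
    have h1 : HasCompactSupport Y := P.hasCompactSupport_weight.smul_right
    have h2 : HasCompactSupport fun y => Y (P.frame.symm y) :=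
      h1.comp_homeomorph P.frame.symm.toHomeomorph
    exact h2.comp_left (map_zero P.frame)
  have hmain := integral_diverg_below_graph hC hZ1 hZc
  have hmeas : MeasurableSet {y : Space | y 2 < P.height !₂[y 0, y 1]} :=
    measurableSet_lt (by fun_prop) (P.continuous_height.comp continuous_planeCoords).measurable
  have hind : ∀ x, V.indicator (diverg Y) x =
      {y : Space | y 2 < P.height !₂[y 0, y 1]}.indicator (diverg Z) (P.frame x) := by
    intro x
    have hd : diverg Z (P.frame x) = diverg Y x := by
      have := diverg_comp_isometry P.frame (X := Y) (y := P.frame x)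
        (hY1.differentiable one_ne_zero _)
      simpa [hZ] using this
    by_cases hx : x ∈ tsupport P.weight
    · have := P.mem_iff x (P.tsupport_weight hx)
      by_cases hxV : x ∈ V
      · rw [indicator_of_mem hxV, indicator_of_mem (by simpa using this.1 hxV), hd]
      · rw [indicator_of_notMem hxV, indicator_of_notMem (by simpa using fun h => hxV (this.2 h))]
    · simp only [indicator, hd, hYs x hx, ite_self]
  rw [← integral_indicator hV.measurableSet, funext hind,
    P.frame.measurePreserving.integral_comp P.frame.toHomeomorph.measurableEmbedding,
    integral_indicator hmeas, hmain, flux]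
  refine integral_congr_ae (Eventually.of_forall fun s => ?_)
  simp only [hZ, hY, normal, point, map_smul, inner_smul_right]
  rw [LinearIsometryEquiv.inner_map_eq_flip]
  simp

end BoundaryPatch

namespace BoundaryAtlas

variable {V : Set Space} (A : BoundaryAtlas V)

theorem flux_congr (hV : IsOpen V) {X Y : Space → Space} (h : ∀ x ∈ frontier V, X x = Y x) :
    A.flux X = A.flux Y :=
  Finset.sum_congr rfl fun k _ => (A.patch k).flux_congr hV h

theorem volume_frontier (A : BoundaryAtlas V) (hV : IsOpen V) : volume (frontier V) = 0 := by
  have hsub : frontier V ⊆ ⋃ k, {x | (A.patch k).excess x = 0} := by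
    intro x hx
    obtain ⟨k, -, hk⟩ : ∃ k ∈ Finset.univ, (A.patch k).weight x ≠ 0 := by
      refine Finset.exists_ne_zero_of_sum_ne_zero ?_
      rw [A.sum_weight x hx]
      exact one_ne_zero
    exact mem_iUnion.2 ⟨k, (A.patch k).excess_eq_zero_of_mem_frontier hV
      ((A.patch k).tsupport_weight (subset_tsupport _ hk)) hx⟩
  refine measure_mono_null hsub ?_
  rw [measure_iUnion_null_iff]
  exact fun k => (A.patch k).volume_excess_eq_zero

/-- The divergence theorem for bounded Lipschitz domains. -/
theorem setIntegral_diverg (hV : IsOpen V) (hb : Bornology.IsBounded V) {X : Space → Space}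
    (hX : ContDiff ℝ 1 X) : ∫ x in V, diverg X x = A.flux X := by
  have hw : ∀ k, ContDiff ℝ 1 (A.patch k).weight := fun k =>
    (A.patch k).contDiff_weight.of_le (by exact_mod_cast le_top)
  -- the field is split with the weights of the patches; what remains vanishes on the boundary
  set wt : Space → ℝ := fun x => ∑ k, (A.patch k).weight x with hwt
  have hwt1 : ContDiff ℝ 1 wt := ContDiff.sum fun k _ => hw k
  set Y : Space → Space := fun x => (1 - wt x) • X x with hY
  have hY1 : ContDiff ℝ 1 Y := (contDiff_const.sub hwt1).smul hX
  have hWX : ∀ k, ContDiff ℝ 1 fun x => (A.patch k).weight x • X x := fun k => (hw k).smul hX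
  have hsum : ContDiff ℝ 1 fun x => ∑ k, (A.patch k).weight x • X x := ContDiff.sum fun k _ => hWX k
  have hint : ∀ {f : Space → ℝ}, Continuous f → IntegrableOn f V := fun {f} hf => by
    obtain ⟨R, hR⟩ := hb.subset_closedBall (0 : Space)
    exact (hf.continuousOn.integrableOn_compact (isCompact_closedBall 0 R)).mono_set hR
  have hdec : ∀ x, diverg X x = ∑ k, diverg (fun x => (A.patch k).weight x • X x) x
      + diverg Y x := by
    intro x
    rw [← diverg_sum fun k => (hWX k).differentiable one_ne_zero x,
      ← diverg_add (hsum.differentiable one_ne_zero x) (hY1.differentiable one_ne_zero x)]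
    congr 1
    funext y
    simp only [hY, hwt, sub_smul, one_smul, Finset.sum_smul]
    abel
  have hY0 : ∫ x in V, diverg Y x = 0 := by
    have hYi : ∀ i, ContDiff ℝ 1 fun y => Y y i := fun i => contDiff_euclidean.1 hY1 i
    simp only [diverg_eq_sum_component (hY1.differentiable one_ne_zero _)]
    rw [integral_finsetSum _ fun i _ => hint
      (((hYi i).continuous_fderiv one_ne_zero).clm_apply continuous_const)]
    refine Finset.sum_eq_zero fun i _ => ?_
    refine setIntegral_fderiv_eq_zero hV hb (A.volume_frontier hV) (hYi i) (fun x hx => ?_) _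
    simp [hY, hwt, A.sum_weight x hx]
  simp only [hdec]
  rw [integral_add (integrable_finsetSum _ fun k _ => hint (continuous_diverg (hWX k)))
    (hint (continuous_diverg hY1)), hY0, add_zero,
    integral_finsetSum _ fun k _ => hint (continuous_diverg (hWX k))]
  exact Finset.sum_congr rfl fun k _ => (A.patch k).setIntegral_diverg_eq_flux hV hX

end BoundaryAtlas

/-! ### Octahedra as Lipschitz domains -/

/-- The open octahedron with centre `c` and radius `ρ`. -/
def octahedron (c : Space) (ρ : ℝ) : Set Space :=
  {x | |x 0 - c 0| + |x 1 - c 1| + |x 2 - c 2| < ρ}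

theorem isOpen_octahedron (c : Space) (ρ : ℝ) : IsOpen (octahedron c ρ) :=
  isOpen_lt (by fun_prop) continuous_const

theorem octahedron_subset_ball (c : Space) (ρ : ℝ) : octahedron c ρ ⊆ Metric.ball c ρ := by
  intro x hx
  have hx' : |x 0 - c 0| + |x 1 - c 1| + |x 2 - c 2| < ρ := hx
  rw [Metric.mem_ball, EuclideanSpace.dist_eq, Fin.sum_univ_three]
  simp only [Real.dist_eq]
  have h0 := abs_nonneg (x 0 - c 0)
  have h1 := abs_nonneg (x 1 - c 1)
  have h2 := abs_nonneg (x 2 - c 2)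
  refine (Real.sqrt_lt' (by linarith)).2 ?_
  nlinarith [mul_nonneg h0 h1, mul_nonneg h0 h2, mul_nonneg h1 h2]

theorem mem_frontier_octahedron {c x : Space} {ρ : ℝ} (hx : x ∈ frontier (octahedron c ρ)) :
    |x 0 - c 0| + |x 1 - c 1| + |x 2 - c 2| = ρ :=
  frontier_lt_subset_eq (f := fun x : Space => |x 0 - c 0| + |x 1 - c 1| + |x 2 - c 2|)
    (g := fun _ => ρ) (by fun_prop) continuous_const hx

theorem lipschitz_tent (a b d : ℝ) :
    ∃ K, LipschitzWith K fun s : Plane => d - |s 0 - a| - |s 1 - b| := by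
  have h : ∀ (i : Fin 2) (a : ℝ), LipschitzWith 1 fun s : Plane => |s i - a| := fun i a => by
    refine LipschitzWith.of_dist_le_mul fun s t => ?_
    rw [Real.dist_eq, NNReal.coe_one, one_mul]
    refine (abs_abs_sub_abs_le _ _).trans ?_
    have : s i - a - (t i - a) = (s - t) i := by simp
    rw [this, dist_eq_norm]
    exact PiLp.norm_apply_le (s - t) i
  exact ⟨_, ((LipschitzWith.const d).sub (h 0 a)).sub (h 1 b)⟩

/-- The coordinate frame of a face direction: the coordinates are permuted by `σ`, and all signs
are changed by `ε`. -/
def octahedronFrame (σ : Equiv.Perm (Fin 3)) (ε : Bool) : Space ≃ₗᵢ[ℝ] Space :=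
  (LinearIsometryEquiv.piLpCongrLeft 2 ℝ ℝ σ).trans
    (if ε then LinearIsometryEquiv.refl ℝ Space else LinearIsometryEquiv.neg ℝ)

theorem octahedronFrame_apply (σ : Equiv.Perm (Fin 3)) (ε : Bool) (x : Space) (i : Fin 3) :
    octahedronFrame σ ε x i = (if ε then 1 else -1) * x (σ.symm i) := by
  cases ε <;> simp [octahedronFrame, LinearIsometryEquiv.piLpCongrLeft_apply,
    Equiv.piCongrLeft'_apply]

/-- The open half-space in which a face direction is positive. -/
def octahedronHalf (c : Space) (σ : Equiv.Perm (Fin 3)) (ε : Bool) : Set Space :=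
  {x | octahedronFrame σ ε c 2 < octahedronFrame σ ε x 2}

theorem abs_frame_sub (σ : Equiv.Perm (Fin 3)) (ε : Bool) (x c : Space) (i : Fin 3) :
    |octahedronFrame σ ε x i - octahedronFrame σ ε c i| = |x (σ.symm i) - c (σ.symm i)| := by
  rw [octahedronFrame_apply, octahedronFrame_apply]
  cases ε
  · rw [← abs_neg]; congr 1; simp; ring
  · simp

/-- In the half-space of a face direction, the octahedron is the region below the graph of a tent
function. -/
theorem mem_octahedron_iff {c x : Space} {ρ : ℝ} {σ : Equiv.Perm (Fin 3)} {ε : Bool}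
    (hx : x ∈ octahedronHalf c σ ε) : x ∈ octahedron c ρ ↔ octahedronFrame σ ε x 2 <
      (octahedronFrame σ ε c 2 + ρ) - |octahedronFrame σ ε x 0 - octahedronFrame σ ε c 0|
        - |octahedronFrame σ ε x 1 - octahedronFrame σ ε c 1| := by
  have hx' : octahedronFrame σ ε c 2 < octahedronFrame σ ε x 2 := hx
  have h2 := abs_frame_sub σ ε x c 2
  rw [abs_of_pos (sub_pos.2 hx')] at h2
  have hsum : |x 0 - c 0| + |x 1 - c 1| + |x 2 - c 2| =
      ∑ i, |x (σ.symm i) - c (σ.symm i)| := by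
    rw [Equiv.sum_comp σ.symm (fun i => |x i - c i|), Fin.sum_univ_three]
  rw [octahedron, mem_ofPred_eq, hsum, Fin.sum_univ_three, ← h2, abs_frame_sub, abs_frame_sub]
  constructor <;> intro h <;> linarith

/-- Every octahedron is a Lipschitz domain. -/
theorem nonempty_boundaryAtlas_octahedron (c : Space) {ρ : ℝ} (hρ : 0 < ρ) :
    Nonempty (BoundaryAtlas (octahedron c ρ)) := by
  -- the six half-spaces in which a coordinate is greater or less than that of the centre
  set dir : Fin 6 → Equiv.Perm (Fin 3) × Bool := fun k =>
    (Equiv.swap 2 ⟨k.1 % 3, Nat.mod_lt _ (by norm_num)⟩, decide (k.1 < 3)) with hdir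
  set U : Fin 6 → Set Space := fun k =>
    octahedronHalf c (dir k).1 (dir k).2 ∩ Metric.ball c (2 * ρ) with hU
  have hUo : ∀ k, IsOpen (U k) := fun k => by
    refine IsOpen.inter (isOpen_lt continuous_const ?_) Metric.isOpen_ball
    have := (octahedronFrame (dir k).1 (dir k).2).continuous
    fun_prop
  have hcl : frontier (octahedron c ρ) ⊆ Metric.closedBall c ρ :=
    frontier_subset_closure.trans (closure_minimal
      ((octahedron_subset_ball c ρ).trans Metric.ball_subset_closedBall)
      Metric.isClosed_closedBall)
  have hcover : frontier (octahedron c ρ) ⊆ ⋃ k, U k := by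
    intro x hx
    have hsum := mem_frontier_octahedron hx
    have hb : x ∈ Metric.ball c (2 * ρ) := by
      have := hcl hx
      rw [Metric.mem_closedBall] at this
      rw [Metric.mem_ball]
      linarith
    obtain ⟨i, hi⟩ : ∃ i, x i - c i ≠ 0 := by
      by_contra! hcon
      simp only [hcon, abs_zero] at hsum
      linarith
    rw [mem_iUnion]
    rcases lt_or_gt_of_ne hi with h | h
    · refine ⟨⟨i.1 + 3, by omega⟩, ?_, hb⟩
      have : (⟨(i.1 + 3) % 3, Nat.mod_lt _ (by norm_num)⟩ : Fin 3) = i := by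
        ext; simp
      simp only [octahedronHalf, mem_ofPred_eq, octahedronFrame_apply, hdir, this,
        Equiv.symm_swap, Equiv.swap_apply_left]
      simp; linarith
    · refine ⟨⟨i.1, by omega⟩, ?_, hb⟩
      have : (⟨i.1 % 3, Nat.mod_lt _ (by norm_num)⟩ : Fin 3) = i := by
        ext; simp
      simp only [octahedronHalf, mem_ofPred_eq, octahedronFrame_apply, hdir, this,
        Equiv.symm_swap, Equiv.swap_apply_left]
      simp; linarith
  obtain ⟨f, hf⟩ := SmoothPartitionOfUnity.exists_isSubordinate
    (modelWithCornersSelf ℝ Space) (isClosed_frontier (s := octahedron c ρ)) U hUo hcover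
  refine ⟨⟨6, fun k =>
    { frame := octahedronFrame (dir k).1 (dir k).2
      height := fun s => (octahedronFrame (dir k).1 (dir k).2 c 2 + ρ)
        - |s 0 - octahedronFrame (dir k).1 (dir k).2 c 0|
        - |s 1 - octahedronFrame (dir k).1 (dir k).2 c 1|
      lipschitz := lipschitz_tent _ _ _
      dom := U k
      isOpen_dom := hUo k
      mem_iff := fun x hx => by simpa using mem_octahedron_iff hx.1
      weight := f k
      contDiff_weight := (f k).contMDiff.contDiff
      hasCompactSupport_weight := ?_
      tsupport_weight := hf k }, ?_⟩⟩
  · refine IsCompact.of_isClosed_subset (isCompact_closedBall c (2 * ρ)) (isClosed_tsupport _) ?_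
    exact (hf k).trans (inter_subset_right.trans Metric.ball_subset_closedBall)
  · intro x hx
    have := f.sum_eq_one hx
    rwa [finsum_eq_sum_of_fintype] at this

/-! ### Polar coordinates and integrals over the unit sphere -/

/-- The unit sphere of physical space. -/
abbrev USphere := Metric.sphere (0 : Space) 1

/-- The surface measure of the unit sphere. -/
abbrev sphereMeasure : Measure USphere := (volume : Measure Space).toSphere

theorem norm_usphere (w : USphere) : ‖(w : Space)‖ = 1 := by simp

theorem finrank_space : Module.finrank ℝ Space = 3 := by simp

theorem integral_volumeIoiPow (f : ℝ → ℝ) :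
    ∫ r, f r ∂(Measure.volumeIoiPow (Module.finrank ℝ Space - 1)) =
      ∫ r in Ioi (0 : ℝ), r ^ 2 * f r := by
  simp only [Measure.volumeIoiPow, ENNReal.ofReal]
  rw [integral_withDensity_eq_integral_smul,
    integral_subtype_comap measurableSet_Ioi fun a ↦
      Real.toNNReal (a ^ (Module.finrank ℝ Space - 1)) • f a,
    setIntegral_congr_fun measurableSet_Ioi fun x hx ↦ ?_]
  · rw [NNReal.smul_def, Real.coe_toNNReal _ (pow_nonneg (le_of_lt hx) _), finrank_space]
    rfl
  · exact (measurable_subtype_coe.pow_const _).real_toNNReal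

theorem integrable_polar {G : Space → ℝ} (hG : Integrable G) :
    Integrable (fun p : USphere × Ioi (0 : ℝ) => G (p.2.1 • (p.1 : Space)))
      (sphereMeasure.prod (Measure.volumeIoiPow (Module.finrank ℝ Space - 1))) := by
  rw [← (volume : Measure Space).measurePreserving_homeomorphUnitSphereProd.integrable_comp_emb
    (Homeomorph.measurableEmbedding _)]
  have h1 : Integrable (fun x : ({(0)}ᶜ : Set Space) => G x)
      ((volume : Measure Space).comap Subtype.val) := by
    have := (integrableOn_iff_comap_subtypeVal (μ := (volume : Measure Space))
      (measurableSet_singleton (0 : Space)).compl (f := G)).1 hG.integrableOn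
    exact this
  refine h1.congr (Eventually.of_forall fun x => ?_)
  have : ‖(x : Space)‖ ≠ 0 := norm_ne_zero_iff.2 x.2
  simp [smul_smul, this]

theorem integral_eq_integral_prod (G : Space → ℝ) :
    ∫ x, G x = ∫ p : USphere × Ioi (0 : ℝ), G (p.2.1 • (p.1 : Space))
      ∂(sphereMeasure.prod (Measure.volumeIoiPow (Module.finrank ℝ Space - 1))) := by
  rw [← (volume : Measure Space).measurePreserving_homeomorphUnitSphereProd.integral_comp
    (Homeomorph.measurableEmbedding _)]
  have : ∫ x, G x = ∫ x : ({(0)}ᶜ : Set Space), G x ∂((volume : Measure Space).comap (↑)) := by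
    rw [integral_subtype_comap (measurableSet_singleton _).compl fun x ↦ G x,
      restrict_compl_singleton]
  rw [this]
  refine integral_congr_ae (Eventually.of_forall fun x => ?_)
  have : ‖(x : Space)‖ ≠ 0 := norm_ne_zero_iff.2 x.2
  simp [smul_smul, this]

/-- Integration in polar coordinates, over the spheres first. -/
theorem integral_polar {G : Space → ℝ} (hG : Integrable G) :
    ∫ x, G x = ∫ r in Ioi (0 : ℝ), r ^ 2 * ∫ w : USphere, G (r • (w : Space)) ∂sphereMeasure := by
  rw [integral_eq_integral_prod, integral_prod_symm _ (integrable_polar hG)]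
  exact integral_volumeIoiPow fun r => ∫ w : USphere, G (r • (w : Space)) ∂sphereMeasure

/-- Integration in polar coordinates, over the rays first. -/
theorem integral_polar_rays {G : Space → ℝ} (hG : Integrable G) :
    ∫ x, G x = ∫ w : USphere, (∫ r in Ioi (0 : ℝ), r ^ 2 * G (r • (w : Space))) ∂sphereMeasure := by
  rw [integral_eq_integral_prod, integral_prod _ (integrable_polar hG)]
  refine integral_congr_ae (Eventually.of_forall fun w => ?_)
  exact integral_volumeIoiPow fun r => G (r • (w : Space))

/-- The action of an isometry on the unit sphere. -/
def sphereIsometry (L : Space ≃ₗᵢ[ℝ] Space) : USphere ≃ₜ USphere where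
  toFun w := ⟨L w, by simp⟩
  invFun w := ⟨L.symm w, by simp⟩
  left_inv w := by ext1; simp
  right_inv w := by ext1; simp
  continuous_toFun := by
    have := L.continuous
    fun_prop
  continuous_invFun := by
    have := L.symm.continuous
    fun_prop

theorem measurePreserving_sphereIsometry (L : Space ≃ₗᵢ[ℝ] Space) :
    MeasurePreserving (sphereIsometry L) sphereMeasure sphereMeasure := by
  refine ⟨(sphereIsometry L).continuous.measurable, ?_⟩
  ext s hs
  rw [Measure.map_apply (sphereIsometry L).continuous.measurable hs, Measure.toSphere_apply' _ hs,
    Measure.toSphere_apply' _ ((sphereIsometry L).continuous.measurable hs)]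
  congr 1
  conv_rhs => rw [← L.measurePreserving.measure_preimage_emb L.toHomeomorph.measurableEmbedding]
  congr 1
  ext x
  simp only [Set.mem_smul, mem_preimage]
  constructor
  · rintro ⟨r, hr, _, ⟨w, hw, rfl⟩, h⟩
    exact ⟨r, hr, _, ⟨_, hw, rfl⟩, by rw [← h]; exact (map_smul L r (w : Space)).symm⟩
  · rintro ⟨r, hr, _, ⟨w, hw, rfl⟩, h⟩
    refine ⟨r, hr, _, ⟨(sphereIsometry L).symm w, by simpa using hw, rfl⟩, ?_⟩
    apply L.injective
    rw [← h, map_smul]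
    exact congrArg (r • ·) (L.apply_symm_apply (w : Space))

theorem integral_sphere_comp (L : Space ≃ₗᵢ[ℝ] Space) (f : Space → ℝ) :
    ∫ w : USphere, f (L w) ∂sphereMeasure = ∫ w : USphere, f w ∂sphereMeasure :=
  (measurePreserving_sphereIsometry L).integral_comp (sphereIsometry L).measurableEmbedding
    fun w => f w

theorem integral_sphere_neg (f : Space → ℝ) :
    ∫ w : USphere, f (-(w : Space)) ∂sphereMeasure = ∫ w : USphere, f w ∂sphereMeasure :=
  integral_sphere_comp (LinearIsometryEquiv.neg ℝ) f

theorem volume_unit_ball : (volume : Measure Space).real (Metric.ball 0 1) = 4 * Real.pi / 3 := by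
  rw [measureReal_def, EuclideanSpace.volume_ball_fin_three]
  rw [ENNReal.toReal_mul, ENNReal.toReal_ofReal (by positivity)]
  simp
  ring

theorem integral_sphere_const (c : ℝ) :
    ∫ _w : USphere, c ∂sphereMeasure = 4 * Real.pi * c := by
  rw [integral_const, Measure.toSphere_real_apply_univ, volume_unit_ball, finrank_space, smul_eq_mul]
  push_cast
  ring

theorem continuous_integrable_sphere {f : USphere → ℝ} (hf : Continuous f) :
    Integrable f sphereMeasure :=
  integrableOn_univ.1 (hf.continuousOn.integrableOn_compact isCompact_univ)

section Coulomb

variable {v : Space}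

/-- The angular density `(1 - v²) / (1 - v² + (v · w)²)^{3/2}` of the flux of the electric field of
a charge moving uniformly with velocity `v`. -/
def fluxDensity (v w : Space) : ℝ :=
  (1 - ‖v‖ ^ 2) / (Real.sqrt (1 - ‖v‖ ^ 2 + inner ℝ v w ^ 2)) ^ 3

theorem one_sub_sq_pos (hv : ‖v‖ < 1) : 0 < 1 - ‖v‖ ^ 2 := by
  nlinarith [norm_nonneg v]

theorem continuous_fluxDensity (hv : ‖v‖ < 1) : Continuous (fluxDensity v) := by
  have := one_sub_sq_pos hv
  refine Continuous.div continuous_const (by fun_prop) fun w => ?_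
  have : 0 < 1 - ‖v‖ ^ 2 + inner ℝ v w ^ 2 := by positivity
  positivity

/-- A linear map with `‖A y‖² = (1 - v²) ‖y‖² + (v · y)²`: it contracts by `√(1 - v²)` orthogonally
to `v`. -/
def contraction (v : Space) : Space →ₗ[ℝ] Space :=
  Real.sqrt (1 - ‖v‖ ^ 2) • LinearMap.id +
    (1 + Real.sqrt (1 - ‖v‖ ^ 2))⁻¹ • (innerSL ℝ v : Space →ₗ[ℝ] ℝ).smulRight v

theorem contraction_apply (v y : Space) : contraction v y = Real.sqrt (1 - ‖v‖ ^ 2) • y +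
    ((1 + Real.sqrt (1 - ‖v‖ ^ 2))⁻¹ * inner ℝ v y) • v := by
  simp [contraction, smul_smul]

theorem norm_sq_contraction (hv : ‖v‖ < 1) (y : Space) :
    ‖contraction v y‖ ^ 2 = (1 - ‖v‖ ^ 2) * ‖y‖ ^ 2 + inner ℝ v y ^ 2 := by
  have hs := Real.sq_sqrt (one_sub_sq_pos hv).le
  have hs0 := Real.sqrt_nonneg (1 - ‖v‖ ^ 2)
  set s := Real.sqrt (1 - ‖v‖ ^ 2) with hsdef
  rw [contraction_apply, ← hsdef, norm_add_sq_real, norm_smul, norm_smul, real_inner_smul_left,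
    real_inner_smul_right, mul_pow, mul_pow, Real.norm_eq_abs, Real.norm_eq_abs, sq_abs, sq_abs,
    hs, real_inner_comm v y]
  have h1 : (1 + s) ≠ 0 := by positivity
  have hv2 : ‖v‖ ^ 2 = (1 - s) * (1 + s) := by linear_combination hs
  rw [hv2]
  field_simp
  ring

/-- Up to the factor `√(1 - v²)`, which it has in the two directions orthogonal to `v`, the map is the
identity. -/
theorem det_contraction (hv : ‖v‖ < 1) : LinearMap.det (contraction v) = 1 - ‖v‖ ^ 2 := by
  have hs := Real.sq_sqrt (one_sub_sq_pos hv).le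
  have hs0 := Real.sqrt_nonneg (1 - ‖v‖ ^ 2)
  rw [← LinearMap.det_toMatrix (EuclideanSpace.basisFun (Fin 3) ℝ).toBasis, Matrix.det_fin_three]
  simp only [LinearMap.toMatrix_apply, OrthonormalBasis.coe_toBasis, EuclideanSpace.basisFun_apply,
    contraction_apply, OrthonormalBasis.coe_toBasis_repr_apply, EuclideanSpace.basisFun_repr,
    PiLp.add_apply, PiLp.smul_apply, EuclideanSpace.inner_single_right, smul_eq_mul]
  have hn : ‖v‖ ^ 2 = v 0 ^ 2 + v 1 ^ 2 + v 2 ^ 2 := by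
    simp [EuclideanSpace.norm_sq_eq, Fin.sum_univ_three]
  set s := Real.sqrt (1 - ‖v‖ ^ 2) with hsdef
  have h1 : (1 + s) ≠ 0 := by positivity
  have key : v 0 ^ 2 + v 1 ^ 2 + v 2 ^ 2 = (1 - s) * (1 + s) := by rw [← hn]; linear_combination hs
  rw [← hs]
  simp
  field_simp
  linear_combination (s ^ 2 + s ^ 3 * 2 + s ^ 4) * key

/-- Gauss' law for a uniformly moving charge. -/
theorem integral_fluxDensity (hv : ‖v‖ < 1) :
    ∫ w : USphere, fluxDensity v w ∂sphereMeasure = 4 * Real.pi := by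
  have hpos := one_sub_sq_pos hv
  have hdet := det_contraction hv
  have hdet0 : LinearMap.det (contraction v) ≠ 0 := by rw [hdet]; exact hpos.ne'
  -- the volume of this ellipsoid follows from the determinant, and is in polar coordinates a third of
  -- the integral of the cubes of the radii, which are a multiple of the flux density
  set B : Set Space := contraction v ⁻¹' Metric.ball 0 1 with hB
  have hBm : MeasurableSet B :=
    (LinearMap.continuous_of_finiteDimensional (contraction v)).measurable measurableSet_ball
  have hvol : volume.real B = (1 - ‖v‖ ^ 2)⁻¹ * (4 * Real.pi / 3) := by
    rw [measureReal_def, hB, Measure.addHaar_preimage_linearMap volume hdet0, hdet,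
      ENNReal.toReal_mul, ENNReal.toReal_ofReal (abs_nonneg _), ← measureReal_def, volume_unit_ball,
      abs_of_pos (inv_pos.2 hpos)]
  have hfin : volume B ≠ ⊤ := by
    rw [hB, Measure.addHaar_preimage_linearMap volume hdet0]
    exact ENNReal.mul_ne_top ENNReal.ofReal_ne_top measure_ball_lt_top.ne
  have hint : Integrable (B.indicator fun _ => (1 : ℝ)) :=
    (integrable_indicator_iff hBm).2 (integrableOn_const hfin)
  have h1 : ∫ x, B.indicator (fun _ => (1 : ℝ)) x = volume.real B := by
    rw [integral_indicator_const _ hBm, smul_eq_mul, mul_one]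
  rw [integral_polar_rays hint] at h1
  have h2 : ∀ w : USphere, ∫ r in Ioi (0 : ℝ), r ^ 2 * B.indicator (fun _ => (1 : ℝ))
      (r • (w : Space)) = (3 * (1 - ‖v‖ ^ 2))⁻¹ * fluxDensity v w := by
    intro w
    have hk2 := norm_sq_contraction hv (w : Space)
    rw [norm_usphere, one_pow, mul_one] at hk2
    set k := ‖contraction v (w : Space)‖ with hk
    have hkpos : 0 < k := by
      have : 0 < k ^ 2 := by rw [hk2]; positivity
      exact lt_of_le_of_ne (norm_nonneg _) fun h => by rw [← h] at this; simp at this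
    have hkeq : Real.sqrt (1 - ‖v‖ ^ 2 + inner ℝ v (w : Space) ^ 2) = k := by
      rw [← hk2, Real.sqrt_sq hkpos.le]
    have hset : ∀ r ∈ Ioi (0 : ℝ), r ^ 2 * B.indicator (fun _ => (1 : ℝ)) (r • (w : Space)) =
        (Iio k⁻¹).indicator (fun r => r ^ 2) r := by
      intro r hr
      have hr' : (0 : ℝ) < r := hr
      have : r • (w : Space) ∈ B ↔ r ∈ Iio k⁻¹ := by
        simp only [hB, mem_preimage, Metric.mem_ball, dist_zero_right, map_smul, norm_smul,
          Real.norm_eq_abs, abs_of_pos hr', ← hk, mem_Iio]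
        rw [lt_inv_comm₀ hr' hkpos, inv_eq_one_div, lt_div_iff₀ hr', mul_comm]
      by_cases h : r ∈ Iio k⁻¹
      · rw [indicator_of_mem (this.2 h), indicator_of_mem h, mul_one]
      · rw [indicator_of_notMem (fun h' => h (this.1 h')), indicator_of_notMem h, mul_zero]
    rw [setIntegral_congr_fun measurableSet_Ioi hset, setIntegral_indicator measurableSet_Iio,
      Ioi_inter_Iio, ← integral_Ioc_eq_integral_Ioo,
      ← intervalIntegral.integral_of_le (inv_pos.2 hkpos).le, integral_pow, fluxDensity, hkeq]
    have : (k ^ 3)⁻¹ * k ^ 3 = 1 := inv_mul_cancel₀ (by positivity)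
    field_simp
    norm_num
    linarith
  simp only [h2] at h1
  rw [integral_const_mul, hvol] at h1
  field_simp at h1
  linarith

/-- The second moments of the flux density couple `v` only to multiples of `v`. -/
theorem exists_integral_fluxDensity_inner (hv : ‖v‖ < 1) : ∃ κ : ℝ, ∀ a : Space,
    ∫ w : USphere, fluxDensity v w * inner ℝ v (w : Space) * inner ℝ a (w : Space) ∂sphereMeasure =
      κ * inner ℝ v a := by
  set I : Space → ℝ := fun a =>
    ∫ w : USphere, fluxDensity v w * inner ℝ v (w : Space) * inner ℝ a (w : Space) ∂sphereMeasure
    with hI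
  have hint : ∀ a : Space, Integrable (fun w : USphere =>
      fluxDensity v w * inner ℝ v (w : Space) * inner ℝ a (w : Space)) sphereMeasure := fun a => by
    have := continuous_fluxDensity hv
    exact continuous_integrable_sphere (by fun_prop)
  have hadd : ∀ a b, I (a + b) = I a + I b := fun a b => by
    simp only [hI]
    rw [← integral_add (hint a) (hint b)]
    simp only [inner_add_left, mul_add]
  have hsmul : ∀ (c : ℝ) a, I (c • a) = c * I a := fun c a => by
    simp only [hI]
    rw [← integral_const_mul]
    simp only [real_inner_smul_left]
    congr 1 with w
    ring
  by_cases h0 : v = 0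
  · exact ⟨0, fun a => by simp [h0]⟩
  have hperp : ∀ a, inner ℝ v a = 0 → I a = 0 := by
    intro a ha
    -- the reflection along `a` fixes `v` and changes the sign of the last factor
    have h := integral_sphere_comp (Submodule.reflection (ℝ ∙ a)ᗮ)
      fun w => fluxDensity v w * inner ℝ v w * inner ℝ a w
    have hv' : Submodule.reflection (ℝ ∙ a)ᗮ v = v := by
      rw [Submodule.reflection_eq_self_iff, Submodule.mem_orthogonal_singleton_iff_inner_right,
        real_inner_comm, ha]
    have ha' : Submodule.reflection (ℝ ∙ a)ᗮ a = -a :=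
      Submodule.reflection_orthogonalComplement_singleton_eq_neg a
    have e1 : ∀ w : Space, inner ℝ v (Submodule.reflection (ℝ ∙ a)ᗮ w) = inner ℝ v w := fun w => by
      conv_lhs => rw [← hv']
      exact LinearIsometryEquiv.inner_map_map _ _ _
    have e2 : ∀ w : Space, inner ℝ a (Submodule.reflection (ℝ ∙ a)ᗮ w) = -inner ℝ a w := fun w => by
      rw [← LinearIsometryEquiv.inner_map_map (Submodule.reflection (ℝ ∙ a)ᗮ) a w, ha',
        inner_neg_left, neg_neg]
    simp only [fluxDensity, e1, e2, mul_neg, integral_neg] at h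
    change -I a = I a at h
    linarith
  have hvv : inner ℝ v v ≠ (0 : ℝ) := by simpa using h0
  refine ⟨I v / inner ℝ v v, fun a => ?_⟩
  change I a = _
  have hsplit : a = (a - (inner ℝ v a / inner ℝ v v : ℝ) • v) + (inner ℝ v a / inner ℝ v v : ℝ) • v := by
    abel
  rw [hsplit, hadd, hsmul, hperp _ (by
    rw [inner_sub_right, real_inner_smul_right]; field_simp; ring), ← hsplit]
  field_simp
  ring

end Coulomb

/-! ### The classical Maxwell equations off the world-lines -/

theorem spacePart_event (t : ℝ) (x : Space) : spacePart (event t x) = x := by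
  ext i; simp [spacePart, event]

theorem event_zero (t : ℝ) (x : Space) : event t x 0 = t := rfl

theorem event_succ (t : ℝ) (x : Space) (i : Fin 3) : event t x i.succ = x i := rfl

theorem event_spacePart (p : Event) : event (p 0) (spacePart p) = p := by
  ext i; refine Fin.cases rfl (fun i => rfl) i

/-- `event` as a continuous linear map. -/
def eventCLM : ℝ × Space →L[ℝ] Event :=
  LinearMap.toContinuousLinearMap
    { toFun := fun q => event q.1 q.2
      map_add' := fun a b => by ext i; refine Fin.cases (by rfl) (fun i => by rfl) i
      map_smul' := fun c a => by ext i; refine Fin.cases (by rfl) (fun i => by rfl) i }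

theorem eventCLM_apply (t : ℝ) (x : Space) : eventCLM (t, x) = event t x := rfl

/-- `spacePart` as a continuous linear map. -/
def spacePartCLM : Event →L[ℝ] Space :=
  LinearMap.toContinuousLinearMap
    { toFun := spacePart
      map_add' := fun a b => by ext i; rfl
      map_smul' := fun c a => by ext i; rfl }

theorem spacePartCLM_apply (p : Event) : spacePartCLM p = spacePart p := rfl

/-- Multiplication with a smooth function that is supported in the open set `Ω` extends a function
that is smooth on `Ω` by zero. -/
theorem contDiff_mul_of_tsupport_subset {E : Type} [NormedAddCommGroup E] [NormedSpace ℝ E]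
    {Ω : Set E} (hΩ : IsOpen Ω) {f g : E → ℝ} (hf : ContDiffOn ℝ ∞ f Ω) (hg : ContDiff ℝ ∞ g)
    (hs : tsupport g ⊆ Ω) : ContDiff ℝ ∞ fun p => f p * g p := by
  refine contDiff_iff_contDiffAt.2 fun p => ?_
  by_cases hp : p ∈ Ω
  · exact (hf.contDiffAt (hΩ.mem_nhds hp)).mul hg.contDiffAt
  · have : (fun p => f p * g p) =ᶠ[𝓝 p] fun _ => 0 := by
      filter_upwards [(isClosed_tsupport g).isOpen_compl.mem_nhds fun h => hp (hs h)] with q hq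
      rw [image_eq_zero_of_notMem_tsupport hq, mul_zero]
    exact contDiffAt_const.congr_of_eventuallyEq this

theorem contDiff_partialD {φ : Event → ℝ} (hφ : ContDiff ℝ ∞ φ) (ν : Fin 4) :
    ContDiff ℝ ∞ (partialD ν φ) :=
  (hφ.fderiv_right (m := ∞) (by simp)).clm_apply contDiff_const

theorem contDiffOn_partialD {Ω : Set Event} (hΩ : IsOpen Ω) {f : Event → ℝ}
    (hf : ContDiffOn ℝ ∞ f Ω) (ν : Fin 4) : ContDiffOn ℝ ∞ (partialD ν f) Ω :=
  (hf.fderiv_of_isOpen hΩ (m := ∞) (by simp)).clm_apply contDiffOn_const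

theorem tsupport_partialD_subset (φ : Event → ℝ) (ν : Fin 4) :
    tsupport (partialD ν φ) ⊆ tsupport φ :=
  (closure_mono fun p hp => by
    intro h
    exact hp (by simp [partialD, show fderiv ℝ φ p = 0 from h])).trans
      (tsupport_fderiv_subset ℝ)

/-- Integration by parts on an open set. -/
theorem integral_mul_partialD {Ω : Set Event} (hΩ : IsOpen Ω) {f φ : Event → ℝ}
    (hf : ContDiffOn ℝ ∞ f Ω) (hφ : ContDiff ℝ ∞ φ) (hc : HasCompactSupport φ)
    (hs : tsupport φ ⊆ Ω) (ν : Fin 4) :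
    ∫ p, f p * partialD ν φ p = -∫ p, partialD ν f p * φ p := by
  have hprod := contDiff_mul_of_tsupport_subset hΩ hf hφ hs
  have hcp : HasCompactSupport fun p => f p * φ p := hc.mul_left
  obtain ⟨C, hC⟩ := hprod.lipschitzWith_of_hasCompactSupport hcp (by simp)
  have h0 := integral_lineDeriv_eq_zero volume hC hcp (Pi.single ν 1)
  have hpt : ∀ p, lineDeriv ℝ (fun p => f p * φ p) p (Pi.single ν 1) =
      f p * partialD ν φ p + partialD ν f p * φ p := by
    intro p
    rw [(hprod.differentiable (by simp) p).lineDeriv_eq_fderiv]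
    by_cases hp : p ∈ tsupport φ
    · have hfd := ((hf.contDiffAt (hΩ.mem_nhds (hs hp))).differentiableAt (by simp)).hasFDerivAt
      have hφd := (hφ.differentiable (by simp) p).hasFDerivAt
      have : HasFDerivAt (fun p => f p * φ p) (f p • fderiv ℝ φ p + φ p • fderiv ℝ f p) p :=
        hfd.mul hφd
      rw [this.fderiv]
      simp [partialD]
      ring
    · have h1 : (fun p => f p * φ p) =ᶠ[𝓝 p] fun _ => 0 := by
        filter_upwards [(isClosed_tsupport φ).isOpen_compl.mem_nhds hp] with q hq
        rw [image_eq_zero_of_notMem_tsupport hq, mul_zero]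
      have h2 := image_eq_zero_of_notMem_tsupport
        (fun h => hp (tsupport_partialD_subset φ ν h))
      rw [h1.fderiv_eq, h2, image_eq_zero_of_notMem_tsupport hp]
      simp
  simp only [hpt] at h0
  rw [integral_add] at h0
  · linarith
  · exact (contDiff_mul_of_tsupport_subset hΩ hf (contDiff_partialD hφ ν)
      ((tsupport_partialD_subset φ ν).trans hs)).continuous.integrable_of_hasCompactSupport
      (HasCompactSupport.mul_left (hc.of_isClosed_subset (isClosed_tsupport _)
        (tsupport_partialD_subset φ ν)))
  · exact (contDiff_mul_of_tsupport_subset hΩ (contDiffOn_partialD hΩ hf ν) hφ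
      hs).continuous.integrable_of_hasCompactSupport hc.mul_left

/-- A vector field which is smooth on an open set and divergence free there in the sense of
distributions is divergence free. -/
theorem sum_partialD_eq_zero {Ω : Set Event} (hΩ : IsOpen Ω) {f : Fin 4 → Event → ℝ}
    (hf : ∀ ν, ContDiffOn ℝ ∞ (f ν) Ω)
    (h : ∀ φ : Event → ℝ, ContDiff ℝ ∞ φ → HasCompactSupport φ → tsupport φ ⊆ Ω →
      ∫ p, ∑ ν, f ν p * partialD ν φ p = 0) {p : Event} (hp : p ∈ Ω) :
    ∑ ν, partialD ν (f ν) p = 0 := by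
  have hcont : ContinuousOn (fun p => ∑ ν, partialD ν (f ν) p) Ω :=
    continuousOn_finsetSum _ fun ν _ => (contDiffOn_partialD hΩ (hf ν) ν).continuousOn
  have hae := hΩ.ae_eq_zero_of_integral_contDiff_smul_eq_zero (μ := volume)
    (f := fun p => ∑ ν, partialD ν (f ν) p)
    (hcont.locallyIntegrableOn hΩ.measurableSet) fun φ hφ hc hs => by
      have h1 := h φ hφ hc hs
      have hi : ∀ ν, Integrable fun p => f ν p * partialD ν φ p := fun ν =>
        (contDiff_mul_of_tsupport_subset hΩ (hf ν) (contDiff_partialD hφ ν)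
          ((tsupport_partialD_subset φ ν).trans hs)).continuous.integrable_of_hasCompactSupport
          (HasCompactSupport.mul_left (hc.of_isClosed_subset (isClosed_tsupport _)
            (tsupport_partialD_subset φ ν)))
      have hi' : ∀ ν, Integrable fun p => partialD ν (f ν) p * φ p := fun ν =>
        (contDiff_mul_of_tsupport_subset hΩ (contDiffOn_partialD hΩ (hf ν) ν) hφ
          hs).continuous.integrable_of_hasCompactSupport hc.mul_left
      rw [integral_finsetSum _ fun ν _ => hi ν] at h1
      simp only [integral_mul_partialD hΩ (hf _) hφ hc hs, Finset.sum_neg_distrib] at h1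
      simp only [smul_eq_mul, mul_comm (φ _), Finset.sum_mul]
      rw [integral_finsetSum _ fun ν _ => hi' ν]
      linarith
  have := Measure.eqOn_open_of_ae_eq (μ := volume) (f := fun p => ∑ ν, partialD ν (f ν) p)
    (g := fun _ => 0) ((ae_restrict_iff' hΩ.measurableSet).2 hae) hΩ hcont continuousOn_const
  exact this hp

theorem contDiffOn_component {F : TensorField} {Ω : Set Event} (hF : ContDiffOn ℝ ∞ F Ω)
    (μ ν : Fin 4) : ContDiffOn ℝ ∞ (fun p => F p μ ν) Ω :=
  contDiffOn_pi.1 (contDiffOn_pi.1 hF μ) ν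

/-- The bilinear form which is half of the polarization of `stress`. -/
def stressPolar (f d : Fin 4 → Fin 4 → ℝ) (μ ν : Fin 4) : ℝ :=
  (∑ l, metric l * (d μ l * f ν l + f μ l * d ν l))
    - 1 / 4 * (if μ = ν then metric μ else 0) *
      ∑ k, ∑ l, metric k * metric l * (2 * f k l * d k l)

theorem hasDerivAt_stress {G : ℝ → Fin 4 → Fin 4 → ℝ} {d : Fin 4 → Fin 4 → ℝ} {t : ℝ}
    (h : ∀ a b, HasDerivAt (fun s => G s a b) (d a b) t) (μ ν : Fin 4) :
    HasDerivAt (fun s => stress (G s) μ ν) (stressPolar (G t) d μ ν) t := by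
  unfold stress stressPolar
  refine HasDerivAt.sub (HasDerivAt.fun_sum fun l _ => ?_)
    (HasDerivAt.const_mul _ (HasDerivAt.fun_sum fun k _ => HasDerivAt.fun_sum fun l _ => ?_))
  · refine (((h μ l).const_mul (metric l)).mul (h ν l)).congr_deriv ?_
    ring
  · refine (((h k l).const_mul (metric k * metric l)).mul (h k l)).congr_deriv ?_
    ring

theorem contDiffOn_stress {E : Type} [NormedAddCommGroup E] [NormedSpace ℝ E] {Ω : Set E}
    {f : E → Fin 4 → Fin 4 → ℝ} {n : WithTop ℕ∞}
    (hf : ∀ a b, ContDiffOn ℝ n (fun p => f p a b) Ω) (μ ν : Fin 4) :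
    ContDiffOn ℝ n (fun p => stress (f p) μ ν) Ω := by
  unfold stress
  refine ContDiffOn.sub (ContDiffOn.sum fun l _ => ?_)
    (contDiffOn_const.mul (ContDiffOn.sum fun k _ => ContDiffOn.sum fun l _ => ?_))
  · exact (contDiffOn_const.mul (hf μ l)).mul (hf ν l)
  · exact (contDiffOn_const.mul (hf k l)).mul (hf k l)

/-- Maxwell's equations imply that the energy-momentum tensor has no divergence. Here `d κ` stands
for the partial derivative `∂_κ` of the field `f`. -/
theorem sum_stressPolar_eq_zero {f : Fin 4 → Fin 4 → ℝ} {d : Fin 4 → Fin 4 → Fin 4 → ℝ}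
    (hf : ∀ a b, f a b = -f b a) (hd : ∀ k a b, d k a b = -d k b a)
    (hM : ∀ μ, ∑ ν, d ν μ ν = 0)
    (hB : ∀ l μ ν, metric l * d l μ ν + metric μ * d μ ν l + metric ν * d ν l μ = 0) (μ : Fin 4) :
    ∑ κ, stressPolar f (d κ) κ μ = 0 := by
  have f0 : ∀ a, f a a = 0 := fun a => by linarith [hf a a]
  have d0 : ∀ k a, d k a a = 0 := fun k a => by linarith [hd k a a]
  have f1 := hf 1 0
  have f2 := hf 2 0
  have f3 := hf 3 0
  have f4 := hf 2 1
  have f5 := hf 3 1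
  have f6 := hf 3 2
  have d1 := fun k => hd k 1 0
  have d2 := fun k => hd k 2 0
  have d3 := fun k => hd k 3 0
  have d4 := fun k => hd k 2 1
  have d5 := fun k => hd k 3 1
  have d6 := fun k => hd k 3 2
  have m0 := hM 0
  have m1 := hM 1
  have m2 := hM 2
  have m3 := hM 3
  have b0 := hB 1 2 3
  have b1 := hB 0 2 3
  have b2 := hB 0 1 3
  have b3 := hB 0 1 2
  clear hf hd hM hB
  simp only [Fin.sum_univ_four, d0, d1, d2, d3, d4, d5, d6] at m0 m1 m2 m3
  simp [metric, d2, d3, d5] at b0 b1 b2 b3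
  have key : ∀ i, i = 0 ∨ i = 1 ∨ i = 2 ∨ i = (3 : Fin 4) := by decide
  rcases key μ with rfl | rfl | rfl | rfl <;>
    simp [stressPolar, metric, Fin.sum_univ_four, f0, d0, f1, f2, f3, f4, f5, f6, d1, d2, d3,
      d4, d5, d6]
  · linear_combination -f 0 1 * m1 - f 0 2 * m2 - f 0 3 * m3 - f 1 2 * b3 - f 1 3 * b2 - f 2 3 * b1
  · linear_combination -f 0 1 * m0 - f 1 2 * m2 - f 1 3 * m3 - f 0 2 * b3 - f 0 3 * b2 - f 2 3 * b0
  · linear_combination -f 0 2 * m0 + f 1 2 * m1 - f 2 3 * m3 + f 0 1 * b3 - f 0 3 * b1 + f 1 3 * b0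
  · linear_combination -f 0 3 * m0 + f 1 3 * m1 + f 2 3 * m2 + f 0 1 * b2 + f 0 2 * b1 - f 1 2 * b0

namespace ParticleSystem

variable {N : ℕ} {S : ParticleSystem N} {F : TensorField}

/-- The events off the world-lines. -/
def offWorldLines (S : ParticleSystem N) : Set Event := (⋃ n, S.worldLine n)ᶜ

theorem mem_worldLine_iff {n : Fin N} {p : Event} :
    p ∈ S.worldLine n ↔ spacePart p = S.pos n (p 0) := by
  constructor
  · rintro ⟨t, rfl⟩
    simp [spacePart_event, event_zero]
  · intro h
    refine ⟨p 0, ?_⟩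
    simp only [← h, event_spacePart]

theorem mem_offWorldLines_iff {t : ℝ} {x : Space} :
    event t x ∈ S.offWorldLines ↔ ∀ n, x ≠ S.pos n t := by
  simp [offWorldLines, mem_worldLine_iff, spacePart_event, event_zero]

theorem isOpen_offWorldLines : IsOpen S.offWorldLines := by
  rw [offWorldLines, isOpen_compl_iff]
  refine isClosed_iUnion_of_finite fun n => ?_
  have : S.worldLine n = {p | spacePart p = S.pos n (p 0)} := by
    ext p; exact mem_worldLine_iff
  rw [this]
  exact isClosed_eq spacePartCLM.continuous ((S.smooth n).continuous.comp (continuous_apply 0))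

/-- The source-free inhomogeneous Maxwell equations, in the classical sense. -/
theorem IsMaxwellField.sum_partialD (hF : S.IsMaxwellField F)
    (hs : ContDiffOn ℝ ∞ F S.offWorldLines) {p : Event} (hp : p ∈ S.offWorldLines) (μ : Fin 4) :
    ∑ ν, partialD ν (fun p => F p μ ν) p = 0 := by
  refine sum_partialD_eq_zero isOpen_offWorldLines (fun ν => contDiffOn_component hs μ ν)
    (fun φ hφ hc hsupp => ?_) hp
  have h := hF.inhomogeneous φ hφ hc μ
  have h0 : ∀ n t, φ (event t (S.pos n t)) = 0 := fun n t =>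
    image_eq_zero_of_notMem_tsupport fun hm => hsupp hm (mem_iUnion.2 ⟨n, t, rfl⟩)
  simp only [h0, mul_zero, integral_zero, Finset.sum_const_zero] at h
  linarith

/-- The homogeneous Maxwell equations, in the classical sense. -/
theorem IsMaxwellField.cyclic_partialD (hF : S.IsMaxwellField F)
    (hs : ContDiffOn ℝ ∞ F S.offWorldLines) {p : Event} (hp : p ∈ S.offWorldLines)
    (l μ ν : Fin 4) : metric l * partialD l (fun p => F p μ ν) p
      + metric μ * partialD μ (fun p => F p ν l) p
      + metric ν * partialD ν (fun p => F p l μ) p = 0 := by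
  have hc := fun a b => contDiffOn_component hs a b
  -- the cyclic sum is the divergence of this vector field
  set f : Fin 4 → Event → ℝ := fun κ p => (if κ = l then metric l else 0) * F p μ ν
    + (if κ = μ then metric μ else 0) * F p ν l + (if κ = ν then metric ν else 0) * F p l μ with hf
  have h := sum_partialD_eq_zero (f := f) isOpen_offWorldLines
    (fun κ => ((contDiffOn_const.mul (hc μ ν)).add (contDiffOn_const.mul (hc ν l))).add
      (contDiffOn_const.mul (hc l μ))) (fun φ hφ hcs _ => ?_) hp
  · have hd : ∀ a b, DifferentiableAt ℝ (fun p => F p a b) p := fun a b =>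
      ((hc a b).contDiffAt (isOpen_offWorldLines.mem_nhds hp)).differentiableAt (by simp)
    have hκ : ∀ κ, partialD κ (f κ) p =
        (if κ = l then metric l else 0) * partialD κ (fun p => F p μ ν) p
        + (if κ = μ then metric μ else 0) * partialD κ (fun p => F p ν l) p
        + (if κ = ν then metric ν else 0) * partialD κ (fun p => F p l μ) p := by
      intro κ
      have : HasFDerivAt (f κ) _ p := (((hd μ ν).hasFDerivAt.const_mul (if κ = l then metric l else 0)).add
        ((hd ν l).hasFDerivAt.const_mul (if κ = μ then metric μ else 0))).add
        ((hd l μ).hasFDerivAt.const_mul (if κ = ν then metric ν else 0))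
      rw [partialD, this.fderiv]
      rfl
    simp only [hκ, Finset.sum_add_distrib, ite_mul, zero_mul, Finset.sum_ite_eq',
      Finset.mem_univ, if_true] at h
    exact h
  · have h := hF.homogeneous φ hφ hcs l μ ν
    rw [← h]
    congr 1 with p
    simp only [hf, add_mul, Finset.sum_add_distrib, ite_mul, zero_mul, Finset.sum_ite_eq',
      Finset.mem_univ, if_true]
    ring

/-- Local conservation of energy and momentum off the world-lines. -/
theorem IsMaxwellField.sum_partialD_stress (hF : S.IsMaxwellField F)
    (hs : ContDiffOn ℝ ∞ F S.offWorldLines) {p : Event} (hp : p ∈ S.offWorldLines) (μ : Fin 4) :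
    ∑ κ, partialD κ (fun p => stress (F p) κ μ) p = 0 := by
  have hc := fun a b => contDiffOn_component hs a b
  have hd : ∀ a b, DifferentiableAt ℝ (fun p => F p a b) p := fun a b =>
    ((hc a b).contDiffAt (isOpen_offWorldLines.mem_nhds hp)).differentiableAt (by simp)
  have hline : ∀ κ, partialD κ (fun p => stress (F p) κ μ) p =
      stressPolar (F p) (fun a b => partialD κ (fun p => F p a b) p) κ μ := by
    intro κ
    have hds : DifferentiableAt ℝ (fun p => stress (F p) κ μ) p :=
      ((contDiffOn_stress hc κ μ).contDiffAt
        (isOpen_offWorldLines.mem_nhds hp)).differentiableAt (by simp)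
    have h1 := hasDerivAt_stress (G := fun t => F (p + t • (Pi.single κ 1 : Event))) (t := 0)
      (d := fun a b => partialD κ (fun p => F p a b) p)
      (fun a b => (hd a b).hasFDerivAt.hasLineDerivAt _) κ μ
    have h2 : HasLineDerivAt ℝ (fun p => stress (F p) κ μ)
        (stressPolar (F (p + (0 : ℝ) • (Pi.single κ 1 : Event)))
          (fun a b => partialD κ (fun p => F p a b) p) κ μ) p (Pi.single κ 1) := h1
    have h3 := (hds.hasFDerivAt.hasLineDerivAt (Pi.single κ 1)).unique h2
    rw [zero_smul, add_zero] at h3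
    exact h3
  simp only [hline]
  refine sum_stressPolar_eq_zero (hF.antisymm p) (fun k a b => ?_)
    (fun μ => hF.sum_partialD hs hp μ) (fun l μ ν => hF.cyclic_partialD hs hp l μ ν) μ
  have : (fun p => F p a b) = fun p => -F p b a := funext fun p => hF.antisymm p a b
  rw [partialD, this, fderiv_fun_neg]
  rfl

end ParticleSystem

/-! ### The retarded time near a world-line -/

theorem contDiff_deriv {E : Type} [NormedAddCommGroup E] [NormedSpace ℝ E] {z : ℝ → E}
    (hz : ContDiff ℝ ∞ z) : ContDiff ℝ ∞ (deriv z) :=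
  (contDiff_infty_iff_deriv.1 hz).2

theorem hasDerivAt_of_contDiff {E : Type} [NormedAddCommGroup E] [NormedSpace ℝ E] {z : ℝ → E}
    (hz : ContDiff ℝ ∞ z) (t : ℝ) : HasDerivAt z (deriv z t) t :=
  (hz.differentiable (by simp) t).hasDerivAt

theorem hasDerivAt_comp_sub {E : Type} [NormedAddCommGroup E] [NormedSpace ℝ E] {z : ℝ → E}
    (hz : ContDiff ℝ ∞ z) (t l : ℝ) : HasDerivAt (fun l => z (t - l)) (-deriv z (t - l)) l := by
  have h := (hasDerivAt_of_contDiff hz (t - l)).scomp l ((hasDerivAt_id l).const_sub t)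
  have h' : HasDerivAt (fun l => z (t - l)) ((-1 : ℝ) • deriv z (t - l)) l := h
  simpa using h'

section Chord

variable {z : ℝ → Space}

/-- The mean velocity over a time interval, as a smooth function of its end `t` and its length,
which may vanish: `z t - z (t - l) = l • chord z (t, l)`. -/
def chord (z : ℝ → Space) : ℝ × ℝ → Space := hadamard fun p => z p.1 - z (p.1 - p.2)

theorem contDiff_chord (hz : ContDiff ℝ ∞ z) : ContDiff ℝ ∞ (chord z) :=
  contDiff_hadamard (by fun_prop)

theorem smul_chord (hz : ContDiff ℝ ∞ z) (t l : ℝ) : l • chord z (t, l) = z t - z (t - l) := by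
  have := hadamard_spec (f := fun p : ℝ × ℝ => z p.1 - z (p.1 - p.2)) (by fun_prop) t l
  simp only [sub_zero, sub_self, zero_add] at this
  exact this.symm

theorem hasDerivAt_chord (hz : ContDiff ℝ ∞ z) (t l : ℝ) :
    HasDerivAt (fun l => chord z (t, l)) (lastD (chord z) (t, l)) l :=
  hasDerivAt_lastD ((contDiff_chord hz).differentiable (by simp) _)

theorem chord_add_smul (hz : ContDiff ℝ ∞ z) (t l : ℝ) :
    chord z (t, l) + l • lastD (chord z) (t, l) = deriv z (t - l) := by
  have h1 := (hasDerivAt_id l).smul (hasDerivAt_chord hz t l)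
  have h2 : HasDerivAt (fun l => z t - z (t - l)) (deriv z (t - l)) l := by
    simpa using (hasDerivAt_comp_sub hz t l).const_sub (z t)
  have h3 : (fun l => z t - z (t - l)) = fun l => id l • chord z (t, l) :=
    funext fun l => (smul_chord hz t l).symm
  rw [h3] at h2
  have := h1.unique h2
  simp only [id_eq, one_smul] at this
  rw [← this]
  abel

theorem chord_zero (hz : ContDiff ℝ ∞ z) (t : ℝ) : chord z (t, 0) = deriv z t := by
  simpa using chord_add_smul hz t 0

/-- The particle is slower than light, also in the mean. -/
theorem norm_sub_lt (hz : ContDiff ℝ ∞ z) (hv : ∀ t, ‖deriv z t‖ < 1) {a b : ℝ} (hab : a ≠ b) :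
    ‖z a - z b‖ < |a - b| := by
  wlog h : b < a generalizing a b
  · rw [norm_sub_rev, abs_sub_comm]
    exact this hab.symm (lt_of_le_of_ne (not_lt.1 h) hab)
  obtain ⟨s, hs, hmax⟩ := isCompact_Icc.exists_isMaxOn (nonempty_Icc.2 h.le)
    (contDiff_deriv hz).continuous.norm.continuousOn
  have h1 := (convex_Icc b a).norm_image_sub_le_of_norm_deriv_le
    (fun x _ => hz.differentiable (by simp) x) (fun x hx => hmax hx)
    (left_mem_Icc.2 h.le) (right_mem_Icc.2 h.le)
  rw [Real.norm_eq_abs] at h1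
  have h2 : 0 < |a - b| := abs_pos.2 (sub_ne_zero.2 hab)
  refine h1.trans_lt ?_
  calc ‖deriv z s‖ * |a - b| < 1 * |a - b| := mul_lt_mul_of_pos_right (hv s) h2
    _ = |a - b| := one_mul _

/-- The vector from the position of the particle at the time `t - r * σ` to the point
`z t + r • w`, in units of `r`. It makes sense for `r = 0`, and also for negative `r`, where
`t - r * σ` is in the future. -/
def connecting (z : ℝ → Space) (q : ℝ × ℝ × Space) (σ : ℝ) : Space :=
  q.2.2 + σ • chord z (q.1, q.2.1 * σ)

theorem contDiff_connecting (hz : ContDiff ℝ ∞ z) :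
    ContDiff ℝ ∞ fun p : (ℝ × ℝ × Space) × ℝ => connecting z p.1 p.2 := by
  have := contDiff_chord hz
  unfold connecting
  fun_prop

theorem smul_connecting (hz : ContDiff ℝ ∞ z) (q : ℝ × ℝ × Space) (σ : ℝ) :
    q.2.1 • connecting z q σ = q.2.1 • q.2.2 + (z q.1 - z (q.1 - q.2.1 * σ)) := by
  rw [connecting, smul_add, smul_smul, smul_chord hz]

theorem hasDerivAt_connecting (hz : ContDiff ℝ ∞ z) (q : ℝ × ℝ × Space) (σ : ℝ) :
    HasDerivAt (connecting z q) (deriv z (q.1 - q.2.1 * σ)) σ := by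
  have h1 := (hasDerivAt_chord hz q.1 (q.2.1 * σ)).scomp σ ((hasDerivAt_id σ).const_mul q.2.1)
  have h2 := ((hasDerivAt_id σ).smul h1).const_add q.2.2
  refine h2.congr_deriv ?_
  rw [← chord_add_smul hz]
  simp only [Function.comp, id_eq, one_smul, mul_one, smul_smul, mul_comm σ]
  abel

/-- As a function of the scaled retardation, the connecting vector moves slower than light, uniformly
in the sign of `r` and also for `r = 0`. -/
theorem norm_connecting_sub_lt (hz : ContDiff ℝ ∞ z) (hv : ∀ t, ‖deriv z t‖ < 1)
    (q : ℝ × ℝ × Space) {σ σ' : ℝ} (h : σ ≠ σ') :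
    ‖connecting z q σ - connecting z q σ'‖ < |σ - σ'| := by
  by_cases hr : q.2.1 = 0
  · have : connecting z q σ - connecting z q σ' = (σ - σ') • deriv z q.1 := by
      simp only [connecting, hr, zero_mul, chord_zero hz, sub_smul]
      abel
    rw [this, norm_smul, Real.norm_eq_abs]
    have h2 : 0 < |σ - σ'| := abs_pos.2 (sub_ne_zero.2 h)
    nlinarith [hv q.1]
  · have hne : q.1 - q.2.1 * σ' ≠ q.1 - q.2.1 * σ := fun he => h (by
      have : q.2.1 * σ' = q.2.1 * σ := by linarith
      exact (mul_left_cancel₀ hr this).symm)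
    have h1 := norm_sub_lt hz hv hne
    have h2 : q.2.1 • (connecting z q σ - connecting z q σ') =
        z (q.1 - q.2.1 * σ') - z (q.1 - q.2.1 * σ) := by
      rw [smul_sub, smul_connecting hz, smul_connecting hz]; abel
    rw [← h2, norm_smul, Real.norm_eq_abs] at h1
    have h3 : |q.1 - q.2.1 * σ' - (q.1 - q.2.1 * σ)| = |q.2.1| * |σ - σ'| := by
      rw [← abs_mul]; congr 1; ring
    rw [h3] at h1
    exact lt_of_mul_lt_mul_left h1 (abs_nonneg _)

/-- The light-cone condition for the scaled retardation `σ`. -/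
def IsScaledDelay (z : ℝ → Space) (q : ℝ × ℝ × Space) (σ : ℝ) : Prop :=
  ‖connecting z q σ‖ = σ

/-- The norm of the connecting vector changes by less than the scaled retardation, so it can coincide
with it only once. -/
theorem IsScaledDelay.unique (hz : ContDiff ℝ ∞ z) (hv : ∀ t, ‖deriv z t‖ < 1)
    {q : ℝ × ℝ × Space} {σ σ' : ℝ} (h : IsScaledDelay z q σ) (h' : IsScaledDelay z q σ') :
    σ = σ' := by
  by_contra hne
  have h1 := norm_connecting_sub_lt hz hv q hne
  have h2 := abs_norm_sub_norm_le (connecting z q σ) (connecting z q σ')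
  rw [show ‖connecting z q σ‖ = σ from h, show ‖connecting z q σ'‖ = σ' from h'] at h2
  linarith

/-- The scaled retardation: the light that reaches the point `z t + r • w` at the time `t` was
emitted at the time `t - r * scaledDelay z (t, r, w)`. For negative `r` it describes the advanced
time. -/
def scaledDelay (z : ℝ → Space) (q : ℝ × ℝ × Space) : ℝ := Classical.epsilon (IsScaledDelay z q)

theorem IsScaledDelay.eq (hz : ContDiff ℝ ∞ z) (hv : ∀ t, ‖deriv z t‖ < 1)
    {q : ℝ × ℝ × Space} {σ : ℝ} (h : IsScaledDelay z q σ) : scaledDelay z q = σ :=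
  IsScaledDelay.unique hz hv (Classical.epsilon_spec (p := IsScaledDelay z q) ⟨σ, h⟩) h

/-- The points at which the scaled retardation is well defined. -/
def delayDomain (z : ℝ → Space) : Set (ℝ × ℝ × Space) :=
  {q | IsScaledDelay z q (scaledDelay z q) ∧ 0 < scaledDelay z q}

/-- The scaled denominator of the Liénard-Wiechert potential is positive. -/
theorem delay_sub_inner_pos (hv : ∀ t, ‖deriv z t‖ < 1) {q : ℝ × ℝ × Space} {σ : ℝ} (hσ : 0 < σ)
    (h : IsScaledDelay z q σ) (s : ℝ) : 0 < σ - inner ℝ (deriv z s) (connecting z q σ) := by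
  have h1 := real_inner_le_norm (deriv z s) (connecting z q σ)
  rw [show ‖connecting z q σ‖ = σ from h] at h1
  nlinarith [hv s]

theorem isInvertible_of_ne_zero {L : ℝ →L[ℝ] ℝ} (h : L 1 ≠ 0) : L.IsInvertible := by
  refine ⟨ContinuousLinearEquiv.unitsEquivAut ℝ (Units.mk0 (L 1) h), ?_⟩
  ext
  simp

/-- The scaled retardation is smooth, by the implicit function theorem, also across `r = 0`. -/
theorem contDiffAt_scaledDelay_and_eventually (hz : ContDiff ℝ ∞ z) (hv : ∀ t, ‖deriv z t‖ < 1)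
    {q : ℝ × ℝ × Space} {σ : ℝ} (hσ : 0 < σ) (h : IsScaledDelay z q σ) :
    ContDiffAt ℝ ∞ (scaledDelay z) q ∧ ∀ᶠ q' in 𝓝 q, q' ∈ delayDomain z := by
  set g : (ℝ × ℝ × Space) × ℝ → ℝ := fun p => ‖connecting z p.1 p.2‖ ^ 2 - p.2 ^ 2 with hg
  have hgs : ContDiff ℝ ∞ g := ((contDiff_connecting hz).norm_sq ℝ).sub (contDiff_snd.pow 2)
  have hg0 : g (q, σ) = 0 := by
    simp only [hg]
    rw [show ‖connecting z q σ‖ = σ from h, sub_self]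
  have hder : HasDerivAt (fun σ => g (q, σ))
      (2 * inner ℝ (connecting z q σ) (deriv z (q.1 - q.2.1 * σ)) - 2 * σ) σ := by
    have := (hasDerivAt_connecting hz q σ).norm_sq.sub ((hasDerivAt_id σ).pow 2)
    refine this.congr_deriv ?_
    simp
  have hval : (fderiv ℝ g (q, σ) ∘L .inr ℝ (ℝ × ℝ × Space) ℝ) 1 ≠ 0 := by
    have h1 : HasDerivAt (fun σ => g (q, σ)) (lastD g (q, σ)) σ :=
      hasDerivAt_lastD (hgs.differentiable (by simp) _)
    have h2 := h1.unique hder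
    have h3 := delay_sub_inner_pos hv hσ h (q.1 - q.2.1 * σ)
    change lastD g (q, σ) ≠ 0
    rw [h2, real_inner_comm]
    intro h4
    linarith
  have hinv := isInvertible_of_ne_zero hval
  have hc : ContDiffAt ℝ ∞ g (q, σ) := hgs.contDiffAt
  set ψ := hc.implicitFunction (by simp) hinv with hψ
  have hψ1 : ContDiffAt ℝ ∞ ψ q := hc.contDiffAt_implicitFunction (by simp) hinv
  have hψ0 : ψ q = σ := hc.implicitFunction_apply_self (by simp) hinv
  have hpos : ∀ᶠ q' in 𝓝 q, 0 < ψ q' := by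
    have := hψ1.continuousAt.eventually (lt_mem_nhds (a := 0) (b := ψ q) (by rw [hψ0]; exact hσ))
    exact this
  have hroot : ∀ᶠ q' in 𝓝 q, IsScaledDelay z q' (ψ q') := by
    have h1 : ∀ᶠ q' in 𝓝 q, g (q', ψ q') = g (q, σ) :=
      hc.eventually_apply_implicitFunction (by simp) hinv
    filter_upwards [h1, hpos] with q' h1 h2
    rw [hg0] at h1
    have h3 : ‖connecting z q' (ψ q')‖ ^ 2 = ψ q' ^ 2 := by
      simp only [hg] at h1; linarith
    exact (sq_eq_sq₀ (norm_nonneg _) h2.le).1 h3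
  have heq : scaledDelay z =ᶠ[𝓝 q] ψ := by
    filter_upwards [hroot] with q' h1 using h1.eq hz hv
  refine ⟨hψ1.congr_of_eventuallyEq heq, ?_⟩
  filter_upwards [hroot, hpos, heq] with q' h1 h2 h3
  exact ⟨by rw [h3]; exact h1, by rw [h3]; exact h2⟩

theorem isOpen_delayDomain (hz : ContDiff ℝ ∞ z) (hv : ∀ t, ‖deriv z t‖ < 1) :
    IsOpen (delayDomain z) :=
  isOpen_iff_mem_nhds.2 fun _ hq => (contDiffAt_scaledDelay_and_eventually hz hv hq.2 hq.1).2

theorem contDiffAt_scaledDelay (hz : ContDiff ℝ ∞ z) (hv : ∀ t, ‖deriv z t‖ < 1)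
    {q : ℝ × ℝ × Space} (hq : q ∈ delayDomain z) : ContDiffAt ℝ ∞ (scaledDelay z) q :=
  (contDiffAt_scaledDelay_and_eventually hz hv hq.2 hq.1).1

/-- At `r = 0` the scaled retardation is that of a uniformly moving particle, that is the positive
root of `‖w + σ • v‖ ^ 2 = σ ^ 2`. -/
theorem scaledDelay_zero (hz : ContDiff ℝ ∞ z) (hv : ∀ t, ‖deriv z t‖ < 1) (t : ℝ) {w : Space}
    (hw : ‖w‖ = 1) : (t, 0, w) ∈ delayDomain z ∧
      scaledDelay z (t, 0, w) * (1 - ‖deriv z t‖ ^ 2) = inner ℝ (deriv z t) w +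
        Real.sqrt (1 - ‖deriv z t‖ ^ 2 + inner ℝ (deriv z t) w ^ 2) := by
  set v := deriv z t with hvd
  have hpos := one_sub_sq_pos (hv t)
  rw [← hvd] at hpos
  have hrad : 0 ≤ 1 - ‖v‖ ^ 2 + inner ℝ v w ^ 2 := by positivity
  have hsq := Real.sq_sqrt hrad
  set D := Real.sqrt (1 - ‖v‖ ^ 2 + inner ℝ v w ^ 2) with hD
  have hlt : |inner ℝ v w| < D := by
    rw [hD]
    refine Real.lt_sqrt_of_sq_lt ?_
    rw [sq_abs]; linarith
  set σ := (inner ℝ v w + D) / (1 - ‖v‖ ^ 2) with hσ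
  have hσpos : 0 < σ := div_pos (by linarith [neg_abs_le (inner ℝ v w : ℝ)]) hpos
  have hσe : σ * (1 - ‖v‖ ^ 2) = inner ℝ v w + D := by rw [hσ]; field_simp
  have hroot : IsScaledDelay z (t, 0, w) σ := by
    have hc : connecting z (t, 0, w) σ = w + σ • v := by
      simp [connecting, chord_zero hz, hvd]
    have : ‖w + σ • v‖ ^ 2 = σ ^ 2 := by
      rw [norm_add_sq_real, norm_smul, real_inner_smul_right, mul_pow, Real.norm_eq_abs, sq_abs, hw,
        real_inner_comm]
      have hD' : D = σ * (1 - ‖v‖ ^ 2) - inner ℝ v w := by linarith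
      rw [hD'] at hsq
      have h5 : (1 - ‖v‖ ^ 2) * (1 + 2 * σ * inner ℝ v w - σ ^ 2 * (1 - ‖v‖ ^ 2)) = 0 := by
        linear_combination -hsq
      have h6 := (mul_eq_zero.1 h5).resolve_left hpos.ne'
      linear_combination h6
    rw [IsScaledDelay, hc]
    exact (sq_eq_sq₀ (norm_nonneg _) hσpos.le).1 this
  have he := hroot.eq hz hv
  refine ⟨⟨by rw [he]; exact hroot, by rw [he]; exact hσpos⟩, ?_⟩
  rw [he, hσe]

end Chord

namespace ParticleSystem

variable {N : ℕ} (S : ParticleSystem N)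

/-- The set of emission times has one element only, which is therefore its supremum. -/
theorem retTime_eq_of_isScaledDelay (n : Fin N) {t r : ℝ} {w : Space} (hr : 0 < r) {σ : ℝ}
    (h : IsScaledDelay (S.pos n) (t, r, w) σ) :
    S.retTime n (event t (S.pos n t + r • w)) = t - r * σ := by
  have hset : {s | ‖spacePart (event t (S.pos n t + r • w)) - S.pos n s‖ =
      event t (S.pos n t + r • w) 0 - s} = {t - r * σ} := by
    ext s
    simp only [mem_ofPred_eq, mem_singleton_iff, spacePart_event, event_zero]
    have hs : s = t - r * ((t - s) / r) := by field_simp; ring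
    have hc := smul_connecting (S.smooth n) (t, r, w) ((t - s) / r)
    simp only [← hs] at hc
    have hc' : S.pos n t + r • w - S.pos n s = r • connecting (S.pos n) (t, r, w) ((t - s) / r) := by
      rw [hc]; abel
    rw [hc', norm_smul, Real.norm_eq_abs, abs_of_pos hr]
    constructor
    · intro h1
      have : IsScaledDelay (S.pos n) (t, r, w) ((t - s) / r) := by
        rw [IsScaledDelay, eq_div_iff hr.ne', mul_comm]; exact h1
      rw [hs, this.unique (S.smooth n) (S.speed_lt_one n) h]
    · rintro rfl
      have : (t - (t - r * σ)) / r = σ := by field_simp; ring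
      rw [this, show ‖connecting (S.pos n) (t, r, w) σ‖ = σ from h]
      ring
  rw [retTime, hset, csSup_singleton]

end ParticleSystem

/-! ### The Liénard-Wiechert field -/

/-- The exterior product of two four-vectors. -/
def wedge (A B : Event) (μ ν : Fin 4) : ℝ := A μ * B ν - A ν * B μ

theorem wedge_swap (A B : Event) (μ ν : Fin 4) : wedge A B ν μ = -wedge A B μ ν := by
  unfold wedge; ring

theorem metric_mul_self (μ : Fin 4) : metric μ * metric μ = 1 := by
  unfold metric; split <;> norm_num

theorem event_smul (r t : ℝ) (x : Space) : event (r * t) (r • x) = r • event t x := by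
  ext μ
  refine Fin.cases rfl (fun i => ?_) μ
  simp [event_succ]

/-- The Liénard-Wiechert field, per unit of `q / 4π`, at a distance `r • X` and a delay `r * R` from
a particle which had the velocity `v` and the acceleration `a`, multiplied by `r ^ 2`. -/
def lienardWiechert (v a X : Space) (R r : ℝ) (μ ν : Fin 4) : ℝ :=
  -(r * wedge (event R X) (event 0 a) μ ν / (R - inner ℝ v X) ^ 2 +
    wedge (event R X) (event 1 v) μ ν * (1 - ‖v‖ ^ 2 + r * inner ℝ a X) / (R - inner ℝ v X) ^ 3)

theorem sq_mul_lienardWiechert (v a X : Space) (R : ℝ) {r : ℝ} (hr : r ≠ 0) (μ ν : Fin 4) :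
    r ^ 2 * lienardWiechert v a (r • X) (r * R) 1 μ ν = lienardWiechert v a X R r μ ν := by
  have h : r * R - inner ℝ v (r • X) = r * (R - inner ℝ v X) := by
    rw [real_inner_smul_right]; ring
  rw [lienardWiechert, h]
  simp only [lienardWiechert, event_smul, wedge, Pi.smul_apply, smul_eq_mul,
    real_inner_smul_right]
  field_simp

theorem contDiffAt_event {E : Type} [NormedAddCommGroup E] [NormedSpace ℝ E] {f : E → ℝ}
    {g : E → Space} {x : E} (hf : ContDiffAt ℝ ∞ f x) (hg : ContDiffAt ℝ ∞ g x) (μ : Fin 4) :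
    ContDiffAt ℝ ∞ (fun y => event (f y) (g y) μ) x := by
  have := eventCLM.contDiff.contDiffAt.comp x (hf.prodMk hg)
  exact contDiffAt_pi.1 this μ

namespace ParticleSystem

variable {N : ℕ} (S : ParticleSystem N)

/-- The retarded field of a particle at the point `z t + r • w` at the time `t`, multiplied by `r ^ 2`,
as a function of `(t, r, w)`; it is smooth across `r = 0`. For negative `r` it is `-r ^ 2` times the
advanced field. -/
def scaledRetField (n : Fin N) (q : ℝ × ℝ × Space) (μ ν : Fin 4) : ℝ :=
  S.charge n / (4 * Real.pi) * lienardWiechert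
    (deriv (S.pos n) (q.1 - q.2.1 * scaledDelay (S.pos n) q))
    (deriv (deriv (S.pos n)) (q.1 - q.2.1 * scaledDelay (S.pos n) q))
    (connecting (S.pos n) q (scaledDelay (S.pos n) q)) (scaledDelay (S.pos n) q) q.2.1 μ ν

theorem contDiffAt_scaledRetField (n : Fin N) {q : ℝ × ℝ × Space}
    (hq : q ∈ delayDomain (S.pos n)) (μ ν : Fin 4) :
    ContDiffAt ℝ ∞ (fun q => S.scaledRetField n q μ ν) q := by
  have hσ := contDiffAt_scaledDelay (S.smooth n) (S.speed_lt_one n) hq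
  have hs : ContDiffAt ℝ ∞ (fun q : ℝ × ℝ × Space => q.1 - q.2.1 * scaledDelay (S.pos n) q) q := by
    fun_prop
  have hv := (contDiff_deriv (S.smooth n)).contDiffAt.comp q hs
  have ha := (contDiff_deriv (contDiff_deriv (S.smooth n))).contDiffAt.comp q hs
  have hX := (contDiff_connecting (S.smooth n)).contDiffAt.comp q (contDiffAt_id.prodMk hσ)
  simp only [Function.comp_def, id_eq] at hv ha hX
  have hd := (delay_sub_inner_pos (S.speed_lt_one n) hq.2 hq.1
    (q.1 - q.2.1 * scaledDelay (S.pos n) q)).ne'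
  have hκ := hσ.sub (hv.inner ℝ hX)
  have hw := contDiffAt_event (contDiffAt_const (c := (1 : ℝ))) hv
  have hw' := contDiffAt_event (contDiffAt_const (c := (0 : ℝ))) ha
  have hK := contDiffAt_event hσ hX
  have hr : ContDiffAt ℝ ∞ (fun q : ℝ × ℝ × Space => q.2.1) q := by fun_prop
  unfold scaledRetField lienardWiechert wedge
  refine contDiffAt_const.mul (ContDiffAt.neg (ContDiffAt.add (ContDiffAt.div
    (hr.mul (((hK μ).mul (hw' ν)).sub ((hK ν).mul (hw' μ)))) (hκ.pow 2) (pow_ne_zero _ hd))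
    (ContDiffAt.div ((((hK μ).mul (hw ν)).sub ((hK ν).mul (hw μ))).mul
      ((contDiffAt_const.sub (hv.norm_sq ℝ)).add (hr.mul (ha.inner ℝ hX)))) (hκ.pow 3)
      (pow_ne_zero _ hd))))

/-- On the sphere `r = 0` the scaled field is the Coulomb field of a uniformly moving charge. -/
theorem scaledRetField_zero (n : Fin N) (t : ℝ) {w : Space} (hw : ‖w‖ = 1) (μ ν : Fin 4) :
    S.scaledRetField n (t, 0, w) μ ν = S.charge n / (4 * Real.pi) * fluxDensity (S.vel n t) w *
      wedge (event 1 (S.vel n t)) (event 0 w) μ ν := by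
  obtain ⟨hq, hσ⟩ := scaledDelay_zero (S.smooth n) (S.speed_lt_one n) t hw
  set σ := scaledDelay (S.pos n) (t, 0, w) with hσd
  set v := S.vel n t with hv
  have hv' : deriv (S.pos n) t = v := rfl
  have hX : connecting (S.pos n) (t, 0, w) σ = w + σ • v := by
    simp only [connecting, zero_mul, chord_zero (S.smooth n)]
    rfl
  have hpos := one_sub_sq_pos (show ‖v‖ < 1 from S.speed_lt_one n t)
  have hd : σ - inner ℝ v (w + σ • v) = Real.sqrt (1 - ‖v‖ ^ 2 + inner ℝ v w ^ 2) := by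
    rw [hv'] at hσ
    rw [inner_add_right, real_inner_smul_right, real_inner_self_eq_norm_sq]
    linear_combination hσ
  have hwedge : wedge (event σ (w + σ • v)) (event 1 v) μ ν =
      -wedge (event 1 v) (event 0 w) μ ν := by
    have h : event σ (w + σ • v) = event 0 w + σ • event 1 v := by
      ext κ
      refine Fin.cases (by simp [event_zero]) (fun i => by simp [event_succ]) κ
    rw [h]; simp only [wedge, Pi.add_apply, Pi.smul_apply, smul_eq_mul]; ring
  have hvz : deriv (S.pos n) (t - 0 * σ) = v := by rw [zero_mul, sub_zero, hv']
  simp only [scaledRetField, ← hσd, hX, hvz]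
  rw [lienardWiechert, hd, hwedge, fluxDensity]
  ring

/-- The retarded time is differentiable near the world-line, where it satisfies the light-cone
condition. -/
theorem differentiableAt_retTime (n : Fin N) {t r : ℝ} {w : Space} (hr : 0 < r)
    (hq : (t, r, w) ∈ delayDomain (S.pos n)) :
    DifferentiableAt ℝ (S.retTime n) (event t (S.pos n t + r • w)) ∧
      ∀ᶠ p in 𝓝 (event t (S.pos n t + r • w)),
        ‖spacePart p - S.pos n (S.retTime n p)‖ ^ 2 = (p 0 - S.retTime n p) ^ 2 := by
  set p₀ := event t (S.pos n t + r • w) with hp₀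
  set Q : Event → ℝ × ℝ × Space :=
    fun p => (p 0, r, r⁻¹ • (spacePartCLM p - S.pos n (p 0))) with hQ
  have hz := S.smooth n
  have hQs : ContDiff ℝ ∞ Q := by
    have h0 : ContDiff ℝ ∞ fun p : Event => p 0 := contDiff_apply ℝ ℝ 0
    have h1 : ContDiff ℝ ∞ fun p : Event => spacePartCLM p := spacePartCLM.contDiff
    exact h0.prodMk (contDiff_const.prodMk ((h1.sub (hz.comp h0)).const_smul r⁻¹))
  have hQ0 : Q p₀ = (t, r, w) := by
    simp [hQ, hp₀, event_zero, spacePartCLM_apply, spacePart_event, hr.ne']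
  have hmem : ∀ᶠ p in 𝓝 p₀, Q p ∈ delayDomain (S.pos n) := by
    refine hQs.continuous.continuousAt.eventually ?_
    rw [hQ0]
    exact (isOpen_delayDomain hz (S.speed_lt_one n)).mem_nhds hq
  have hpt : ∀ p : Event, p = event (p 0) (S.pos n (p 0) + r • (Q p).2.2) := by
    intro p
    simp [hQ, smul_smul, hr.ne', spacePartCLM_apply, event_spacePart]
  have hτ : ∀ᶠ p in 𝓝 p₀, S.retTime n p = p 0 - r * scaledDelay (S.pos n) (Q p) := by
    filter_upwards [hmem] with p hp
    conv_lhs => rw [hpt p]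
    exact S.retTime_eq_of_isScaledDelay n hr hp.1
  constructor
  · have h1 : ContDiffAt ℝ ∞ (fun p => scaledDelay (S.pos n) (Q p)) p₀ := by
      have h0 : ContDiffAt ℝ ∞ (scaledDelay (S.pos n)) (Q p₀) := by
        rw [hQ0]
        exact contDiffAt_scaledDelay hz (S.speed_lt_one n) hq
      exact h0.comp p₀ hQs.contDiffAt
    have h2 : DifferentiableAt ℝ (fun p : Event => p 0 - r * scaledDelay (S.pos n) (Q p)) p₀ :=
      (differentiableAt_apply 0 p₀).sub ((h1.differentiableAt (by simp)).const_mul r)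
    exact h2.congr_of_eventuallyEq hτ
  · filter_upwards [hmem, hτ] with p hp hp'
    have hc := smul_connecting hz (Q p) (scaledDelay (S.pos n) (Q p))
    have h1 : spacePart p - S.pos n (S.retTime n p) =
        r • connecting (S.pos n) (Q p) (scaledDelay (S.pos n) (Q p)) := by
      rw [hp']
      refine Eq.trans ?_ hc.symm
      simp only [hQ, smul_smul, mul_inv_cancel₀ hr.ne', one_smul, spacePartCLM_apply]
      abel
    rw [h1, norm_smul, hp', mul_pow, show ‖connecting (S.pos n) (Q p) (scaledDelay (S.pos n) (Q p))‖
      = scaledDelay (S.pos n) (Q p) from hp.1, Real.norm_eq_abs, sq_abs]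
    ring

/-- The Liénard-Wiechert formula for the retarded field. -/
theorem retField_eq (n : Fin N) {t r : ℝ} {w : Space} (hr : 0 < r)
    (hq : (t, r, w) ∈ delayDomain (S.pos n)) (μ ν : Fin 4) :
    S.retField n (event t (S.pos n t + r • w)) μ ν =
      S.scaledRetField n (t, r, w) μ ν / r ^ 2 := by
  obtain ⟨hd, hcone⟩ := S.differentiableAt_retTime n hr hq
  have hz := S.smooth n
  set p₀ := event t (S.pos n t + r • w) with hp₀
  set σ := scaledDelay (S.pos n) (t, r, w) with hσ
  have hτ : S.retTime n p₀ = t - r * σ := S.retTime_eq_of_isScaledDelay n hr hq.1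
  set v := deriv (S.pos n) (t - r * σ) with hv
  set a := deriv (deriv (S.pos n)) (t - r * σ) with ha
  set k := connecting (S.pos n) (t, r, w) σ with hk
  have hX : spacePart p₀ - S.pos n (t - r * σ) = r • k := by
    have := smul_connecting hz (t, r, w) σ
    rw [hk, this, hp₀, spacePart_event]
    simp only
    abel
  have hκpos : 0 < σ - inner ℝ v k := delay_sub_inner_pos (S.speed_lt_one n) hq.2 hq.1 _
  -- the denominator of the potential
  set κ := r * σ - inner ℝ v (r • k) with hκ
  have hκ0 : κ ≠ 0 := by
    rw [hκ, real_inner_smul_right, ← mul_sub]; positivity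
  -- `B` is minus the derivative of the denominator with respect to the emission time, and `ℓ` is the
  -- gradient of the emission time
  set B := 1 - ‖v‖ ^ 2 + inner ℝ a (r • k) with hB
  set ℓ : Fin 4 → ℝ := fun κ => fderiv ℝ (S.retTime n) p₀ (Pi.single κ 1) with hℓ
  have hline : ∀ κ : Fin 4, HasDerivAt (fun ε : ℝ => p₀ + ε • (Pi.single κ 1 : Event))
      (Pi.single κ 1 : Event) 0 := fun κ => by
    simpa using ((hasDerivAt_id (0 : ℝ)).smul_const (Pi.single κ 1 : Event)).const_add p₀
  have hlineτ : ∀ κ, HasDerivAt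
      (fun ε : ℝ => S.retTime n (p₀ + ε • (Pi.single κ 1 : Event))) (ℓ κ) 0 := fun κ => by
    have h0 : HasFDerivAt (S.retTime n) (fderiv ℝ (S.retTime n) p₀)
      (p₀ + (0 : ℝ) • (Pi.single κ 1 : Event)) := by simpa using hd.hasFDerivAt
    exact h0.comp_hasDerivAt 0 (hline κ)
  have hτ0 : ∀ κ : Fin 4, S.retTime n (p₀ + (0 : ℝ) • (Pi.single κ 1 : Event)) = t - r * σ :=
    fun κ => by simp [hτ]
  have hlineX : ∀ κ, HasDerivAt
      (fun ε : ℝ => spacePart (p₀ + ε • (Pi.single κ 1 : Event)) -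
        S.pos n (S.retTime n (p₀ + ε • (Pi.single κ 1 : Event))))
      (spacePart (Pi.single κ 1) - ℓ κ • v) 0 := fun κ => by
    have h1 : HasDerivAt (fun ε : ℝ => spacePart (p₀ + ε • (Pi.single κ 1 : Event)))
      (spacePart (Pi.single κ 1)) 0 := spacePartCLM.hasFDerivAt.comp_hasDerivAt 0 (hline κ)
    have h2 : HasDerivAt (S.pos n) v
        (S.retTime n (p₀ + (0 : ℝ) • (Pi.single κ 1 : Event))) := by
      rw [hτ0]; exact hasDerivAt_of_contDiff hz _
    exact h1.sub (h2.scomp 0 (hlineτ κ))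
  have hlineV : ∀ κ, HasDerivAt
      (fun ε : ℝ => S.vel n (S.retTime n (p₀ + ε • (Pi.single κ 1 : Event)))) (ℓ κ • a) 0 := fun κ => by
    have h2 : HasDerivAt (S.vel n) a
        (S.retTime n (p₀ + (0 : ℝ) • (Pi.single κ 1 : Event))) := by
      rw [hτ0]; exact hasDerivAt_of_contDiff (contDiff_deriv hz) _
    exact h2.scomp 0 (hlineτ κ)
  have hlineR : ∀ κ, HasDerivAt
      (fun ε : ℝ => (p₀ + ε • (Pi.single κ 1 : Event)) 0 -
        S.retTime n (p₀ + ε • (Pi.single κ 1 : Event)))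
      ((Pi.single κ 1 : Event) 0 - ℓ κ) 0 := fun κ =>
    ((hasDerivAt_pi.1 (hline κ)) 0).sub (hlineτ κ)
  have hX0 : ∀ κ : Fin 4, spacePart (p₀ + (0 : ℝ) • (Pi.single κ 1 : Event)) -
      S.pos n (S.retTime n (p₀ + (0 : ℝ) • (Pi.single κ 1 : Event))) = r • k := fun κ => by
    rw [hτ0]; simpa using hX
  have hR0 : ∀ κ : Fin 4, (p₀ + (0 : ℝ) • (Pi.single κ 1 : Event)) 0 -
      S.retTime n (p₀ + (0 : ℝ) • (Pi.single κ 1 : Event)) = r * σ := fun κ => by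
    rw [hτ0]; simp [hp₀, event_zero]
  have hV0 : ∀ κ : Fin 4, S.vel n (S.retTime n (p₀ + (0 : ℝ) • (Pi.single κ 1 : Event))) = v :=
    fun κ => by rw [hτ0]; rfl
  -- lowering an index
  have hlow : ∀ (X : Space) (R : ℝ) (κ : Fin 4), R * (Pi.single κ 1 : Event) 0 -
      inner ℝ X (spacePart (Pi.single κ 1)) = -(metric κ * event R X κ) := by
    intro X R κ
    refine Fin.cases ?_ (fun i => ?_) κ
    · simp [spacePart, PiLp.inner_apply, metric, event_zero]
    · simp [spacePart, PiLp.inner_apply, metric, event_succ, Pi.single_apply, Fin.succ_ne_zero]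
  -- the derivative of the light-cone condition
  have hℓe : ∀ κ', ℓ κ' * κ = -(metric κ' * event (r * σ) (r • k) κ') := fun κ' => by
    have h1 := (hlineX κ').norm_sq
    have h2 := (hlineR κ').pow 2
    have hc : ∀ᶠ ε : ℝ in 𝓝 0, ‖spacePart (p₀ + ε • (Pi.single κ' 1 : Event)) -
        S.pos n (S.retTime n (p₀ + ε • (Pi.single κ' 1 : Event)))‖ ^ 2 =
        ((p₀ + ε • (Pi.single κ' 1 : Event)) 0 -
          S.retTime n (p₀ + ε • (Pi.single κ' 1 : Event))) ^ 2 := by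
      have : Tendsto (fun ε : ℝ => p₀ + ε • (Pi.single κ' 1 : Event)) (𝓝 0) (𝓝 p₀) := by
        simpa using (hline κ').continuousAt.tendsto
      exact this.eventually hcone
    have h3 := h1.unique (h2.congr_of_eventuallyEq hc)
    rw [hX0, hR0, inner_sub_right, real_inner_smul_right] at h3
    rw [← hlow, hκ, real_inner_comm (r • k) v]
    push_cast at h3
    linear_combination (1 / 2 : ℝ) * h3
  have hlineκ : ∀ κ', HasDerivAt
      (fun ε : ℝ => ((p₀ + ε • (Pi.single κ' 1 : Event)) 0 -
        S.retTime n (p₀ + ε • (Pi.single κ' 1 : Event))) -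
        inner ℝ (S.vel n (S.retTime n (p₀ + ε • (Pi.single κ' 1 : Event))))
          (spacePart (p₀ + ε • (Pi.single κ' 1 : Event)) -
            S.pos n (S.retTime n (p₀ + ε • (Pi.single κ' 1 : Event)))))
      (-(metric κ' * event 1 v κ') - ℓ κ' * B) 0 := fun κ' => by
    refine ((hlineR κ').sub ((hlineV κ').inner ℝ (hlineX κ'))).congr_deriv ?_
    rw [hX0, hV0, inner_sub_right, real_inner_smul_right, real_inner_smul_left,
      real_inner_self_eq_norm_sq, ← hlow, hB]
    ring
  have hlinew : ∀ κ' μ, HasDerivAt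
      (fun ε : ℝ => event 1 (S.vel n (S.retTime n (p₀ + ε • (Pi.single κ' 1 : Event)))) μ)
      (ℓ κ' * event 0 a μ) 0 := fun κ' μ => by
    have := eventCLM.hasFDerivAt.comp_hasDerivAt (0 : ℝ)
      ((hasDerivAt_const (0 : ℝ) (1 : ℝ)).prodMk (hlineV κ'))
    refine ((hasDerivAt_pi.1 this) μ).congr_deriv ?_
    rw [eventCLM_apply]
    have h := event_smul (ℓ κ') 0 a
    rw [mul_zero] at h
    rw [h]; rfl
  have hdiff : ∀ μ, DifferentiableAt ℝ (fun p => S.retPotential n p μ) p₀ := fun μ => by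
    have hV : DifferentiableAt ℝ (fun p => S.vel n (S.retTime n p)) p₀ :=
      ((contDiff_deriv hz).differentiable (by simp) _).comp p₀ hd
    have hXd : DifferentiableAt ℝ (fun p => spacePart p - S.pos n (S.retTime n p)) p₀ :=
      (spacePartCLM.differentiableAt (x := p₀)).sub ((hz.differentiable (by simp) _).comp p₀ hd)
    have hw : DifferentiableAt ℝ (fun p => event 1 (S.vel n (S.retTime n p)) μ) p₀ :=
      differentiableAt_pi.1 (eventCLM.differentiableAt.comp p₀
        ((differentiableAt_const (1 : ℝ)).prodMk hV)) μ
    have hκd : DifferentiableAt ℝ (fun p => (p 0 - S.retTime n p) -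
        inner ℝ (S.vel n (S.retTime n p)) (spacePart p - S.pos n (S.retTime n p))) p₀ :=
      ((differentiableAt_apply 0 p₀).sub hd).sub (hV.inner ℝ hXd)
    have hκ1 : (p₀ 0 - S.retTime n p₀) - inner ℝ (S.vel n (S.retTime n p₀))
        (spacePart p₀ - S.pos n (S.retTime n p₀)) ≠ 0 := by
      rw [hτ, hX]
      have : p₀ 0 - (t - r * σ) = r * σ := by rw [hp₀, event_zero]; ring
      rw [this]
      exact hκ0
    have := (hw.const_mul (S.charge n / (4 * Real.pi))).mul (hκd.inv hκ1)
    simp only [retPotential, div_eq_mul_inv (_ * _)]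
    exact this
  have hA : ∀ κ' μ, partialD κ' (fun p => S.retPotential n p μ) p₀ = S.charge n / (4 * Real.pi) *
      (ℓ κ' * event 0 a μ / κ -
        event 1 v μ * (-(metric κ' * event 1 v κ') - ℓ κ' * B) / κ ^ 2) := fun κ' μ => by
    have h1 := ((hlinew κ' μ).const_mul (S.charge n / (4 * Real.pi))).div (hlineκ κ')
      (by rw [hX0, hR0, hV0]; exact hκ0)
    have h0 : HasFDerivAt (fun p => S.retPotential n p μ)
      (fderiv ℝ (fun p => S.retPotential n p μ) p₀)
      (p₀ + (0 : ℝ) • (Pi.single κ' 1 : Event)) := by simpa using (hdiff μ).hasFDerivAt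
    have h3 : HasDerivAt (fun ε : ℝ => S.retPotential n (p₀ + ε • (Pi.single κ' 1 : Event)) μ)
      (fderiv ℝ (fun p => S.retPotential n p μ) p₀ (Pi.single κ' 1)) 0 := by
      have := h0.comp_hasDerivAt 0 (hline κ')
      exact this
    have h2 := h3.unique h1
    rw [partialD, h2, hX0, hR0, hV0, ← hκ]
    clear_value κ B ℓ
    field_simp
  have hℓ' : ∀ κ', ℓ κ' = -(metric κ' * event (r * σ) (r • k) κ') / κ := fun κ' => by
    rw [eq_div_iff hκ0]; exact hℓe κ'
  -- the terms in which both indices belong to the velocity cancel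
  have hfin : S.retField n p₀ μ ν =
      S.charge n / (4 * Real.pi) * lienardWiechert v a (r • k) (r * σ) 1 μ ν := by
    have hμ := metric_mul_self μ
    have hν := metric_mul_self ν
    rw [retField, hA, hA, hℓ', hℓ', lienardWiechert, ← hκ, one_mul, one_mul, ← hB, wedge, wedge]
    generalize event (r * σ) (r • k) = K
    clear_value κ B
    field_simp
    linear_combination S.charge n * (event 1 v μ * event 1 v ν * κ - K μ * event 0 a ν * κ
        - K μ * event 1 v ν * B) * hμ -
      S.charge n * (event 1 v μ * event 1 v ν * κ - K ν * event 0 a μ * κ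
        - K ν * event 1 v μ * B) * hν
  rw [hfin, eq_div_iff (pow_ne_zero 2 hr.ne'), mul_assoc, mul_comm _ (r ^ 2),
    sq_mul_lienardWiechert _ _ _ _ hr.ne']
  rfl

end ParticleSystem

/-! ### Divided differences -/

section DividedDifference

variable {E G : Type} [NormedAddCommGroup E] [NormedSpace ℝ E]
  [NormedAddCommGroup G] [NormedSpace ℝ G]

/-- The divided difference `(f (x, b) - f (x, a)) / (b - a)`, as a smooth function of
`((x, a), b)`. -/
def dividedDifference (f : E × ℝ → G) (p : (E × ℝ) × ℝ) : G :=
  hadamard (fun y : (E × ℝ) × ℝ => f (y.1.1, y.1.2 + y.2)) (p.1, p.2 - p.1.2)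

theorem contDiff_dividedDifference [FiniteDimensional ℝ E] {f : E × ℝ → G} (hf : ContDiff ℝ ∞ f) :
    ContDiff ℝ ∞ (dividedDifference f) := by
  have h : ContDiff ℝ ∞ fun y : (E × ℝ) × ℝ => f (y.1.1, y.1.2 + y.2) := by fun_prop
  have := contDiff_hadamard h
  unfold dividedDifference
  fun_prop

theorem dividedDifference_spec [CompleteSpace G] {f : E × ℝ → G} (hf : ContDiff ℝ ∞ f) (x : E) (a b : ℝ) :
    f (x, b) = f (x, a) + (b - a) • dividedDifference f ((x, a), b) := by
  have h : ContDiff ℝ ∞ fun y : (E × ℝ) × ℝ => f (y.1.1, y.1.2 + y.2) := by fun_prop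
  have := hadamard_spec h (x, a) (b - a)
  simpa [dividedDifference] using this

/-- The quotient of a function by its two zeros `a` and `b`. -/
theorem eq_mul_dividedDifference [FiniteDimensional ℝ E] {f : E × ℝ → ℝ} (hf : ContDiff ℝ ∞ f)
    {x : E} {a b : ℝ} (hab : a ≠ b) (ha : f (x, a) = 0) (hb : f (x, b) = 0) (c : ℝ) :
    f (x, c) = (c - a) * (c - b) * dividedDifference (dividedDifference f) (((x, a), b), c) := by
  have h1 := dividedDifference_spec hf x a b
  rw [ha, hb, zero_add, smul_eq_mul, eq_comm, mul_eq_zero] at h1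
  have h2 := h1.resolve_left (sub_ne_zero.2 hab.symm)
  have h3 := dividedDifference_spec (contDiff_dividedDifference hf) (x, a) b c
  have h4 := dividedDifference_spec hf x a c
  rw [h2, zero_add, smul_eq_mul] at h3
  rw [ha, zero_add, smul_eq_mul, h3] at h4
  rw [h4]; ring

theorem eq_of_eq_of_ne_zero {f g : ℝ → ℝ} (hf : Continuous f) (hg : Continuous g)
    (h : ∀ l, l ≠ 0 → f l = g l) : f = g :=
  hf.ext_on (dense_compl_singleton 0) hg fun l hl => h l hl

/-- The quotient of a function by a double zero at `0`. -/
theorem dividedDifference_zero [FiniteDimensional ℝ E] {f : E × ℝ → ℝ} (hf : ContDiff ℝ ∞ f)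
    {x : E} {q : ℝ → ℝ} (hq : Continuous q) (h : ∀ l, f (x, l) = l ^ 2 * q l) (l : ℝ) :
    dividedDifference (dividedDifference f) (((x, 0), 0), l) = q l := by
  have hd := contDiff_dividedDifference hf
  have hdd := contDiff_dividedDifference hd
  have h1 : (fun l => dividedDifference f ((x, 0), l)) = fun l => l * q l := by
    refine eq_of_eq_of_ne_zero ?_ (by fun_prop) fun l hl => ?_
    · have := hd.continuous
      fun_prop
    · have := dividedDifference_spec hf x 0 l
      rw [h, h, smul_eq_mul] at this
      refine mul_left_cancel₀ hl ?_
      linear_combination -this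
  have h2 : (fun l => dividedDifference (dividedDifference f) (((x, 0), 0), l)) = q := by
    refine eq_of_eq_of_ne_zero ?_ hq fun l hl => ?_
    · have := hdd.continuous
      fun_prop
    · have := dividedDifference_spec hd (x, 0) 0 l
      rw [congrFun h1 l, congrFun h1 0, smul_eq_mul] at this
      refine mul_left_cancel₀ hl ?_
      linear_combination -this
  exact congrFun h2 l

/-- A Hermite divided difference at two double nodes that merge converges to a sixth of the third
derivative. -/
theorem tendsto_hermite_divided_difference {g : E × ℝ → ℝ} {p₀ : E}
    (hg : ∀ᶠ y in 𝓝 (p₀, (0 : ℝ)), ContDiffAt ℝ ∞ g y) {l : Filter ℝ} {P : ℝ → E} {a b : ℝ → ℝ}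
    (hP : Tendsto P l (𝓝 p₀)) (ha : Tendsto a l (𝓝 0)) (hb : Tendsto b l (𝓝 0))
    (hab : ∀ᶠ r in l, a r < b r) :
    Tendsto (fun r => ((lastD g (P r, a r) + lastD g (P r, b r)) * (b r - a r)
      - 2 * (g (P r, b r) - g (P r, a r))) / (b r - a r) ^ 3) l
      (𝓝 (lastD (lastD (lastD g)) (p₀, 0) / 6)) := by
  have hc : ContinuousAt (lastD (lastD (lastD g))) (p₀, 0) :=
    (contDiffAt_lastD (contDiffAt_lastD (contDiffAt_lastD hg.self_of_nhds))).continuousAt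
  rw [Metric.tendsto_nhds]
  intro ε hε
  have h1 : ∀ᶠ y in 𝓝 (p₀, (0 : ℝ)), dist (lastD (lastD (lastD g)) y / 6)
      (lastD (lastD (lastD g)) (p₀, 0) / 6) < ε :=
    Metric.tendsto_nhds.1 (hc.div_const 6) ε hε
  obtain ⟨δ, hδ, hball⟩ := Metric.eventually_nhds_iff.1 (hg.and h1)
  filter_upwards [Metric.tendsto_nhds.1 hP δ hδ, Metric.tendsto_nhds.1 ha δ hδ,
    Metric.tendsto_nhds.1 hb δ hδ, hab] with r h1 h2 h3 h4
  rw [Real.dist_eq, sub_zero, abs_lt] at h2 h3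
  have hin : ∀ y ∈ Icc (a r) (b r), dist (P r, y) (p₀, (0 : ℝ)) < δ := fun y hy => by
    rw [Prod.dist_eq, max_lt_iff]
    refine ⟨h1, ?_⟩
    rw [Real.dist_eq, sub_zero, abs_lt]
    exact ⟨h2.1.trans_le hy.1, hy.2.trans_lt h3.2⟩
  obtain ⟨ξ, hξ, he⟩ := exists_hermite_divided_difference (g := fun y => g (P r, y))
    (g₁ := fun y => lastD g (P r, y)) (g₂ := fun y => lastD (lastD g) (P r, y))
    (g₃ := fun y => lastD (lastD (lastD g)) (P r, y)) h4
    (fun y hy => hasDerivAt_lastD ((hball (hin y hy)).1.differentiableAt (by simp)))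
    (fun y hy => hasDerivAt_lastD
      ((contDiffAt_lastD (hball (hin y hy)).1).differentiableAt (by simp)))
    (fun y hy => hasDerivAt_lastD
      ((contDiffAt_lastD (contDiffAt_lastD (hball (hin y hy)).1)).differentiableAt (by simp)))
  rw [he, mul_div_cancel_right₀ _ (pow_ne_zero 3 (sub_pos.2 h4).ne')]
  exact (hball (hin ξ (Ioo_subset_Icc_self hξ))).2

end DividedDifference

/-- The values of the first two derivatives of `(l - a) * (l - b) * Q l` at its zero `a`. -/
theorem derivatives_of_eq_mul {N N₁ N₂ Q Q₁ Q₂ : ℝ → ℝ} (hN : ∀ l, HasDerivAt N (N₁ l) l)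
    (hN₁ : ∀ l, HasDerivAt N₁ (N₂ l) l) (hQ : ∀ l, HasDerivAt Q (Q₁ l) l)
    (hQ₁ : ∀ l, HasDerivAt Q₁ (Q₂ l) l) {a b : ℝ} (h : ∀ l, N l = (l - a) * (l - b) * Q l) :
    N₁ a = (a - b) * Q a ∧ N₂ a = 2 * Q a + 2 * (a - b) * Q₁ a := by
  have hid := fun l : ℝ => hasDerivAt_id l
  have h1 : ∀ l, N₁ l = (2 * l - a - b) * Q l + (l - a) * (l - b) * Q₁ l := fun l => by
    have h2 := (((hid l).sub_const a).mul ((hid l).sub_const b)).mul (hQ l)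
    have h3 : N = fun l => (l - a) * (l - b) * Q l := funext h
    have h4 := hN l
    rw [h3] at h4
    rw [h4.unique h2]
    simp only [Pi.mul_apply, id_eq]; ring
  refine ⟨by rw [h1]; ring, ?_⟩
  have h2 := (((((hid a).const_mul 2).sub_const a).sub_const b).mul (hQ a)).add
    ((((hid a).sub_const a).mul ((hid a).sub_const b)).mul (hQ₁ a))
  have h3 : N₁ = fun l => (2 * l - a - b) * Q l + (l - a) * (l - b) * Q₁ l := funext h1
  have h4 := hN₁ a
  rw [h3] at h4
  rw [h4.unique h2]
  simp only [Pi.mul_apply, id_eq]; ring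

/-- The third derivative at `0` of the quotient `l * m l / E l`, if `m 0 = 0`. -/
theorem third_derivative_quotient {G G₁ G₂ E m : ℝ → ℝ} {G₃ : ℝ}
    (h₀ : ∀ᶠ l in 𝓝 0, HasDerivAt G (G₁ l) l) (h₁ : ∀ᶠ l in 𝓝 0, HasDerivAt G₁ (G₂ l) l)
    (h₂ : HasDerivAt G₂ G₃ 0) (hE : ContDiff ℝ ∞ E) (hm : ContDiff ℝ ∞ m)
    (h : ∀ᶠ l in 𝓝 0, G l * E l = l * m l) (hE0 : E 0 ≠ 0) (hm0 : m 0 = 0) :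
    G₃ * E 0 ^ 2 = 3 * deriv (deriv m) 0 * E 0 - 6 * deriv m 0 * deriv E 0 := by
  have dE := hasDerivAt_of_contDiff hE
  have dE1 := hasDerivAt_of_contDiff (contDiff_deriv hE)
  have dE2 := hasDerivAt_of_contDiff (contDiff_deriv (contDiff_deriv hE))
  have dm := hasDerivAt_of_contDiff hm
  have dm1 := hasDerivAt_of_contDiff (contDiff_deriv hm)
  have dm2 := hasDerivAt_of_contDiff (contDiff_deriv (contDiff_deriv hm))
  have hid := fun l : ℝ => hasDerivAt_id l
  have e1 : ∀ᶠ l in 𝓝 0, G₁ l * E l + G l * deriv E l = m l + l * deriv m l := by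
    filter_upwards [h.eventually_nhds, h₀] with l hl hG
    have h3 := (hG.mul (dE l)).unique (((hid l).mul (dm l)).congr_of_eventuallyEq hl)
    simp only [id_eq, one_mul] at h3
    linarith
  have e2 : ∀ᶠ l in 𝓝 0, G₂ l * E l + G₁ l * deriv E l + (G₁ l * deriv E l +
      G l * deriv (deriv E) l) = deriv m l + (deriv m l + l * deriv (deriv m) l) := by
    filter_upwards [e1.eventually_nhds, h₀, h₁] with l hl hG hG1
    have h3 := ((hG1.mul (dE l)).add (hG.mul (dE1 l))).unique
      (((dm l).add ((hid l).mul (dm1 l))).congr_of_eventuallyEq hl)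
    simp only [id_eq, one_mul] at h3
    linarith
  have e3 : G₃ * E 0 + G₂ 0 * deriv E 0 + (G₂ 0 * deriv E 0 + G₁ 0 * deriv (deriv E) 0) +
      ((G₂ 0 * deriv E 0 + G₁ 0 * deriv (deriv E) 0) +
        (G₁ 0 * deriv (deriv E) 0 + G 0 * deriv (deriv (deriv E)) 0)) =
      deriv (deriv m) 0 + (deriv (deriv m) 0 + (deriv (deriv m) 0 + 0)) := by
    have hG := h₀.self_of_nhds
    have hG1 := h₁.self_of_nhds
    have h3 := (((h₂.mul (dE 0)).add (hG1.mul (dE1 0))).add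
      ((hG1.mul (dE1 0)).add (hG.mul (dE2 0)))).unique
      (((dm1 0).add ((dm1 0).add ((hid 0).mul (dm2 0)))).congr_of_eventuallyEq e2)
    simp only [id_eq, one_mul, zero_mul] at h3
    exact h3
  have g0 : G 0 = 0 := by
    have := h.self_of_nhds
    rw [zero_mul, mul_eq_zero] at this
    exact this.resolve_right hE0
  have g1 : G₁ 0 = 0 := by
    have := e1.self_of_nhds
    rw [g0, zero_mul, zero_mul, hm0, add_zero, add_zero, mul_eq_zero] at this
    exact this.resolve_right hE0
  have g2 := e2.self_of_nhds
  rw [g0, g1] at g2 e3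
  linear_combination E 0 * e3 - 3 * deriv E 0 * g2

/-! ### The difference of the retarded and the advanced field -/

theorem hasDerivAt_event {f : ℝ → ℝ} {g : ℝ → Space} {f' : ℝ} {g' : Space} {l : ℝ}
    (hf : HasDerivAt f f' l) (hg : HasDerivAt g g' l) :
    HasDerivAt (fun l => event (f l) (g l)) (event f' g') l := by
  have := eventCLM.hasFDerivAt.comp_hasDerivAt l (hf.prodMk hg)
  exact this

theorem hasDerivAt_wedge {A B : ℝ → Event} {A' B' : Event} {l : ℝ} (hA : HasDerivAt A A' l)
    (hB : HasDerivAt B B' l) (μ ν : Fin 4) :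
    HasDerivAt (fun l => wedge (A l) (B l) μ ν) (wedge A' (B l) μ ν + wedge (A l) B' μ ν) l := by
  have hA' := hasDerivAt_pi.1 hA
  have hB' := hasDerivAt_pi.1 hB
  refine (((hA' μ).mul (hB' ν)).sub ((hA' ν).mul (hB' μ))).congr_deriv ?_
  unfold wedge; ring

theorem wedge_self (A : Event) (μ ν : Fin 4) : wedge A A μ ν = 0 := by
  unfold wedge; ring

theorem wedge_smul_left (c : ℝ) (A B : Event) (μ ν : Fin 4) :
    wedge (c • A) B μ ν = c * wedge A B μ ν := by
  simp only [wedge, Pi.smul_apply, smul_eq_mul]; ring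

theorem wedge_smul_right (c : ℝ) (A B : Event) (μ ν : Fin 4) :
    wedge A (c • B) μ ν = c * wedge A B μ ν := by
  simp only [wedge, Pi.smul_apply, smul_eq_mul]; ring

theorem event_zero_neg (x : Space) : event 0 (-x) = -event 0 x := by
  rw [← neg_one_smul ℝ x, ← neg_one_smul ℝ (event 0 x), ← event_smul, mul_zero]

theorem event_zero_smul (c : ℝ) (x : Space) : event 0 (c • x) = c • event 0 x := by
  have := event_smul c 0 x
  rwa [mul_zero] at this

section Chord

variable {z : ℝ → Space}

theorem norm_chord_lt_one (hz : ContDiff ℝ ∞ z) (hv : ∀ t, ‖deriv z t‖ < 1) (t l : ℝ) :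
    ‖chord z (t, l)‖ < 1 := by
  by_cases hl : l = 0
  · rw [hl, chord_zero hz]; exact hv t
  · have h := norm_sub_lt hz hv (a := t) (b := t - l) (by intro h; apply hl; linarith)
    rw [← smul_chord hz, norm_smul, Real.norm_eq_abs, sub_sub_cancel] at h
    have := abs_pos.2 hl
    exact lt_of_mul_lt_mul_left (by linarith) this.le

/-- The Taylor coefficients of the mean velocity. -/
theorem lastD_chord_zero (hz : ContDiff ℝ ∞ z) (t : ℝ) :
    lastD (chord z) (t, 0) = (-1 / 2 : ℝ) • deriv (deriv z) t ∧
      lastD (lastD (chord z)) (t, 0) = (1 / 3 : ℝ) • deriv (deriv (deriv z)) t := by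
  have c0 := contDiff_chord hz
  have c1 := contDiff_lastD c0
  have c2 := contDiff_lastD c1
  have d0 : ∀ l, HasDerivAt (fun l => chord z (t, l)) (lastD (chord z) (t, l)) l :=
    fun l => hasDerivAt_chord hz t l
  have d1 : ∀ l, HasDerivAt (fun l => lastD (chord z) (t, l)) (lastD (lastD (chord z)) (t, l)) l :=
    fun l => hasDerivAt_lastD (c1.differentiable (by simp) _)
  have d2 : ∀ l, HasDerivAt (fun l => lastD (lastD (chord z)) (t, l))
      (lastD (lastD (lastD (chord z))) (t, l)) l :=
    fun l => hasDerivAt_lastD (c2.differentiable (by simp) _)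
  have hid := fun l : ℝ => hasDerivAt_id l
  have e1 : ∀ l, lastD (chord z) (t, l) + (l • lastD (lastD (chord z)) (t, l) +
      lastD (chord z) (t, l)) = -deriv (deriv z) (t - l) := fun l => by
    have h := (d0 l).add ((hid l).smul (d1 l))
    have h' : HasDerivAt (fun l => deriv z (t - l)) _ l :=
      h.congr_of_eventuallyEq (.of_forall fun l => (chord_add_smul hz t l).symm)
    have := h'.unique (hasDerivAt_comp_sub (contDiff_deriv hz) t l)
    simpa using this
  have e2 : lastD (lastD (chord z)) (t, 0) + (lastD (lastD (chord z)) (t, 0) +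
      lastD (lastD (chord z)) (t, 0)) = deriv (deriv (deriv z)) t := by
    have h := (d1 0).add (((hid 0).smul (d2 0)).add (d1 0))
    have h' : HasDerivAt (fun l => -deriv (deriv z) (t - l)) _ 0 :=
      h.congr_of_eventuallyEq (.of_forall fun l => (e1 l).symm)
    have := h'.unique (hasDerivAt_comp_sub (contDiff_deriv (contDiff_deriv hz)) t 0).neg
    simpa using this
  constructor
  · have := e1 0
    rw [zero_smul, zero_add, sub_zero] at this
    rw [div_eq_inv_mul, mul_smul, neg_one_smul, ← this, ← two_smul ℝ, smul_smul]
    norm_num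
  · rw [← e2]
    module

end Chord

/-- The Liénard-Wiechert field in terms of `K ∧ w` and of the derivatives of `‖X‖ ^ 2 - l ^ 2` and of
`K ∧ w` along the world-line. -/
theorem lienardWiechert_eq (v a X : Space) (l : ℝ) (h : l - inner ℝ v X ≠ 0) (μ ν : Fin 4) :
    lienardWiechert v a X l 1 μ ν =
      4 * (-wedge (event l X) (event 0 a) μ ν / (-2 * (l - inner ℝ v X)) ^ 2 -
        wedge (event l X) (event 1 v) μ ν * (-2 * (1 - ‖v‖ ^ 2 + inner ℝ a X)) /
          (-2 * (l - inner ℝ v X)) ^ 3) := by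
  rw [lienardWiechert, one_mul, one_mul]
  generalize l - inner ℝ v X = κ at *
  field_simp
  ring

namespace ParticleSystem

variable {N : ℕ} (S : ParticleSystem N)

/-- Half the difference of the retarded and the advanced field of a particle, at the particle. -/
def selfField (n : Fin N) (t : ℝ) (μ ν : Fin 4) : ℝ :=
  S.charge n / (6 * Real.pi) *
    (wedge (event 1 (S.vel n t)) (event 0 (deriv (deriv (S.vel n)) t)) μ ν /
        (1 - ‖S.vel n t‖ ^ 2) ^ 2 +
      3 * inner ℝ (S.vel n t) (deriv (S.vel n) t) *
        wedge (event 1 (S.vel n t)) (event 0 (deriv (S.vel n) t)) μ ν /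
        (1 - ‖S.vel n t‖ ^ 2) ^ 3)

theorem scaledRetField_eq_mul (n : Fin N) (t : ℝ) {r : ℝ} (hr : r ≠ 0) (w : Space)
    (μ ν : Fin 4) {l : ℝ} (hl : l = r * scaledDelay (S.pos n) (t, r, w)) :
    S.scaledRetField n (t, r, w) μ ν = S.charge n / (4 * Real.pi) * (r ^ 2 * lienardWiechert
      (deriv (S.pos n) (t - l)) (deriv (deriv (S.pos n)) (t - l))
      (r • w + (S.pos n t - S.pos n (t - l))) l 1 μ ν) := by
  have h := smul_connecting (S.smooth n) (t, r, w) (scaledDelay (S.pos n) (t, r, w))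
  simp only [← hl] at h
  rw [← h, hl, sq_mul_lienardWiechert _ _ _ _ hr]
  rfl

/-- The difference of the retarded and the advanced field of a particle, which is what the sum with
the reflected arguments `(-r, -w)` describes, is regular at the particle. The two fields at the point
`z t + r • w` are boundary terms, at the two roots of the light-cone condition, of one and the same
function of the emission time, and their difference is a Hermite divided difference of it with nodes at
the two roots, which merge as `r` tends to `0`. -/
theorem tendsto_scaledRetField_add (n : Fin N) (t : ℝ) {w : Space} (hw : ‖w‖ = 1) (μ ν : Fin 4) :
    Tendsto (fun r => (S.scaledRetField n (t, r, w) μ ν + S.scaledRetField n (t, -r, -w) μ ν) / r ^ 2)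
      (𝓝[>] 0) (𝓝 (2 * S.selfField n t μ ν)) := by
  set z := S.pos n with hzd
  have hz : ContDiff ℝ ∞ z := S.smooth n
  have hv : ∀ t, ‖deriv z t‖ < 1 := S.speed_lt_one n
  -- `X (r, l)` is the vector to the point `z t + r • w` from the particle at the time `t - l`
  set X : ℝ × ℝ → Space := fun p => p.1 • w + p.2 • chord z (t, p.2) with hX
  have hchord := contDiff_chord hz
  have hXs : ContDiff ℝ ∞ X := by fun_prop
  have hXe : ∀ r l, X (r, l) = r • w + (z t - z (t - l)) := fun r l => by
    simp only [hX, smul_chord hz]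
  have hdz := contDiff_deriv hz
  -- the light-cone condition, which vanishes at the retarded and at the advanced delay
  set f : ℝ × ℝ → ℝ := fun p => ‖X p‖ ^ 2 - p.2 ^ 2 with hf
  have hfs : ContDiff ℝ ∞ f := (hXs.norm_sq ℝ).sub (contDiff_snd.pow 2)
  -- The field at a root of `f` is `4 * (M' / f' ^ 2 - M * f'' / f' ^ 3)` up to a constant. If `Q` is the
  -- quotient of `f` by its two roots, these are the combinations of the values of `M / Q ^ 2` and its
  -- derivative at the roots that occur in the Hermite divided difference.
  set M : ℝ × ℝ → ℝ := fun p => wedge (event p.2 (X p)) (event 1 (deriv z (t - p.2))) μ ν with hM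
  have hMs : ContDiff ℝ ∞ M := by
    have h1 : ∀ κ, ContDiff ℝ ∞ fun p => event p.2 (X p) κ := fun κ =>
      contDiff_iff_contDiffAt.2 fun p => contDiffAt_event contDiffAt_snd hXs.contDiffAt κ
    have h2 : ∀ κ, ContDiff ℝ ∞ fun p : ℝ × ℝ => event 1 (deriv z (t - p.2)) κ := fun κ =>
      contDiff_iff_contDiffAt.2 fun p => contDiffAt_event contDiffAt_const
        (by fun_prop) κ
    exact ((h1 μ).mul (h2 ν)).sub ((h1 ν).mul (h2 μ))
  set Q := dividedDifference (dividedDifference f) with hQ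
  have hQs : ContDiff ℝ ∞ Q := contDiff_dividedDifference (contDiff_dividedDifference hfs)
  have hQ0 : ∀ l, Q (((0, 0), 0), l) = ‖chord z (t, l)‖ ^ 2 - 1 := by
    refine dividedDifference_zero hfs (by have := hchord.continuous; fun_prop) fun l => ?_
    simp only [hf, hX, zero_smul, zero_add, norm_smul, mul_pow, Real.norm_eq_abs, sq_abs]
    ring
  have hQne : ∀ l, Q (((0, 0), 0), l) ≠ 0 := fun l => by
    have := one_sub_sq_pos (norm_chord_lt_one hz hv t l)
    rw [hQ0]; linarith
  -- the parameters are `r` and the two roots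
  set g : ((ℝ × ℝ) × ℝ) × ℝ → ℝ := fun y => M (y.1.1.1, y.2) / Q y ^ 2 with hg
  have hgs : ∀ y, Q y ≠ 0 → ContDiffAt ℝ ∞ g y := fun y hy => by
    refine ContDiffAt.div ?_ (hQs.contDiffAt.pow 2) (pow_ne_zero 2 hy)
    fun_prop
  have hgev : ∀ l, ∀ᶠ y in 𝓝 ((((0 : ℝ), (0 : ℝ)), (0 : ℝ)), l), ContDiffAt ℝ ∞ g y := fun l => by
    filter_upwards [hQs.continuous.continuousAt.eventually_ne (hQne l)] with y hy using hgs y hy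
  -- the advanced and the retarded root
  set a : ℝ → ℝ := fun r => -r * scaledDelay z (t, -r, -w) with ha
  set b : ℝ → ℝ := fun r => r * scaledDelay z (t, r, w) with hb
  obtain ⟨hd1, -⟩ := scaledDelay_zero hz hv t hw
  obtain ⟨hd2, -⟩ := scaledDelay_zero hz hv t (w := -w) (by rwa [norm_neg])
  have hc1 : Tendsto (fun r : ℝ => (t, r, w)) (𝓝[>] 0) (𝓝 (t, 0, w)) := by
    have : Continuous fun r : ℝ => (t, r, w) := by fun_prop
    exact (this.tendsto 0).mono_left nhdsWithin_le_nhds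
  have hc2 : Tendsto (fun r : ℝ => (t, -r, -w)) (𝓝[>] 0) (𝓝 (t, 0, -w)) := by
    have : Continuous fun r : ℝ => (t, -r, -w) := by fun_prop
    have := (this.tendsto 0).mono_left (nhdsWithin_le_nhds (s := Ioi 0))
    simpa using this
  have he1 := hc1.eventually ((isOpen_delayDomain hz hv).mem_nhds hd1)
  have he2 := hc2.eventually ((isOpen_delayDomain hz hv).mem_nhds hd2)
  have hr0 : Tendsto (fun r : ℝ => r) (𝓝[>] 0) (𝓝 0) := nhdsWithin_le_nhds
  have hbt : Tendsto b (𝓝[>] 0) (𝓝 0) := by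
    have := hr0.mul ((contDiffAt_scaledDelay hz hv hd1).continuousAt.tendsto.comp hc1)
    rw [zero_mul] at this; exact this
  have hat : Tendsto a (𝓝[>] 0) (𝓝 0) := by
    have := hr0.neg.mul ((contDiffAt_scaledDelay hz hv hd2).continuousAt.tendsto.comp hc2)
    rw [neg_zero, zero_mul] at this; exact this
  have hab : ∀ᶠ r in 𝓝[>] 0, a r < b r := by
    filter_upwards [he1, he2, self_mem_nhdsWithin] with r h1 h2 h3
    have h4 : 0 < r * scaledDelay z (t, r, w) := mul_pos h3 h1.2
    have h5 : 0 < r * scaledDelay z (t, -r, -w) := mul_pos h3 h2.2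
    simp only [ha, hb]
    linarith
  have hPt : Tendsto (fun r => ((r, a r), b r)) (𝓝[>] 0) (𝓝 ((0, 0), 0)) :=
    (hr0.prodMk_nhds hat).prodMk_nhds hbt
  have hlim := tendsto_hermite_divided_difference (hgev 0) hPt hat hbt hab
  -- the value of the third derivative: for `r = 0`, the function is `l * m l / Ef l`
  have hG3 : lastD (lastD (lastD g)) (((0, 0), 0), 0) * (1 - ‖deriv z t‖ ^ 2) ^ 4 =
      2 * wedge (event 1 (deriv z t)) (event 0 (deriv (deriv (deriv z)) t)) μ ν *
        (1 - ‖deriv z t‖ ^ 2) ^ 2 + 6 * inner ℝ (deriv z t) (deriv (deriv z) t) *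
        wedge (event 1 (deriv z t)) (event 0 (deriv (deriv z) t)) μ ν *
        (1 - ‖deriv z t‖ ^ 2) := by
    set Ef : ℝ → ℝ := fun l => (1 - ‖chord z (t, l)‖ ^ 2) ^ 2 with hE
    set m : ℝ → ℝ := fun l => wedge (event 1 (chord z (t, l))) (event 1 (deriv z (t - l))) μ ν with hm
    have c0 : ContDiff ℝ ∞ fun l : ℝ => chord z (t, l) := by fun_prop
    have hEs : ContDiff ℝ ∞ Ef := (contDiff_const.sub (c0.norm_sq ℝ)).pow 2
    have hms : ContDiff ℝ ∞ m := by
      have h1 : ∀ κ, ContDiff ℝ ∞ fun l => event 1 (chord z (t, l)) κ := fun κ =>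
        contDiff_iff_contDiffAt.2 fun p => contDiffAt_event contDiffAt_const c0.contDiffAt κ
      have h2 : ∀ κ, ContDiff ℝ ∞ fun l : ℝ => event 1 (deriv z (t - l)) κ := fun κ =>
        contDiff_iff_contDiffAt.2 fun p => contDiffAt_event contDiffAt_const
          (by fun_prop) κ
      exact ((h1 μ).mul (h2 ν)).sub ((h1 ν).mul (h2 μ))
    have hline : Tendsto (fun l : ℝ => ((((0 : ℝ), (0 : ℝ)), (0 : ℝ)), l)) (𝓝 0)
        (𝓝 (((0, 0), 0), 0)) := by
      have : Continuous fun l : ℝ => ((((0 : ℝ), (0 : ℝ)), (0 : ℝ)), l) := by fun_prop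
      exact this.tendsto 0
    have hgl := hline.eventually (hgev 0)
    have key := third_derivative_quotient (G := fun l => g (((0, 0), 0), l))
      (G₁ := fun l => lastD g (((0, 0), 0), l)) (G₂ := fun l => lastD (lastD g) (((0, 0), 0), l))
      (G₃ := lastD (lastD (lastD g)) (((0, 0), 0), 0)) (E := Ef) (m := m)
      (hgl.mono fun l hl => hasDerivAt_lastD (hl.differentiableAt (by simp)))
      (hgl.mono fun l hl => hasDerivAt_lastD ((contDiffAt_lastD hl).differentiableAt (by simp)))
      (hasDerivAt_lastD ((contDiffAt_lastD (contDiffAt_lastD hgl.self_of_nhds)).differentiableAt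
        (by simp))) hEs hms ?_ ?_ ?_
    · have d0 : ∀ l, HasDerivAt (fun l => chord z (t, l)) (lastD (chord z) (t, l)) l :=
        fun l => hasDerivAt_chord hz t l
      have d1 : ∀ l, HasDerivAt (fun l => lastD (chord z) (t, l))
          (lastD (lastD (chord z)) (t, l)) l :=
        fun l => hasDerivAt_lastD ((contDiff_lastD hchord).differentiable (by simp) _)
      have dc : ∀ (c l : ℝ), HasDerivAt (fun _ : ℝ => c) 0 l := fun c l => hasDerivAt_const l c
      have dE : deriv Ef 0 = 2 * (1 - ‖deriv z t‖ ^ 2) *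
          inner ℝ (deriv z t) (deriv (deriv z) t) := by
        have := (((dc 1 0).sub (d0 0).norm_sq).pow 2).deriv
        simp only [Pi.sub_apply, (lastD_chord_zero hz t).1, chord_zero hz,
          real_inner_smul_right] at this
        refine Eq.trans this ?_
        push_cast; ring
      have dm : ∀ l, HasDerivAt m (wedge (event 0 (lastD (chord z) (t, l)))
          (event 1 (deriv z (t - l))) μ ν + wedge (event 1 (chord z (t, l)))
          (event 0 (-deriv (deriv z) (t - l))) μ ν) l := fun l =>
        hasDerivAt_wedge (hasDerivAt_event (dc 1 l) (d0 l))
          (hasDerivAt_event (dc 1 l) (hasDerivAt_comp_sub hdz t l)) μ ν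
      have dm1 : deriv m = _ := funext fun l => (dm l).deriv
      have e0 : deriv m 0 = -(1 / 2) *
          wedge (event 1 (deriv z t)) (event 0 (deriv (deriv z) t)) μ ν := by
        rw [(dm 0).deriv, (lastD_chord_zero hz t).1, chord_zero hz, sub_zero, event_zero_smul,
          event_zero_neg]
        simp only [wedge, Pi.smul_apply, Pi.neg_apply, smul_eq_mul]; ring
      have e1 : deriv (deriv m) 0 = 2 / 3 *
          wedge (event 1 (deriv z t)) (event 0 (deriv (deriv (deriv z)) t)) μ ν := by
        have := ((hasDerivAt_wedge (hasDerivAt_event (dc 0 0) (d1 0))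
          (hasDerivAt_event (dc 1 0) (hasDerivAt_comp_sub hdz t 0)) μ ν).add
          (hasDerivAt_wedge (hasDerivAt_event (dc 1 0) (d0 0)) (hasDerivAt_event (dc 0 0)
            (hasDerivAt_comp_sub (contDiff_deriv hdz) t 0).neg) μ ν)).deriv
        rw [dm1]
        refine Eq.trans this ?_
        simp only [Pi.neg_apply]
        rw [(lastD_chord_zero hz t).1, (lastD_chord_zero hz t).2, chord_zero hz, sub_zero,
          neg_neg, event_zero_smul, event_zero_smul, event_zero_neg]
        simp only [wedge, Pi.smul_apply, Pi.neg_apply, smul_eq_mul]; ring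
      rw [e0, e1, dE] at key
      simp only [hE, chord_zero hz] at key
      linear_combination key
    · filter_upwards with l
      have h1 : M (0, l) = l * m l := by
        simp only [hM, hX, zero_smul, zero_add]
        have : event l (l • chord z (t, l)) = l • event 1 (chord z (t, l)) := by
          rw [← event_smul, mul_one]
        rw [this, wedge_smul_left]
      have h2 := hQne l
      have h3 : Ef l = Q (((0, 0), 0), l) ^ 2 := by rw [hQ0]; simp only [hE]; ring
      simp only [hg, h1, h3]
      field_simp
    · have := one_sub_sq_pos (norm_chord_lt_one hz hv t 0)
      exact pow_ne_zero 2 this.ne'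
    · simp only [hm, chord_zero hz, sub_zero, wedge_self]
  have hc0 := (one_sub_sq_pos (hv t)).ne'
  have hval : S.charge n / Real.pi * (lastD (lastD (lastD g)) (((0, 0), 0), 0) / 6) =
      2 * S.selfField n t μ ν := by
    have h1 : lastD (lastD (lastD g)) (((0, 0), 0), 0) =
        2 * wedge (event 1 (deriv z t)) (event 0 (deriv (deriv (deriv z)) t)) μ ν /
        (1 - ‖deriv z t‖ ^ 2) ^ 2 + 6 * inner ℝ (deriv z t) (deriv (deriv z) t) *
        wedge (event 1 (deriv z t)) (event 0 (deriv (deriv z) t)) μ ν /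
        (1 - ‖deriv z t‖ ^ 2) ^ 3 := by
      generalize 1 - ‖deriv z t‖ ^ 2 = c at *
      field_simp
      refine mul_right_cancel₀ hc0 ?_
      linear_combination hG3
    have hvel : S.vel n = deriv z := rfl
    rw [h1, selfField, hvel]
    field_simp
    ring
  rw [← hval]
  refine (hlim.const_mul (S.charge n / Real.pi)).congr' ?_
  have hQt : ∀ c : ℝ → ℝ, Tendsto c (𝓝[>] 0) (𝓝 0) →
      ∀ᶠ r in 𝓝[>] 0, Q (((r, a r), b r), c r) ≠ 0 := fun c hc =>
    (hPt.prodMk_nhds hc).eventually (hQs.continuous.continuousAt.eventually_ne (hQne 0))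
  filter_upwards [he1, he2, self_mem_nhdsWithin, hab, hQt a hat, hQt b hbt] with r h1 h2 h3 h4 h5 h6
  have hr : r ≠ 0 := ne_of_gt h3
  -- derivatives along the world-line
  have dX : ∀ l, HasDerivAt (fun l => X (r, l)) (deriv z (t - l)) l := fun l => by
    simp only [hXe]
    have := ((hasDerivAt_comp_sub hz t l).const_sub (z t)).const_add (r • w)
    simpa using this
  have hid := fun l : ℝ => hasDerivAt_id l
  have dv := fun l => hasDerivAt_comp_sub hdz t l
  have dN : ∀ l, HasDerivAt (fun l => f (r, l))
      (-2 * (l - inner ℝ (deriv z (t - l)) (X (r, l)))) l := fun l => by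
    refine ((dX l).norm_sq.sub ((hid l).pow 2)).congr_deriv ?_
    rw [real_inner_comm]
    simp only [id_eq]; push_cast; ring
  have dN1 : ∀ l, HasDerivAt (fun l => -2 * (l - inner ℝ (deriv z (t - l)) (X (r, l))))
      (-2 * (1 - ‖deriv z (t - l)‖ ^ 2 + inner ℝ (deriv (deriv z) (t - l)) (X (r, l)))) l :=
    fun l => by
    refine (((hid l).sub ((dv l).inner ℝ (dX l))).const_mul (-2)).congr_deriv ?_
    rw [real_inner_self_eq_norm_sq, inner_neg_left]; ring
  have dM : ∀ l, HasDerivAt (fun l => M (r, l))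
      (-wedge (event l (X (r, l))) (event 0 (deriv (deriv z) (t - l))) μ ν) l := fun l => by
    refine (hasDerivAt_wedge (hasDerivAt_event (hid l) (dX l))
      (hasDerivAt_event (hasDerivAt_const l 1) (dv l)) μ ν).congr_deriv ?_
    rw [wedge_self, zero_add, ← neg_one_smul ℝ (deriv (deriv z) (t - l)), event_zero_smul,
      wedge_smul_right]
    simp
  set P : (ℝ × ℝ) × ℝ := ((r, a r), b r) with hP
  have dQ : ∀ l, HasDerivAt (fun l => Q (P, l)) (lastD Q (P, l)) l := fun l =>
    hasDerivAt_lastD (hQs.differentiable (by simp) _)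
  have dQ1 : ∀ l, HasDerivAt (fun l => lastD Q (P, l)) (lastD (lastD Q) (P, l)) l := fun l =>
    hasDerivAt_lastD ((contDiff_lastD hQs).differentiable (by simp) _)
  have dg : ∀ l, Q (P, l) ≠ 0 → lastD g (P, l) =
      -wedge (event l (X (r, l))) (event 0 (deriv (deriv z) (t - l))) μ ν / Q (P, l) ^ 2 -
        2 * M (r, l) * lastD Q (P, l) / Q (P, l) ^ 3 := fun l hl => by
    have h7 : HasDerivAt (fun l => g (P, l)) (lastD g (P, l)) l :=
      hasDerivAt_lastD ((hgs _ hl).differentiableAt (by simp))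
    have h8 := (dM l).div ((dQ l).pow 2) (pow_ne_zero 2 hl)
    rw [h7.unique h8]
    simp only [Pi.pow_apply]
    push_cast
    field_simp
  have hroot : ∀ (r' : ℝ) (w' : Space), r' • w' = r • w → (t, r', w') ∈ delayDomain z →
      f (r, r' * scaledDelay z (t, r', w')) = 0 := fun r' w' hrw hq => by
    have h7 := smul_connecting hz (t, r', w') (scaledDelay z (t, r', w'))
    simp only [hf, hXe]
    simp only [hrw] at h7
    rw [← h7, norm_smul, mul_pow, Real.norm_eq_abs, sq_abs,
      show ‖connecting z (t, r', w') (scaledDelay z (t, r', w'))‖ = scaledDelay z (t, r', w')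
        from hq.1]
    ring
  have hra : f (r, a r) = 0 := hroot (-r) (-w) (by simp) h2
  have hrb : f (r, b r) = 0 := hroot r w rfl h1
  have hfac := eq_mul_dividedDifference hfs h4.ne hra hrb
  have hfac' : ∀ l, f (r, l) = (l - b r) * (l - a r) * Q (P, l) := fun l => by rw [hfac l]; ring
  obtain ⟨na1, na2⟩ := derivatives_of_eq_mul dN dN1 dQ dQ1 hfac
  obtain ⟨nb1, nb2⟩ := derivatives_of_eq_mul dN dN1 dQ dQ1 hfac'
  have hΔ : b r - a r ≠ 0 := (sub_pos.2 h4).ne'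
  have hΔ' : a r - b r ≠ 0 := (sub_neg.2 h4).ne
  have ka : a r - inner ℝ (deriv z (t - a r)) (X (r, a r)) ≠ 0 := fun h => by
    rw [h, mul_zero] at na1
    exact mul_ne_zero hΔ' h5 na1.symm
  have kb : b r - inner ℝ (deriv z (t - b r)) (X (r, b r)) ≠ 0 := fun h => by
    rw [h, mul_zero] at nb1
    exact mul_ne_zero hΔ h6 nb1.symm
  have s1 := S.scaledRetField_eq_mul n t hr w μ ν (l := b r) rfl
  have s2 := S.scaledRetField_eq_mul n t (neg_ne_zero.2 hr) (-w) μ ν (l := a r) rfl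
  rw [neg_smul_neg] at s2
  rw [s1, s2, ← hzd, ← hXe, ← hXe, lienardWiechert_eq _ _ _ _ ka, lienardWiechert_eq _ _ _ _ kb,
    na1, na2, nb1, nb2, dg _ h5, dg _ h6]
  simp only [hg, hP]
  simp only [hP] at h5 h6
  change _ = (S.charge n / (4 * Real.pi) * (r ^ 2 * (4 * (_ - M (r, b r) * _ / _))) +
    S.charge n / (4 * Real.pi) * ((-r) ^ 2 * (4 * (_ - M (r, a r) * _ / _)))) / r ^ 2
  have hΔ2 : a r - b r = -(b r - a r) := by ring
  rw [hΔ2]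
  generalize b r - a r = Δ at *
  field_simp
  ring

end ParticleSystem

/-! ### The field near a particle -/

/-- If `f (p, r) / r ^ 2` has the limit `L`, then `f` vanishes to the second order, with the coefficient
`L`. -/
theorem hadamard_eq_of_tendsto_div_sq {E : Type} [NormedAddCommGroup E] [NormedSpace ℝ E]
    [FiniteDimensional ℝ E] {f : E × ℝ → ℝ} (hf : ContDiff ℝ ∞ f) {p : E} {L : ℝ}
    (h : Tendsto (fun r => f (p, r) / r ^ 2) (𝓝[>] 0) (𝓝 L)) :
    f (p, 0) = 0 ∧ hadamard f (p, 0) = 0 ∧ hadamard (hadamard f) (p, 0) = L := by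
  have h1 := contDiff_hadamard hf
  have h2 := contDiff_hadamard h1
  have hr : Tendsto (fun r : ℝ => r) (𝓝[>] 0) (𝓝 0) := nhdsWithin_le_nhds
  have hk : Tendsto (fun r => hadamard (hadamard f) (p, r)) (𝓝[>] 0)
      (𝓝 (hadamard (hadamard f) (p, 0))) := by
    have : Continuous fun r : ℝ => hadamard (hadamard f) (p, r) := by
      have := h2.continuous; fun_prop
    exact (this.tendsto 0).mono_left nhdsWithin_le_nhds
  have he : ∀ r, f (p, r) = f (p, 0) + hadamard f (p, 0) * r + r ^ 2 * hadamard (hadamard f) (p, r) :=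
    fun r => by
    have e1 := hadamard_spec hf p r
    have e2 := hadamard_spec h1 p r
    rw [smul_eq_mul] at e1 e2
    rw [e1, e2]; ring
  have t0 : Tendsto (fun r => f (p, 0) / r ^ 2 + hadamard f (p, 0) / r) (𝓝[>] 0)
      (𝓝 (L - hadamard (hadamard f) (p, 0))) := by
    refine (h.sub hk).congr' ?_
    filter_upwards [self_mem_nhdsWithin] with r hr'
    have : r ≠ 0 := ne_of_gt hr'
    rw [he r]; field_simp; ring
  have f0 : f (p, 0) = 0 := by
    have t1 := t0.mul (hr.mul hr)
    have t2 : Tendsto (fun r => f (p, 0) + hadamard f (p, 0) * r) (𝓝[>] 0)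
        (𝓝 (f (p, 0) + hadamard f (p, 0) * 0)) := tendsto_const_nhds.add (hr.const_mul _)
    have t3 := tendsto_nhds_unique t2 (t1.congr' (by
      filter_upwards [self_mem_nhdsWithin] with r hr'
      have : r ≠ 0 := ne_of_gt hr'
      field_simp))
    simpa using t3
  have f1 : hadamard f (p, 0) = 0 := by
    rw [f0] at t0
    have t1 := t0.mul hr
    have t3 := tendsto_nhds_unique (tendsto_const_nhds (x := hadamard f (p, 0))) (t1.congr' (by
      filter_upwards [self_mem_nhdsWithin] with r hr'
      have : r ≠ 0 := ne_of_gt hr'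
      field_simp
      ring))
    simpa using t3
  refine ⟨f0, f1, ?_⟩
  rw [f0, f1] at t0
  have t3 := tendsto_nhds_unique (tendsto_const_nhds (x := (0 : ℝ))) (t0.congr fun r => by simp)
  linarith

namespace ParticleSystem

variable {N : ℕ} (S : ParticleSystem N)

/-- The regularized field at particle `n`, for the external field `Fext`. -/
def particleField (Fext : TensorField) (n : Fin N) (t : ℝ) (μ ν : Fin 4) : ℝ :=
  Fext (event t (S.pos n t)) μ ν + S.selfField n t μ ν

/-- A smooth function `φ ((t, w), r)` that represents `r ^ 2 * F` at the points `z t + r • w` near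
the particle, with its Coulomb part and its behaviour under the reflection of `(w, r)` to `(-w, -r)`,
which exchanges the retarded and the advanced field and fixes the point `z t + r • w`. -/
structure IsNearField (F Fext : TensorField) (n : Fin N) (t₀ δ : ℝ)
    (φ : (ℝ × Space) × ℝ → Fin 4 → Fin 4 → ℝ) : Prop where
  pos : 0 < δ
  contDiff : ∀ μ ν, ContDiff ℝ ∞ fun q => φ q μ ν
  mem : ∀ t r : ℝ, ∀ w : Space, |t - t₀| < δ → 0 < r → r < δ → ‖w‖ = 1 →
    event t (S.pos n t + r • w) ∈ S.offWorldLines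
  eq : ∀ t r : ℝ, ∀ w : Space, |t - t₀| < δ → 0 < r → r < δ → ‖w‖ = 1 → ∀ μ ν,
    F (event t (S.pos n t + r • w)) μ ν = φ ((t, w), r) μ ν / r ^ 2
  coulomb : ∀ t : ℝ, ∀ w : Space, |t - t₀| < δ → ‖w‖ = 1 → ∀ μ ν,
    φ ((t, w), 0) μ ν = S.charge n / (4 * Real.pi) * fluxDensity (S.vel n t) w *
      wedge (event 1 (S.vel n t)) (event 0 w) μ ν
  tendsto : ∀ t : ℝ, ∀ w : Space, |t - t₀| < δ → ‖w‖ = 1 → ∀ μ ν,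
    Tendsto (fun r => (φ ((t, w), r) μ ν + φ ((t, -w), -r) μ ν) / r ^ 2) (𝓝[>] 0)
      (𝓝 (2 * S.particleField Fext n t μ ν))

theorem event_notMem_worldLine (n : Fin N) {t r : ℝ} (hr : r ≠ 0) {w : Space} (hw : ‖w‖ = 1) :
    event t (S.pos n t + r • w) ∉ S.worldLine n := by
  rw [S.mem_worldLine_iff, event_zero, spacePart_event]
  intro h
  have h1 : r • w = 0 := by simpa using h
  rcases smul_eq_zero.1 h1 with h2 | h2
  · exact hr h2
  · rw [h2, norm_zero] at hw; exact zero_ne_one hw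

/-- The scaled retarded field and `r ^ 2 * Fext`, with a cutoff that extends them smoothly to all
arguments. -/
theorem exists_isNearField {F : TensorField} {Fext : Fin N → TensorField}
    (hreg : S.IsRegularField F Fext) (n : Fin N) (t₀ : ℝ) :
    ∃ φ δ, S.IsNearField F (Fext n) n t₀ δ φ := by
  obtain ⟨U, hU, hzU, hext, hdec⟩ := hreg.decomposition n
  have hz := S.smooth n
  have hv := S.speed_lt_one n
  set π : (ℝ × Space) × ℝ → ℝ × ℝ × Space := fun q => (q.1.1, q.2, q.1.2) with hπ
  have hπs : ContDiff ℝ ∞ π := by fun_prop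
  set e : (ℝ × Space) × ℝ → Event := fun q => event q.1.1 (S.pos n q.1.1 + q.2 • q.1.2) with he
  have hes : ContDiff ℝ ∞ e := by
    have : ContDiff ℝ ∞ fun q : (ℝ × Space) × ℝ => (q.1.1, S.pos n q.1.1 + q.2 • q.1.2) := by
      fun_prop
    exact eventCLM.contDiff.comp this
  have hz0 : ∀ t w, e ((t, w), 0) ∈ U := fun t w => by
    simp only [he, zero_smul, add_zero]
    exact hzU ⟨t, rfl⟩
  set O : Set ((ℝ × Space) × ℝ) := π ⁻¹' delayDomain (S.pos n) ∩ e ⁻¹' U with hO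
  have hOo : IsOpen O := ((isOpen_delayDomain hz hv).preimage hπs.continuous).inter
    (hU.preimage hes.continuous)
  set K : Set ((ℝ × Space) × ℝ) := ({t₀} ×ˢ Metric.sphere 0 1) ×ˢ {0} with hK
  have hKc : IsCompact K := (isCompact_singleton.prod (isCompact_sphere 0 1)).prod isCompact_singleton
  have hKO : K ⊆ O := by
    rintro ⟨⟨t, w⟩, r⟩ ⟨⟨ht, hw⟩, hr⟩
    obtain rfl : t = t₀ := ht
    obtain rfl : r = 0 := hr
    exact ⟨(scaledDelay_zero hz hv t (mem_sphere_zero_iff_norm.1 hw)).1, hz0 t w⟩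
  -- a cutoff which is `1` near the sphere `t = t₀`, `r = 0`, and is supported where both fields are smooth
  obtain ⟨χ, hχ0, hχ1, -⟩ := exists_contMDiffMap_zero_one_nhds_of_isClosed
    (n := (⊤ : ℕ∞)) (modelWithCornersSelf ℝ ((ℝ × Space) × ℝ)) hOo.isClosed_compl hKc.isClosed
    (Set.disjoint_left.2 fun q hq hq' => hq (hKO hq'))
  have hχs : ContDiff ℝ ∞ χ := χ.contMDiff.contDiff
  have hsupp : tsupport χ ⊆ O := by
    intro q hq
    by_contra hqO
    exact (notMem_tsupport_iff_eventuallyEq.2 (hχ0.filter_mono (nhds_le_nhdsSet hqO))) hq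
  obtain ⟨W, hW, hKW, hW1⟩ := eventually_nhdsSet_iff_exists.1 hχ1
  obtain ⟨δ₁, hδ₁, hthick⟩ := hKc.exists_thickening_subset_open (hW.inter hOo)
    (subset_inter hKW hKO)
  have hin : ∀ t r : ℝ, ∀ w : Space, |t - t₀| < δ₁ → |r| < δ₁ → ‖w‖ = 1 →
      χ ((t, w), r) = 1 ∧ ((t, w), r) ∈ O := fun t r w ht hr hw => by
    have : ((t, w), r) ∈ W ∩ O := hthick (Metric.mem_thickening_iff.2
      ⟨((t₀, w), 0), ⟨⟨rfl, mem_sphere_zero_iff_norm.2 hw⟩, rfl⟩, by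
        simp only [Prod.dist_eq, dist_self, Real.dist_eq, sub_zero]
        rw [max_lt_iff, max_lt_iff]
        exact ⟨⟨ht, hδ₁⟩, hr⟩⟩)
    exact ⟨hW1 _ this.1, this.2⟩
  -- the other particles keep their distance
  have hother : ∀ᶠ q : ℝ × ℝ in 𝓝 (t₀, 0), ∀ m, m ≠ n → |q.2| < dist (S.pos m q.1) (S.pos n q.1) := by
    rw [eventually_all]
    intro m
    by_cases hm : m = n
    · simp [hm]
    · have h1 : Continuous fun q : ℝ × ℝ => dist (S.pos m q.1) (S.pos n q.1) := by
        have := (S.smooth m).continuous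
        have := hz.continuous
        fun_prop
      have h2 : Continuous fun q : ℝ × ℝ => |q.2| := by fun_prop
      have h3 : ∀ᶠ q : ℝ × ℝ in 𝓝 (t₀, 0), |q.2| < dist (S.pos m q.1) (S.pos n q.1) := by
        refine h2.continuousAt.eventually_lt h1.continuousAt ?_
        simp only [abs_zero, dist_pos]
        exact fun h => hm (S.distinct t₀ h)
      exact h3.mono fun q hq _ => hq
  obtain ⟨δ₂, hδ₂, hother⟩ := Metric.eventually_nhds_iff.1 hother
  set φ : (ℝ × Space) × ℝ → Fin 4 → Fin 4 → ℝ := fun q μ ν =>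
    (S.scaledRetField n (π q) μ ν + q.2 ^ 2 * Fext n (e q) μ ν) * χ q with hφ
  have hφ1 : ∀ t r : ℝ, ∀ w : Space, |t - t₀| < δ₁ → |r| < δ₁ → ‖w‖ = 1 → ∀ μ ν,
      φ ((t, w), r) μ ν = S.scaledRetField n (t, r, w) μ ν + r ^ 2 * Fext n (e ((t, w), r)) μ ν :=
    fun t r w ht hr hw μ ν => by
    simp only [hφ]
    rw [(hin t r w ht hr hw).1, mul_one]
  refine ⟨φ, min δ₁ δ₂, lt_min hδ₁ hδ₂, fun μ ν => ?_, fun t r w ht hr hr' hw => ?_,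
    fun t r w ht hr hr' hw μ ν => ?_, fun t w ht hw μ ν => ?_, fun t w ht hw μ ν => ?_⟩
  · refine contDiff_mul_of_tsupport_subset hOo (fun q hq => ContDiffAt.contDiffWithinAt ?_) hχs hsupp
    refine ((S.contDiffAt_scaledRetField n hq.1 μ ν).comp q hπs.contDiffAt).add
      ((contDiffAt_snd.pow 2).mul ?_)
    exact ((contDiffOn_component hext μ ν).contDiffAt (hU.mem_nhds hq.2)).comp q hes.contDiffAt
  · rw [S.mem_offWorldLines_iff]
    intro m hm
    by_cases hmn : m = n
    · subst hmn
      refine S.event_notMem_worldLine (t := t) m hr.ne' hw ((S.mem_worldLine_iff).2 ?_)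
      rw [event_zero, spacePart_event]; exact hm
    · have h1 := @hother (t, r) (by
        simp only [Prod.dist_eq, Real.dist_eq, sub_zero, max_lt_iff]
        exact ⟨ht.trans_le (min_le_right _ _), by
          rw [abs_of_pos hr]; exact hr'.trans_le (min_le_right _ _)⟩) m hmn
      simp only at h1
      rw [← hm, dist_eq_norm, add_sub_cancel_left, norm_smul, hw, mul_one, Real.norm_eq_abs] at h1
      exact lt_irrefl _ h1
  · have ht' := ht.trans_le (min_le_left _ _)
    have hr1 : |r| < δ₁ := by rw [abs_of_pos hr]; exact hr'.trans_le (min_le_left _ _)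
    obtain ⟨-, hq1, hq2⟩ := hin t r w ht' hr1 hw
    rw [hφ1 t r w ht' hr1 hw, hdec _ hq2 (S.event_notMem_worldLine n hr.ne' hw),
      S.retField_eq n hr hq1]
    have : r ≠ 0 := hr.ne'
    field_simp
    ring
  · have ht' := ht.trans_le (min_le_left _ _)
    rw [hφ1 t 0 w ht' (by simpa using hδ₁) hw, S.scaledRetField_zero n t hw]
    ring
  · have ht' := ht.trans_le (min_le_left _ _)
    have h1 := S.tendsto_scaledRetField_add n t hw μ ν
    have hc : ∀ w' : Space, ContinuousAt (fun r : ℝ => Fext n (e ((t, w'), r)) μ ν) 0 := fun w' => by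
      have h2 := ((contDiffOn_component hext μ ν).contDiffAt (hU.mem_nhds (hz0 t w'))).continuousAt
      have h3 : Continuous fun r : ℝ => e ((t, w'), r) := by
        have := hes.continuous
        fun_prop
      exact ContinuousAt.comp (f := fun r : ℝ => e ((t, w'), r)) h2 h3.continuousAt
    have h4 : Tendsto (fun r : ℝ => 2 * Fext n (e ((t, w), r)) μ ν) (𝓝[>] 0)
        (𝓝 (2 * Fext n (e ((t, w), 0)) μ ν)) :=
      ((hc w).tendsto.mono_left nhdsWithin_le_nhds).const_mul 2
    have h5 := h1.add h4
    have h6 : 2 * S.selfField n t μ ν + 2 * Fext n (e ((t, w), 0)) μ ν =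
        2 * S.particleField (Fext n) n t μ ν := by
      simp only [particleField, he, zero_smul, add_zero]; ring
    rw [h6] at h5
    refine h5.congr' ?_
    filter_upwards [self_mem_nhdsWithin, nhdsWithin_le_nhds (Iio_mem_nhds hδ₁)] with r hr hr'
    have hr0 : 0 < r := hr
    have hr1 : |r| < δ₁ := by rw [abs_of_pos hr0]; exact hr'
    have hw' : ‖-w‖ = 1 := by rwa [norm_neg]
    have hee : e ((t, -w), -r) = e ((t, w), r) := by simp only [he, neg_smul_neg]
    rw [hφ1 t r w ht' hr1 hw, hφ1 t (-r) (-w) ht' (by rwa [abs_neg]) hw', hee]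
    have := hr0.ne'
    field_simp
    ring

/-- The external field is antisymmetric at the particle. -/
theorem IsRegularField.antisymm {F : TensorField} {Fext : Fin N → TensorField}
    (hreg : S.IsRegularField F Fext) (hF : ∀ p μ ν, F p μ ν = -F p ν μ) (n : Fin N) (t : ℝ)
    (μ ν : Fin 4) : Fext n (event t (S.pos n t)) μ ν = -Fext n (event t (S.pos n t)) ν μ := by
  obtain ⟨U, hU, hzU, hext, hdec⟩ := hreg.decomposition n
  have hp : event t (S.pos n t) ∈ U := hzU ⟨t, rfl⟩
  have hc : ∀ μ ν, ContinuousAt (fun p => Fext n p μ ν) (event t (S.pos n t)) := fun μ ν =>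
    ((contDiffOn_component hext μ ν).contDiffAt (hU.mem_nhds hp)).continuousAt
  set w : Space := EuclideanSpace.single 0 1 with hw
  have hw1 : ‖w‖ = 1 := by simp [hw]
  have hl : Tendsto (fun r : ℝ => event t (S.pos n t + r • w)) (𝓝[>] 0)
      (𝓝 (event t (S.pos n t))) := by
    have : Continuous fun r : ℝ => event t (S.pos n t + r • w) :=
      eventCLM.continuous.comp (by fun_prop : Continuous fun r : ℝ => (t, S.pos n t + r • w))
    have := (this.tendsto 0).mono_left (nhdsWithin_le_nhds (s := Ioi 0))
    simpa using this
  have h1 := (hc μ ν).tendsto.comp hl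
  have h2 := ((hc ν μ).tendsto.comp hl).neg
  refine tendsto_nhds_unique h1 (h2.congr' ?_)
  filter_upwards [hl.eventually (hU.mem_nhds hp), self_mem_nhdsWithin] with r hr hr'
  have hn := S.event_notMem_worldLine n (t := t) (ne_of_gt hr') hw1
  have e1 := hdec _ hr hn μ ν
  have e2 := hdec _ hr hn ν μ
  have e3 := hF (event t (S.pos n t + r • w)) μ ν
  have e4 : S.retField n (event t (S.pos n t + r • w)) μ ν =
    -S.retField n (event t (S.pos n t + r • w)) ν μ := by unfold retField; ring
  simp only [Function.comp]
  linarith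

end ParticleSystem

/-! ### Momentum and flow on small spheres -/

/-- The coefficients of order `0` and `2` of a function, from the limit of its even part. -/
theorem even_part_of_tendsto {E : Type} [NormedAddCommGroup E] [NormedSpace ℝ E]
    [FiniteDimensional ℝ E] {f : E × ℝ → ℝ} (hf : ContDiff ℝ ∞ f) {p : E} {L : ℝ}
    (h : Tendsto (fun r => (f (p, r) + f (p, -r)) / r ^ 2) (𝓝[>] 0) (𝓝 (2 * L))) :
    f (p, 0) = 0 ∧ hadamard (hadamard f) (p, 0) = L := by
  have hg : ContDiff ℝ ∞ fun q : E × ℝ => f (q.1, q.2) + f (q.1, -q.2) := by fun_prop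
  obtain ⟨h0, -, -⟩ := hadamard_eq_of_tendsto_div_sq hg h
  have f0 : f (p, 0) = 0 := by
    simp only [neg_zero] at h0; linarith
  refine ⟨f0, ?_⟩
  have h1 := contDiff_hadamard hf
  have h2 := contDiff_hadamard h1
  have he : ∀ r, f (p, r) = hadamard f (p, 0) * r + r ^ 2 * hadamard (hadamard f) (p, r) :=
    fun r => by
    have e1 := hadamard_spec hf p r
    have e2 := hadamard_spec h1 p r
    rw [smul_eq_mul] at e1 e2
    rw [e1, e2, f0]; ring
  have hk : Tendsto (fun r => hadamard (hadamard f) (p, r) + hadamard (hadamard f) (p, -r)) (𝓝[>] 0)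
      (𝓝 (hadamard (hadamard f) (p, 0) + hadamard (hadamard f) (p, -0))) := by
    have : Continuous fun r : ℝ =>
        hadamard (hadamard f) (p, r) + hadamard (hadamard f) (p, -r) := by
      have := h2.continuous; fun_prop
    exact (this.tendsto 0).mono_left nhdsWithin_le_nhds
  have := tendsto_nhds_unique hk (h.congr' (by
    filter_upwards [self_mem_nhdsWithin] with r hr
    have : r ≠ 0 := ne_of_gt hr
    rw [he r, he (-r)]
    field_simp
    ring))
  rw [neg_zero] at this
  linarith

/-- The coefficient of order `1` of a function vanishes if its odd part is of second order. -/
theorem odd_part_of_tendsto {E : Type} [NormedAddCommGroup E] [NormedSpace ℝ E]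
    [FiniteDimensional ℝ E] {f : E × ℝ → ℝ} (hf : ContDiff ℝ ∞ f) {p : E} {L : ℝ}
    (h : Tendsto (fun r => (f (p, r) - f (p, -r)) / r ^ 2) (𝓝[>] 0) (𝓝 L)) :
    hadamard f (p, 0) = 0 := by
  have hg : ContDiff ℝ ∞ fun q : E × ℝ => f (q.1, q.2) - f (q.1, -q.2) := by fun_prop
  obtain ⟨-, h0, -⟩ := hadamard_eq_of_tendsto_div_sq hg h
  rw [hadamard_zero] at h0 ⊢
  have d1 : HasDerivAt (fun r => f (p, r)) (lastD f (p, 0)) 0 :=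
    hasDerivAt_lastD (hf.differentiable (by simp) _)
  have d2 : HasDerivAt (fun r => f (p, -r)) (-lastD f (p, 0)) 0 := by
    have d1' : HasDerivAt (fun r => f (p, r)) (lastD f (p, 0)) (-0) := by rwa [neg_zero]
    have d2' : HasDerivAt (fun r => f (p, -r)) ((-1 : ℝ) • lastD f (p, 0)) 0 :=
      d1'.scomp (0 : ℝ) (hasDerivAt_neg (0 : ℝ))
    simpa using d2'
  have d3 : HasDerivAt (fun r => f (p, r) - f (p, -r))
      (lastD (fun q : E × ℝ => f (q.1, q.2) - f (q.1, -q.2)) (p, 0)) 0 :=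
    hasDerivAt_lastD (f := fun q : E × ℝ => f (q.1, q.2) - f (q.1, -q.2))
      (hg.differentiable (by simp) _)
  have := d3.unique (d1.sub d2)
  rw [h0] at this
  linarith

/-- A pole and a differentiable remainder have the finite part `k 0`. -/
theorem hasRLim_div_add {k : ℝ → ℝ} (hk : DifferentiableAt ℝ k 0) (a : ℝ) {f : ℝ → ℝ}
    (h : ∀ᶠ r in 𝓝[>] 0, f r = a / r + k r) : HasRLim f (k 0) := by
  refine ⟨a, ?_⟩
  have h1 : (fun r => k r - k 0) =O[𝓝[>] 0] fun r => r := by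
    simpa using hk.isBigO_sub.mono (nhdsWithin_le_nhds (s := Ioi 0))
  refine h1.congr' ?_ (.of_forall fun _ => rfl)
  filter_upwards [h] with r hr
  rw [hr]; ring

theorem contDiff_integral_sphere {f : (ℝ × Space) × ℝ → ℝ} (hf : ContDiff ℝ ∞ f) :
    ContDiff ℝ ∞ fun p : ℝ × ℝ => ∫ w : USphere, f ((p.1, (w : Space)), p.2) ∂sphereMeasure := by
  refine contDiff_integral_comp (E := ℝ × ℝ) (Z := Space) (ι := fun w : USphere => (w : Space))
    (f := fun q => f ((q.1.1, q.2), q.1.2)) continuous_subtype_val (isCompact_sphere 0 1)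
    (.of_forall fun w => w.2) ?_
  fun_prop

/-- The flow of a quantity with the density `T 0` and the current `(T 1, T 2, T 3)` into a sphere
that moves with the velocity `v`, at the point of the sphere in the direction `w`. -/
def flow (v w : Space) (T : Fin 4 → ℝ) : ℝ := ∑ i : Fin 3, w i * (v i * T 0 - T i.succ)

theorem flow_neg_left (v w : Space) (T : Fin 4 → ℝ) : flow v (-w) T = -flow v w T := by
  simp only [flow, PiLp.neg_apply, neg_mul, Finset.sum_neg_distrib]

theorem contDiff_flow {E : Type} [NormedAddCommGroup E] [NormedSpace ℝ E] {v w : E → Space}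
    {T : E → Fin 4 → ℝ} (hv : ContDiff ℝ ∞ v) (hw : ContDiff ℝ ∞ w)
    (hT : ∀ κ, ContDiff ℝ ∞ fun x => T x κ) : ContDiff ℝ ∞ fun x => flow (v x) (w x) (T x) := by
  unfold flow
  have hc : ∀ {u : E → Space}, ContDiff ℝ ∞ u → ∀ i, ContDiff ℝ ∞ fun x => u x i :=
    fun hu i => (EuclideanSpace.proj i : Space →L[ℝ] ℝ).contDiff.comp hu
  exact ContDiff.sum fun i _ => (hc hw i).mul (((hc hv i).mul (hT 0)).sub (hT i.succ))

theorem contDiff_stress {E : Type} [NormedAddCommGroup E] [NormedSpace ℝ E]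
    {f : E → Fin 4 → Fin 4 → ℝ} (hf : ∀ a b, ContDiff ℝ ∞ fun p => f p a b) (μ ν : Fin 4) :
    ContDiff ℝ ∞ fun p => stress (f p) μ ν :=
  contDiffOn_univ.1 (contDiffOn_stress (fun a b => (hf a b).contDiffOn) μ ν)

theorem contDiff_stressPolar {E : Type} [NormedAddCommGroup E] [NormedSpace ℝ E]
    {f d : E → Fin 4 → Fin 4 → ℝ} (hf : ∀ a b, ContDiff ℝ ∞ fun p => f p a b)
    (hd : ∀ a b, ContDiff ℝ ∞ fun p => d p a b) (μ ν : Fin 4) :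
    ContDiff ℝ ∞ fun p => stressPolar (f p) (d p) μ ν := by
  unfold stressPolar
  refine ContDiff.sub (ContDiff.sum fun l _ => ?_)
    (contDiff_const.mul (ContDiff.sum fun k _ => ContDiff.sum fun l _ => ?_))
  · exact contDiff_const.mul (((hd μ l).mul (hf ν l)).add ((hf μ l).mul (hd ν l)))
  · exact contDiff_const.mul ((contDiff_const.mul (hf k l)).mul (hd k l))

/-- The energy-momentum tensor of a field that is the negative of `f` up to the term `c * d`. -/
theorem stress_neg_add_mul {f g d : Fin 4 → Fin 4 → ℝ} {c : ℝ}
    (h : ∀ a b, g a b = -f a b + c * d a b) (μ ν : Fin 4) :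
    stress g μ ν = stress f μ ν - c * (stressPolar f d μ ν - c * stress d μ ν) := by
  simp only [stress, stressPolar, h, Fin.sum_univ_four]
  ring

theorem stress_div {f g : Fin 4 → Fin 4 → ℝ} {c : ℝ} (h : ∀ a b, g a b = f a b / c) (μ ν : Fin 4) :
    stress g μ ν = stress f μ ν / c ^ 2 := by
  simp only [stress, h, Fin.sum_univ_four]
  ring

theorem stressPolar_mul_left {f g d : Fin 4 → Fin 4 → ℝ} {c : ℝ} (h : ∀ a b, f a b = c * g a b)
    (μ ν : Fin 4) : stressPolar f d μ ν = c * stressPolar g d μ ν := by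
  simp only [stressPolar, h, Fin.sum_univ_four]
  ring

theorem stressPolar_mul_right {f g d : Fin 4 → Fin 4 → ℝ} {c : ℝ} (h : ∀ a b, d a b = c * g a b)
    (μ ν : Fin 4) : stressPolar f d μ ν = c * stressPolar f g μ ν := by
  simp only [stressPolar, h, Fin.sum_univ_four]
  ring

theorem flow_sub (v w : Space) (T T' : Fin 4 → ℝ) :
    flow v w (fun κ => T κ - T' κ) = flow v w T - flow v w T' := by
  simp only [flow, ← Finset.sum_sub_distrib]
  exact Finset.sum_congr rfl fun i _ => by ring

theorem flow_mul (v w : Space) (c : ℝ) (T : Fin 4 → ℝ) :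
    flow v w (fun κ => c * T κ) = c * flow v w T := by
  simp only [flow, Finset.mul_sum]
  exact Finset.sum_congr rfl fun i _ => by ring

/-- The flow of the momentum of the interference of the Coulomb field with a constant field `G`. It
consists of the Lorentz force and of a term `(v · w) (b · w)` with `b` orthogonal to `v`, which
disappears upon integration. -/
theorem exists_flow_stressPolar_wedge (v : Space) {G : Fin 4 → Fin 4 → ℝ}
    (hG : ∀ a b, G a b = -G b a) (μ : Fin 4) : ∃ b : Space, inner ℝ v b = 0 ∧
      ∀ w : Space, ‖w‖ = 1 →
        flow v w (fun κ => stressPolar (wedge (event 1 v) (event 0 w)) G κ μ) =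
          ∑ ν, metric ν * event 1 v ν * G μ ν + inner ℝ v w * inner ℝ b w := by
  have g0 : ∀ a, G a a = 0 := fun a => by linarith [hG a a]
  have g1 := hG 1 0
  have g2 := hG 2 0
  have g3 := hG 3 0
  have g4 := hG 2 1
  have g5 := hG 3 1
  have g6 := hG 3 2
  have e0 : ∀ (t : ℝ) (x : Space), event t x 0 = t := fun _ _ => rfl
  have e1 : ∀ (t : ℝ) (x : Space), event t x 1 = x 0 := fun _ _ => rfl
  have e2 : ∀ (t : ℝ) (x : Space), event t x 2 = x 1 := fun _ _ => rfl
  have e3 : ∀ (t : ℝ) (x : Space), event t x 3 = x 2 := fun _ _ => rfl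
  have s0 : (0 : Fin 3).succ = 1 := rfl
  have s1 : (1 : Fin 3).succ = 2 := rfl
  have s2 : (2 : Fin 3).succ = 3 := rfl
  clear hG
  set b : Space := if μ = 0 then
      !₂[G 2 1 * v 1 + G 3 1 * v 2, G 1 2 * v 0 + G 3 2 * v 2, G 1 3 * v 0 + G 2 3 * v 1]
    else if μ = 1 then !₂[-(G 0 2 * v 1 + G 0 3 * v 2), G 0 2 * v 0, G 0 3 * v 0]
    else if μ = 2 then !₂[G 0 1 * v 1, -(G 0 1 * v 0 + G 0 3 * v 2), G 0 3 * v 1]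
    else !₂[G 0 1 * v 2, G 0 2 * v 2, -(G 0 1 * v 0 + G 0 2 * v 1)] with hb
  have key : ∀ i, i = 0 ∨ i = 1 ∨ i = 2 ∨ i = (3 : Fin 4) := by decide
  refine ⟨b, ?_, fun w hw => ?_⟩
  · rw [hb]
    rcases key μ with rfl | rfl | rfl | rfl <;>
      simp [PiLp.inner_apply, Fin.sum_univ_three, g4, g5, g6] <;> ring
  · have hw2 : w 0 ^ 2 + w 1 ^ 2 + w 2 ^ 2 = 1 := by
      have := EuclideanSpace.real_norm_sq_eq w
      rw [hw, Fin.sum_univ_three] at this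
      linarith
    rw [hb]
    rcases key μ with rfl | rfl | rfl | rfl <;>
      simp [flow, stressPolar, wedge, metric, PiLp.inner_apply, Fin.sum_univ_three,
        Fin.sum_univ_four, e0, e1, e2, e3, s0, s1, s2, g0, g1, g2, g3, g4, g5, g6]
    · linear_combination (v 0 * G 0 1 + v 1 * G 0 2 + v 2 * G 0 3) * hw2
    · linear_combination (G 0 1 + v 1 * G 1 2 + v 2 * G 1 3) * hw2
    · linear_combination (G 0 2 - v 0 * G 1 2 + v 2 * G 2 3) * hw2
    · linear_combination (G 0 3 - v 0 * G 1 3 - v 1 * G 2 3) * hw2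

/-- The force of a constant field `G` on the charge, as a flow of momentum. -/
theorem integral_flow_stressPolar {v : Space} (hv : ‖v‖ < 1) {G : Fin 4 → Fin 4 → ℝ}
    (hG : ∀ a b, G a b = -G b a) (μ : Fin 4) :
    ∫ w : USphere, fluxDensity v w * flow v w (fun κ =>
        stressPolar (wedge (event 1 v) (event 0 w)) G κ μ) ∂sphereMeasure =
      4 * Real.pi * ∑ ν, metric ν * event 1 v ν * G μ ν := by
  obtain ⟨b, hb, h⟩ := exists_flow_stressPolar_wedge v hG μ
  obtain ⟨κ, hκ⟩ := exists_integral_fluxDensity_inner hv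
  have hc := continuous_fluxDensity hv
  set A := ∑ ν, metric ν * event 1 v ν * G μ ν with hA
  have e : ∀ w : USphere, fluxDensity v w * flow v w (fun κ =>
        stressPolar (wedge (event 1 v) (event 0 w)) G κ μ) =
      fluxDensity v w * A + fluxDensity v w * inner ℝ v (w : Space) * inner ℝ b (w : Space) :=
    fun w => by rw [h w (norm_usphere w)]; ring
  simp only [e]
  rw [integral_add (continuous_integrable_sphere (by fun_prop))
    (continuous_integrable_sphere (by fun_prop)), integral_mul_const, integral_fluxDensity hv, hκ,
    hb, mul_zero, add_zero]

namespace ParticleSystem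

variable {N : ℕ} {S : ParticleSystem N}

namespace IsNearField

variable {F Fext : TensorField} {n : Fin N} {t₀ δ : ℝ} {φ : (ℝ × Space) × ℝ → Fin 4 → Fin 4 → ℝ}

/-- Twice the even part of the scaled field under the reflection of `(w, r)` to `(-w, -r)`, divided by
`r ^ 2`. -/
def evenPart (φ : (ℝ × Space) × ℝ → Fin 4 → Fin 4 → ℝ) (q : (ℝ × Space) × ℝ) (μ ν : Fin 4) : ℝ :=
  hadamard (hadamard fun q : (ℝ × Space) × ℝ =>
    φ q μ ν + φ ((q.1.1, -q.1.2), -q.2) μ ν) q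

theorem contDiff_evenPart (h : S.IsNearField F Fext n t₀ δ φ) (μ ν : Fin 4) :
    ContDiff ℝ ∞ fun q => evenPart φ q μ ν := by
  refine contDiff_hadamard (contDiff_hadamard ?_)
  have := h.contDiff μ ν
  have h2 : ContDiff ℝ ∞ fun q : (ℝ × Space) × ℝ => φ ((q.1.1, -q.1.2), -q.2) μ ν :=
    this.comp (g := fun q => φ q μ ν) (by fun_prop)
  exact this.add h2

/-- The scaled field is odd under the reflection, up to terms of the order `r ^ 2`. -/
theorem eq_neg_add (h : S.IsNearField F Fext n t₀ δ φ) {t : ℝ} (ht : |t - t₀| < δ) {w : Space}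
    (hw : ‖w‖ = 1) (r : ℝ) (μ ν : Fin 4) : φ ((t, -w), -r) μ ν =
      -φ ((t, w), r) μ ν + r ^ 2 * evenPart φ ((t, w), r) μ ν := by
  have hφ := h.contDiff μ ν
  have h2 : ContDiff ℝ ∞ fun q : (ℝ × Space) × ℝ => φ ((q.1.1, -q.1.2), -q.2) μ ν :=
    hφ.comp (g := fun q => φ q μ ν) (by fun_prop)
  have hs : ContDiff ℝ ∞ fun q : (ℝ × Space) × ℝ => φ q μ ν + φ ((q.1.1, -q.1.2), -q.2) μ ν :=
    hφ.add h2
  obtain ⟨s0, s1, -⟩ := hadamard_eq_of_tendsto_div_sq hs (h.tendsto t w ht hw μ ν)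
  have e1 := hadamard_spec hs (t, w) r
  have e2 := hadamard_spec (contDiff_hadamard hs) (t, w) r
  rw [s0, zero_add, smul_eq_mul] at e1
  rw [s1, zero_add, smul_eq_mul] at e2
  rw [e2] at e1
  rw [evenPart]
  linear_combination e1

/-- The even part of the field is the regularized field. -/
theorem evenPart_zero (h : S.IsNearField F Fext n t₀ δ φ) {t : ℝ} (ht : |t - t₀| < δ) {w : Space}
    (hw : ‖w‖ = 1) (μ ν : Fin 4) :
    evenPart φ ((t, w), 0) μ ν = 2 * S.particleField Fext n t μ ν := by
  have hφ := h.contDiff μ ν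
  have h2 : ContDiff ℝ ∞ fun q : (ℝ × Space) × ℝ => φ ((q.1.1, -q.1.2), -q.2) μ ν :=
    hφ.comp (g := fun q => φ q μ ν) (by fun_prop)
  exact (hadamard_eq_of_tendsto_div_sq (hφ.add h2) (h.tendsto t w ht hw μ ν)).2.2

/-- The spherical averages of the field have an expansion `a / r + b + O(r)`. -/
theorem hasRLim_fieldAverage (h : S.IsNearField F Fext n t₀ δ φ) {t : ℝ} (ht : |t - t₀| < δ)
    (μ ν : Fin 4) : HasRLim (S.fieldAverage F n t μ ν) (S.particleField Fext n t μ ν) := by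
  have hφ := h.contDiff μ ν
  have hρ := h.contDiff_evenPart μ ν
  set A : ℝ × ℝ → ℝ := fun p =>
    ∫ w : USphere, φ ((p.1, (w : Space)), p.2) μ ν ∂sphereMeasure with hA
  have hAs : ContDiff ℝ ∞ A := contDiff_integral_sphere (f := fun q => φ q μ ν) hφ
  set B : ℝ × ℝ → ℝ := fun p =>
    ∫ w : USphere, evenPart φ ((p.1, (w : Space)), p.2) μ ν ∂sphereMeasure with hB
  have hBs : ContDiff ℝ ∞ B := contDiff_integral_sphere (f := fun q => evenPart φ q μ ν) hρ
  have hi : ∀ (f : (ℝ × Space) × ℝ → ℝ), Continuous f → ∀ r : ℝ,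
      Integrable (fun w : USphere => f ((t, (w : Space)), r)) sphereMeasure := fun f hf r =>
    continuous_integrable_sphere (by fun_prop)
  have hsum : ∀ r, A (t, r) + A (t, -r) = r ^ 2 * B (t, r) := fun r => by
    have h1 : A (t, -r) = ∫ w : USphere, φ ((t, -(w : Space)), -r) μ ν ∂sphereMeasure :=
      (integral_sphere_neg fun w => φ ((t, w), -r) μ ν).symm
    rw [h1]
    simp only [hA, hB]
    have h2 : ∀ w : USphere, φ ((t, -(w : Space)), -r) μ ν =
      r ^ 2 * evenPart φ ((t, (w : Space)), r) μ ν - φ ((t, (w : Space)), r) μ ν := fun w => by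
        rw [h.eq_neg_add ht (norm_usphere w) r μ ν]; ring
    simp only [h2]
    have i1 := hi _ hφ.continuous r
    have i2 := hi _ hρ.continuous r
    rw [integral_sub (i2.const_mul _) i1, integral_const_mul]
    ring
  have hlim : Tendsto (fun r => (A (t, r) + A (t, -r)) / r ^ 2) (𝓝[>] 0)
      (𝓝 (2 * (4 * Real.pi * S.particleField Fext n t μ ν))) := by
    have h0 : B (t, 0) = 2 * (4 * Real.pi * S.particleField Fext n t μ ν) := by
      simp only [hB, h.evenPart_zero ht (norm_usphere _)]
      rw [integral_sphere_const]; ring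
    rw [← h0]
    have hc : Continuous fun r : ℝ => B (t, r) := by
      have := hBs.continuous; fun_prop
    refine ((hc.tendsto 0).mono_left nhdsWithin_le_nhds).congr' ?_
    filter_upwards [self_mem_nhdsWithin] with r hr
    have : r ≠ 0 := ne_of_gt hr
    rw [hsum]; field_simp
  obtain ⟨a0, a2⟩ := even_part_of_tendsto hAs hlim
  have hπ := Real.pi_ne_zero
  have hval : S.particleField Fext n t μ ν = (4 * Real.pi)⁻¹ * hadamard (hadamard A) (t, 0) := by
    rw [a2]; field_simp
  rw [hval]
  have hAh := contDiff_hadamard hAs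
  have hk : Differentiable ℝ fun r : ℝ => (4 * Real.pi)⁻¹ * hadamard (hadamard A) (t, r) := by
    have : ContDiff ℝ ∞ fun r : ℝ => (4 * Real.pi)⁻¹ * hadamard (hadamard A) (t, r) := by
      have := contDiff_hadamard hAh
      fun_prop
    exact this.differentiable (by simp)
  refine hasRLim_div_add (hk 0) ((4 * Real.pi)⁻¹ * hadamard A (t, 0)) ?_
  filter_upwards [self_mem_nhdsWithin, nhdsWithin_le_nhds (Iio_mem_nhds h.pos)] with r hr hr'
  have hr0 : r ≠ 0 := ne_of_gt hr
  have e1 := hadamard_spec hAs t r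
  have e2 := hadamard_spec hAh t r
  rw [smul_eq_mul] at e1 e2
  have e3 : S.fieldAverage F n t μ ν r = (4 * Real.pi)⁻¹ * (A (t, r) / r ^ 2) := by
    rw [fieldAverage, sphereAverage, hA]
    simp only [h.eq t r _ ht hr hr' (norm_usphere _), integral_div]
  rw [e3, e1, a0, e2]
  field_simp
  ring

/-- The momentum on the sphere of radius `r`, multiplied by `r ^ 4`. -/
def sphereMomentum (φ : (ℝ × Space) × ℝ → Fin 4 → Fin 4 → ℝ) (μ : Fin 4) (p : ℝ × ℝ) : ℝ :=
  ∫ w : USphere, stress (φ ((p.1, (w : Space)), p.2)) 0 μ ∂sphereMeasure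

/-- The flow of momentum into the sphere of radius `r` around the particle with the trajectory `z`,
multiplied by `r ^ 4`. -/
def sphereFlow (z : ℝ → Space) (φ : (ℝ × Space) × ℝ → Fin 4 → Fin 4 → ℝ) (μ : Fin 4)
    (p : ℝ × ℝ) : ℝ :=
  ∫ w : USphere, flow (deriv z p.1) w (fun κ => stress (φ ((p.1, (w : Space)), p.2)) κ μ)
    ∂sphereMeasure

theorem contDiff_sphereMomentum (h : S.IsNearField F Fext n t₀ δ φ) (μ : Fin 4) :
    ContDiff ℝ ∞ (sphereMomentum φ μ) :=
  contDiff_integral_sphere (f := fun q => stress (φ q) 0 μ) (contDiff_stress h.contDiff 0 μ)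

theorem contDiff_flow_stress (h : S.IsNearField F Fext n t₀ δ φ) (μ : Fin 4) :
    ContDiff ℝ ∞ fun q : (ℝ × Space) × ℝ =>
      flow (deriv (S.pos n) q.1.1) q.1.2 (fun κ => stress (φ q) κ μ) := by
  have := contDiff_deriv (S.smooth n)
  exact contDiff_flow (by fun_prop) (by fun_prop) fun κ => contDiff_stress h.contDiff κ μ

theorem contDiff_sphereFlow (h : S.IsNearField F Fext n t₀ δ φ) (μ : Fin 4) :
    ContDiff ℝ ∞ (sphereFlow (S.pos n) φ μ) :=
  contDiff_integral_sphere (h.contDiff_flow_stress μ)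

/-- The momentum is quadratic in the field, hence even under the reflection up to terms of the order
`r ^ 2`, and has no term of first order in `r`. Thus there is no logarithm in the integrated momentum. -/
theorem hadamard_sphereMomentum_zero (h : S.IsNearField F Fext n t₀ δ φ) {t : ℝ}
    (ht : |t - t₀| < δ) (μ : Fin 4) : hadamard (sphereMomentum φ μ) (t, 0) = 0 := by
  set D : (ℝ × Space) × ℝ → ℝ := fun q => stressPolar (φ q) (evenPart φ q) 0 μ -
    q.2 ^ 2 * stress (evenPart φ q) 0 μ with hD
  have hDs : ContDiff ℝ ∞ D := (contDiff_stressPolar h.contDiff h.contDiff_evenPart 0 μ).sub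
    ((contDiff_snd.pow 2).mul (contDiff_stress h.contDiff_evenPart 0 μ))
  have hs := contDiff_stress h.contDiff 0 μ
  set B : ℝ × ℝ → ℝ := fun p =>
    ∫ w : USphere, D ((p.1, (w : Space)), p.2) ∂sphereMeasure with hB
  have hBs : ContDiff ℝ ∞ B := contDiff_integral_sphere hDs
  refine odd_part_of_tendsto (L := B (t, 0)) (h.contDiff_sphereMomentum μ) ?_
  have hc : Continuous fun r : ℝ => B (t, r) := by
    have := hBs.continuous; fun_prop
  refine ((hc.tendsto 0).mono_left nhdsWithin_le_nhds).congr' ?_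
  filter_upwards [self_mem_nhdsWithin] with r hr
  have hr0 : r ≠ 0 := ne_of_gt hr
  have hi : ∀ (f : (ℝ × Space) × ℝ → ℝ), Continuous f →
      Integrable (fun w : USphere => f ((t, (w : Space)), r)) sphereMeasure := fun f hf =>
    continuous_integrable_sphere (by fun_prop)
  have h1 : sphereMomentum φ μ (t, -r) =
      ∫ w : USphere, stress (φ ((t, -(w : Space)), -r)) 0 μ ∂sphereMeasure :=
    (integral_sphere_neg fun w => stress (φ ((t, w), -r)) 0 μ).symm
  have h2 : ∀ w : USphere, stress (φ ((t, -(w : Space)), -r)) 0 μ =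
      stress (φ ((t, (w : Space)), r)) 0 μ - r ^ 2 * D ((t, (w : Space)), r) := fun w =>
    stress_neg_add_mul (h.eq_neg_add ht (norm_usphere w) r) 0 μ
  rw [h1]
  simp only [h2]
  rw [integral_sub (hi _ hs.continuous) ((hi _ hDs.continuous).const_mul _), integral_const_mul]
  simp only [sphereMomentum, hB]
  field_simp
  ring

/-- The finite part of the flow of momentum into the particle is the Lorentz force of the
regularized field: the Coulomb field itself contributes nothing by parity, and its interference with
the regularized field contributes the force, by the law of Gauss. -/
theorem sphereFlow_zero (h : S.IsNearField F Fext n t₀ δ φ)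
    (hG : ∀ t a b, S.particleField Fext n t a b = -S.particleField Fext n t b a) {t : ℝ}
    (ht : |t - t₀| < δ) (μ : Fin 4) : sphereFlow (S.pos n) φ μ (t, 0) = 0 ∧
      hadamard (hadamard (sphereFlow (S.pos n) φ μ)) (t, 0) = S.charge n *
        ∑ ν, metric ν * event 1 (S.vel n t) ν * S.particleField Fext n t μ ν := by
  have hz := contDiff_deriv (S.smooth n)
  set D : (ℝ × Space) × ℝ → ℝ := fun q => flow (deriv (S.pos n) q.1.1) q.1.2 (fun κ =>
    stressPolar (φ q) (evenPart φ q) κ μ - q.2 ^ 2 * stress (evenPart φ q) κ μ) with hD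
  have hDs : ContDiff ℝ ∞ D := contDiff_flow (by fun_prop) (by fun_prop) fun κ =>
    (contDiff_stressPolar h.contDiff h.contDiff_evenPart κ μ).sub
      ((contDiff_snd.pow 2).mul (contDiff_stress h.contDiff_evenPart κ μ))
  have hs := h.contDiff_flow_stress μ
  set B : ℝ × ℝ → ℝ := fun p =>
    ∫ w : USphere, D ((p.1, (w : Space)), p.2) ∂sphereMeasure with hB
  have hBs : ContDiff ℝ ∞ B := contDiff_integral_sphere hDs
  refine even_part_of_tendsto (h.contDiff_sphereFlow μ) ?_
  have hB0 : B (t, 0) = 2 * (S.charge n *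
        ∑ ν, metric ν * event 1 (S.vel n t) ν * S.particleField Fext n t μ ν) := by
    have h1 : ∀ w : USphere, D ((t, (w : Space)), 0) = 2 * (S.charge n / (4 * Real.pi)) *
        (fluxDensity (S.vel n t) w * flow (S.vel n t) w (fun κ =>
          stressPolar (wedge (event 1 (S.vel n t)) (event 0 w)) (S.particleField Fext n t) κ μ)) := by
      intro w
      simp only [hD, ne_eq, OfNat.ofNat_ne_zero, not_false_eq_true, zero_pow, zero_mul, sub_zero]
      rw [← flow_mul, ← flow_mul]
      congr 1
      ext κ
      rw [stressPolar_mul_left (c := S.charge n / (4 * Real.pi) * fluxDensity (S.vel n t) w)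
          (fun a b => h.coulomb t w ht (norm_usphere w) a b),
        stressPolar_mul_right (c := 2) (fun a b => h.evenPart_zero ht (norm_usphere w) a b)]
      ring
    simp only [hB, h1]
    rw [integral_const_mul, integral_flow_stressPolar (v := S.vel n t) (S.speed_lt_one n t) (hG t)]
    have := Real.pi_ne_zero
    field_simp
  rw [← hB0]
  have hc : Continuous fun r : ℝ => B (t, r) := by
    have := hBs.continuous; fun_prop
  refine ((hc.tendsto 0).mono_left nhdsWithin_le_nhds).congr' ?_
  filter_upwards [self_mem_nhdsWithin] with r hr
  have hr0 : r ≠ 0 := ne_of_gt hr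
  have hi : ∀ (f : (ℝ × Space) × ℝ → ℝ), Continuous f →
      Integrable (fun w : USphere => f ((t, (w : Space)), r)) sphereMeasure := fun f hf =>
    continuous_integrable_sphere (by fun_prop)
  have h1 : sphereFlow (S.pos n) φ μ (t, -r) = ∫ w : USphere, flow (deriv (S.pos n) t)
      (-(w : Space)) (fun κ => stress (φ ((t, -(w : Space)), -r)) κ μ) ∂sphereMeasure :=
    (integral_sphere_neg fun w =>
      flow (deriv (S.pos n) t) w (fun κ => stress (φ ((t, w), -r)) κ μ)).symm
  have h2 : ∀ w : USphere, flow (deriv (S.pos n) t) (-(w : Space))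
      (fun κ => stress (φ ((t, -(w : Space)), -r)) κ μ) =
      r ^ 2 * D ((t, (w : Space)), r) -
        flow (deriv (S.pos n) t) w (fun κ => stress (φ ((t, (w : Space)), r)) κ μ) := fun w => by
    simp only [stress_neg_add_mul (h.eq_neg_add ht (norm_usphere w) r)]
    rw [flow_neg_left, flow_sub, flow_mul]
    simp only [hD]
    ring
  rw [h1]
  simp only [h2]
  rw [integral_sub ((hi _ hDs.continuous).const_mul _) (hi _ hs.continuous), integral_const_mul]
  simp only [sphereFlow, hB]
  field_simp
  ring

end IsNearField

theorem selfField_swap (n : Fin N) (t : ℝ) (μ ν : Fin 4) :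
    S.selfField n t ν μ = -S.selfField n t μ ν := by
  simp only [selfField, wedge_swap _ _ μ ν]; ring

theorem IsRegularField.particleField_antisymm {F : TensorField} {Fext : Fin N → TensorField}
    (hreg : S.IsRegularField F Fext) (hF : ∀ p μ ν, F p μ ν = -F p ν μ) (n : Fin N) (t : ℝ)
    (μ ν : Fin 4) : S.particleField (Fext n) n t μ ν = -S.particleField (Fext n) n t ν μ := by
  rw [particleField, particleField, IsRegularField.antisymm S hreg hF n t μ ν, selfField_swap n t ν μ]
  ring

end ParticleSystem

/-! ### Balance of momentum on small spheres -/

/-- The partial derivative with respect to the first, real, variable. -/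
def firstD {Z : Type} [NormedAddCommGroup Z] [NormedSpace ℝ Z] (f : ℝ × Z → ℝ) (p : ℝ × Z) : ℝ :=
  fderiv ℝ f p (1, 0)

theorem hasDerivAt_firstD {Z : Type} [NormedAddCommGroup Z] [NormedSpace ℝ Z] {f : ℝ × Z → ℝ}
    (hf : ContDiff ℝ ∞ f) (s : ℝ) (z : Z) :
    HasDerivAt (fun s => f (s, z)) (firstD f (s, z)) s := by
  have h := (hf.differentiable (by simp) (s, z)).hasFDerivAt.comp_hasDerivAt s
    ((hasDerivAt_id s).prodMk (hasDerivAt_const s z))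
  exact h

theorem contDiff_firstD {Z : Type} [NormedAddCommGroup Z] [NormedSpace ℝ Z] {f : ℝ × Z → ℝ}
    (hf : ContDiff ℝ ∞ f) : ContDiff ℝ ∞ (firstD f) :=
  (hf.fderiv_right (m := ∞) (by simp)).clm_apply contDiff_const

/-- Differentiation under the integral sign. -/
theorem hasDerivAt_integral_firstD {Z Y : Type} [NormedAddCommGroup Z] [NormedSpace ℝ Z]
    [TopologicalSpace Y] [SecondCountableTopology Y] [MeasurableSpace Y] [OpensMeasurableSpace Y]
    {μ : Measure Y} [IsFiniteMeasure μ] {ι : Y → Z} {A : Set Z} (hι : Continuous ι)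
    (hA : IsCompact A) (hιA : ∀ᵐ y ∂μ, ι y ∈ A) {f : ℝ × Z → ℝ} (hf : ContDiff ℝ ∞ f) (s : ℝ) :
    HasDerivAt (fun s => ∫ y, f (s, ι y) ∂μ) (∫ y, firstD f (s, ι y) ∂μ) s := by
  have h1 := hasFDerivAt_integral_comp hι hA hιA (hf.of_le (by exact_mod_cast le_top)) s
  have hc : Continuous fun p : ℝ × Z => (fderiv ℝ f p).comp (ContinuousLinearMap.inl ℝ ℝ Z) :=
    (hf.continuous_fderiv (by simp)).clm_comp continuous_const
  obtain ⟨C, hC⟩ := exists_local_bound_of_continuous hA hc s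
  have hi : Integrable (fun y => (fderiv ℝ f (s, ι y)).comp (ContinuousLinearMap.inl ℝ ℝ Z)) μ := by
    refine Integrable.of_bound
      (hc.comp (continuous_const.prodMk hι)).aestronglyMeasurable C ?_
    filter_upwards [hιA] with y hy using hC s (Metric.mem_closedBall_self zero_le_one) _ hy
  have h2 := h1.hasDerivAt
  rw [ContinuousLinearMap.integral_apply hi] at h2
  exact h2

/-- Functions of the norm are smooth if they are constant near the origin. -/
theorem contDiff_comp_norm {η : ℝ → ℝ} (hη : ContDiff ℝ ∞ η) {c : ℝ}
    (h0 : ∀ᶠ r in 𝓝 0, η r = c) : ContDiff ℝ ∞ fun y : Space => η ‖y‖ := by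
  refine contDiff_iff_contDiffAt.2 fun y => ?_
  by_cases hy : y = 0
  · have : (fun y : Space => η ‖y‖) =ᶠ[𝓝 y] fun _ => c := by
      have hn : Tendsto (fun y : Space => ‖y‖) (𝓝 y) (𝓝 0) := by
        rw [hy]
        simpa using (continuous_norm (E := Space)).tendsto 0
      exact hn.eventually h0
    exact contDiffAt_const.congr_of_eventuallyEq this
  · exact hη.contDiffAt.comp y (contDiffAt_norm ℝ hy)

theorem hasFDerivAt_comp_norm {η : ℝ → ℝ} (hη : ContDiff ℝ ∞ η) {y : Space} (hy : y ≠ 0) :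
    HasFDerivAt (fun y : Space => η ‖y‖) ((deriv η ‖y‖ / ‖y‖) • innerSL ℝ y) y := by
  have h1 : HasStrictFDerivAt (fun y : Space => ‖y‖ ^ 2) (2 • innerSL ℝ y) y :=
    hasStrictFDerivAt_norm_sq y
  have hn : ‖y‖ ^ 2 ≠ 0 := pow_ne_zero 2 (norm_ne_zero_iff.2 hy)
  have h2 : HasFDerivAt (fun y : Space => Real.sqrt (‖y‖ ^ 2))
      ((1 / (2 * Real.sqrt (‖y‖ ^ 2))) • (2 • innerSL ℝ y)) y := h1.hasFDerivAt.sqrt hn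
  simp only [Real.sqrt_sq (norm_nonneg _)] at h2
  have h3 := (hasDerivAt_of_contDiff hη ‖y‖).comp_hasFDerivAt y h2
  refine h3.congr_fderiv ?_
  ext x
  have := norm_ne_zero_iff.2 hy
  simp
  field_simp

theorem clm_apply_event (L : Event →L[ℝ] ℝ) (a : ℝ) (v : Space) :
    L (event a v) = a * L (Pi.single 0 1) + ∑ i : Fin 3, v i * L (Pi.single i.succ 1) := by
  have h : event a v = ∑ κ, event a v κ • (Pi.single κ 1 : Event) := by
    ext κ; simp [Finset.sum_apply, Pi.single_apply]
  rw [h, map_sum, Fin.sum_univ_succ]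
  simp only [map_smul, smul_eq_mul, event_zero, event_succ]

theorem flow_smul (v w : Space) (c : ℝ) (T : Fin 4 → ℝ) :
    flow v (c • w) T = c * flow v w T := by
  simp only [flow, Finset.mul_sum, PiLp.smul_apply, smul_eq_mul, mul_assoc]

namespace ParticleSystem

variable {N : ℕ} {S : ParticleSystem N} {F : TensorField}

theorem contDiffOn_stress_component (hs : ContDiffOn ℝ ∞ F S.offWorldLines) (κ μ : Fin 4) :
    ContDiffOn ℝ ∞ (fun p => stress (F p) κ μ) S.offWorldLines :=
  contDiffOn_stress (fun a b => contDiffOn_component hs a b) κ μ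

/-- The rate of change of the density of momentum at the point `z t + y`, which moves with the
particle: the divergence of the current relative to the particle. -/
def comovingRate (S : ParticleSystem N) (F : TensorField) (n : Fin N) (μ : Fin 4) (t : ℝ)
    (y : Space) : ℝ :=
  ∑ i : Fin 3, (S.vel n t i * partialD i.succ (fun p => stress (F p) 0 μ)
      (event t (S.pos n t + y)) -
    partialD i.succ (fun p => stress (F p) i.succ μ) (event t (S.pos n t + y)))

/-- By local conservation, the density of momentum at a point moving with the particle changes by the
divergence of the relative current. -/
theorem hasDerivAt_comoving (hF : S.IsMaxwellField F) (hs : ContDiffOn ℝ ∞ F S.offWorldLines)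
    (n : Fin N) (μ : Fin 4) {t : ℝ} {y : Space} (hp : event t (S.pos n t + y) ∈ S.offWorldLines) :
    HasDerivAt (fun s => stress (F (event s (S.pos n s + y))) 0 μ) (S.comovingRate F n μ t y) t := by
  have h1 : HasDerivAt (fun s => event s (S.pos n s + y)) (event 1 (S.vel n t)) t :=
    hasDerivAt_event (hasDerivAt_id t) ((hasDerivAt_of_contDiff (S.smooth n) t).add_const y)
  have h2 := ((contDiffOn_stress_component hs 0 μ).contDiffAt
    (S.isOpen_offWorldLines.mem_nhds hp)).differentiableAt (by simp)
  have h3 := h2.hasFDerivAt.comp_hasDerivAt t h1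
  have h4 : HasDerivAt (fun s => stress (F (event s (S.pos n s + y))) 0 μ) _ t := h3
  refine h4.congr_deriv ?_
  have h5 := hF.sum_partialD_stress hs hp μ
  rw [clm_apply_event, comovingRate, Finset.sum_sub_distrib]
  rw [Fin.sum_univ_succ] at h5
  simp only [partialD] at h5 ⊢
  linarith

/-- The component `i` of the current of momentum relative to the particle. -/
def relativeCurrent (S : ParticleSystem N) (F : TensorField) (n : Fin N) (μ : Fin 4) (t : ℝ)
    (i : Fin 3) (y : Space) : ℝ :=
  S.vel n t i * stress (F (event t (S.pos n t + y))) 0 μ -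
    stress (F (event t (S.pos n t + y))) i.succ μ

theorem contDiffAt_relativeCurrent (hs : ContDiffOn ℝ ∞ F S.offWorldLines) (n : Fin N) (μ : Fin 4)
    {t : ℝ} (i : Fin 3) {y : Space} (hp : event t (S.pos n t + y) ∈ S.offWorldLines) :
    ContDiffAt ℝ ∞ (S.relativeCurrent F n μ t i) y := by
  have he : ContDiff ℝ ∞ fun y => event t (S.pos n t + y) :=
    eventCLM.contDiff.comp (by fun_prop : ContDiff ℝ ∞ fun y : Space => (t, S.pos n t + y))
  have h : ∀ κ, ContDiffAt ℝ ∞ (fun y => stress (F (event t (S.pos n t + y))) κ μ) y := fun κ =>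
    ContDiffAt.comp (g := fun p => stress (F p) κ μ) y ((contDiffOn_stress_component hs κ μ).contDiffAt
      (S.isOpen_offWorldLines.mem_nhds hp)) he.contDiffAt
  exact (contDiffAt_const.mul (h 0)).sub (h i.succ)

theorem sum_fderiv_relativeCurrent (hs : ContDiffOn ℝ ∞ F S.offWorldLines) (n : Fin N) (μ : Fin 4)
    {t : ℝ} {y : Space} (hp : event t (S.pos n t + y) ∈ S.offWorldLines) :
    ∑ i, fderiv ℝ (S.relativeCurrent F n μ t i) y (EuclideanSpace.single i 1) =
      S.comovingRate F n μ t y := by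
  have he : ∀ i : Fin 3, HasDerivAt (fun ε : ℝ => event t (S.pos n t + (y + ε • EuclideanSpace.single i 1)))
      (Pi.single i.succ 1 : Event) 0 := fun i => by
    have h1 : HasDerivAt (fun ε : ℝ => S.pos n t + (y + ε • EuclideanSpace.single i (1 : ℝ)))
        (EuclideanSpace.single i (1 : ℝ)) 0 := by
      have := (((hasDerivAt_id (0 : ℝ)).smul_const
        (EuclideanSpace.single i (1 : ℝ))).const_add y).const_add (S.pos n t)
      simpa using this
    refine (hasDerivAt_event (hasDerivAt_const (0 : ℝ) t) h1).congr_deriv ?_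
    ext κ
    refine Fin.cases ?_ (fun j => ?_) κ
    · simp [event_zero, (Fin.succ_ne_zero i).symm]
    · simp [event_succ, Pi.single_apply]
  refine Finset.sum_congr rfl fun i _ => ?_
  have hT : ∀ κ, HasDerivAt
      (fun ε : ℝ => stress (F (event t (S.pos n t + (y + ε • EuclideanSpace.single i 1)))) κ μ)
      (partialD i.succ (fun p => stress (F p) κ μ) (event t (S.pos n t + y))) 0 := fun κ => by
    have h2 := ((contDiffOn_stress_component hs κ μ).contDiffAt
      (S.isOpen_offWorldLines.mem_nhds hp)).differentiableAt (by simp)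
    have h3 : HasFDerivAt (fun p => stress (F p) κ μ)
        (fderiv ℝ (fun p => stress (F p) κ μ) (event t (S.pos n t + y)))
        (event t (S.pos n t + (y + (0 : ℝ) • EuclideanSpace.single i 1))) := by
      simpa using h2.hasFDerivAt
    have h4 := h3.comp_hasDerivAt 0 (he i)
    exact h4
  have h5 := ((hT 0).const_mul (S.vel n t i)).sub (hT i.succ)
  have h6 := ((contDiffAt_relativeCurrent hs n μ i hp).differentiableAt (by simp)).hasFDerivAt
  have h7 : HasFDerivAt (S.relativeCurrent F n μ t i) (fderiv ℝ (S.relativeCurrent F n μ t i) y)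
      (y + (0 : ℝ) • EuclideanSpace.single i 1) := by simpa using h6
  have h8 : HasDerivAt (fun ε : ℝ => y + ε • EuclideanSpace.single i (1 : ℝ))
      (EuclideanSpace.single i (1 : ℝ)) 0 := by
    have := ((hasDerivAt_id (0 : ℝ)).smul_const (EuclideanSpace.single i (1 : ℝ))).const_add y
    simpa using this
  have h9 := h7.comp_hasDerivAt 0 h8
  exact HasDerivAt.unique h9 h5

theorem flow_eq_sum_relativeCurrent (n : Fin N) (μ : Fin 4) (t : ℝ) (w y : Space) :
    flow (S.vel n t) w (fun κ => stress (F (event t (S.pos n t + y))) κ μ) =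
      ∑ i, w i * S.relativeCurrent F n μ t i y := rfl

/-- The balance of momentum, tested with a radial function that is supported in a shell around the
particle. -/
theorem integral_comovingRate (hs : ContDiffOn ℝ ∞ F S.offWorldLines) (n : Fin N) (μ : Fin 4)
    {t δ : ℝ} (hoff : ∀ y : Space, y ≠ 0 → ‖y‖ < δ → event t (S.pos n t + y) ∈ S.offWorldLines)
    {η : ℝ → ℝ} (hη : ContDiff ℝ ∞ η) (hsupp : tsupport η ⊆ Ioo 0 δ) :
    ∫ y, S.comovingRate F n μ t y * η ‖y‖ = -∫ y, deriv η ‖y‖ / ‖y‖ *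
      flow (S.vel n t) y (fun κ => stress (F (event t (S.pos n t + y))) κ μ) ∧
    Integrable (fun y => S.comovingRate F n μ t y * η ‖y‖) ∧
    Integrable (fun y => deriv η ‖y‖ / ‖y‖ *
      flow (S.vel n t) y (fun κ => stress (F (event t (S.pos n t + y))) κ μ)) := by
  set Ω : Set Space := {y | 0 < ‖y‖ ∧ ‖y‖ < δ} with hΩ
  have hΩo : IsOpen Ω := (isOpen_lt continuous_const continuous_norm).inter
    (isOpen_lt continuous_norm continuous_const)
  have hmem : ∀ y ∈ Ω, event t (S.pos n t + y) ∈ S.offWorldLines := fun y hy =>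
    hoff y (norm_pos_iff.1 hy.1) hy.2
  have h0 : ∀ᶠ r in 𝓝 0, η r = 0 := by
    have : (0 : ℝ) ∉ tsupport η := fun h => lt_irrefl _ (hsupp h).1
    exact notMem_tsupport_iff_eventuallyEq.1 this
  set ψ : Space → ℝ := fun y => η ‖y‖ with hψ
  have hψs : ContDiff ℝ ∞ ψ := contDiff_comp_norm hη h0
  have htsub : ∀ y, y ∈ tsupport ψ → ‖y‖ ∈ tsupport η := fun y hy => by
    by_contra hn
    have := notMem_tsupport_iff_eventuallyEq.1 hn
    exact (notMem_tsupport_iff_eventuallyEq.2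
      ((continuous_norm (E := Space)).continuousAt.eventually this)) hy
  have hψsupp : tsupport ψ ⊆ Ω := fun y hy => hsupp (htsub y hy)
  have hψc : HasCompactSupport ψ := by
    refine HasCompactSupport.of_support_subset_isCompact (isCompact_closedBall (0 : Space) δ) ?_
    intro y hy
    exact mem_closedBall_zero_iff.2 (hψsupp (subset_tsupport _ hy)).2.le
  have hYs : ∀ i, ContDiffOn ℝ ∞ (S.relativeCurrent F n μ t i) Ω := fun i y hy =>
    (contDiffAt_relativeCurrent hs n μ i (hmem y hy)).contDiffWithinAt
  set g : Fin 3 → Space → ℝ := fun i y => S.relativeCurrent F n μ t i y * ψ y with hg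
  have hgs : ∀ i, ContDiff ℝ ∞ (g i) := fun i =>
    contDiff_mul_of_tsupport_subset hΩo (hYs i) hψs hψsupp
  have hgc : ∀ i, HasCompactSupport (g i) := fun i => hψc.mul_left
  have hzero : ∀ i, ∫ y, fderiv ℝ (g i) y (EuclideanSpace.single i 1) = 0 := fun i => by
    have hg1 : ContDiff ℝ 1 (g i) := (hgs i).of_le (by exact_mod_cast le_top)
    obtain ⟨C, hC⟩ := hg1.lipschitzWith_of_hasCompactSupport (hgc i) one_ne_zero
    have := integral_lineDeriv_eq_zero volume hC (hgc i) (EuclideanSpace.single i (1 : ℝ))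
    rw [← this]
    refine integral_congr_ae (.of_forall fun y => ?_)
    exact (((hgs i).differentiable (by simp)) y).lineDeriv_eq_fderiv.symm
  have hgi : ∀ i, Integrable fun y => fderiv ℝ (g i) y (EuclideanSpace.single i 1) := fun i => by
    have hc1 : Continuous fun y => fderiv ℝ (g i) y (EuclideanSpace.single i (1 : ℝ)) :=
      ((hgs i).continuous_fderiv (by simp)).clm_apply continuous_const
    refine hc1.integrable_of_hasCompactSupport ?_
    have := (hgc i).fderiv (𝕜 := ℝ)
    exact this.comp_left (g := fun L : Space →L[ℝ] ℝ => L (EuclideanSpace.single i (1 : ℝ))) (by simp)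
  have hpt : ∀ y, ∑ i, fderiv ℝ (g i) y (EuclideanSpace.single i 1) =
      S.comovingRate F n μ t y * η ‖y‖ + deriv η ‖y‖ / ‖y‖ *
      flow (S.vel n t) y (fun κ => stress (F (event t (S.pos n t + y))) κ μ) := fun y => by
    by_cases hy : y ∈ Ω
    · have hy0 : y ≠ 0 := norm_pos_iff.1 hy.1
      have hd : ∀ i, fderiv ℝ (g i) y (EuclideanSpace.single i 1) =
          fderiv ℝ (S.relativeCurrent F n μ t i) y (EuclideanSpace.single i 1) * η ‖y‖ +
            deriv η ‖y‖ / ‖y‖ * (y i * S.relativeCurrent F n μ t i y) := fun i => by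
        have h1 := ((contDiffAt_relativeCurrent hs n μ i (hmem y hy)).differentiableAt
          (by simp)).hasFDerivAt.mul (hasFDerivAt_comp_norm hη hy0)
        have h2 : HasFDerivAt (g i) _ y := h1
        rw [h2.fderiv]
        simp [EuclideanSpace.inner_single_right]
        ring
      simp only [hd, Finset.sum_add_distrib, ← Finset.sum_mul, ← Finset.mul_sum]
      rw [sum_fderiv_relativeCurrent hs n μ (hmem y hy), flow_eq_sum_relativeCurrent]
    · have hn : y ∉ tsupport ψ := fun h => hy (hψsupp h)
      have hz : ∀ i, fderiv ℝ (g i) y = 0 := fun i => by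
        have : g i =ᶠ[𝓝 y] fun _ => 0 := by
          filter_upwards [notMem_tsupport_iff_eventuallyEq.1 hn] with x hx
          simp only [hg, hx, Pi.zero_apply, mul_zero]
        rw [this.fderiv_eq]; simp
      have hn' : ‖y‖ ∉ tsupport η := fun h => hy (hsupp h)
      have e1 : η ‖y‖ = 0 := image_eq_zero_of_notMem_tsupport hn'
      have e2 : deriv η ‖y‖ = 0 := by
        have := notMem_tsupport_iff_eventuallyEq.1 hn'
        rw [this.deriv_eq]; simp
      simp [hz, e1, e2]
  have hA : Integrable (fun y => S.comovingRate F n μ t y * η ‖y‖) := by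
    have hcont : ContDiffOn ℝ ∞ (S.comovingRate F n μ t) Ω := by
      have he : ContDiff ℝ ∞ fun y => event t (S.pos n t + y) :=
        eventCLM.contDiff.comp (by fun_prop : ContDiff ℝ ∞ fun y : Space => (t, S.pos n t + y))
      have h : ∀ (i : Fin 3) κ, ContDiffOn ℝ ∞ (fun y => partialD i.succ (fun p => stress (F p) κ μ)
          (event t (S.pos n t + y))) Ω := fun i κ =>
        (contDiffOn_partialD S.isOpen_offWorldLines (contDiffOn_stress_component hs κ μ) i.succ).comp
          he.contDiffOn hmem
      exact ContDiffOn.sum fun i _ => (contDiffOn_const.mul (h i 0)).sub (h i i.succ)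
    exact (contDiff_mul_of_tsupport_subset hΩo hcont hψs
      hψsupp).continuous.integrable_of_hasCompactSupport hψc.mul_left
  have hsum : Integrable fun y => ∑ i, fderiv ℝ (g i) y (EuclideanSpace.single i 1) :=
    integrable_finsetSum _ fun i _ => hgi i
  have hB : Integrable (fun y => deriv η ‖y‖ / ‖y‖ *
      flow (S.vel n t) y (fun κ => stress (F (event t (S.pos n t + y))) κ μ)) := by
    refine (hsum.sub hA).congr (.of_forall fun y => ?_)
    simp only [Pi.sub_apply, hpt]; ring
  refine ⟨?_, hA, hB⟩
  have h1 : ∫ y, ∑ i, fderiv ℝ (g i) y (EuclideanSpace.single i 1) = 0 := by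
    rw [integral_finsetSum _ fun i _ => hgi i]
    exact Finset.sum_eq_zero fun i _ => hzero i
  simp only [hpt] at h1
  rw [integral_add hA hB] at h1
  linarith

end ParticleSystem

/-! ### The momentum in a punctured neighbourhood of a particle -/

/-- A smooth cutoff: `1` up to the radius `ρ / 2`, and `0` from the radius `3 * ρ / 4` on. -/
def cutoff (ρ r : ℝ) : ℝ := Real.smoothTransition (3 - 4 * r / ρ)

theorem contDiff_cutoff (ρ : ℝ) : ContDiff ℝ ∞ (cutoff ρ) :=
  Real.smoothTransition.contDiff.comp (by fun_prop)

theorem cutoff_of_le {ρ r : ℝ} (hρ : 0 < ρ) (hr : r ≤ ρ / 2) : cutoff ρ r = 1 := by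
  refine Real.smoothTransition.one_of_one_le ?_
  have : 4 * r / ρ ≤ 2 := by rw [div_le_iff₀ hρ]; linarith
  linarith

theorem cutoff_of_ge {ρ r : ℝ} (hρ : 0 < ρ) (hr : 3 * ρ / 4 ≤ r) : cutoff ρ r = 0 := by
  refine Real.smoothTransition.zero_of_nonpos ?_
  have : 3 ≤ 4 * r / ρ := by rw [le_div_iff₀ hρ]; linarith
  linarith

theorem deriv_cutoff_of_lt {ρ r : ℝ} (hρ : 0 < ρ) (hr : r < ρ / 2) : deriv (cutoff ρ) r = 0 := by
  have : cutoff ρ =ᶠ[𝓝 r] fun _ => 1 := by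
    filter_upwards [Iio_mem_nhds hr] with s hs using cutoff_of_le hρ (le_of_lt hs)
  rw [this.deriv_eq]; simp

theorem deriv_cutoff_of_gt {ρ r : ℝ} (hρ : 0 < ρ) (hr : 3 * ρ / 4 < r) :
    deriv (cutoff ρ) r = 0 := by
  have : cutoff ρ =ᶠ[𝓝 r] fun _ => 0 := by
    filter_upwards [Ioi_mem_nhds hr] with s hs using cutoff_of_ge hρ (le_of_lt hs)
  rw [this.deriv_eq]; simp

theorem continuous_deriv_cutoff (ρ : ℝ) : Continuous (deriv (cutoff ρ)) :=
  (contDiff_deriv (contDiff_cutoff ρ)).continuous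

theorem continuous_deriv_cutoff_div {ρ : ℝ} (hρ : 0 < ρ) :
    Continuous fun r => deriv (cutoff ρ) r / r := by
  rw [continuous_iff_continuousAt]
  intro r
  by_cases hr : r = 0
  · have : (fun r => deriv (cutoff ρ) r / r) =ᶠ[𝓝 r] fun _ => 0 := by
      filter_upwards [Iio_mem_nhds (show r < ρ / 2 by rw [hr]; positivity)] with s hs
      rw [deriv_cutoff_of_lt hρ hs, zero_div]
    exact continuousAt_const.congr this.symm
  · exact (continuous_deriv_cutoff ρ).continuousAt.div continuousAt_id hr

/-- The constant `∫ (dη/dr) / r`, the finite part of `∫ η / r ^ 2`. -/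
def cutoffConst (ρ : ℝ) : ℝ := ∫ r in (0 : ℝ)..ρ, deriv (cutoff ρ) r / r

/-- The finite part of `∫ η / r ^ 2`, by integration by parts. -/
theorem integral_cutoff_div_sq {ρ r : ℝ} (hρ : 0 < ρ) (hr : 0 < r) (hr' : r < ρ / 2) :
    ∫ s in r..ρ, cutoff ρ s / s ^ 2 = 1 / r + cutoffConst ρ := by
  have hle : r ≤ ρ := by linarith
  have hpos : ∀ x ∈ uIcc r ρ, x ≠ 0 := fun x hx => by
    rw [uIcc_of_le hle] at hx; exact (hr.trans_le hx.1).ne'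
  have hd := continuous_deriv_cutoff_div hρ
  have h1 := intervalIntegral.integral_mul_deriv_eq_deriv_mul (a := r) (b := ρ)
    (u := cutoff ρ) (v := fun x => -x⁻¹) (u' := deriv (cutoff ρ)) (v' := fun x => (x ^ 2)⁻¹)
    (fun x _ => hasDerivAt_of_contDiff (contDiff_cutoff ρ) x)
    (fun x hx => by
      have h : HasDerivAt (fun x : ℝ => -x⁻¹) (-(-(x ^ 2)⁻¹)) x := (hasDerivAt_inv (hpos x hx)).neg
      rwa [neg_neg] at h)
    ((continuous_deriv_cutoff ρ).intervalIntegrable _ _)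
    (ContinuousOn.intervalIntegrable fun x hx =>
      ((continuousAt_id.pow 2).inv₀ (pow_ne_zero 2 (hpos x hx))).continuousWithinAt)
  have h2 : ∫ s in (0 : ℝ)..r, deriv (cutoff ρ) s / s = 0 := by
    refine (intervalIntegral.integral_congr fun x hx => ?_).trans intervalIntegral.integral_zero
    rw [uIcc_of_le hr.le] at hx
    simp only [deriv_cutoff_of_lt hρ (hx.2.trans_lt hr'), zero_div]
  have h3 := intervalIntegral.integral_add_adjacent_intervals
    (hd.intervalIntegrable (μ := volume) 0 r) (hd.intervalIntegrable r ρ)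
  rw [h2, zero_add] at h3
  simp only [div_eq_mul_inv] at h3 ⊢
  rw [h1, cutoff_of_le hρ hr'.le, cutoff_of_ge hρ (by linarith), cutoffConst]
  simp only [mul_neg, intervalIntegral.integral_neg, div_eq_mul_inv, ← h3]
  ring

namespace ParticleSystem

variable {N : ℕ} {S : ParticleSystem N}

namespace IsNearField

variable {F Fext : TensorField} {n : Fin N} {t₀ δ : ℝ} {φ : (ℝ × Space) × ℝ → Fin 4 → Fin 4 → ℝ}

theorem mem_offWorldLines (h : S.IsNearField F Fext n t₀ δ φ) {t : ℝ} (ht : |t - t₀| < δ)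
    {y : Space} (hy : y ≠ 0) (hyδ : ‖y‖ < δ) : event t (S.pos n t + y) ∈ S.offWorldLines := by
  have hn := norm_pos_iff.2 hy
  have := h.mem t ‖y‖ (‖y‖⁻¹ • y) ht hn hyδ (by rw [norm_smul, norm_inv, norm_norm]; field_simp)
  rwa [smul_smul, mul_inv_cancel₀ hn.ne', one_smul] at this

theorem stress_eq (h : S.IsNearField F Fext n t₀ δ φ) {t : ℝ} (ht : |t - t₀| < δ) {r : ℝ}
    (hr : 0 < r) (hr' : r < δ) {w : Space} (hw : ‖w‖ = 1) (κ μ : Fin 4) :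
    stress (F (event t (S.pos n t + r • w))) κ μ = stress (φ ((t, w), r)) κ μ / r ^ 4 := by
  rw [stress_div (h.eq t r w ht hr hr' hw)]
  congr 1
  ring

theorem integral_flow_eq (h : S.IsNearField F Fext n t₀ δ φ) {t : ℝ} (ht : |t - t₀| < δ) {r : ℝ}
    (hr : 0 < r) (hr' : r < δ) (μ : Fin 4) :
    ∫ w : USphere, flow (S.vel n t) w
      (fun κ => stress (F (event t (S.pos n t + r • (w : Space)))) κ μ) ∂sphereMeasure =
      sphereFlow (S.pos n) φ μ (t, r) / r ^ 4 := by
  rw [sphereFlow, ← integral_div]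
  refine integral_congr_ae (.of_forall fun w => ?_)
  simp only [h.stress_eq ht hr hr' (norm_usphere w), div_eq_inv_mul]
  exact flow_mul _ _ _ _

theorem integral_stress_eq (h : S.IsNearField F Fext n t₀ δ φ) {t : ℝ} (ht : |t - t₀| < δ) {r : ℝ}
    (hr : 0 < r) (hr' : r < δ) (μ : Fin 4) :
    ∫ w : USphere, stress (F (event t (S.pos n t + r • (w : Space)))) 0 μ ∂sphereMeasure =
      sphereMomentum φ μ (t, r) / r ^ 4 := by
  rw [sphereMomentum, ← integral_div]
  exact integral_congr_ae (.of_forall fun w => h.stress_eq ht hr hr' (norm_usphere w) 0 μ)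

theorem integral_comovingRate_eq (h : S.IsNearField F Fext n t₀ δ φ) (hF : S.IsMaxwellField F)
    (hs : ContDiffOn ℝ ∞ F S.offWorldLines) {t : ℝ} (ht : |t - t₀| < δ) {r : ℝ}
    (hr : 0 < r) (hr' : r < δ) (μ : Fin 4) :
    ∫ w : USphere, S.comovingRate F n μ t (r • (w : Space)) ∂sphereMeasure =
      firstD (sphereMomentum φ μ) (t, r) / r ^ 4 := by
  set f : ℝ × Space → ℝ := fun q => stress (φ (q, r)) 0 μ with hf
  have hfs : ContDiff ℝ ∞ f := by
    have := contDiff_stress h.contDiff 0 μ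
    exact this.comp (g := fun q => stress (φ q) 0 μ) (by fun_prop : ContDiff ℝ ∞ fun q => (q, r))
  have h1 := hasDerivAt_integral_firstD (μ := sphereMeasure) (ι := fun w : USphere => (w : Space))
    continuous_subtype_val (isCompact_sphere 0 1) (.of_forall fun w => w.2) hfs t
  have h2 := (hasDerivAt_firstD (h.contDiff_sphereMomentum μ) t r).unique h1
  rw [h2, ← integral_div]
  refine integral_congr_ae (.of_forall fun w => ?_)
  have hp := h.mem t r w ht hr hr' (norm_usphere w)
  have h3 := hasDerivAt_comoving hF hs n μ hp
  have h4 := (hasDerivAt_firstD hfs t (w : Space)).div_const (r ^ 4)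
  refine h3.unique (h4.congr_of_eventuallyEq ?_)
  have ho : ∀ᶠ s in 𝓝 t, |s - t₀| < δ := by
    have : Continuous fun s : ℝ => |s - t₀| := by fun_prop
    exact this.continuousAt.eventually (Iio_mem_nhds ht)
  filter_upwards [ho] with s hs'
  exact h.stress_eq hs' hr hr' (norm_usphere w) 0 μ

/-- The balance of momentum between concentric spheres around the particle. In terms of the true
densities it says that the momentum `K / r ^ 2` per unit of the radius changes by the radial derivative
of the flow `J / r ^ 2`. -/
theorem radial_balance (h : S.IsNearField F Fext n t₀ δ φ) (hF : S.IsMaxwellField F)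
    (hs : ContDiffOn ℝ ∞ F S.offWorldLines) {t : ℝ} (ht : |t - t₀| < δ) {r : ℝ}
    (hr : 0 < r) (hr' : r < δ) (μ : Fin 4) :
    r * lastD (sphereFlow (S.pos n) φ μ) (t, r) - 2 * sphereFlow (S.pos n) φ μ (t, r) =
      r * firstD (sphereMomentum φ μ) (t, r) := by
  set J := sphereFlow (S.pos n) φ μ with hJ
  set K := sphereMomentum φ μ with hK
  have hJs : ContDiff ℝ ∞ J := h.contDiff_sphereFlow μ
  have hKs : ContDiff ℝ ∞ K := h.contDiff_sphereMomentum μ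
  set Q : ℝ → ℝ := fun r => J (t, r) / r ^ 2 with hQ
  set Q' : ℝ → ℝ := fun r => lastD J (t, r) / r ^ 2 - 2 * J (t, r) / r ^ 3 with hQ'
  set k : ℝ → ℝ := fun r => firstD K (t, r) / r ^ 2 with hk
  have hQd : ∀ r, r ≠ 0 → HasDerivAt Q (Q' r) r := fun r hr => by
    have h1 : HasDerivAt (fun r => J (t, r)) (lastD J (t, r)) r :=
      hasDerivAt_lastD (hJs.differentiable (by simp) _)
    refine (h1.div (hasDerivAt_pow 2 r) (pow_ne_zero 2 hr)).congr_deriv ?_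
    simp only [hQ']
    field_simp
    push_cast
    ring
  have hne : ∀ r ∈ Ioo 0 δ, r ≠ 0 := fun r hr => hr.1.ne'
  have hQs : ContDiffOn ℝ ∞ Q (Ioo 0 δ) := by
    have : ContDiff ℝ ∞ fun r : ℝ => J (t, r) := by fun_prop
    exact this.contDiffOn.div (by fun_prop) fun r hr => pow_ne_zero 2 (hne r hr)
  have hQc' : ContinuousOn Q' (Ioo 0 δ) := by
    have h1 : Continuous fun r : ℝ => J (t, r) := by have := hJs.continuous; fun_prop
    have h2 : Continuous fun r : ℝ => lastD J (t, r) := by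
      have := (contDiff_lastD hJs).continuous; fun_prop
    exact (h2.continuousOn.div (by fun_prop) fun r hr => pow_ne_zero 2 (hne r hr)).sub
      ((h1.const_mul 2).continuousOn.div (by fun_prop) fun r hr => pow_ne_zero 3 (hne r hr))
  have hkc : ContinuousOn k (Ioo 0 δ) := by
    have h2 : Continuous fun r : ℝ => firstD K (t, r) := by
      have := (contDiff_firstD hKs).continuous; fun_prop
    exact h2.continuousOn.div (by fun_prop) fun r hr => pow_ne_zero 2 (hne r hr)
  -- the balance holds in the weak sense, tested with functions of the radius
  have hweak : ∀ η : ℝ → ℝ, ContDiff ℝ ∞ η → HasCompactSupport η → tsupport η ⊆ Ioo 0 δ →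
      ∫ r, η r • (k r - Q' r) = 0 := fun η hη hc hsupp => by
    obtain ⟨e1, i1, i2⟩ := integral_comovingRate hs n μ
      (fun y hy hyδ => h.mem_offWorldLines ht hy hyδ) hη hsupp
    have hη0 : ∀ r, r ∉ Ioo 0 δ → η r = 0 := fun r hr =>
      image_eq_zero_of_notMem_tsupport fun h => hr (hsupp h)
    have hη0' : ∀ r, r ∉ Ioo 0 δ → deriv η r = 0 := fun r hr => by
      have := notMem_tsupport_iff_eventuallyEq.1 fun h => hr (hsupp h)
      rw [this.deriv_eq]; simp
    rw [integral_polar i1, integral_polar i2] at e1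
    have e2 : ∫ r in Ioi (0 : ℝ), r ^ 2 * ∫ w : USphere,
        S.comovingRate F n μ t (r • (w : Space)) * η ‖r • (w : Space)‖ ∂sphereMeasure =
        ∫ r, η r * k r := by
      rw [← setIntegral_eq_integral_of_forall_compl_eq_zero (s := Ioi (0 : ℝ))
        (f := fun r => η r * k r) fun r hr => by rw [hη0 r fun h => hr h.1, zero_mul]]
      refine setIntegral_congr_fun measurableSet_Ioi fun r hr => ?_
      have hr0 : 0 < r := hr
      simp only [norm_smul, norm_usphere, Real.norm_eq_abs, abs_of_pos hr0, mul_one]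
      rw [integral_mul_const]
      by_cases hrδ : r < δ
      · rw [h.integral_comovingRate_eq hF hs ht hr0 hrδ, ← hK]
        simp only [hk]
        field_simp
      · rw [hη0 r fun h => hrδ h.2]; ring
    have e3 : ∫ r in Ioi (0 : ℝ), r ^ 2 * ∫ w : USphere,
        deriv η ‖r • (w : Space)‖ / ‖r • (w : Space)‖ * flow (S.vel n t) (r • (w : Space))
          (fun κ => stress (F (event t (S.pos n t + r • (w : Space)))) κ μ) ∂sphereMeasure =
        ∫ r, deriv η r * Q r := by
      rw [← setIntegral_eq_integral_of_forall_compl_eq_zero (s := Ioi (0 : ℝ))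
        (f := fun r => deriv η r * Q r) fun r hr => by rw [hη0' r fun h => hr h.1, zero_mul]]
      refine setIntegral_congr_fun measurableSet_Ioi fun r hr => ?_
      have hr0 : 0 < r := hr
      simp only [norm_smul, norm_usphere, Real.norm_eq_abs, abs_of_pos hr0, mul_one, flow_smul]
      rw [integral_const_mul, integral_const_mul]
      by_cases hrδ : r < δ
      · rw [h.integral_flow_eq ht hr0 hrδ, ← hJ]
        simp only [hQ]
        field_simp
      · rw [hη0' r fun h => hrδ h.2]; ring
    rw [e2, e3] at e1
    have hP : ContDiff ℝ ∞ fun r => Q r * η r :=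
      contDiff_mul_of_tsupport_subset isOpen_Ioo hQs hη hsupp
    have hPd : ∀ r, HasDerivAt (fun r => Q r * η r) (Q' r * η r + Q r * deriv η r) r := fun r => by
      by_cases hr : r ∈ Ioo 0 δ
      · exact (hQd r (hne r hr)).mul (hasDerivAt_of_contDiff hη r)
      · rw [hη0 r hr, hη0' r hr, mul_zero, mul_zero, add_zero]
        have : (fun r => Q r * η r) =ᶠ[𝓝 r] fun _ => 0 := by
          filter_upwards [notMem_tsupport_iff_eventuallyEq.1 fun h => hr (hsupp h)] with s hs
          simp only [hs, Pi.zero_apply, mul_zero]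
        exact (hasDerivAt_const r (0 : ℝ)).congr_of_eventuallyEq this
    have hint : ∀ f : ℝ → ℝ, ContinuousOn f (Ioo 0 δ) → ∀ η : ℝ → ℝ, Continuous η →
        HasCompactSupport η → tsupport η ⊆ Ioo 0 δ → Integrable fun r => η r * f r :=
      fun f hf η hη hc hsupp => by
      refine Continuous.integrable_of_hasCompactSupport ?_ hc.mul_right
      rw [continuous_iff_continuousAt]
      intro r
      by_cases hr : r ∈ Ioo 0 δ
      · exact hη.continuousAt.mul (hf.continuousAt (isOpen_Ioo.mem_nhds hr))
      · have : (fun r => η r * f r) =ᶠ[𝓝 r] fun _ => 0 := by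
          filter_upwards [notMem_tsupport_iff_eventuallyEq.1 fun h => hr (hsupp h)] with s hs
          simp only [hs, Pi.zero_apply, zero_mul]
        exact continuousAt_const.congr this.symm
    have ik := hint k hkc η hη.continuous hc hsupp
    have iQ' := hint Q' hQc' η hη.continuous hc hsupp
    have iQ := hint Q hQs.continuousOn (deriv η) (contDiff_deriv hη).continuous hc.deriv
      ((tsupport_deriv_subset (𝕜 := ℝ)).trans hsupp)
    have e4 : ∫ r, (Q' r * η r + Q r * deriv η r) = 0 := by
      have hPc : HasCompactSupport fun r => Q r * η r := hc.mul_left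
      refine integral_eq_zero_of_hasDerivAt_of_integrable hPd ?_
        (hP.continuous.integrable_of_hasCompactSupport hPc)
      exact ((iQ'.congr (.of_forall fun r => mul_comm _ _)).add
        (iQ.congr (.of_forall fun r => mul_comm _ _)))
    simp only [smul_eq_mul, mul_sub]
    rw [integral_sub ik iQ', e1]
    have e5 : ∫ r, (Q' r * η r + Q r * deriv η r) = (∫ r, η r * Q' r) + ∫ r, deriv η r * Q r := by
      rw [← integral_add iQ' iQ]
      exact integral_congr_ae (.of_forall fun r => by simp only; ring)
    linarith
  have hae := isOpen_Ioo.ae_eq_zero_of_integral_contDiff_smul_eq_zero (μ := volume)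
    (f := fun r => k r - Q' r)
    ((hkc.sub hQc').locallyIntegrableOn measurableSet_Ioo) hweak
  have hz := Measure.eqOn_open_of_ae_eq (μ := volume) (f := fun r => k r - Q' r)
    (g := fun _ => 0) ((ae_restrict_iff' measurableSet_Ioo).2 hae) isOpen_Ioo (hkc.sub hQc')
    continuousOn_const (show r ∈ Ioo 0 δ from ⟨hr, hr'⟩)
  simp only [hk, hQ'] at hz
  field_simp at hz
  linarith

/-- The momentum of the field in the neighbourhood of the particle, weighted with the cutoff: the
finite part of `∫ η K / r ^ 2`. -/
def nearMomentum (φ : (ℝ × Space) × ℝ → Fin 4 → Fin 4 → ℝ) (μ : Fin 4) (ρ t : ℝ) : ℝ :=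
  (∫ r in (0 : ℝ)..ρ, cutoff ρ r * hadamard (hadamard (sphereMomentum φ μ)) (t, r)) +
    cutoffConst ρ * sphereMomentum φ μ (t, 0)

/-- The momentum on spheres has no term of first order. -/
theorem sphereMomentum_eq (h : S.IsNearField F Fext n t₀ δ φ) {t : ℝ} (ht : |t - t₀| < δ) (r : ℝ)
    (μ : Fin 4) : sphereMomentum φ μ (t, r) =
      sphereMomentum φ μ (t, 0) + r ^ 2 * hadamard (hadamard (sphereMomentum φ μ)) (t, r) := by
  have hK := h.contDiff_sphereMomentum μ
  have e1 := hadamard_spec hK t r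
  have e2 := hadamard_spec (contDiff_hadamard hK) t r
  rw [h.hadamard_sphereMomentum_zero ht] at e2
  rw [smul_eq_mul] at e1 e2
  rw [e1, e2]; ring

theorem hasRLim_nearMomentum (h : S.IsNearField F Fext n t₀ δ φ) {t : ℝ} (ht : |t - t₀| < δ)
    (μ : Fin 4) {ρ : ℝ} (hρ : 0 < ρ) :
    HasRLim (fun r => ∫ s in r..ρ, cutoff ρ s * (sphereMomentum φ μ (t, s) / s ^ 2))
      (nearMomentum φ μ ρ t) := by
  set k : ℝ → ℝ := fun r => cutoff ρ r * hadamard (hadamard (sphereMomentum φ μ)) (t, r) with hk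
  have hkc : Continuous k := by
    have h1 := (contDiff_hadamard (contDiff_hadamard (h.contDiff_sphereMomentum μ))).continuous
    have h2 := (contDiff_cutoff ρ).continuous
    fun_prop
  have hd : HasDerivAt (fun r => nearMomentum φ μ ρ t - ∫ s in (0 : ℝ)..r, k s) (-k 0) 0 :=
    (hkc.integral_hasStrictDerivAt 0 0).hasDerivAt.const_sub _
  have hlim := hasRLim_div_add hd.differentiableAt (sphereMomentum φ μ (t, 0))
    (f := fun r => ∫ s in r..ρ, cutoff ρ s * (sphereMomentum φ μ (t, s) / s ^ 2)) ?_
  · simpa using hlim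
  filter_upwards [self_mem_nhdsWithin,
    nhdsWithin_le_nhds (Iio_mem_nhds (show 0 < ρ / 2 by positivity))] with r hr hr'
  have hr0 : 0 < r := hr
  have hr2 : r < ρ / 2 := hr'
  have hle : r ≤ ρ := by linarith
  have hpos : ∀ x ∈ uIcc r ρ, x ≠ 0 := fun x hx => by
    rw [uIcc_of_le hle] at hx; exact (hr0.trans_le hx.1).ne'
  have h1 : ∫ s in r..ρ, cutoff ρ s * (sphereMomentum φ μ (t, s) / s ^ 2) =
      ∫ s in r..ρ, (sphereMomentum φ μ (t, 0) * (cutoff ρ s / s ^ 2) + k s) := by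
    refine intervalIntegral.integral_congr fun s hs => ?_
    have := hpos s hs
    simp only [hk]
    rw [h.sphereMomentum_eq ht s]
    field_simp
  have hi : IntervalIntegrable (fun s => cutoff ρ s / s ^ 2) volume r ρ :=
    ContinuousOn.intervalIntegrable fun x hx => ((contDiff_cutoff ρ).continuous.continuousAt.div
      (continuousAt_id.pow 2) (pow_ne_zero 2 (hpos x hx))).continuousWithinAt
  have h2 := intervalIntegral.integral_add_adjacent_intervals
    (hkc.intervalIntegrable (μ := volume) 0 r) (hkc.intervalIntegrable r ρ)
  rw [h1, intervalIntegral.integral_add (hi.const_mul _) (hkc.intervalIntegrable _ _),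
    intervalIntegral.integral_const_mul, integral_cutoff_div_sq hρ hr0 hr2, nearMomentum]
  have h3 : (∫ r in (0 : ℝ)..ρ, cutoff ρ r * hadamard (hadamard (sphereMomentum φ μ)) (t, r)) =
    ∫ s in (0 : ℝ)..ρ, k s := rfl
  rw [h3, ← h2]
  ring

/-- The rate of change of the weighted momentum near the particle. -/
theorem hasDerivAt_nearMomentum (h : S.IsNearField F Fext n t₀ δ φ) (hF : S.IsMaxwellField F)
    (hs : ContDiffOn ℝ ∞ F S.offWorldLines) {t : ℝ} (ht : |t - t₀| < δ) (μ : Fin 4) {ρ : ℝ}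
    (hρ : 0 < ρ) (hρδ : ρ < δ) (hJ0 : sphereFlow (S.pos n) φ μ (t, 0) = 0) :
    HasDerivAt (nearMomentum φ μ ρ)
      (-hadamard (hadamard (sphereFlow (S.pos n) φ μ)) (t, 0) -
        ∫ r in (0 : ℝ)..ρ, deriv (cutoff ρ) r * (sphereFlow (S.pos n) φ μ (t, r) / r ^ 2)) t := by
  set J := sphereFlow (S.pos n) φ μ with hJ
  set K := sphereMomentum φ μ with hK
  have hJs : ContDiff ℝ ∞ J := h.contDiff_sphereFlow μ
  have hKs : ContDiff ℝ ∞ K := h.contDiff_sphereMomentum μ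
  set k := hadamard (hadamard K) with hk
  set j := hadamard (hadamard J) with hj
  have hJ1 := contDiff_hadamard hJs
  have hks : ContDiff ℝ ∞ k := contDiff_hadamard (contDiff_hadamard hKs)
  have hjs : ContDiff ℝ ∞ j := contDiff_hadamard hJ1
  set J₁ := hadamard J (t, 0) with hJ₁
  -- By the expansions of `J` and `K`, the balance of order `0` relates the coefficient `J₁` to the change
  -- of the Coulomb momentum, and what remains is the balance of the regular parts `j` and `k`.
  have hJe : ∀ r, J (t, r) = r * J₁ + r ^ 2 * j (t, r) := fun r => by
    have e1 := hadamard_spec hJs t r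
    have e2 := hadamard_spec hJ1 t r
    rw [smul_eq_mul] at e1 e2
    rw [e1, e2, hJ0]; ring
  have dj : ∀ r, HasDerivAt (fun r => j (t, r)) (lastD j (t, r)) r := fun r =>
    hasDerivAt_lastD (hjs.differentiable (by simp) _)
  have hJd : ∀ r, lastD J (t, r) = J₁ + (2 * r * j (t, r) + r ^ 2 * lastD j (t, r)) := fun r => by
    have h1 : HasDerivAt (fun r => J (t, r)) (lastD J (t, r)) r :=
      hasDerivAt_lastD (hJs.differentiable (by simp) _)
    have h2 := ((hasDerivAt_id r).mul_const J₁).add ((hasDerivAt_pow 2 r).mul (dj r))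
    have h3 := h1.unique (h2.congr_of_eventuallyEq (.of_forall hJe))
    rw [h3]; simp
  have hKd : ∀ r, firstD K (t, r) = firstD K (t, 0) + r ^ 2 * firstD k (t, r) := fun r => by
    have ho : ∀ᶠ s in 𝓝 t, |s - t₀| < δ := by
      have : Continuous fun s : ℝ => |s - t₀| := by fun_prop
      exact this.continuousAt.eventually (Iio_mem_nhds ht)
    refine (hasDerivAt_firstD hKs t r).unique (((hasDerivAt_firstD hKs t 0).add
      ((hasDerivAt_firstD hks t r).const_mul (r ^ 2))).congr_of_eventuallyEq ?_)
    filter_upwards [ho] with s hs using h.sphereMomentum_eq hs r μ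
  have hbal : ∀ r, 0 < r → r < δ →
      r ^ 2 * (lastD j (t, r) - firstD k (t, r)) = J₁ + firstD K (t, 0) := fun r hr hr' => by
    have := h.radial_balance hF hs ht hr hr' μ
    rw [← hJ, ← hK, hJd, hJe, hKd] at this
    refine mul_left_cancel₀ hr.ne' ?_
    linear_combination this
  have hJK : J₁ = -firstD K (t, 0) := by
    have hc : Continuous fun r : ℝ => r ^ 2 * (lastD j (t, r) - firstD k (t, r)) := by
      have h1 := (contDiff_lastD hjs).continuous
      have h2 := (contDiff_firstD hks).continuous
      fun_prop
    have h1 := (hc.tendsto 0).mono_left (nhdsWithin_le_nhds (s := Ioi 0))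
    have h2 : Tendsto (fun _ : ℝ => J₁ + firstD K (t, 0)) (𝓝[>] 0)
        (𝓝 (0 ^ 2 * (lastD j (t, 0) - firstD k (t, 0)))) := by
      refine h1.congr' ?_
      filter_upwards [self_mem_nhdsWithin, nhdsWithin_le_nhds (Iio_mem_nhds h.pos)] with r hr hr'
        using hbal r hr hr'
    have := tendsto_nhds_unique tendsto_const_nhds h2
    linarith
  have hjk : ∀ r, 0 < r → r < δ → lastD j (t, r) = firstD k (t, r) := fun r hr hr' => by
    have := hbal r hr hr'
    rw [hJK, neg_add_cancel, mul_eq_zero] at this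
    rcases this with h1 | h1
    · exact absurd h1 (pow_ne_zero 2 hr.ne')
    · linarith
  set f : ℝ × ℝ → ℝ := fun p => cutoff ρ p.2 * k p with hf
  have hcs := contDiff_cutoff ρ
  have hfs : ContDiff ℝ ∞ f := (hcs.comp contDiff_snd).mul hks
  have h1 := hasDerivAt_integral_firstD (μ := volume.restrict (Ioc 0 ρ)) (ι := id)
    continuous_id (isCompact_Icc (a := (0 : ℝ)) (b := ρ))
    ((ae_restrict_mem measurableSet_Ioc).mono fun r hr => Ioc_subset_Icc_self hr) hfs t
  have h2 : HasDerivAt (nearMomentum φ μ ρ)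
      ((∫ r in (0 : ℝ)..ρ, firstD f (t, r)) + cutoffConst ρ * firstD K (t, 0)) t := by
    have h3 := h1.add ((hasDerivAt_firstD hKs t 0).const_mul (cutoffConst ρ))
    rw [intervalIntegral.integral_of_le hρ.le]
    refine h3.congr_of_eventuallyEq (.of_forall fun s => ?_)
    rw [nearMomentum, intervalIntegral.integral_of_le hρ.le]
    rfl
  refine h2.congr_deriv ?_
  have hff : ∀ r, firstD f (t, r) = cutoff ρ r * firstD k (t, r) := fun r =>
    (hasDerivAt_firstD hfs t r).unique ((hasDerivAt_firstD hks t r).const_mul (cutoff ρ r))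
  have e1 : ∫ r in (0 : ℝ)..ρ, firstD f (t, r) = ∫ r in (0 : ℝ)..ρ, cutoff ρ r * lastD j (t, r) := by
    refine intervalIntegral.integral_congr_ae (.of_forall fun r hr => ?_)
    rw [uIoc_of_le hρ.le] at hr
    rw [hff, hjk r hr.1 (hr.2.trans_lt hρδ)]
  have hjc : Continuous fun r : ℝ => lastD j (t, r) := by
    have := (contDiff_lastD hjs).continuous; fun_prop
  have hjc0 : Continuous fun r : ℝ => j (t, r) := by
    have := hjs.continuous; fun_prop
  have hηc := continuous_deriv_cutoff ρ
  -- integration by parts leaves the finite part `j (t, 0)` of the flow at the particle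
  have e2 := intervalIntegral.integral_mul_deriv_eq_deriv_mul (a := 0) (b := ρ)
    (u := cutoff ρ) (v := fun r => j (t, r)) (u' := deriv (cutoff ρ)) (v' := fun r => lastD j (t, r))
    (fun x _ => hasDerivAt_of_contDiff hcs x) (fun x _ => dj x) (hηc.intervalIntegrable _ _)
    (hjc.intervalIntegrable _ _)
  have e3 : ∫ r in (0 : ℝ)..ρ, deriv (cutoff ρ) r * (J (t, r) / r ^ 2) =
      ∫ r in (0 : ℝ)..ρ, (deriv (cutoff ρ) r / r * J₁ + deriv (cutoff ρ) r * j (t, r)) := by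
    refine intervalIntegral.integral_congr_ae (.of_forall fun r hr => ?_)
    rw [uIoc_of_le hρ.le] at hr
    have : r ≠ 0 := hr.1.ne'
    rw [hJe]
    field_simp
  have c0 : cutoff ρ 0 = 1 := cutoff_of_le hρ (by positivity)
  have cρ : cutoff ρ ρ = 0 := cutoff_of_ge hρ (by linarith)
  have i1 : IntervalIntegrable (fun r => deriv (cutoff ρ) r / r * J₁) volume 0 ρ :=
    ((continuous_deriv_cutoff_div hρ).mul continuous_const).intervalIntegrable _ _
  have i2 : IntervalIntegrable (fun r => deriv (cutoff ρ) r * j (t, r)) volume 0 ρ :=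
    (hηc.mul hjc0).intervalIntegrable _ _
  rw [e1, e2, e3, c0, cρ, intervalIntegral.integral_add i1 i2, intervalIntegral.integral_mul_const,
    show firstD K (t, 0) = -J₁ by rw [hJK, neg_neg]]
  change _ = -j (t, 0) - (cutoffConst ρ * J₁ + _)
  ring

end IsNearField

end ParticleSystem

/-! ### Finite parts, and isolation of the particles -/

theorem HasRLim.add {f g : ℝ → ℝ} {a b : ℝ} (hf : HasRLim f a) (hg : HasRLim g b) :
    HasRLim (fun r => f r + g r) (a + b) := by
  obtain ⟨c, hc⟩ := hf
  obtain ⟨d, hd⟩ := hg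
  refine ⟨c + d, (hc.add hd).congr_left fun r => ?_⟩
  ring

theorem hasRLim_const (b : ℝ) : HasRLim (fun _ => b) b :=
  ⟨0, by simpa using Asymptotics.isBigO_zero _ _⟩

theorem HasRLim.sum {ι : Type} (s : Finset ι) {f : ι → ℝ → ℝ} {b : ι → ℝ}
    (h : ∀ i ∈ s, HasRLim (f i) (b i)) : HasRLim (fun r => ∑ i ∈ s, f i r) (∑ i ∈ s, b i) := by
  classical
  induction s using Finset.induction_on with
  | empty => simpa using hasRLim_const 0
  | insert i s hi ih =>
    simp only [Finset.sum_insert hi]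
    exact (h i (Finset.mem_insert_self i s)).add
      (ih fun j hj => h j (Finset.mem_insert_of_mem hj))

theorem HasRLim.congr {f g : ℝ → ℝ} {b : ℝ} (h : HasRLim f b) (he : g =ᶠ[𝓝[>] 0] f) :
    HasRLim g b := by
  obtain ⟨a, ha⟩ := h
  exact ⟨a, ha.congr' (he.symm.mono fun r hr => by simp only [hr]) .rfl⟩

/-- Functions that are continuous off the particle are integrable on shells around it. -/
theorem integrable_of_continuousAt_shell {g : Space → ℝ} {A : Set Space}
    {r ρ : ℝ} (hA : MeasurableSet A) (hAr : ∀ y ∈ A, r ≤ ‖y‖)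
    (hg : ∀ y, r ≤ ‖y‖ → ‖y‖ ≤ ρ → ContinuousAt g y) (h0 : ∀ y, ρ < ‖y‖ → g y = 0) :
    Integrable (A.indicator g) := by
  set B : Set Space := {y | r ≤ ‖y‖} ∩ Metric.closedBall 0 ρ with hB
  have hBc : IsCompact B := (isCompact_closedBall (0 : Space) ρ).inter_left
    (isClosed_le continuous_const continuous_norm)
  have hi : IntegrableOn g B := ContinuousOn.integrableOn_compact hBc fun y hy =>
    (hg y hy.1 (mem_closedBall_zero_iff.1 hy.2)).continuousWithinAt
  have hi2 := (hi.integrable_indicator hBc.measurableSet).indicator hA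
  refine hi2.congr (.of_forall fun y => ?_)
  by_cases hy : y ∈ A
  · rw [indicator_of_mem hy, indicator_of_mem hy]
    by_cases hyB : y ∈ B
    · rw [indicator_of_mem hyB]
    · rw [indicator_of_notMem hyB, h0]
      by_contra! hle
      exact hyB ⟨hAr y hy, mem_closedBall_zero_iff.2 hle⟩
  · rw [indicator_of_notMem hy, indicator_of_notMem hy]

namespace ParticleSystem

variable {N : ℕ} {S : ParticleSystem N}

namespace IsNearField

variable {F Fext : TensorField} {n : Fin N} {t₀ δ : ℝ} {φ : (ℝ × Space) × ℝ → Fin 4 → Fin 4 → ℝ}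

theorem continuousAt_stress (h : S.IsNearField F Fext n t₀ δ φ)
    (hs : ContDiffOn ℝ ∞ F S.offWorldLines) {t : ℝ} (ht : |t - t₀| < δ) {y : Space} (hy : y ≠ 0)
    (hyδ : ‖y‖ < δ) (κ μ : Fin 4) :
    ContinuousAt (fun y => stress (F (event t (S.pos n t + y))) κ μ) y := by
  have he : Continuous fun y => event t (S.pos n t + y) :=
    eventCLM.continuous.comp (by fun_prop : Continuous fun y : Space => (t, S.pos n t + y))
  exact ContinuousAt.comp (g := fun p => stress (F p) κ μ)
    ((contDiffOn_stress_component hs κ μ).contDiffAt (S.isOpen_offWorldLines.mem_nhds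
      (h.mem_offWorldLines ht hy hyδ))).continuousAt he.continuousAt

/-- The weighted momentum outside of a small ball, in polar coordinates. -/
theorem integral_cutoff_stress (h : S.IsNearField F Fext n t₀ δ φ)
    (hs : ContDiffOn ℝ ∞ F S.offWorldLines) {t : ℝ} (ht : |t - t₀| < δ) (μ : Fin 4) {r ρ : ℝ}
    (hr : 0 < r) (hrρ : r < ρ) (hρδ : ρ < δ) :
    Integrable ({y : Space | r < ‖y‖}.indicator
      fun y => cutoff ρ ‖y‖ * stress (F (event t (S.pos n t + y))) 0 μ) ∧
    ∫ y, {y : Space | r < ‖y‖}.indicator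
      (fun y => cutoff ρ ‖y‖ * stress (F (event t (S.pos n t + y))) 0 μ) y =
      ∫ s in r..ρ, cutoff ρ s * (sphereMomentum φ μ (t, s) / s ^ 2) := by
  have hρ : 0 < ρ := hr.trans hrρ
  have hi : Integrable ({y : Space | r < ‖y‖}.indicator
      fun y => cutoff ρ ‖y‖ * stress (F (event t (S.pos n t + y))) 0 μ) := by
    refine integrable_of_continuousAt_shell (r := r) (ρ := ρ)
      (isOpen_lt continuous_const continuous_norm).measurableSet (fun y hy => le_of_lt hy)
      (fun y hy hy' => ?_) fun y hy => ?_
    · exact ((contDiff_cutoff ρ).continuous.comp continuous_norm).continuousAt.mul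
        (h.continuousAt_stress hs ht (norm_pos_iff.1 (hr.trans_le hy)) (hy'.trans_lt hρδ) 0 μ)
    · rw [cutoff_of_ge hρ (by linarith), zero_mul]
  refine ⟨hi, ?_⟩
  rw [integral_polar hi, intervalIntegral.integral_of_le hrρ.le]
  have hset : Ioc r ρ = Ioi 0 ∩ Ioc r ρ := by
    rw [inter_eq_right.2]
    exact fun x hx => hr.trans hx.1
  rw [hset, ← setIntegral_indicator measurableSet_Ioc]
  refine setIntegral_congr_fun measurableSet_Ioi fun s hs' => ?_
  have hs0 : 0 < s := hs'
  have hn : ∀ w : USphere, ‖s • (w : Space)‖ = s := fun w => by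
    rw [norm_smul, norm_usphere, Real.norm_eq_abs, abs_of_pos hs0, mul_one]
  by_cases hsr : r < s
  · have e1 : ∀ w : USphere, {y : Space | r < ‖y‖}.indicator
        (fun y => cutoff ρ ‖y‖ * stress (F (event t (S.pos n t + y))) 0 μ) (s • (w : Space)) =
        cutoff ρ s * stress (F (event t (S.pos n t + s • (w : Space)))) 0 μ := fun w => by
      rw [indicator_of_mem (show s • (w : Space) ∈ {y : Space | r < ‖y‖} by simpa [hn] using hsr), hn]
    simp only [e1]
    rw [integral_const_mul]
    by_cases hsρ : s ≤ ρ
    · rw [indicator_of_mem (show s ∈ Ioc r ρ from ⟨hsr, hsρ⟩), h.integral_stress_eq ht hs0 (hsρ.trans_lt hρδ)]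
      field_simp
    · rw [indicator_of_notMem (show s ∉ Ioc r ρ from fun hh => hsρ hh.2), cutoff_of_ge hρ (by linarith)]
      ring
  · have e1 : ∀ w : USphere, {y : Space | r < ‖y‖}.indicator
        (fun y => cutoff ρ ‖y‖ * stress (F (event t (S.pos n t + y))) 0 μ) (s • (w : Space)) = 0 :=
      fun w => indicator_of_notMem (by simpa [hn] using hsr) _
    simp only [e1]
    rw [indicator_of_notMem (show s ∉ Ioc r ρ from fun hh => hsr hh.1)]
    simp

/-- The exchange of momentum in the shell where the cutoff varies, in polar coordinates. -/
theorem integral_shell (h : S.IsNearField F Fext n t₀ δ φ)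
    (hs : ContDiffOn ℝ ∞ F S.offWorldLines) {t : ℝ} (ht : |t - t₀| < δ) (μ : Fin 4) {ρ : ℝ}
    (hρ : 0 < ρ) (hρδ : ρ < δ) :
    Integrable (fun y => deriv (cutoff ρ) ‖y‖ / ‖y‖ *
      flow (S.vel n t) y (fun κ => stress (F (event t (S.pos n t + y))) κ μ)) ∧
    ∫ y, deriv (cutoff ρ) ‖y‖ / ‖y‖ *
      flow (S.vel n t) y (fun κ => stress (F (event t (S.pos n t + y))) κ μ) =
      ∫ r in (0 : ℝ)..ρ, deriv (cutoff ρ) r * (sphereFlow (S.pos n) φ μ (t, r) / r ^ 2) := by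
  have hi : Integrable (fun y => deriv (cutoff ρ) ‖y‖ / ‖y‖ *
      flow (S.vel n t) y (fun κ => stress (F (event t (S.pos n t + y))) κ μ)) := by
    have := integrable_of_continuousAt_shell (r := ρ / 4) (ρ := ρ) (A := {y : Space | ρ / 4 ≤ ‖y‖})
      (g := fun y => deriv (cutoff ρ) ‖y‖ / ‖y‖ *
        flow (S.vel n t) y (fun κ => stress (F (event t (S.pos n t + y))) κ μ))
      (isClosed_le continuous_const continuous_norm).measurableSet (fun y hy => hy)
      (fun y hy hy' => ?_) fun y hy => ?_
    · refine this.congr (.of_forall fun y => ?_)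
      by_cases hy : ρ / 4 ≤ ‖y‖
      · exact indicator_of_mem (s := {y : Space | ρ / 4 ≤ ‖y‖}) hy _
      · simp only
        rw [indicator_of_notMem (show y ∉ {y : Space | ρ / 4 ≤ ‖y‖} from hy),
          deriv_cutoff_of_lt hρ ((not_le.1 hy).trans (by linarith)), zero_div, zero_mul]
    · have hy0 : y ≠ 0 := norm_pos_iff.1 (lt_of_lt_of_le (by positivity) hy)
      refine ((continuous_deriv_cutoff_div hρ).comp continuous_norm).continuousAt.mul ?_
      have hT := fun κ => h.continuousAt_stress hs ht hy0 (hy'.trans_lt hρδ) κ μ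
      simp only [flow, ContinuousAt] at hT ⊢
      refine tendsto_finsetSum _ fun i _ => ?_
      have hc : Continuous fun y : Space => y i := by fun_prop
      exact (hc.tendsto y).mul (((hT 0).const_mul _).sub (hT i.succ))
    · rw [deriv_cutoff_of_gt hρ (by linarith), zero_div, zero_mul]
  refine ⟨hi, ?_⟩
  rw [integral_polar hi, intervalIntegral.integral_of_le hρ.le]
  have hset : Ioc 0 ρ = Ioi 0 ∩ Ioc 0 ρ := by
    rw [inter_eq_right.2]
    exact fun x hx => hx.1
  rw [hset, ← setIntegral_indicator measurableSet_Ioc]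
  refine setIntegral_congr_fun measurableSet_Ioi fun r hr => ?_
  have hr0 : 0 < r := hr
  simp only [norm_smul, norm_usphere, Real.norm_eq_abs, abs_of_pos hr0, mul_one, flow_smul]
  rw [integral_const_mul, integral_const_mul]
  by_cases hrρ : r ≤ ρ
  · rw [indicator_of_mem (show r ∈ Ioc 0 ρ from ⟨hr0, hrρ⟩), h.integral_flow_eq ht hr0 (hrρ.trans_lt hρδ)]
    field_simp
  · rw [indicator_of_notMem (show r ∉ Ioc 0 ρ from fun hh => hrρ hh.2), deriv_cutoff_of_gt hρ (by linarith)]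
    ring

end IsNearField

/-- In the time interval of half-length `τ` around `t₀`, the balls of radius `ρ` around the
particles are disjoint, and each of them stays inside or outside of `V`. -/
structure IsIsolating (S : ParticleSystem N) (V : Set Space) (t₀ ρ τ : ℝ) : Prop where
  pos_radius : 0 < ρ
  pos_time : 0 < τ
  inside : ∀ n t, |t - t₀| < τ → S.pos n t₀ ∈ V → Metric.closedBall (S.pos n t) ρ ⊆ V
  outside : ∀ n t, |t - t₀| < τ → S.pos n t₀ ∉ V →
    Disjoint (Metric.closedBall (S.pos n t) ρ) (closure V)
  separated : ∀ n k t, |t - t₀| < τ → n ≠ k → 2 * ρ < dist (S.pos n t) (S.pos k t)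

/-- If no particle is on the boundary at the time `t₀`, small balls around the particles stay away from
it and from each other for a short time. -/
theorem exists_isIsolating (S : ParticleSystem N) {V : Set Space} (hV : IsOpen V) {t₀ : ℝ}
    (hp : ∀ n, S.pos n t₀ ∉ frontier V) {δ : Fin N → ℝ} (hδ : ∀ n, 0 < δ n) :
    ∃ ρ τ, S.IsIsolating V t₀ ρ τ ∧ ∀ n, ρ < δ n ∧ τ ≤ δ n := by
  have h1 : ∀ n, ∀ᶠ ρ in 𝓝[>] (0 : ℝ), (S.pos n t₀ ∈ V → Metric.ball (S.pos n t₀) (3 * ρ) ⊆ V) ∧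
      (S.pos n t₀ ∉ V → Disjoint (Metric.ball (S.pos n t₀) (3 * ρ)) (closure V)) ∧ ρ < δ n ∧
      ∀ k, n ≠ k → 4 * ρ < dist (S.pos n t₀) (S.pos k t₀) := fun n => by
    have hsmall : ∀ ε : ℝ, 0 < ε → ∀ᶠ ρ in 𝓝[>] (0 : ℝ), 4 * ρ < ε := fun ε hε => by
      have h4 : (0 : ℝ) < ε / 4 := by positivity
      filter_upwards [nhdsWithin_le_nhds (Iio_mem_nhds h4)] with ρ hρ
      have : ρ < ε / 4 := hρ
      linarith
    have hpos : ∀ᶠ ρ in 𝓝[>] (0 : ℝ), 0 < ρ := self_mem_nhdsWithin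
    have a1 : ∀ᶠ ρ in 𝓝[>] (0 : ℝ), (S.pos n t₀ ∈ V → Metric.ball (S.pos n t₀) (3 * ρ) ⊆ V) := by
      by_cases hn : S.pos n t₀ ∈ V
      · obtain ⟨ε, hε, hb⟩ := Metric.isOpen_iff.1 hV _ hn
        filter_upwards [hsmall ε hε, hpos] with ρ hρ hρ0 _
        exact (Metric.ball_subset_ball (by linarith)).trans hb
      · exact .of_forall fun ρ hh => absurd hh hn
    have a2 : ∀ᶠ ρ in 𝓝[>] (0 : ℝ), (S.pos n t₀ ∉ V →
        Disjoint (Metric.ball (S.pos n t₀) (3 * ρ)) (closure V)) := by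
      by_cases hn : S.pos n t₀ ∈ V
      · exact .of_forall fun ρ hh => absurd hn hh
      · have hc : S.pos n t₀ ∈ (closure V)ᶜ := fun hc => hp n (by
          rw [hV.frontier_eq]; exact ⟨hc, hn⟩)
        obtain ⟨ε, hε, hb⟩ := Metric.isOpen_iff.1 isClosed_closure.isOpen_compl _ hc
        filter_upwards [hsmall ε hε, hpos] with ρ hρ hρ0 _
        exact disjoint_left.2 fun x hx => hb (Metric.ball_subset_ball (by linarith) hx)
    have a3 : ∀ᶠ ρ in 𝓝[>] (0 : ℝ), ∀ k, n ≠ k → 4 * ρ < dist (S.pos n t₀) (S.pos k t₀) := by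
      refine eventually_all.2 fun k => ?_
      by_cases hnk : n = k
      · exact .of_forall fun ρ hh => absurd hnk hh
      · filter_upwards [hsmall _ (dist_pos.2 ((S.distinct t₀).ne hnk))] with ρ hρ _ using hρ
    filter_upwards [a1, a2, a3, nhdsWithin_le_nhds (Iio_mem_nhds (hδ n))] with ρ b1 b2 b3 b4
      using ⟨b1, b2, b4, b3⟩
  obtain ⟨ρ, hρ, hρ0⟩ := ((eventually_all.2 h1).and self_mem_nhdsWithin).exists
  have hρ0 : 0 < ρ := hρ0
  have h2 : ∀ᶠ τ in 𝓝[>] (0 : ℝ), ∀ n, τ ≤ δ n ∧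
      ∀ t, |t - t₀| < τ → dist (S.pos n t) (S.pos n t₀) < ρ := by
    refine eventually_all.2 fun n => ?_
    obtain ⟨ε, hε, hb⟩ := Metric.continuousAt_iff.1
      ((S.smooth n).continuous.continuousAt (x := t₀)) ρ hρ0
    filter_upwards [nhdsWithin_le_nhds (Iio_mem_nhds (hδ n)),
      nhdsWithin_le_nhds (Iio_mem_nhds hε)] with τ h3 h4
    exact ⟨le_of_lt h3, fun t ht => hb (by rw [Real.dist_eq]; exact ht.trans h4)⟩
  obtain ⟨τ, hτ, hτ0⟩ := (h2.and self_mem_nhdsWithin).exists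
  have hball : ∀ n t, |t - t₀| < τ →
      Metric.closedBall (S.pos n t) ρ ⊆ Metric.ball (S.pos n t₀) (3 * ρ) := fun n t ht =>
    Metric.closedBall_subset_ball' (by have := (hτ n).2 t ht; linarith)
  refine ⟨ρ, τ, ⟨hρ0, hτ0, fun n t ht hn => (hball n t ht).trans ((hρ n).1 hn),
    fun n t ht hn => ((hρ n).2.1 hn).mono_left (hball n t ht), fun n k t ht hnk => ?_⟩,
    fun n => ⟨(hρ n).2.2.1, (hτ n).1⟩⟩
  have e1 := (hτ n).2 t ht
  have e2 := (hτ k).2 t ht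
  have e3 := (hρ n).2.2.2 k hnk
  have e4 := dist_triangle4 (S.pos n t₀) (S.pos n t) (S.pos k t) (S.pos k t₀)
  rw [dist_comm (S.pos n t₀) (S.pos n t)] at e4
  linarith

namespace IsIsolating

variable {V : Set Space} {t₀ ρ τ : ℝ}

theorem mem_iff (h : S.IsIsolating V t₀ ρ τ) {t : ℝ} (ht : |t - t₀| < τ) (n : Fin N) :
    S.pos n t ∈ V ↔ S.pos n t₀ ∈ V := by
  have hm : S.pos n t ∈ Metric.closedBall (S.pos n t) ρ :=
    Metric.mem_closedBall_self h.pos_radius.le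
  refine ⟨fun hn => ?_, fun hn => h.inside n t ht hn hm⟩
  by_contra hn'
  exact disjoint_left.1 (h.outside n t ht hn') hm (subset_closure hn)

/-- At most one of the particles is within the distance `ρ` of a point. -/
theorem lt_norm_sub (h : S.IsIsolating V t₀ ρ τ) {t : ℝ} (ht : |t - t₀| < τ) {n k : Fin N}
    (hnk : k ≠ n) {x : Space} (hx : ‖x - S.pos n t‖ ≤ ρ) : ρ < ‖x - S.pos k t‖ := by
  have h1 := h.separated n k t ht hnk.symm
  have h2 := dist_triangle_left (S.pos n t) (S.pos k t) x
  rw [dist_eq_norm x, dist_eq_norm x] at h2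
  linarith

/-- The weight `1 - ∑ η` vanishes near the particles. -/
theorem weight_eq_zero (h : S.IsIsolating V t₀ ρ τ) {t : ℝ} (ht : |t - t₀| < τ) {n : Fin N}
    {x : Space} (hx : ‖x - S.pos n t‖ ≤ ρ / 2) : 1 - ∑ k, cutoff ρ ‖x - S.pos k t‖ = 0 := by
  have hρ := h.pos_radius
  rw [Finset.sum_eq_single_of_mem n (Finset.mem_univ n), cutoff_of_le hρ hx, sub_self]
  intro k _ hk
  have := h.lt_norm_sub ht hk (hx.trans (by linarith))
  exact cutoff_of_ge hρ (by linarith)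

/-- The weight `1 - ∑ η` is `1` on the boundary of `V`. -/
theorem weight_eq_one (h : S.IsIsolating V t₀ ρ τ) {t : ℝ} (ht : |t - t₀| < τ)
    (hV : IsOpen V) {x : Space} (hx : x ∈ frontier V) :
    1 - ∑ k, cutoff ρ ‖x - S.pos k t‖ = 1 := by
  rw [Finset.sum_eq_zero, sub_zero]
  intro k _
  refine cutoff_of_ge h.pos_radius ?_
  by_contra! hlt
  have hρ := h.pos_radius
  have hm : x ∈ Metric.closedBall (S.pos k t) ρ := by
    rw [Metric.mem_closedBall, dist_eq_norm]; linarith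
  rw [hV.frontier_eq] at hx
  by_cases hk : S.pos k t₀ ∈ V
  · exact hx.2 (h.inside k t ht hk hm)
  · exact disjoint_left.1 (h.outside k t ht hk) hm hx.1

end IsIsolating

end ParticleSystem

/-! ### The momentum away from the particles -/

namespace ParticleSystem

variable {N : ℕ} {S : ParticleSystem N} {F : TensorField}

namespace IsIsolating

variable {V : Set Space} {t₀ ρ τ : ℝ}

/-- The weight `1 - ∑ η`, restricted to a neighbourhood of the time `t₀`, cuts off the singularities
of the energy-momentum tensor. -/
theorem exists_contDiff_weighted (h : S.IsIsolating V t₀ ρ τ)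
    (hs : ContDiffOn ℝ ∞ F S.offWorldLines) (μ : Fin 4) :
    ∃ f : Fin 4 → ℝ × Space → ℝ, (∀ κ, ContDiff ℝ ∞ (f κ)) ∧ ∀ κ t x, |t - t₀| < τ / 3 →
      f κ (t, x) = (1 - ∑ k, cutoff ρ ‖x - S.pos k t‖) * stress (F (event t x)) κ μ := by
  have hτ := h.pos_time
  have hρ := h.pos_radius
  let β : ContDiffBump t₀ := ⟨τ / 3, 2 * τ / 3, by positivity, by linarith⟩
  set G : ℝ × Space → ℝ := fun p => β p.1 * (1 - ∑ k, cutoff ρ ‖p.2 - S.pos k p.1‖) with hG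
  have hη0 : ∀ᶠ r in 𝓝 0, cutoff ρ r = 1 := by
    filter_upwards [Iio_mem_nhds (show 0 < ρ / 2 by positivity)] with r hr
      using cutoff_of_le hρ (le_of_lt hr)
  have hGs : ContDiff ℝ ∞ G := by
    refine (β.contDiff.comp contDiff_fst).mul (contDiff_const.sub (ContDiff.sum fun k _ => ?_))
    exact (contDiff_comp_norm (contDiff_cutoff ρ) hη0).comp
      (contDiff_snd.sub ((S.smooth k).comp contDiff_fst))
  set Ω : Set (ℝ × Space) := eventCLM ⁻¹' S.offWorldLines with hΩ
  have hΩo : IsOpen Ω := S.isOpen_offWorldLines.preimage eventCLM.continuous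
  have hsupp : tsupport G ⊆ Ω := by
    intro p hp
    by_contra hn
    have hn' : ¬ event p.1 p.2 ∈ S.offWorldLines := hn
    rw [mem_offWorldLines_iff] at hn'
    push Not at hn'
    obtain ⟨n, hxn⟩ := hn'
    refine notMem_tsupport_iff_eventuallyEq.2 ?_ hp
    by_cases ht : |p.1 - t₀| < τ
    · have c1 : Continuous fun q : ℝ × Space => |q.1 - t₀| := by fun_prop
      have c2 : Continuous fun q : ℝ × Space => ‖q.2 - S.pos n q.1‖ := by
        have := (S.smooth n).continuous
        fun_prop
      have z : ‖p.2 - S.pos n p.1‖ < ρ / 2 := by rw [hxn, sub_self, norm_zero]; positivity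
      filter_upwards [c1.continuousAt.eventually (Iio_mem_nhds ht),
        c2.continuousAt.eventually (Iio_mem_nhds z)] with q hq1 hq2
      simp only [hG, h.weight_eq_zero hq1 (le_of_lt hq2), mul_zero, Pi.zero_apply]
    · have : p.1 ∉ tsupport β := by
        rw [β.tsupport_eq, Metric.mem_closedBall, Real.dist_eq]
        change ¬ |p.1 - t₀| ≤ 2 * τ / 3
        intro hle
        exact ht (by linarith)
      filter_upwards [continuous_fst.continuousAt.eventually
        (notMem_tsupport_iff_eventuallyEq.1 this)] with q hq
      simp only [hG, hq, Pi.zero_apply, zero_mul]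
  refine ⟨fun κ p => stress (F (event p.1 p.2)) κ μ * G p, fun κ => ?_, fun κ t x ht => ?_⟩
  · refine contDiff_mul_of_tsupport_subset hΩo ?_ hGs hsupp
    exact (contDiffOn_stress_component hs κ μ).comp eventCLM.contDiff.contDiffOn fun p hp => hp
  · have : β t = 1 := β.one_of_mem_closedBall (by
      rw [Metric.mem_closedBall, Real.dist_eq]; exact ht.le)
    simp only [hG, this]
    ring

/-- Near the particle `n`, the points of `V` at distances greater than `r` from all the particles are the
points at distances greater than `r` from the particle `n`, or none. -/
theorem indicator_cutoff (h : S.IsIsolating V t₀ ρ τ) {t : ℝ} (ht : |t - t₀| < τ) (n : Fin N)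
    {r : ℝ} (hr : r < ρ) (G : Space → ℝ) [Decidable (S.pos n t₀ ∈ V)] (x : Space) :
    {x ∈ V | ∀ k, r < dist x (S.pos k t)}.indicator
      (fun x => cutoff ρ ‖x - S.pos n t‖ * G x) x =
    if S.pos n t₀ ∈ V then {y : Space | r < ‖y‖}.indicator
      (fun y => cutoff ρ ‖y‖ * G (S.pos n t + y)) (x - S.pos n t) else 0 := by
  have hρ := h.pos_radius
  by_cases hx : ‖x - S.pos n t‖ ≤ ρ
  · have hxm : x ∈ Metric.closedBall (S.pos n t) ρ := by
      rw [Metric.mem_closedBall, dist_eq_norm]; exact hx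
    split_ifs with hn
    · by_cases hxr : r < ‖x - S.pos n t‖
      · rw [indicator_of_mem, indicator_of_mem, add_sub_cancel]
        · exact hxr
        · refine ⟨h.inside n t ht hn hxm, fun k => ?_⟩
          rw [dist_eq_norm]
          by_cases hk : k = n
          · rw [hk]; exact hxr
          · exact hr.trans (h.lt_norm_sub ht hk hx)
      · rw [indicator_of_notMem, indicator_of_notMem]
        · exact hxr
        · exact fun hh => hxr (by rw [← dist_eq_norm]; exact hh.2 n)
    · exact indicator_of_notMem (fun hh =>
        disjoint_left.1 (h.outside n t ht hn) hxm (subset_closure hh.1)) _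
  · have h0 : cutoff ρ ‖x - S.pos n t‖ = 0 := cutoff_of_ge hρ (by linarith)
    have e1 : {x ∈ V | ∀ k, r < dist x (S.pos k t)}.indicator
        (fun x => cutoff ρ ‖x - S.pos n t‖ * G x) x = 0 := by
      refine indicator_apply_eq_zero.2 fun _ => ?_
      rw [h0, zero_mul]
    have e2 : {y : Space | r < ‖y‖}.indicator
        (fun y => cutoff ρ ‖y‖ * G (S.pos n t + y)) (x - S.pos n t) = 0 := by
      refine indicator_apply_eq_zero.2 fun _ => ?_
      rw [h0, zero_mul]
    rw [e1, e2, ite_self]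

open Classical in
/-- The `R`-integral of the density of momentum is the sum of a regular part and of the momenta near
the particles in `V`. -/
theorem hasRIntegral (h : S.IsIsolating V t₀ ρ τ) (hs : ContDiffOn ℝ ∞ F S.offWorldLines)
    {Fext : Fin N → TensorField} {δ : Fin N → ℝ}
    {φ : Fin N → (ℝ × Space) × ℝ → Fin 4 → Fin 4 → ℝ}
    (hφ : ∀ n, S.IsNearField F (Fext n) n t₀ (δ n) (φ n)) (hδ : ∀ n, ρ < δ n ∧ τ ≤ δ n)
    (hV : IsOpen V) (hb : Bornology.IsBounded V) {μ : Fin 4} {f : ℝ × Space → ℝ}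
    (hf : Continuous f) {t : ℝ} (ht : |t - t₀| < τ)
    (hfe : ∀ x, f (t, x) = (1 - ∑ k, cutoff ρ ‖x - S.pos k t‖) * stress (F (event t x)) 0 μ) :
    HasRIntegral (fun n => S.pos n t) V (fun x => stress (F (event t x)) 0 μ)
      ((∫ x in V, f (t, x)) + ∑ n, if S.pos n t₀ ∈ V then IsNearField.nearMomentum (φ n) μ ρ t else 0) := by
  have hρ := h.pos_radius
  set T : Space → ℝ := fun x => stress (F (event t x)) 0 μ with hT
  have hAm : ∀ r : ℝ, MeasurableSet {x ∈ V | ∀ n, r < dist x (S.pos n t)} := fun r => by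
    refine (hV.inter ?_).measurableSet
    have e : IsOpen (⋂ n, {x | r < dist x (S.pos n t)}) := isOpen_iInter_of_finite fun n =>
      isOpen_lt continuous_const (continuous_id.dist continuous_const)
    refine (congrArg IsOpen ?_).mp e
    ext x
    exact mem_iInter
  have hfi : IntegrableOn (fun x => f (t, x)) V := by
    have hc : Continuous fun x => f (t, x) := by fun_prop
    exact (hc.continuousOn.integrableOn_compact hb.isCompact_closure).mono_set subset_closure
  have hnear : ∀ r, 0 < r → r < ρ → ∀ n,
      IntegrableOn (fun x => cutoff ρ ‖x - S.pos n t‖ * T x)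
        {x ∈ V | ∀ k, r < dist x (S.pos k t)} ∧
      ∫ x in {x ∈ V | ∀ k, r < dist x (S.pos k t)}, cutoff ρ ‖x - S.pos n t‖ * T x =
        if S.pos n t₀ ∈ V then
          ∫ s in r..ρ, cutoff ρ s * (IsNearField.sphereMomentum (φ n) μ (t, s) / s ^ 2) else 0 := by
    intro r hr hrρ n
    have hi := h.indicator_cutoff ht n hrρ T
    obtain ⟨j1, j2⟩ := (hφ n).integral_cutoff_stress hs (ht.trans_le (hδ n).2) μ hr hrρ (hδ n).1
    have hfun := funext hi
    rw [← integrable_indicator_iff (hAm r), ← integral_indicator (hAm r), hfun]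
    split_ifs with hn
    · refine ⟨j1.comp_sub_right (S.pos n t), ?_⟩
      rw [← j2]
      exact integral_sub_right_eq_self _ (S.pos n t)
    · exact ⟨integrable_zero _ _ _, integral_zero _ _⟩
  have hTe : ∀ x, T x = f (t, x) + ∑ n, cutoff ρ ‖x - S.pos n t‖ * T x := fun x => by
    rw [hfe, ← Finset.sum_mul]; ring
  have hev : ∀ᶠ r in 𝓝[>] (0 : ℝ), 0 < r ∧ r < ρ / 2 :=
    (eventually_mem_nhdsWithin (a := (0 : ℝ)) (s := Ioi 0)).and
      (nhdsWithin_le_nhds (Iio_mem_nhds (by positivity)))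
  refine ⟨?_, ?_⟩
  · filter_upwards [hev] with r hr
    have hsum : IntegrableOn (fun x => ∑ n, cutoff ρ ‖x - S.pos n t‖ * T x)
        {x ∈ V | ∀ k, r < dist x (S.pos k t)} :=
      integrable_finsetSum _ fun n _ => (hnear r hr.1 (by linarith [hr.2]) n).1
    refine ((hfi.mono_set fun x hx => hx.1).add hsum).congr (.of_forall fun x => ?_)
    exact (hTe x).symm
  · have hlim := (hasRLim_const (∫ x in V, f (t, x))).add (HasRLim.sum Finset.univ
      (f := fun n r => if S.pos n t₀ ∈ V then
        ∫ s in r..ρ, cutoff ρ s * (IsNearField.sphereMomentum (φ n) μ (t, s) / s ^ 2) else 0)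
      (b := fun n => if S.pos n t₀ ∈ V then IsNearField.nearMomentum (φ n) μ ρ t else 0) fun n _ => ?_)
    · refine hlim.congr ?_
      filter_upwards [hev] with r hr
      have hrρ : r < ρ := by linarith [hr.2]
      have hsum : ∀ n ∈ Finset.univ, IntegrableOn (fun x => cutoff ρ ‖x - S.pos n t‖ * T x)
          {x ∈ V | ∀ k, r < dist x (S.pos k t)} := fun n _ => (hnear r hr.1 hrρ n).1
      have e1 : ∫ x in {x ∈ V | ∀ k, r < dist x (S.pos k t)}, T x =
          ∫ x in {x ∈ V | ∀ k, r < dist x (S.pos k t)},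
            (f (t, x) + ∑ n, cutoff ρ ‖x - S.pos n t‖ * T x) :=
        integral_congr_ae (.of_forall fun x => hTe x)
      have e2 : ∫ x in V, f (t, x) = ∫ x in {x ∈ V | ∀ k, r < dist x (S.pos k t)}, f (t, x) := by
        refine (setIntegral_eq_of_subset_of_forall_sdiff_eq_zero hV.measurableSet
          (fun x hx => hx.1) fun x hx => ?_)
        have hx2 : ¬ ∀ k, r < dist x (S.pos k t) := fun hh => hx.2 ⟨hx.1, hh⟩
        push Not at hx2
        obtain ⟨k, hk⟩ := hx2
        rw [hfe, h.weight_eq_zero ht (n := k) (by rw [← dist_eq_norm]; linarith [hr.2]), zero_mul]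
      rw [cutIntegral, e1, integral_add (hfi.mono_set fun x hx => hx.1)
        (integrable_finsetSum _ hsum), integral_finsetSum _ hsum, e2]
      congr 1
      exact Finset.sum_congr rfl fun n _ => (hnear r hr.1 hrρ n).2
    · split_ifs with hn
      · exact (hφ n).hasRLim_nearMomentum (ht.trans_le (hδ n).2) μ hρ
      · exact hasRLim_const 0

/-- The four-divergence of the weighted energy-momentum tensor. By local conservation, only the
derivatives of the weight contribute, and they are the flow through the shells around the particles. -/
theorem firstD_add_sum_fderiv (h : S.IsIsolating V t₀ ρ τ) (hF : S.IsMaxwellField F)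
    (hs : ContDiffOn ℝ ∞ F S.offWorldLines) {μ : Fin 4} {f : Fin 4 → ℝ × Space → ℝ}
    (hfe : ∀ κ t x, |t - t₀| < τ / 3 →
      f κ (t, x) = (1 - ∑ k, cutoff ρ ‖x - S.pos k t‖) * stress (F (event t x)) κ μ) (x : Space) :
    firstD (f 0) (t₀, x) +
      ∑ i : Fin 3, fderiv ℝ (f i.succ) (t₀, x) (0, EuclideanSpace.single i 1) =
    ∑ n, deriv (cutoff ρ) ‖x - S.pos n t₀‖ / ‖x - S.pos n t₀‖ *
      flow (S.vel n t₀) (x - S.pos n t₀)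
        (fun κ => stress (F (event t₀ (S.pos n t₀ + (x - S.pos n t₀)))) κ μ) := by
  have hτ := h.pos_time
  have hρ := h.pos_radius
  have ht0 : |t₀ - t₀| < τ := by simpa using hτ
  have c1 : Continuous fun q : ℝ × Space => |q.1 - t₀| := by fun_prop
  have hev : ∀ᶠ q : ℝ × Space in 𝓝 (t₀, x), |q.1 - t₀| < τ / 3 :=
    c1.continuousAt.eventually (Iio_mem_nhds (by simpa using hτ))
  by_cases hx : event t₀ x ∈ S.offWorldLines
  · have hxn : ∀ n, x - S.pos n t₀ ≠ 0 := fun n =>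
      sub_ne_zero.2 ((S.mem_offWorldLines_iff).1 hx n)
    have hW : HasFDerivAt (fun q : ℝ × Space => 1 - ∑ k, cutoff ρ ‖q.2 - S.pos k q.1‖)
        (-∑ k, ((deriv (cutoff ρ) ‖x - S.pos k t₀‖ / ‖x - S.pos k t₀‖) •
          innerSL ℝ (x - S.pos k t₀)).comp (ContinuousLinearMap.snd ℝ ℝ Space -
            (ContinuousLinearMap.fst ℝ ℝ Space).smulRight (S.vel k t₀))) (t₀, x) := by
      refine (HasFDerivAt.fun_sum fun k _ => ?_).const_sub 1
      have h1 : HasFDerivAt (fun q : ℝ × Space => q.2 - S.pos k q.1)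
          (ContinuousLinearMap.snd ℝ ℝ Space -
            (ContinuousLinearMap.fst ℝ ℝ Space).smulRight (S.vel k t₀)) (t₀, x) := by
        have h2 : HasFDerivAt (fun q : ℝ × Space => S.pos k q.1)
            ((ContinuousLinearMap.toSpanSingleton ℝ (S.vel k t₀)).comp
              (ContinuousLinearMap.fst ℝ ℝ Space)) (t₀, x) :=
          HasFDerivAt.comp (t₀, x) (g := S.pos k)
            (hasDerivAt_of_contDiff (S.smooth k) t₀).hasFDerivAt hasFDerivAt_fst
        refine (hasFDerivAt_snd.sub h2).congr_fderiv ?_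
        ext q <;> simp
      exact HasFDerivAt.comp (t₀, x) (hasFDerivAt_comp_norm (contDiff_cutoff ρ) (hxn k)) h1
    have hT : ∀ κ, HasFDerivAt (fun q : ℝ × Space => stress (F (event q.1 q.2)) κ μ)
        ((fderiv ℝ (fun p => stress (F p) κ μ) (event t₀ x)).comp eventCLM) (t₀, x) := fun κ => by
      have h2 := (((contDiffOn_stress_component hs κ μ).contDiffAt
        (S.isOpen_offWorldLines.mem_nhds hx)).differentiableAt (by simp)).hasFDerivAt
      exact HasFDerivAt.comp (g := fun p => stress (F p) κ μ) (t₀, x) h2 eventCLM.hasFDerivAt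
    have hfd := fun κ => ((hW.mul (hT κ)).congr_of_eventuallyEq (f₁ := f κ)
      (hev.mono fun q hq => hfe κ q.1 q.2 hq)).fderiv
    have e0 : eventCLM ((1 : ℝ), (0 : Space)) = Pi.single 0 1 := by
      rw [eventCLM_apply]
      ext κ
      refine Fin.cases ?_ (fun j => ?_) κ
      · simp [event_zero]
      · simp [event_succ]
    have ei : ∀ i : Fin 3, eventCLM ((0 : ℝ), EuclideanSpace.single i (1 : ℝ)) =
        Pi.single i.succ 1 := fun i => by
      rw [eventCLM_apply]
      ext κ
      refine Fin.cases ?_ (fun j => ?_) κ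
      · simp [event_zero, (Fin.succ_ne_zero i).symm]
      · simp [event_succ, Pi.single_apply]
    have hdiv := hF.sum_partialD_stress hs hx μ
    rw [Fin.sum_univ_succ] at hdiv
    simp only [partialD] at hdiv
    rw [firstD, hfd 0]
    simp only [hfd, add_sub_cancel]
    simp only [add_apply, smul_apply,
      ContinuousLinearMap.comp_apply, neg_apply, sum_apply,
      sub_apply, ContinuousLinearMap.coe_snd', ContinuousLinearMap.coe_fst',
      ContinuousLinearMap.smulRight_apply, e0, ei, innerSL_apply_apply, one_smul, zero_smul, zero_sub,
      sub_zero, smul_eq_mul, inner_neg_right, EuclideanSpace.inner_single_right, flow]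
    rw [Finset.sum_add_distrib, ← Finset.mul_sum]
    have hinner : ∀ k, inner ℝ (x - S.pos k t₀) (S.vel k t₀) =
        ∑ i, (x - S.pos k t₀) i * S.vel k t₀ i := fun k => by
      rw [PiLp.inner_apply]
      exact Finset.sum_congr rfl fun i _ => by simp [mul_comm]
    simp only [hinner, conj_trivial, one_mul]
    have hsum : ∀ (a : Fin N → ℝ) (y v : Fin N → Fin 3 → ℝ) (T : Fin 4 → ℝ),
        ∑ k, a k * ∑ i, y k i * (v k i * T 0 - T i.succ) =
        T 0 * ∑ k, a k * (∑ i, y k i * v k i) - ∑ i, T i.succ * ∑ k, a k * y k i := by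
      intro a y v T
      simp only [Fin.sum_univ_three, Finset.mul_sum]
      rw [← Finset.sum_add_distrib, ← Finset.sum_add_distrib, ← Finset.sum_sub_distrib]
      exact Finset.sum_congr rfl fun k _ => by ring
    rw [hsum _ (fun k i => (x - S.pos k t₀) i) (fun k i => S.vel k t₀ i)
      (fun κ => stress (F (event t₀ x)) κ μ)]
    simp only [mul_neg, Finset.sum_neg_distrib, neg_neg]
    linear_combination (1 - ∑ k, cutoff ρ ‖x - S.pos k t₀‖) * hdiv
  · rw [S.mem_offWorldLines_iff] at hx
    push Not at hx
    obtain ⟨m, hm⟩ := hx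
    have c2 : Continuous fun q : ℝ × Space => ‖q.2 - S.pos m q.1‖ := by
      have := (S.smooth m).continuous
      fun_prop
    have z : ‖x - S.pos m t₀‖ < ρ / 2 := by rw [hm, sub_self, norm_zero]; positivity
    have hz : ∀ κ, fderiv ℝ (f κ) (t₀, x) = 0 := fun κ => by
      have : f κ =ᶠ[𝓝 (t₀, x)] fun _ => 0 := by
        filter_upwards [hev, c2.continuousAt.eventually (Iio_mem_nhds z)] with q hq1 hq2
        rw [show f κ q = f κ (q.1, q.2) from rfl, hfe κ q.1 q.2 hq1,
          h.weight_eq_zero (hq1.trans (by linarith)) (le_of_lt hq2), zero_mul]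
      rw [this.fderiv_eq]; simp
    simp only [firstD, hz, zero_apply, Finset.sum_const_zero, add_zero]
    refine (Finset.sum_eq_zero fun k _ => ?_).symm
    have : deriv (cutoff ρ) ‖x - S.pos k t₀‖ = 0 := by
      by_cases hk : k = m
      · rw [hk]; exact deriv_cutoff_of_lt hρ z
      · have := h.lt_norm_sub ht0 hk (z.le.trans (by linarith))
        exact deriv_cutoff_of_gt hρ (by linarith)
    rw [this, zero_div, zero_mul]

end IsIsolating

end ParticleSystem

namespace ParticleSystem

variable {N : ℕ} {S : ParticleSystem N} {F : TensorField}

namespace IsIsolating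

variable {V : Set Space} {t₀ ρ τ : ℝ}

/-- A function that is supported in the ball around a particle is integrated over all of it, or not at
all. -/
theorem setIntegral_shell (h : S.IsIsolating V t₀ ρ τ) (n : Fin N) {g : Space → ℝ}
    [Decidable (S.pos n t₀ ∈ V)] (hV : IsOpen V)
    (h0 : ∀ y, ρ < ‖y‖ → g y = 0) :
    ∫ x in V, g (x - S.pos n t₀) = if S.pos n t₀ ∈ V then ∫ y, g y else 0 := by
  have ht0 : |t₀ - t₀| < τ := by simpa using h.pos_time
  have hball : ∀ x, ‖x - S.pos n t₀‖ ≤ ρ → x ∈ Metric.closedBall (S.pos n t₀) ρ := fun x hx => by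
    rwa [Metric.mem_closedBall, dist_eq_norm]
  split_ifs with hn
  · rw [setIntegral_eq_integral_of_forall_compl_eq_zero]
    · exact integral_sub_right_eq_self g (S.pos n t₀)
    · intro x hx
      refine h0 _ ?_
      by_contra! hle
      exact hx (h.inside n t₀ ht0 hn (hball x hle))
  · refine (setIntegral_congr_fun hV.measurableSet fun x hx => ?_).trans (integral_zero _ _)
    refine h0 _ ?_
    by_contra! hle
    exact disjoint_left.1 (h.outside n t₀ ht0 hn) (hball x hle) (subset_closure hx)

open Classical in
/-- The rate of change of the regular part of the momentum: the flux through the boundary, and the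
exchange with the neighbourhoods of the particles in `V`. -/
theorem hasDerivAt_setIntegral (h : S.IsIsolating V t₀ ρ τ) (hF : S.IsMaxwellField F)
    (hs : ContDiffOn ℝ ∞ F S.offWorldLines) {Fext : Fin N → TensorField} {δ : Fin N → ℝ}
    {φ : Fin N → (ℝ × Space) × ℝ → Fin 4 → Fin 4 → ℝ}
    (hφ : ∀ n, S.IsNearField F (Fext n) n t₀ (δ n) (φ n)) (hδ : ∀ n, ρ < δ n)
    (hV : IsOpen V) (hb : Bornology.IsBounded V) (A : BoundaryAtlas V) {μ : Fin 4}
    {f : Fin 4 → ℝ × Space → ℝ} (hf : ∀ κ, ContDiff ℝ ∞ (f κ))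
    (hfe : ∀ κ t x, |t - t₀| < τ / 3 →
      f κ (t, x) = (1 - ∑ k, cutoff ρ ‖x - S.pos k t‖) * stress (F (event t x)) κ μ) :
    HasDerivAt (fun t => ∫ x in V, f 0 (t, x))
      ((∑ n, if S.pos n t₀ ∈ V then ∫ r in (0 : ℝ)..ρ, deriv (cutoff ρ) r *
        (IsNearField.sphereFlow (S.pos n) (φ n) μ (t₀, r) / r ^ 2) else 0) -
        A.flux (momentumCurrent F μ t₀)) t₀ := by
  have hτ := h.pos_time
  have hρ := h.pos_radius
  have ht0 : |t₀ - t₀| < τ / 3 := by simpa using hτ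
  have hfin : IsFiniteMeasure (volume.restrict V) := ⟨by
    rw [Measure.restrict_apply_univ]; exact hb.measure_lt_top⟩
  have h1 := hasDerivAt_integral_firstD (μ := volume.restrict V) (ι := id) continuous_id
    hb.isCompact_closure ((ae_restrict_mem hV.measurableSet).mono fun x hx => subset_closure hx)
    (hf 0) t₀
  refine h1.congr_deriv ?_
  set X : Space → Space := fun x => WithLp.toLp 2 fun i : Fin 3 => f i.succ (t₀, x) with hX
  have hpair : ContDiff ℝ ∞ fun x : Space => (t₀, x) := by fun_prop
  have hXs : ContDiff ℝ 1 X := by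
    rw [contDiff_euclidean]
    exact fun i => ((hf i.succ).comp hpair).of_le (by exact_mod_cast le_top)
  have hdiv : ∀ x, diverg X x = ∑ i : Fin 3,
      fderiv ℝ (f i.succ) (t₀, x) (0, EuclideanSpace.single i 1) := fun x => by
    rw [diverg_eq_sum_component (hXs.differentiable (by simp) x)]
    refine Finset.sum_congr rfl fun i _ => ?_
    have h2 : HasFDerivAt (fun y => X y i) _ x :=
      (((hf i.succ).differentiable (by simp)) (t₀, x)).hasFDerivAt.comp x
        (hasFDerivAt_prodMk_right t₀ x)
    rw [h2.fderiv]
    rfl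
  have hflux : A.flux (momentumCurrent F μ t₀) = ∫ x in V, diverg X x := by
    rw [A.setIntegral_diverg hV hb hXs]
    refine A.flux_congr hV fun x hx => ?_
    ext i
    change stress (F (event t₀ x)) i.succ μ = f i.succ (t₀, x)
    rw [hfe _ _ _ ht0, h.weight_eq_one (by simpa using hτ) hV hx, one_mul]
  have hint : ∀ g : Space → ℝ, Continuous g → IntegrableOn g V := fun g hg =>
    (hg.continuousOn.integrableOn_compact hb.isCompact_closure).mono_set subset_closure
  have i1 : IntegrableOn (fun x => firstD (f 0) (t₀, x)) V := hint _ (by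
    have := (contDiff_firstD (hf 0)).continuous; fun_prop)
  have i2 : IntegrableOn (fun x => diverg X x) V := hint _ (continuous_diverg hXs)
  rw [eq_sub_iff_add_eq, hflux]
  refine (integral_add i1 i2).symm.trans ?_
  have hpt : ∀ x, firstD (f 0) (t₀, x) + diverg X x = _ := fun x =>
    (congrArg _ (hdiv x)).trans (h.firstD_add_sum_fderiv hF hs hfe x)
  have ht1 : ∀ n, |t₀ - t₀| < δ n := fun n => by simpa using (hφ n).pos
  have hsh := fun n => (hφ n).integral_shell hs (ht1 n) μ hρ (hδ n)
  simp only [hpt]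
  rw [integral_finsetSum _ fun n _ =>
    (((hsh n).1.comp_sub_right (S.pos n t₀)).integrableOn (s := V))]
  refine Finset.sum_congr rfl fun n _ => ?_
  rw [← (hsh n).2]
  refine h.setIntegral_shell n hV (g := fun y => deriv (cutoff ρ) ‖y‖ / ‖y‖ *
    flow (S.vel n t₀) y (fun κ => stress (F (event t₀ (S.pos n t₀ + y))) κ μ)) fun y hy => ?_
  rw [deriv_cutoff_of_gt hρ (by linarith), zero_div, zero_mul]

end IsIsolating

/-! ### The balance of energy and momentum -/

/-- The force `q (1, v)_ν F̃^{μν}` on particle `n`, per unit of coordinate time. -/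
def force (S : ParticleSystem N) (Fext : TensorField) (n : Fin N) (t : ℝ) (μ : Fin 4) : ℝ :=
  S.charge n * ∑ ν, metric ν * event 1 (S.vel n t) ν * S.particleField Fext n t μ ν

theorem one_sub_vel_sq_pos (S : ParticleSystem N) (n : Fin N) (t : ℝ) : 0 < 1 - ‖S.vel n t‖ ^ 2 :=
  one_sub_sq_pos (S.speed_lt_one n t)

theorem contDiff_vel (S : ParticleSystem N) (n : Fin N) : ContDiff ℝ ∞ (S.vel n) :=
  contDiff_deriv (S.smooth n)

theorem gamma_pos (S : ParticleSystem N) (n : Fin N) (t : ℝ) : 0 < S.gamma n t :=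
  inv_pos.2 (Real.sqrt_pos.2 (S.one_sub_vel_sq_pos n t))

theorem gamma_sq (S : ParticleSystem N) (n : Fin N) (t : ℝ) :
    S.gamma n t ^ 2 * (1 - ‖S.vel n t‖ ^ 2) = 1 := by
  have h := S.one_sub_vel_sq_pos n t
  rw [gamma, inv_pow, Real.sq_sqrt h.le, inv_mul_cancel₀ h.ne']

theorem hasDerivAt_gamma (S : ParticleSystem N) (n : Fin N) (t : ℝ) :
    HasDerivAt (S.gamma n) (S.gamma n t ^ 3 * inner ℝ (S.vel n t) (deriv (S.vel n) t)) t := by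
  have h := S.one_sub_vel_sq_pos n t
  have h1 : HasDerivAt (fun s => 1 - ‖S.vel n s‖ ^ 2)
      (-(2 * inner ℝ (S.vel n t) (deriv (S.vel n) t))) t :=
    ((hasDerivAt_of_contDiff (S.contDiff_vel n) t).norm_sq).const_sub 1
  have h2 := (h1.sqrt h.ne').inv (Real.sqrt_pos.2 h).ne'
  have h3 : HasDerivAt (S.gamma n) _ t := h2
  refine h3.congr_deriv ?_
  have hs := (Real.sqrt_pos.2 h).ne'
  simp only [gamma]
  field_simp

theorem hasDerivAt_event_vel (S : ParticleSystem N) (n : Fin N) (t : ℝ) (μ : Fin 4) :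
    HasDerivAt (fun s => event 1 (S.vel n s) μ) (event 0 (deriv (S.vel n) t) μ) t :=
  hasDerivAt_pi.1 (hasDerivAt_event (hasDerivAt_const t (1 : ℝ))
    (hasDerivAt_of_contDiff (S.contDiff_vel n) t)) μ

theorem hasDerivAt_u (S : ParticleSystem N) (n : Fin N) (t : ℝ) (μ : Fin 4) :
    HasDerivAt (fun s => S.u n s μ)
      (S.gamma n t ^ 3 * inner ℝ (S.vel n t) (deriv (S.vel n) t) * event 1 (S.vel n t) μ +
        S.gamma n t * event 0 (deriv (S.vel n) t) μ) t :=
  (S.hasDerivAt_gamma n t).mul (S.hasDerivAt_event_vel n t μ)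

open Classical in
/-- The balance of energy and momentum: their rate of change in `V` is the flux through the boundary
and the sum of what the equations of motion of the particles in `V` lack. -/
theorem hasDerivAt_momentum {Fext : Fin N → TensorField} (hF : S.IsMaxwellField F)
    (hreg : S.IsRegularField F Fext) {V : Set Space} (hV : IsOpen V) (hb : Bornology.IsBounded V)
    (A : BoundaryAtlas V) {t₀ : ℝ} (hp : ∀ n, S.pos n t₀ ∉ frontier V) (μ : Fin 4) :
    HasDerivAt (S.momentum F V μ) (-A.flux (momentumCurrent F μ t₀) +
      ∑ n, if S.pos n t₀ ∈ V then
        S.mass n * deriv (fun s => S.u n s μ) t₀ - S.force (Fext n) n t₀ μ else 0) t₀ := by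
  choose φ δ hφ using fun n => S.exists_isNearField hreg n t₀
  obtain ⟨ρ, τ, h, hδ⟩ := S.exists_isIsolating hV hp fun n => (hφ n).pos
  have hs : ContDiffOn ℝ ∞ F S.offWorldLines := hreg.smooth_off
  obtain ⟨f, hf, hfe⟩ := h.exists_contDiff_weighted hs μ
  have hτ := h.pos_time
  have hρ := h.pos_radius
  have e1 : S.momentum F V μ =ᶠ[𝓝 t₀] fun t => (∫ x in V, f 0 (t, x)) + ∑ n,
      if S.pos n t₀ ∈ V then IsNearField.nearMomentum (φ n) μ ρ t + S.mass n * S.u n t μ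
        else 0 := by
    have c1 : Continuous fun t : ℝ => |t - t₀| := by fun_prop
    filter_upwards [c1.continuousAt.eventually (Iio_mem_nhds (show |t₀ - t₀| < τ / 3 by
      simpa using hτ))] with t ht
    have ht' : |t - t₀| < τ := lt_trans ht (by linarith)
    have h1 := (h.hasRIntegral hs hφ hδ hV hb (hf 0).continuous ht'
      fun x => hfe 0 t x ht).2.rLim_eq
    rw [momentum, emMomentum, rIntegral, h1, add_assoc, ← Finset.sum_add_distrib]
    congr 1
    refine Finset.sum_congr rfl fun n _ => ?_
    simp only [h.mem_iff ht' n]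
    split_ifs <;> simp
  have h1 := h.hasDerivAt_setIntegral hF hs hφ (fun n => (hδ n).1) hV hb A hf hfe
  have h2 : HasDerivAt (fun t => ∑ n, if S.pos n t₀ ∈ V then
      IsNearField.nearMomentum (φ n) μ ρ t + S.mass n * S.u n t μ else 0)
      (∑ n, if S.pos n t₀ ∈ V then ((-S.force (Fext n) n t₀ μ -
        ∫ r in (0 : ℝ)..ρ, deriv (cutoff ρ) r *
          (IsNearField.sphereFlow (S.pos n) (φ n) μ (t₀, r) / r ^ 2)) +
        S.mass n * deriv (fun s => S.u n s μ) t₀) else 0) t₀ := by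
    refine HasDerivAt.fun_sum fun n _ => ?_
    split_ifs with hn
    · have ht0 : |t₀ - t₀| < δ n := by simpa using (hφ n).pos
      obtain ⟨z1, z2⟩ := (hφ n).sphereFlow_zero
        (fun t a b => hreg.particleField_antisymm hF.antisymm n t a b) ht0 μ
      have h3 := (hφ n).hasDerivAt_nearMomentum hF hs ht0 μ hρ (hδ n).1 z1
      rw [z2] at h3
      exact h3.add ((S.hasDerivAt_u n t₀ μ).differentiableAt.hasDerivAt.const_mul _)
    · exact hasDerivAt_const _ _
  refine ((h1.add h2).congr_of_eventuallyEq e1).congr_deriv ?_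
  rw [sub_add_eq_add_sub, ← Finset.sum_add_distrib, sub_eq_neg_add]
  congr 1
  refine Finset.sum_congr rfl fun n _ => ?_
  split_ifs
  · ring
  · simp

/-- The regularized field exists, and consists of the external field and of the self-field. -/
theorem hasRLim_particleField {Fext : Fin N → TensorField} (hreg : S.IsRegularField F Fext) (n : Fin N)
    (t : ℝ) (μ ν : Fin 4) :
    HasRLim (S.fieldAverage F n t μ ν) (S.particleField (Fext n) n t μ ν) := by
  obtain ⟨φ, δ, h⟩ := S.exists_isNearField hreg n t
  exact h.hasRLim_fieldAverage (by simpa using h.pos) μ ν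

/-- The equation of motion per unit of coordinate time, without the common factor `γ`. -/
theorem equationOfMotion_iff {Fext : Fin N → TensorField} (hreg : S.IsRegularField F Fext)
    (n : Fin N) (t : ℝ) : S.EquationOfMotion F n t ↔
      ∀ μ, S.mass n * deriv (fun s => S.u n s μ) t = S.force (Fext n) n t μ := by
  refine forall_congr' fun μ => ?_
  have hγ := (S.gamma_pos n t).ne'
  have h1 : S.charge n * ∑ ν, metric ν * S.u n t ν * S.regField F n t μ ν =
      S.gamma n t * S.force (Fext n) n t μ := by
    rw [force, mul_left_comm]
    congr 1
    rw [Finset.mul_sum]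
    refine Finset.sum_congr rfl fun ν _ => ?_
    rw [regField, (hasRLim_particleField hreg n t μ ν).rLim_eq, u, Pi.smul_apply, smul_eq_mul]
    ring
  rw [h1, mul_right_comm, mul_comm _ (S.gamma n t)]
  exact mul_right_inj' hγ

/-- An octahedron around a particle singles out its equation of motion. -/
theorem equationOfMotion_of_localConservation {Fext : Fin N → TensorField}
    (hF : S.IsMaxwellField F) (hreg : S.IsRegularField F Fext) (hc : S.LocalConservation F)
    (n : Fin N) (t : ℝ) : S.EquationOfMotion F n t := by
  classical
  obtain ⟨ρ, hρ, hρ0⟩ : ∃ ρ : ℝ, (∀ k, k ≠ n → ρ < dist (S.pos k t) (S.pos n t)) ∧ 0 < ρ := by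
    have : ∀ᶠ ρ in 𝓝[>] (0 : ℝ), ∀ k, k ≠ n → ρ < dist (S.pos k t) (S.pos n t) := by
      refine eventually_all.2 fun k => ?_
      by_cases hk : k = n
      · exact .of_forall fun ρ hh => absurd hk hh
      · filter_upwards [nhdsWithin_le_nhds (Iio_mem_nhds
          (dist_pos.2 ((S.distinct t).ne hk)))] with ρ hρ _ using hρ
    exact (this.and self_mem_nhdsWithin).exists
  set V := octahedron (S.pos n t) ρ with hVdef
  have hV : IsOpen V := isOpen_octahedron _ _
  have hb : Bornology.IsBounded V :=
    Metric.isBounded_ball.subset (octahedron_subset_ball (S.pos n t) ρ)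
  obtain ⟨A⟩ := nonempty_boundaryAtlas_octahedron (S.pos n t) hρ0
  have hcl : closure V ⊆ Metric.closedBall (S.pos n t) ρ :=
    closure_minimal ((octahedron_subset_ball _ ρ).trans Metric.ball_subset_closedBall)
      Metric.isClosed_closedBall
  have hnot : ∀ k, k ≠ n → S.pos k t ∉ closure V := fun k hk hm =>
    absurd (Metric.mem_closedBall.1 (hcl hm)) (not_le.2 (hρ k hk))
  have hp : ∀ k, S.pos k t ∉ frontier V := fun k hk => by
    by_cases hkn : k = n
    · have := mem_frontier_octahedron hk
      rw [hkn] at this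
      simp only [sub_self, abs_zero, add_zero] at this
      exact hρ0.ne this
    · exact hnot k hkn (frontier_subset_closure hk)
  have hn : S.pos n t ∈ V := by
    rw [hVdef, octahedron, mem_ofPred_eq]
    simpa using hρ0
  rw [equationOfMotion_iff hreg]
  intro μ
  have h1 := (hc V hV hb A t hp μ).unique (hasDerivAt_momentum hF hreg hV hb A hp μ)
  rw [Finset.sum_eq_single_of_mem n (Finset.mem_univ n), if_pos hn] at h1
  · linarith
  · exact fun k _ hk => if_neg fun hm => hnot k hk (subset_closure hm)

theorem localConservation_iff {Fext : Fin N → TensorField} (hF : S.IsMaxwellField F)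
    (hreg : S.IsRegularField F Fext) :
    S.LocalConservation F ↔ ∀ n t, S.EquationOfMotion F n t := by
  refine ⟨fun hc n t => equationOfMotion_of_localConservation hF hreg hc n t,
    fun he V hV hb A t hp μ => ?_⟩
  refine (hasDerivAt_momentum hF hreg hV hb A hp μ).congr_deriv ?_
  rw [Finset.sum_eq_zero, add_zero]
  intro n _
  rw [(equationOfMotion_iff hreg n t).1 (he n t) μ, sub_self, ite_self]

theorem exists_hasRIntegral {Fext : Fin N → TensorField} (hreg : S.IsRegularField F Fext)
    {V : Set Space} (hV : IsOpen V) (hb : Bornology.IsBounded V) {t : ℝ}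
    (hp : ∀ n, S.pos n t ∉ frontier V) (μ : Fin 4) :
    ∃ b, HasRIntegral (fun n => S.pos n t) V (fun x => stress (F (event t x)) 0 μ) b := by
  classical
  choose φ δ hφ using fun n => S.exists_isNearField hreg n t
  obtain ⟨ρ, τ, h, hδ⟩ := S.exists_isIsolating hV hp fun n => (hφ n).pos
  have hs : ContDiffOn ℝ ∞ F S.offWorldLines := hreg.smooth_off
  obtain ⟨f, hf, hfe⟩ := h.exists_contDiff_weighted hs μ
  exact ⟨_, h.hasRIntegral hs hφ hδ hV hb (hf 0).continuous (by simpa using h.pos_time)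
    fun x => hfe 0 t x (by simpa using h.pos_time)⟩

/-! ### The Lorentz-Dirac equation -/

theorem uDot_eq (S : ParticleSystem N) (n : Fin N) (t : ℝ) (μ : Fin 4) :
    S.uDot n t μ = S.gamma n t ^ 4 * inner ℝ (S.vel n t) (deriv (S.vel n) t) *
      event 1 (S.vel n t) μ + S.gamma n t ^ 2 * event 0 (deriv (S.vel n) t) μ := by
  rw [uDot, (S.hasDerivAt_u n t μ).deriv]; ring

theorem uDDot_eq (S : ParticleSystem N) (n : Fin N) (t : ℝ) (μ : Fin 4) :
    S.uDDot n t μ =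
      (4 * S.gamma n t ^ 7 * inner ℝ (S.vel n t) (deriv (S.vel n) t) ^ 2 +
        S.gamma n t ^ 5 * (inner ℝ (deriv (S.vel n) t) (deriv (S.vel n) t) +
          inner ℝ (S.vel n t) (deriv (deriv (S.vel n)) t))) * event 1 (S.vel n t) μ +
      3 * S.gamma n t ^ 5 * inner ℝ (S.vel n t) (deriv (S.vel n) t) *
        event 0 (deriv (S.vel n) t) μ +
      S.gamma n t ^ 3 * event 0 (deriv (deriv (S.vel n)) t) μ := by
  have hv := S.contDiff_vel n
  have ha := contDiff_deriv hv
  have d1 := S.hasDerivAt_gamma n t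
  have d2 := (hasDerivAt_of_contDiff hv t).inner ℝ (hasDerivAt_of_contDiff ha t)
  have d3 := S.hasDerivAt_event_vel n t μ
  have d4 : HasDerivAt (fun s => event 0 (deriv (S.vel n) s) μ)
      (event 0 (deriv (deriv (S.vel n)) t) μ) t :=
    hasDerivAt_pi.1 (hasDerivAt_event (hasDerivAt_const t (0 : ℝ))
      (hasDerivAt_of_contDiff ha t)) μ
  have d5 := (((d1.pow 4).mul d2).mul d3).add ((d1.pow 2).mul d4)
  have d6 : HasDerivAt (fun s => S.uDot n s μ) _ t :=
    d5.congr_of_eventuallyEq (.of_forall fun s => S.uDot_eq n s μ)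
  rw [uDDot, d6.deriv]
  simp only [Pi.mul_apply, Pi.pow_apply]
  push_cast
  ring

theorem sum_metric_event (a b : ℝ) (x y : Space) :
    ∑ ν, metric ν * event a x ν * event b y ν = inner ℝ x y - a * b := by
  rw [Fin.sum_univ_succ, PiLp.inner_apply]
  simp only [event_zero, event_succ, metric, if_pos, Fin.succ_ne_zero, if_false]
  rw [add_comm, ← sub_neg_eq_add]
  congr 1
  · exact Finset.sum_congr rfl fun i _ => by simp [mul_comm]
  · ring

theorem sum_metric_wedge (X A B : Event) (μ : Fin 4) :
    ∑ ν, metric ν * X ν * wedge A B μ ν =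
      A μ * (∑ ν, metric ν * X ν * B ν) - B μ * ∑ ν, metric ν * X ν * A ν := by
  rw [Finset.mul_sum, Finset.mul_sum, ← Finset.sum_sub_distrib]
  exact Finset.sum_congr rfl fun ν _ => by rw [wedge]; ring

/-- The part of the regularized field that the particle itself generates is the radiation
reaction. -/
theorem sum_selfField (S : ParticleSystem N) (n : Fin N) (t : ℝ) (μ : Fin 4) :
    S.charge n * ∑ ν, metric ν * S.u n t ν * S.selfField n t μ ν =
      2 / 3 * (S.charge n ^ 2 / (4 * Real.pi)) *
        (S.uDDot n t μ - (∑ ν, metric ν * S.uDot n t ν * S.uDot n t ν) * S.u n t μ) := by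
  set γ := S.gamma n t with hγ
  set v := S.vel n t with hv
  set a := deriv (S.vel n) t with ha
  set b := deriv (deriv (S.vel n)) t with hb
  have hγ0 : γ ≠ 0 := (S.gamma_pos n t).ne'
  have hg : γ ^ 2 * (1 - ‖v‖ ^ 2) = 1 := S.gamma_sq n t
  have hvv : (1 - ‖v‖ ^ 2) = (γ ^ 2)⁻¹ := eq_inv_of_mul_eq_one_right hg
  have hin : inner ℝ v v - 1 * 1 = -(γ ^ 2)⁻¹ := by
    rw [real_inner_self_eq_norm_sq, ← hvv]; ring
  have h1 : ∑ ν, metric ν * S.u n t ν * S.selfField n t μ ν =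
      S.charge n / (6 * Real.pi) * γ * (γ ^ 4 *
        (∑ ν, metric ν * event 1 v ν * wedge (event 1 v) (event 0 b) μ ν) +
        3 * inner ℝ v a * γ ^ 6 *
          ∑ ν, metric ν * event 1 v ν * wedge (event 1 v) (event 0 a) μ ν) := by
    rw [Finset.mul_sum, Finset.mul_sum, ← Finset.sum_add_distrib, Finset.mul_sum]
    refine Finset.sum_congr rfl fun ν _ => ?_
    rw [selfField, ← hv, ← ha, ← hb, hvv, u, Pi.smul_apply, smul_eq_mul, ← hγ, ← hv]
    field_simp
  have h2 : ∑ ν, metric ν * S.uDot n t ν * S.uDot n t ν =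
      γ ^ 6 * inner ℝ v a ^ 2 + γ ^ 4 * inner ℝ a a := by
    have : ∀ ν, metric ν * S.uDot n t ν * S.uDot n t ν =
        (γ ^ 4 * inner ℝ v a) ^ 2 * (metric ν * event 1 v ν * event 1 v ν) +
        2 * (γ ^ 4 * inner ℝ v a) * γ ^ 2 * (metric ν * event 1 v ν * event 0 a ν) +
        γ ^ 4 * (metric ν * event 0 a ν * event 0 a ν) := fun ν => by
      rw [uDot_eq]; ring
    simp only [this]
    rw [Finset.sum_add_distrib, Finset.sum_add_distrib, ← Finset.mul_sum, ← Finset.mul_sum,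
      ← Finset.mul_sum, sum_metric_event, sum_metric_event, sum_metric_event, hin]
    field_simp
    ring
  rw [h1, h2, sum_metric_wedge, sum_metric_wedge, sum_metric_event, sum_metric_event,
    sum_metric_event, hin, uDDot_eq, u, Pi.smul_apply, smul_eq_mul, ← hγ, ← hv, ← ha, ← hb]
  have hπ := Real.pi_ne_zero
  field_simp
  ring

theorem equationOfMotion_iff_lorentzDirac {Fext : Fin N → TensorField}
    (hreg : S.IsRegularField F Fext) (n : Fin N) (t : ℝ) :
    S.EquationOfMotion F n t ↔ S.LorentzDirac (Fext n) n t := by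
  refine forall_congr' fun μ => ?_
  have h1 : S.charge n * ∑ ν, metric ν * S.u n t ν * S.regField F n t μ ν =
      S.charge n * ∑ ν, metric ν * S.u n t ν * Fext n (event t (S.pos n t)) μ ν +
        S.charge n * ∑ ν, metric ν * S.u n t ν * S.selfField n t μ ν := by
    rw [← mul_add, ← Finset.sum_add_distrib]
    congr 1
    refine Finset.sum_congr rfl fun ν _ => ?_
    rw [regField, (hasRLim_particleField hreg n t μ ν).rLim_eq, particleField]
    ring
  rw [h1, sum_selfField, uDot, mul_assoc (S.mass n)]

end ParticleSystem

end PointChargeED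

end

theorem theorem1 {N : ℕ} (S : PointChargeED.ParticleSystem N)
    (F : PointChargeED.TensorField) (Fext : Fin N → PointChargeED.TensorField)
    (hF : S.IsMaxwellField F) (hreg : S.IsRegularField F Fext) :
    -- the `R`-limits that define the regularized fields at the particles exist
    (∀ (n : Fin N) (t : ℝ) (μ ν : Fin 4),
      ∃ b : ℝ, PointChargeED.HasRLim (S.fieldAverage F n t μ ν) b) ∧
    -- the `R`-integrals that define the electromagnetic energy-momentum exist
    (∀ V : Set PointChargeED.Space, IsOpen V → Bornology.IsBounded V →
      ∀ t : ℝ, (∀ n, S.pos n t ∉ frontier V) → ∀ μ : Fin 4,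
        ∃ b : ℝ, PointChargeED.HasRIntegral (fun n => S.pos n t) V
          (fun x => PointChargeED.stress (F (PointChargeED.event t x)) 0 μ) b) ∧
    -- conservation is equivalent to the equations of motion of the particles
    (S.LocalConservation F ↔ ∀ (n : Fin N) (t : ℝ), S.EquationOfMotion F n t) ∧
    -- which are the Lorentz-Dirac equations
    (∀ (n : Fin N) (t : ℝ), S.EquationOfMotion F n t ↔ S.LorentzDirac (Fext n) n t) :=
  ⟨fun n t μ ν => ⟨_, PointChargeED.ParticleSystem.hasRLim_particleField hreg n t μ ν⟩,
    fun _ hV hb _ hp μ => PointChargeED.ParticleSystem.exists_hasRIntegral hreg hV hb hp μ,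
    PointChargeED.ParticleSystem.localConservation_iff hF hreg,
    fun n t => PointChargeED.ParticleSystem.equationOfMotion_iff_lorentzDirac hreg n t⟩
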